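/- \textbf{Lemma (non-concurrent composition of post-quantum $\epsilon$-simulatable two-party protocols).} \emph{Values and functionalities.} Values are bit strings or $\bot$. A two-party functionality is a family $f=(f_\lambda)_{\lambda\in\mathbb N}$ of randomized maps from pairs of values to pairs of values whose output lengths are polynomially bounded in $\lambda$ and the input lengths. \emph{Protocols.} A classical protocol in the $(f_1,\dots,f_m)$-hybrid model is, for each $\lambda$, a finite sequence of steps; each step is either a local computation of one party followed by delivery of the message on the shared classical channel, or a single ideal call by both parties to some $f_i$, or a session boundary, at which the value handed over by the honest party is moved to its input register and pending messages are discarded. The parties use classical probabilistic circuits, and the whole code is generated uniformly in time polynomial in $\lambda$. The plain model is the case without ideal calls. One party $P_i$ ($i\in\{0,1\}$) is statically corrupted. Ideal calls are with abort: the adversary chooses the input of $P_i$, sees the output of $P_i$, and then decides whether the honest party $P_{1-i}$ gets its output or $\bot$. \emph{Security.} A non-uniform QPT adversary $\mathcal A=\{\mathcal A_\lambda,\rho_\lambda\}_\lambda$ consists of polynomial-size quantum circuits and polynomial-size quantum advice. Let $\mathsf{EXEC}^{f_1,\dots,f_m}_{\pi,\mathcal A,i}(\lambda,\mathbf x,\rho_\lambda)$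 be the joint output of the adversary (a quantum state) and of the honest party in an execution of $\pi$ on inputs $\mathbf x$. In the plain model this is $\mathsf{REAL}_{\pi,\mathcal A,i}$. Let $\mathsf{IDEAL}_{g,\mathcal S,i}(\lambda,\epsilon,\mathbf x,\rho_\lambda)$ be the joint output of the simulator $\mathcal S$ and the honest party in an execution consisting of one ideal call to $g$. Write $X\approx^{c}_{\epsilon}Y$ if every non-uniform QPT distinguisher with quantum advice has advantage at most $\epsilon(\lambda)+\mathrm{negl}(\lambda)$. A protocol $\pi$ is \emph{$\epsilon$-simulatable} for $g$ in the $(f_1,\dots,f_m)$-hybrid model if there is one uniform QPT simulator $\mathcal S$, which is given $1^\lambda$, $1^{\lceil 1/\epsilon(\lambda)\rceil}$, $i$, the input $x_{\lambda,i}$ of $P_i$, the circuits $\mathcal A_\lambda$, the advice $\rho_\lambda$ and its number of qubits, and runs in time polynomial in the length of what it is given, such that for all non-uniform QPT adversaries $\mathcal A$, all $i\in\{0,1\}$, all sequences $(\mathbf x_\lambda)_\lambda$ of pairs of values of length polynomial in $\lambda$, and all noticeable $\epsilon:\mathbb N\to[0,1]$, $$\{\mathsf{EXEC}^{f_1,\dots,f_m}_{\pi,\mathcal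 A,i}(\lambda,\mathbf x_\lambda,\rho_\lambda)\}_{\lambda}\ \approx^{c}_{\epsilon}\ \{\mathsf{IDEAL}_{g,\mathcal S,i}(\lambda,\epsilon,\mathbf x_\lambda,\rho_\lambda)\}_{\lambda}.$$ \emph{Claim.} Let $m\in\mathbb N$ be a constant. For $i=1,\dots,m$ let $\rho_i$ be an $\epsilon$-simulatable protocol for a two-party functionality $f_i$ in the plain model, and let $\pi$ be an $\epsilon$-simulatable protocol for a two-party functionality $g$ in the $(f_1,\dots,f_m)$-hybrid model, where at most one ideal call is made at each step. Let $\pi^{\rho_1,\dots,\rho_m}$ be the plain-model protocol obtained from $\pi$ by replacing every call to $f_i$ by an execution of $\rho_i$ on the parties' call inputs, with fresh work space, during which $\pi$ is suspended. Then $\pi^{\rho_1,\dots,\rho_m}$ is an $\epsilon$-simulatable protocol for $g$. -/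

import Mathlib

noncomputable section

namespace TwoPC

/-! ## Polynomial-time computation

A WHILE language over binary trees. Every elementary step is charged the size of the value that it
produces, so that running time is polynomially equivalent to running time on Turing machines, and
the size of the result never exceeds the running time. -/

/-- Binary trees, the data on which programs compute. -/
inductive Tree where
  | nil : Tree
  | cons : Tree → Tree → Tree

def Tree.size : Tree → ℕ
  | .nil => 1
  | .cons a b => a.size + b.size + 1

def Tree.fst : Tree → Tree
  | .nil => .nil
  | .cons a _ => a

def Tree.snd : Tree → Tree
  | .nil => .nil
  | .cons _ b => b

/-- Programs. `loop c` repeats `c` as long as the left component of the current value is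
different from `nil`. -/
inductive Prog where
  | nil : Prog
  | id : Prog
  | fst : Prog
  | snd : Prog
  | pair : Prog → Prog → Prog
  | comp : Prog → Prog → Prog
  | ite : Prog → Prog → Prog → Prog
  | loop : Prog → Prog

/-- `Runs c x y t`: on input `x` the program `c` halts with result `y` after `t` time units. -/
inductive Runs : Prog → Tree → Tree → ℕ → Prop where
  | nil (x : Tree) : Runs .nil x .nil 1
  | id (x : Tree) : Runs .id x x x.size
  | fst (x : Tree) : Runs .fst x x.fst x.fst.size
  | snd (x : Tree) : Runs .snd x x.snd x.snd.size
  | pair {c d : Prog} {x y z : Tree} {t u : ℕ} (h₁ : Runs c x y t) (h₂ : Runs d x z u) :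
      Runs (.pair c d) x (.cons y z) (t + u + (Tree.cons y z).size)
  | comp {c d : Prog} {x y z : Tree} {t u : ℕ} (h₁ : Runs d x y t) (h₂ : Runs c y z u) :
      Runs (.comp c d) x z (t + u + 1)
  | ite_nil {c d e : Prog} {x y : Tree} {t u : ℕ} (h₁ : Runs c x .nil t) (h₂ : Runs e x y u) :
      Runs (.ite c d e) x y (t + u + 1)
  | ite_cons {c d e : Prog} {x a b y : Tree} {t u : ℕ} (h₁ : Runs c x (.cons a b) t)
      (h₂ : Runs d x y u) : Runs (.ite c d e) x y (t + u + 1)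
  | loop_stop {c : Prog} {x : Tree} (h : x.fst = .nil) : Runs (.loop c) x x x.size
  | loop_step {c : Prog} {x y z : Tree} {t u : ℕ} (h : x.fst ≠ .nil) (h₁ : Runs c x y t)
      (h₂ : Runs (.loop c) y z u) : Runs (.loop c) x z (t + u + 1)

/-- Types whose elements are written down as trees. -/
class Enc (α : Type) where
  enc : α → Tree

/-- Natural numbers are written in unary. -/
def encNat : ℕ → Tree
  | 0 => .nil
  | n + 1 => .cons .nil (encNat n)

def encList {α : Type} [Enc α] : List α → Tree
  | [] => .nil
  | a :: l => .cons (Enc.enc a) (encList l)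

instance instEncNat : Enc ℕ := ⟨encNat⟩

instance instEncBool : Enc Bool := ⟨fun b => if b then .cons .nil .nil else .nil⟩

instance instEncFin (m : ℕ) : Enc (Fin m) := ⟨fun i => encNat i.val⟩

instance instEncList {α : Type} [Enc α] : Enc (List α) := ⟨encList⟩

instance instEncOption {α : Type} [Enc α] : Enc (Option α) :=
  ⟨fun o => match o with
    | none => .nil
    | some a => .cons .nil (Enc.enc a)⟩

instance instEncProd {α β : Type} [Enc α] [Enc β] : Enc (α × β) :=
  ⟨fun p => .cons (Enc.enc p.1) (Enc.enc p.2)⟩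

/-- The length of the description of an object. -/
def descLength {α : Type} [Enc α] (a : α) : ℕ := (Enc.enc a).size

/-- `F` is computed by a program whose running time is polynomial in the length of the input. -/
def PolyTime {α β : Type} [Enc α] [Enc β] (F : α → β) : Prop :=
  ∃ (c : Prog) (p : Polynomial ℕ), ∀ a : α,
    ∃ t ≤ p.eval (descLength a), Runs c (Enc.enc a) (Enc.enc (F a)) t

/-! ## Quantum circuits

Wires are labelled by a type `W`. A computational basis state is given by the finite set of the
wires that carry a `1`, and a density operator by its matrix entries `K s t`. -/

/-- Gates. Hadamard, the `π/4` phase gate and CNOT are universal; `reset w` discards the qubit `w`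
and replaces it by a fresh `0`; `coin w` replaces it by a uniformly random classical bit. -/
inductive Gate (W : Type) where
  | flip (w : W) : Gate W
  | cnot (control target : W) : Gate W
  | ccnot (control₁ control₂ target : W) : Gate W
  | had (w : W) : Gate W
  | phase (w : W) : Gate W
  | reset (w : W) : Gate W
  | coin (w : W) : Gate W

abbrev Circuit (W : Type) := List (Gate W)

def Gate.map {V W : Type} (e : V → W) : Gate V → Gate W
  | .flip w => .flip (e w)
  | .cnot a w => .cnot (e a) (e w)
  | .ccnot a b w => .ccnot (e a) (e b) (e w)
  | .had w => .had (e w)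
  | .phase w => .phase (e w)
  | .reset w => .reset (e w)
  | .coin w => .coin (e w)

/-- The gates that a classical probabilistic machine may use. -/
def Gate.IsClassical {W : Type} : Gate W → Prop
  | .had _ => False
  | .phase _ => False
  | _ => True

instance instEncGate {W : Type} [Enc W] : Enc (Gate W) :=
  ⟨fun g => match g with
    | .flip w => Enc.enc ((0 : ℕ), w)
    | .cnot a w => Enc.enc ((1 : ℕ), a, w)
    | .ccnot a b w => Enc.enc ((2 : ℕ), a, b, w)
    | .had w => Enc.enc ((3 : ℕ), w)
    | .phase w => Enc.enc ((4 : ℕ), w)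
    | .reset w => Enc.enc ((5 : ℕ), w)
    | .coin w => Enc.enc ((6 : ℕ), w)⟩

/-- Matrix entries of an operator on the qubits labelled by `W`. -/
abbrev Op (W : Type) := Finset W → Finset W → ℂ

/-- Flips wire `w` of a basis state. -/
def toggle {W : Type} [DecidableEq W] (w : W) (s : Finset W) : Finset W :=
  if w ∈ s then s.erase w else insert w s

/-- The action of a gate on density operators. A controlled gate one of whose controls is its own
target is read as the identity. -/
def Gate.apply {W : Type} [DecidableEq W] : Gate W → Op W → Op W
  | .flip w, K => fun s t => K (toggle w s) (toggle w t)
  | .cnot a w, K =>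
      let σ : Finset W → Finset W := fun s => if a ∈ s ∧ a ≠ w then toggle w s else s
      fun s t => K (σ s) (σ t)
  | .ccnot a b w, K =>
      let σ : Finset W → Finset W :=
        fun s => if a ∈ s ∧ b ∈ s ∧ a ≠ w ∧ b ≠ w then toggle w s else s
      fun s t => K (σ s) (σ t)
  | .had w, K =>
      let sign : Finset W → Finset W → ℂ := fun s a => if w ∈ s ∧ w ∈ a then -1 else 1
      fun s t => (1 / 2) * ∑ a ∈ {s.erase w, insert w s}, ∑ b ∈ {t.erase w, insert w t},
        sign s a * sign t b * K a b
  | .phase w, K =>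
      let ω : Finset W → ℂ := fun s => if w ∈ s then Complex.exp (Complex.I * Real.pi / 4) else 1
      fun s t => ω s * star (ω t) * K s t
  | .reset w, K => fun s t =>
      if w ∈ s ∨ w ∈ t then 0 else K s t + K (insert w s) (insert w t)
  | .coin w, K => fun s t =>
      if w ∈ s ↔ w ∈ t then
        (1 / 2) * (K (s.erase w) (t.erase w) + K (insert w s) (insert w t))
      else 0

/-- Applies the gates of a circuit, whose wires are embedded by `e`, from left to right. -/
def Circuit.apply {V W : Type} [DecidableEq W] (e : V → W) (C : Circuit V) (K : Op W) : Op W :=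
  C.foldl (fun K g => (g.map e).apply K) K

/-- The basis states of the qubits `w` with `R w` are measured, and a measured value `c` is replaced
by the value `d` with probability `p c d`. -/
def transition {W : Type} [DecidableEq W] (R : W → Prop) [DecidablePred R]
    (p : Finset W → Finset W → ℝ) (K : Op W) : Op W := fun s t =>
  if s.filter R = t.filter R then
    ∑' c : {c : Finset W // ∀ w ∈ c, R w},
      (p c.1 (s.filter R) : ℂ) *
        K (s.filter (fun w => ¬ R w) ∪ c.1) (t.filter (fun w => ¬ R w) ∪ c.1)
  else 0

open scoped ComplexOrder in
/-- A (mixed) state of finitely many qubits. -/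
structure QState where
  qubits : ℕ
  mat : Matrix (Fin qubits → Bool) (Fin qubits → Bool) ℂ
  posSemidef : mat.PosSemidef
  trace_eq_one : mat.trace = 1

/-- The state on the wires `0, …, qubits - 1`, all other wires being `0`. -/
def QState.op (ρ : QState) : Op ℕ := fun s t =>
  if s ⊆ Finset.range ρ.qubits ∧ t ⊆ Finset.range ρ.qubits then
    ρ.mat (fun j => decide (j.val ∈ s)) (fun j => decide (j.val ∈ t))
  else 0

/-! ## Parties, protocols, functionalities -/

/-- Inputs and outputs: bit strings, or `none` for `⊥` (no value). -/
abbrev Val := Option (List Bool)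

def Val.length : Val → ℕ
  | none => 0
  | some l => l.length

/-- A register holding a string `l` carries the bits of `l` followed by a single end marker `1`; a
register that is all `0` holds `⊥`. -/
def Val.toWires : Val → Finset ℕ
  | none => ∅
  | some l => insert l.length ((Finset.range l.length).filter (fun j => l[j]? = some true))

/-- The value held by a register (the inverse of `Val.toWires`). -/
def Val.ofWires (s : Finset ℕ) : Val :=
  if s = ∅ then none else some ((List.range (s.sup id)).map (fun j => decide (j ∈ s)))

/-- The registers that a party works on: its private work space, the register in which it receives
values (its input, results of ideal calls), the register in which it hands over values (its
output, inputs to ideal calls), and the message channel that is shared with the other party. -/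
inductive Port where
  | work | inp | out | msg
  deriving DecidableEq

abbrev PWire := Port × ℕ

instance instEncPort : Enc Port :=
  ⟨fun r => match r with
    | .work => encNat 0
    | .inp => encNat 1
    | .out => encNat 2
    | .msg => encNat 3⟩

/-- The steps of a two-party protocol with access to `m` ideal functionalities. The parties are
`false` and `true`.
* `send b C`: party `b` performs the computation `C`, after which the contents of the message
  channel are delivered.
* `call i`: both parties call the `i`-th ideal functionality, and do nothing else meanwhile.
* `handover`: the beginning or end of a session, see `handover` below. -/
inductive Step (m : ℕ) where
  | send (b : Bool) (C : Circuit PWire) : Step m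
  | call (i : Fin m) : Step m
  | handover : Step m

instance instEncStep (m : ℕ) : Enc (Step m) :=
  ⟨fun s => match s with
    | .send b C => Enc.enc ((0 : ℕ), b, C)
    | .call i => Enc.enc ((1 : ℕ), i)
    | .handover => Enc.enc ((2 : ℕ), (0 : ℕ))⟩

/-- A protocol in the hybrid model with `m` ideal functionalities: for every security parameter the
sequence of its steps, at most one ideal call at a time. A protocol in the plain model is a
`Protocol 0`. -/
abbrev Protocol (m : ℕ) := ℕ → List (Step m)

/-- The protocol is classical and polynomial time: its code is generated in time polynomial in the
security parameter, and the parties use classical gates and coins only. -/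
def Protocol.IsPPT {m : ℕ} (P : Protocol m) : Prop :=
  PolyTime P ∧ ∀ lam b C, Step.send b C ∈ P lam → ∀ g ∈ C, g.IsClassical

/-- A classical (randomized) two-party functionality, depending on the security parameter, with
outputs of polynomial length. The value of party `b` is the component `b`. -/
structure Functionality where
  eval : ℕ → (Bool → Val) → PMF (Bool → Val)
  poly_length : ∃ p : Polynomial ℕ, ∀ lam x, ∀ y ∈ (eval lam x).support, ∀ b,
    (y b).length ≤ p.eval (lam + (x false).length + (x true).length)

/-! ## Executions with one corrupted party -/

/-- All registers: those of the adversary, those of the honest party, the message channel, and the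
private register `dist` of a distinguisher. -/
inductive Reg where
  | advWork | advInp | advOut | honWork | honInp | honOut | msg | dist
  deriving DecidableEq

abbrev Wire := Reg × ℕ

def advWire : PWire → Wire
  | (.work, k) => (.advWork, k)
  | (.inp, k) => (.advInp, k)
  | (.out, k) => (.advOut, k)
  | (.msg, k) => (.msg, k)

def honWire : PWire → Wire
  | (.work, k) => (.honWork, k)
  | (.inp, k) => (.honInp, k)
  | (.out, k) => (.honOut, k)
  | (.msg, k) => (.msg, k)

/-- The contents of the register `r`. -/
def content (r : Reg) (s : Finset Wire) : Finset ℕ := (s.filter (fun w => w.1 = r)).image Prod.snd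

/-- The basis state in which `r` contains `a` and everything else is `0`. -/
def fill (r : Reg) (a : Finset ℕ) : Finset Wire := a.image (fun k => (r, k))

/-- An activation of a party; the message channel is classical, so it is measured afterwards. -/
def activate (e : PWire → Wire) (C : Circuit PWire) (K : Op Wire) : Op Wire :=
  let K' := Circuit.apply e C K
  fun s t => if content .msg s = content .msg t then K' s t else 0

/-- Pending messages are discarded. -/
def clearChannel : Op Wire → Op Wire :=
  transition (fun w => w.1 = Reg.msg) (fun _ d => if d = ∅ then 1 else 0)

/-- The beginning or end of a session: pending messages are discarded, and the value that the honest
party has handed over moves to the register in which it receives values. -/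
def handover : Op Wire → Op Wire :=
  transition (fun w => w.1 = Reg.msg ∨ w.1 = Reg.honInp ∨ w.1 = Reg.honOut)
    (fun c d => if d = fill .honInp (content .honOut c) then 1 else 0)

/-- The trusted party takes the inputs of both parties, where `c` is the corrupted one, evaluates the
functionality and writes the results. -/
def trusted (f : Functionality) (lam : ℕ) (c : Bool) : Op Wire → Op Wire :=
  transition
    (fun w => w.1 = Reg.advInp ∨ w.1 = Reg.advOut ∨ w.1 = Reg.honInp ∨ w.1 = Reg.honOut)
    (fun a d =>
      if content .advOut d = ∅ ∧ content .honOut d = ∅ then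
        (f.eval lam
          (fun b => Val.ofWires (content (if b = c then .advOut else .honOut) a))
          (fun b => Val.ofWires (content (if b = c then .advInp else .honInp) d))).toReal
      else 0)

/-- The adversary, who has seen its own result, decides by means of the message channel: if it has
written nothing, the honest party keeps its result; otherwise the honest party gets `⊥`. -/
def deliver : Op Wire → Op Wire :=
  transition (fun w => w.1 = Reg.msg ∨ w.1 = Reg.honInp)
    (fun a d => if d = (if content .msg a = ∅ then a else ∅) then 1 else 0)

/-- Executes a list of steps in the `f`-hybrid model, party `c` being corrupted. The list `A` contains
the circuits for the successive activations of the adversary (missing ones are empty). The adversary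
is activated at each `send`, after the honest party if that is the sender, and twice in each ideal
call: to choose its input, and to see its result and decide on delivery. -/
def exec {m : ℕ} (f : Fin m → Functionality) (lam : ℕ) (c : Bool) :
    List (Step m) → List (Circuit PWire) → Op Wire → Op Wire
  | [], _, K => K
  | .send b C :: P, A, K =>
      exec f lam c P A.tail
        (activate advWire (A.headD []) (if b = c then K else activate honWire C K))
  | .call i :: P, A, K =>
      exec f lam c P A.tail.tail
        (deliver (activate advWire (A.tail.headD [])
          (trusted (f i) lam c (activate advWire (A.headD []) (clearChannel K)))))
  | .handover :: P, A, K => exec f lam c P A (handover K)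

/-- The initial state: quantum advice `ρ` and input `x c` for the adversary, who corrupts party `c`,
and the input of the honest party, ready to be handed over. -/
def start (c : Bool) (x : Bool → Val) (ρ : QState) : Op Wire := fun s t =>
  let target := fill .advInp (x c).toWires ∪ fill .honOut (x (!c)).toWires
  if s.filter (fun w => w.1 ≠ Reg.advWork) = target ∧ t.filter (fun w => w.1 ≠ Reg.advWork) = target
  then ρ.op (content .advWork s) (content .advWork t)
  else 0

/-- A session of a protocol: the parties receive their inputs, run the protocol, and hand over their
outputs. -/
def session {m : ℕ} (P : List (Step m)) : List (Step m) := .handover :: P ++ [.handover]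

/-- The final state of an execution of the protocol `P` in the `f`-hybrid model with the adversary
`(A, ρ)`. The output of the adversary is the contents of all its registers (it may reset what it does
not want to output), that of the honest party is the contents of `honInp`. With `m = 0` this is the
real execution of a protocol in the plain model. -/
def hybridExec {m : ℕ} (f : Fin m → Functionality) (P : Protocol m) (c : Bool) (lam : ℕ)
    (x : Bool → Val) (A : List (Circuit PWire)) (ρ : QState) : Op Wire :=
  exec f lam c (session (P lam)) A (start c x ρ)

/-- The final state of the ideal execution of `g` with a simulator that has the circuits `S.1` (to
choose the input of the corrupted party) and `S.2` (to decide on delivery and compute the output). -/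
def idealExec (g : Functionality) (c : Bool) (lam : ℕ) (x : Bool → Val)
    (S : Circuit PWire × Circuit PWire) (ρ : QState) : Op Wire :=
  exec (fun _ : Fin 1 => g) lam c [.call 0] [S.1, S.2] (start c x ρ)

/-! ## Indistinguishability -/

/-- The registers that a distinguisher acts on: the output of the adversary (three registers), the
output of the honest party, and a private register. -/
inductive DPort where
  | advWork | advInp | advOut | hon | own

abbrev DWire := DPort × ℕ

instance instEncDPort : Enc DPort :=
  ⟨fun r => match r with
    | .advWork => encNat 0
    | .advInp => encNat 1
    | .advOut => encNat 2
    | .hon => encNat 3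
    | .own => encNat 4⟩

def distWire : DWire → Wire
  | (.advWork, k) => (.advWork, k)
  | (.advInp, k) => (.advInp, k)
  | (.advOut, k) => (.advOut, k)
  | (.hon, k) => (.honInp, k)
  | (.own, k) => (.dist, k)

/-- The state `K`, whose register `dist` is `0`, together with the state `σ` of that register. -/
def adjoin (σ : QState) (K : Op Wire) : Op Wire := fun s t =>
  σ.op (content .dist s) (content .dist t) *
    K (s.filter (fun w => w.1 ≠ Reg.dist)) (t.filter (fun w => w.1 ≠ Reg.dist))

/-- The probability that the distinguisher with circuit `D` and advice `σ` outputs `1` on `K`: its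
output bit is the first wire of its private register. -/
def acceptProb (D : Circuit DWire) (σ : QState) (K : Op Wire) : ℝ :=
  ∑' s : Finset Wire,
    if ((Reg.dist, 0) : Wire) ∈ s then (Circuit.apply distWire D (adjoin σ K) s s).re else 0

/-- Sequences of natural numbers that are bounded by a polynomial. -/
def PolyBounded (u : ℕ → ℕ) : Prop := ∃ p : Polynomial ℕ, ∀ n, u n ≤ p.eval n

def Negligible (μ : ℕ → ℝ) : Prop :=
  ∀ k : ℕ, ∀ᶠ n : ℕ in Filter.atTop, |μ n| < 1 / (n : ℝ) ^ k

/-- Noticeable functions `ε : ℕ → [0, 1]`. -/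
def Noticeable (ε : ℕ → ℝ) : Prop :=
  (∀ n, 0 ≤ ε n ∧ ε n ≤ 1) ∧ ∃ k : ℕ, ∀ᶠ n : ℕ in Filter.atTop, 1 / (n : ℝ) ^ k ≤ ε n

/-- A non-uniform quantum polynomial-time algorithm: polynomial-size circuits together with quantum
advice on polynomially many qubits. -/
structure NonUniformQPT (C : Type) [Enc C] where
  code : ℕ → C
  advice : ℕ → QState
  poly_code : PolyBounded (fun n => descLength (code n))
  poly_advice : PolyBounded (fun n => (advice n).qubits)

/-- `X` and `Y` are computationally indistinguishable up to `δ`. -/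
def IndistUpTo (δ : ℕ → ℝ) (X Y : ℕ → Op Wire) : Prop :=
  ∀ D : NonUniformQPT (Circuit DWire), ∃ μ : ℕ → ℝ, Negligible μ ∧ ∀ lam : ℕ,
    |acceptProb (D.code lam) (D.advice lam) (X lam) -
      acceptProb (D.code lam) (D.advice lam) (Y lam)| ≤ δ lam + μ lam

/-! ## Simulatability and composition -/

/-- What a simulator is given besides the quantum advice of the adversary: the security parameter
(in unary), the slackness parameter `ε`, given by the integer `⌈1 / ε⌉` in unary, the corrupted party
and its input, the circuits of the adversary, and the number of qubits of its advice. -/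
structure SimInput where
  lam : ℕ
  slack : ℕ
  corrupted : Bool
  input : Val
  code : List (Circuit PWire)
  qubits : ℕ

instance instEncSimInput : Enc SimInput :=
  ⟨fun z => Enc.enc (z.lam, z.slack, z.corrupted, z.input, z.code, z.qubits)⟩

/-- `P` is an `ε`-simulatable protocol for `g` in the `f`-hybrid model. The simulator is a quantum
polynomial-time machine, that is, its circuits are generated uniformly in time polynomial in the
length of what it is given; so its running time is polynomial in the security parameter, in `1 / ε`
and in the size of the adversary. -/
def IsSimulatable {m : ℕ} (f : Fin m → Functionality) (P : Protocol m) (g : Functionality) : Prop :=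
  P.IsPPT ∧ ∃ S : SimInput → Circuit PWire × Circuit PWire, PolyTime S ∧
    ∀ (A : NonUniformQPT (List (Circuit PWire))) (c : Bool) (x : ℕ → Bool → Val),
      (∀ b, PolyBounded (fun lam => (x lam b).length)) →
      ∀ ε : ℕ → ℝ, Noticeable ε →
        IndistUpTo ε
          (fun lam => hybridExec f P c lam (x lam) (A.code lam) (A.advice lam))
          (fun lam => idealExec g c lam (x lam)
            (S { lam := lam
                 slack := ⌈1 / ε lam⌉₊
                 corrupted := c
                 input := x lam c
                 code := A.code lam
                 qubits := (A.advice lam).qubits })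
            (A.advice lam))

/-- `P` is an `ε`-simulatable protocol for `g` in the plain model. -/
def IsPlainSimulatable (P : Protocol 0) (g : Functionality) : Prop :=
  IsSimulatable (fun i : Fin 0 => i.elim0) P g

/-- Moves the private work space of both parties to the `j`-th of countably many disjoint frames, so
that different sessions do not share work space. -/
def inFrame (j : ℕ) : PWire → PWire
  | (.work, k) => (.work, Nat.pair j k)
  | (r, k) => (r, k)

def Step.inFrame {m : ℕ} (j : ℕ) : Step m → Step m
  | .send b C => .send b (C.map (Gate.map (TwoPC.inFrame j)))
  | .call i => .call i
  | .handover => .handover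

/-- The composed protocol: `P` in which every call to the `i`-th ideal functionality is replaced by a
session of the protocol `R i`. The computation of `P` is suspended during such a session. -/
def compose {m : ℕ} (P : Protocol m) (R : Fin m → Protocol 0) : Protocol 0 := fun lam =>
  (P lam).zipIdx.flatMap fun sj =>
    match sj.1 with
    | .send b C => [Step.inFrame 0 (.send b C)]
    | .call i => session ((R i lam).map (Step.inFrame (sj.2 + 1)))
    | .handover => [.handover]

end TwoPC

end

/-!
A simulator for the composed protocol is obtained in two steps. Given an adversary against the
composed protocol, every session of a subprotocol is replaced by an ideal call in which the
simulator of the subprotocol plays the part of the adversary. This gives the code of an adversary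
against the calling protocol in the hybrid model (`hybridCode`, `hybridInput`), and the simulator of
the calling protocol is applied to that adversary. The number of calls is not constant: it is
bounded by the number `n` of steps of the calling protocol only. So half of the slack `ε` is given
to the calling protocol, and the other half is shared by the sessions, each of which gets at least
`ε / (2 * (n + 1))`. As the slack enters the running time of a simulator through `⌈1 / ε⌉`, the
composed simulator is still a polynomial-time one (`polyTime_hybridInput`,
`polyTime_unpackedSimulator`).

The replacement is justified by a hybrid argument over the steps of the calling protocol
(`abs_hybrid_diff_le`). What remains to be executed after a session is moved into the distinguisher.
This is possible since every operation of an execution in the plain model is performed by a quantum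
circuit, namely `execCircuit`, including the measurements of the channel and the moves of values at
the boundaries of sessions. To apply the security of the subprotocol one needs initial states of
isolated sessions, with advice for the adversary and definite values for the inputs. The state in
which a session begins is a mixture of such states (`Ready.exists_mixture`): the registers of the
honest party stay classical, because the honest party only uses classical gates and the channel is
measured. A component of the mixture fixes the suspended work space of the honest party, which is
handed to the distinguisher as part of its advice (`exists_view_advice`, `acceptProb_view`). The
security definition speaks about one sequence of adversaries at a time, while the hybrid argument
needs one bound for all sessions of a security parameter; the bound is uniform since a worst choice
of adversary, inputs and distinguisher can be made for every security parameter
(`eventually_uniform`). This is where non-uniformity is used.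

A subprotocol expects that the corrupted party receives its input in a register of its own, whereas
an adversary may have stored anything there. Therefore adversaries are first made *packed*: all
their registers are swapped into the work space, so that input and output registers hold the
original input and `⊥` when a session begins. A simulator may leave those registers in a different
state; `cleanCircuit` resets them after each simulated session. Packing is a unitary change of
coordinates that commutes with executions (`exec_packed`), and it is undone by the composed
simulator and by the distinguisher (`indistUpTo_of_pack`).

States are operators indexed by pairs of sets of wires. Almost all operations that have to be
commuted past gates, measurements and executions read one matrix entry for each entry of the result:
embeddings into a larger system, tensor products with advice, projections, permutations of wires.
They are treated together as *frames* (`IsFrame`, `IsFrame.run`, `IsFrame.transition_eq`,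
`IsFrame.exec_eq`).
-/

noncomputable section

namespace TwoPC

/-! ### Polynomial-time programs -/

theorem Tree.size_pos (x : Tree) : 0 < x.size := by cases x <;> simp [Tree.size]

theorem Tree.size_fst_le (x : Tree) : x.fst.size ≤ x.size := by
  cases x <;> simp [Tree.size, Tree.fst]; omega

theorem Tree.size_snd_le (x : Tree) : x.snd.size ≤ x.size := by
  cases x <;> simp [Tree.size, Tree.snd]; omega

theorem Runs.size_le {c : Prog} {x y : Tree} {t : ℕ} (h : Runs c x y t) : y.size ≤ t := by
  induction h <;> (try simp only [Tree.size] at *) <;> omega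

theorem Runs.loop_of_nil {c : Prog} {x : Tree} (h : x.fst = .nil) : Runs (.loop c) x x x.size := by
  constructor
  exact h

theorem poly_mono (p : Polynomial ℕ) {a b : ℕ} (h : a ≤ b) : p.eval a ≤ p.eval b := by
  simp only [Polynomial.eval_eq_sum_range]
  gcongr

/-- A tree is written down as itself. -/
instance instEncTree : Enc Tree := ⟨fun x => x⟩

instance instEncUnit : Enc Unit := ⟨fun _ => .nil⟩

/-- The proof that an element belongs to a subtype is not written down. Functions on subtypes serve
for the cases of a case distinction. -/
instance instEncSubtype {α : Type} [Enc α] (p : α → Prop) : Enc {a // p a} :=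
  ⟨fun a => Enc.enc a.1⟩

section Programs

variable {α β γ σ τ : Type} [Enc α] [Enc β] [Enc γ] [Enc σ] [Enc τ]

theorem descLength_pos (a : α) : 0 < descLength a := Tree.size_pos _

theorem descLength_prod (p : α × β) : descLength p = descLength p.1 + descLength p.2 + 1 := rfl

theorem descLength_pair (a : α) (b : β) :
    descLength (a, b) = descLength a + descLength b + 1 := rfl

theorem descLength_cons (a : α) (l : List α) :
    descLength (a :: l) = descLength a + descLength l + 1 := rfl

theorem descLength_nil : descLength ([] : List α) = 1 := rfl

theorem descLength_append (l l' : List α) :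
    descLength (l ++ l') + 1 = descLength l + descLength l' := by
  induction l with
  | nil => simp [descLength_nil]; omega
  | cons a l ih => simp only [List.cons_append, descLength_cons]; omega

theorem descLength_reverse (l : List α) : descLength l.reverse = descLength l := by
  induction l with
  | nil => rfl
  | cons a l ih =>
    have := descLength_append l.reverse [a]
    simp only [List.reverse_cons, descLength_cons, descLength_nil] at *; omega

theorem length_lt_descLength (l : List α) : l.length < descLength l := by
  induction l with
  | nil => simp [descLength_nil]
  | cons a l ih => simp only [List.length_cons, descLength_cons]; omega

theorem descLength_le_of_mem {l : List α} {a : α} (h : a ∈ l) : descLength a ≤ descLength l := by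
  induction l with
  | nil => simp at h
  | cons b l ih =>
    rw [descLength_cons]
    rcases List.mem_cons.1 h with rfl | h
    · omega
    · have := ih h; omega

theorem descLength_nat (n : ℕ) : descLength n = 2 * n + 1 := by
  induction n with
  | zero => rfl
  | succ n ih =>
    change (encNat n).size = _ at ih
    change (Tree.cons .nil (encNat n)).size = _
    simp [Tree.size, ih]; omega

theorem PolyTime.size_le {F : α → β} (h : PolyTime F) :
    ∃ p : Polynomial ℕ, ∀ a, descLength (F a) ≤ p.eval (descLength a) := by
  obtain ⟨c, p, h⟩ := h
  refine ⟨p, fun a => ?_⟩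
  obtain ⟨t, ht, hr⟩ := h a
  exact hr.size_le.trans ht

/-- Only the descriptions of arguments and values matter for running times. -/
theorem PolyTime.congr_enc {F : α → β} {G : α → γ} (hF : PolyTime F)
    (h : ∀ a, Enc.enc (G a) = Enc.enc (F a)) : PolyTime G := by
  obtain ⟨c, p, hc⟩ := hF
  refine ⟨c, p, fun a => ?_⟩
  rw [h a]; exact hc a

theorem PolyTime.congr {F G : α → β} (hF : PolyTime F) (h : ∀ a, G a = F a) : PolyTime G :=
  hF.congr_enc fun a => by rw [h a]

theorem PolyTime.id : PolyTime (fun a : α => a) :=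
  ⟨.id, .X, fun a => ⟨_, by simp [descLength], .id _⟩⟩

/-- A map that does not change the description is computed by doing nothing. -/
theorem PolyTime.of_enc {F : α → β} (h : ∀ a, Enc.enc (F a) = Enc.enc a) : PolyTime F :=
  PolyTime.id.congr_enc h

theorem PolyTime.comp {G : β → γ} {F : α → β} (hG : PolyTime G) (hF : PolyTime F) :
    PolyTime (fun a => G (F a)) := by
  obtain ⟨c, p, hc⟩ := hF
  obtain ⟨d, q, hd⟩ := hG
  refine ⟨.comp d c, p + q.comp p + 1, fun a => ?_⟩
  obtain ⟨t, ht, hr⟩ := hc a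
  obtain ⟨u, hu, hs⟩ := hd (F a)
  refine ⟨t + u + 1, ?_, .comp hr hs⟩
  have : q.eval (descLength (F a)) ≤ q.eval (p.eval (descLength a)) :=
    poly_mono q (hr.size_le.trans ht)
  simp only [Polynomial.eval_add, Polynomial.eval_comp, Polynomial.eval_one]
  omega

theorem PolyTime.pair {F : α → β} {G : α → γ} (hF : PolyTime F) (hG : PolyTime G) :
    PolyTime (fun a => (F a, G a)) := by
  obtain ⟨c, p, hc⟩ := hF
  obtain ⟨d, q, hd⟩ := hG
  refine ⟨.pair c d, p + q + (p + q + 1), fun a => ?_⟩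
  obtain ⟨t, ht, hr⟩ := hc a
  obtain ⟨u, hu, hs⟩ := hd a
  refine ⟨_, ?_, .pair hr hs⟩
  have := hr.size_le
  have := hs.size_le
  simp only [Polynomial.eval_add, Polynomial.eval_one, Tree.size]
  omega

theorem polyTime_treeFst : PolyTime Tree.fst :=
  ⟨.fst, .X, fun a => ⟨_, by simpa [descLength, Enc.enc] using a.size_fst_le, .fst _⟩⟩

theorem polyTime_treeSnd : PolyTime Tree.snd :=
  ⟨.snd, .X, fun a => ⟨_, by simpa [descLength, Enc.enc] using a.size_snd_le, .snd _⟩⟩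

theorem polyTime_enc : PolyTime (Enc.enc : α → Tree) := PolyTime.of_enc fun _ => rfl

theorem PolyTime.fst {F : α → β × γ} (hF : PolyTime F) : PolyTime (fun a => (F a).1) :=
  (polyTime_treeFst.comp (polyTime_enc.comp hF)).congr_enc fun _ => rfl

theorem PolyTime.snd {F : α → β × γ} (hF : PolyTime F) : PolyTime (fun a => (F a).2) :=
  (polyTime_treeSnd.comp (polyTime_enc.comp hF)).congr_enc fun _ => rfl

theorem PolyTime.const (b : β) : PolyTime (fun _ : α => b) := by
  suffices h : ∀ y : Tree, PolyTime (fun _ : α => y) from (h (Enc.enc b)).congr_enc fun _ => rfl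
  intro y
  induction y with
  | nil => exact ⟨.nil, 1, fun a => ⟨1, by simp, .nil _⟩⟩
  | cons y z hy hz => exact (hy.pair hz).congr_enc fun _ => rfl

theorem PolyTime.val {p : β → Prop} {F : α → {b // p b}} (hF : PolyTime F) :
    PolyTime (fun a => (F a).1) := hF.congr_enc fun _ => rfl

theorem PolyTime.restrict {F : α → β} (hF : PolyTime F) (p : α → Prop) :
    PolyTime (fun a : {a // p a} => F a.1) := hF.comp (PolyTime.of_enc fun _ => rfl)

/-- Case distinction on whether a description is `nil`; each branch has to be correct only where it
is taken. -/
theorem PolyTime.caseNil {F : α → β} {H : α → γ} (hH : PolyTime H)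
    (h₁ : PolyTime (fun a : {a // Enc.enc (H a) = Tree.nil} => F a.1))
    (h₂ : PolyTime (fun a : {a // Enc.enc (H a) ≠ Tree.nil} => F a.1)) : PolyTime F := by
  obtain ⟨c, p, hc⟩ := hH
  obtain ⟨d, q, hd⟩ := h₁
  obtain ⟨e, r, he⟩ := h₂
  refine ⟨.ite c e d, p + q + r + 1, fun a => ?_⟩
  obtain ⟨t, ht, hr⟩ := hc a
  simp only [Polynomial.eval_add, Polynomial.eval_one]
  by_cases h : Enc.enc (H a) = Tree.nil
  · obtain ⟨u, hu, hs⟩ := hd ⟨a, h⟩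
    rw [h] at hr
    refine ⟨_, ?_, .ite_nil hr hs⟩
    change u ≤ q.eval (descLength a) at hu
    omega
  · obtain ⟨u, hu, hs⟩ := he ⟨a, h⟩
    cases hy : Enc.enc (H a) with
    | nil => exact absurd hy h
    | cons y z =>
      rw [hy] at hr
      refine ⟨_, ?_, .ite_cons hr hs⟩
      change u ≤ r.eval (descLength a) at hu
      omega

theorem PolyTime.cond_on {b : α → Bool} (hb : PolyTime b) {F : α → β}
    (h₁ : PolyTime (fun a : {a // b a = true} => F a.1))
    (h₂ : PolyTime (fun a : {a // b a = false} => F a.1)) : PolyTime F := by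
  have key : ∀ a, Enc.enc (b a) = Tree.nil ↔ b a = false := by
    intro a
    cases b a <;> simp [Enc.enc]
  refine PolyTime.caseNil hb ?_ ?_
  · exact h₂.comp (PolyTime.of_enc (F := fun a : {a // Enc.enc (b a) = Tree.nil} =>
      (⟨a.1, (key _).1 a.2⟩ : {a // b a = false})) fun _ => rfl)
  · exact h₁.comp (PolyTime.of_enc (F := fun a : {a // Enc.enc (b a) ≠ Tree.nil} =>
      (⟨a.1, by have := a.2; rw [Ne, key] at this; simpa using this⟩ : {a // b a = true}))
      fun _ => rfl)

theorem PolyTime.ite {b : α → Bool} (hb : PolyTime b) {F G : α → β} (hF : PolyTime F)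
    (hG : PolyTime G) : PolyTime (fun a => if b a then F a else G a) := by
  refine PolyTime.cond_on hb ?_ ?_
  · exact (hF.restrict _).congr fun a => by simp [a.2]
  · exact (hG.restrict _).congr fun a => by simp [a.2]

theorem PolyTime.tail {F : α → List β} (hF : PolyTime F) : PolyTime (fun a => (F a).tail) :=
  (polyTime_treeSnd.comp (polyTime_enc.comp hF)).congr_enc fun a => by
    cases F a <;> rfl

theorem PolyTime.cons {F : α → β} {G : α → List β} (hF : PolyTime F) (hG : PolyTime G) :
    PolyTime (fun a => F a :: G a) := (hF.pair hG).congr_enc fun _ => rfl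

theorem PolyTime.isEmpty {F : α → List β} (hF : PolyTime F) :
    PolyTime (fun a => (F a).isEmpty) := by
  refine PolyTime.caseNil hF ?_ ?_
  · refine (PolyTime.const true).congr fun a => ?_
    have := a.2
    cases h : F a.1 with
    | nil => rfl
    | cons b l => rw [h] at this; simp [Enc.enc, encList] at this
  · refine (PolyTime.const false).congr fun a => ?_
    have := a.2
    cases h : F a.1 with
    | nil => rw [h] at this; simp [Enc.enc, encList] at this
    | cons b l => rfl

theorem PolyTime.headD {F : α → List β} (hF : PolyTime F) {d : β} :
    PolyTime (fun a => (F a).headD d) := by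
  refine PolyTime.cond_on hF.isEmpty ?_ ?_
  · exact (PolyTime.const d).congr fun a => by
      have := a.2; simp at this; simp [this]
  · refine (polyTime_treeFst.comp (polyTime_enc.comp (hF.restrict _))).congr_enc fun a => ?_
    have := a.2
    cases h : F a.1 with
    | nil => rw [h] at this; simp at this
    | cons b l => rfl

theorem PolyTime.succ {F : α → ℕ} (hF : PolyTime F) : PolyTime (fun a => F a + 1) :=
  ((PolyTime.const ()).pair hF).congr_enc fun _ => rfl

theorem enc_replicate (n : ℕ) : Enc.enc (List.replicate n ()) = Enc.enc n := by
  induction n with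
  | zero => rfl
  | succ n ih =>
    change Tree.cons .nil (Enc.enc (List.replicate n ())) = Tree.cons .nil (Enc.enc n)
    rw [ih]

/-- Numbers are written in unary, so that a number and a list of that length have the same
description. -/
theorem PolyTime.replicate_unit {F : α → ℕ} (hF : PolyTime F) :
    PolyTime (fun a => List.replicate (F a) ()) := hF.congr_enc fun _ => enc_replicate _

theorem PolyTime.of_replicate_unit {F : α → ℕ}
    (hF : PolyTime (fun a => List.replicate (F a) ())) : PolyTime F :=
  hF.congr_enc fun _ => (enc_replicate _).symm

/-- Polynomially many iterations of a polynomial-time step, with states of polynomial size. The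
iteration continues as long as the left component of the description of the state is not `nil`. -/
theorem PolyTime.iterate {F : σ → σ} (hF : PolyTime F) {init : α → σ} (hinit : PolyTime init)
    (n : α → ℕ) (q r : Polynomial ℕ) (hn : ∀ a, n a ≤ r.eval (descLength a))
    (hsize : ∀ a, ∀ i ≤ n a, descLength (F^[i] (init a)) ≤ q.eval (descLength a))
    (hgo : ∀ a, ∀ i < n a, (Enc.enc (F^[i] (init a))).fst ≠ .nil)
    (hend : ∀ a, (Enc.enc (F^[n a] (init a))).fst = .nil) :
    PolyTime (fun a => F^[n a] (init a)) := by
  obtain ⟨c, p, hc⟩ := hF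
  obtain ⟨d, p', hd⟩ := hinit
  -- at most `r` rounds, each of which costs at most `p` of the size of the state, plus overhead
  refine ⟨.comp (.loop c) d, p' + ((r + 1) * (p.comp q + q + 1)) + 1, fun a => ?_⟩
  obtain ⟨t, ht, hr⟩ := hd a
  set B := p.eval (q.eval (descLength a)) + q.eval (descLength a) + 1 with hB
  have main : ∀ k i, i + k = n a → ∃ u ≤ (k + 1) * B,
      Runs (.loop c) (Enc.enc (F^[i] (init a))) (Enc.enc (F^[n a] (init a))) u := by
    intro k
    induction k with
    | zero =>
      intro i hi
      obtain rfl : i = n a := by omega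
      refine ⟨_, ?_, .loop_of_nil (hend a)⟩
      have := hsize a _ le_rfl
      change (Enc.enc _).size ≤ _ at this
      omega
    | succ k ih =>
      intro i hi
      obtain ⟨u, hu, hs⟩ := ih (i + 1) (by omega)
      obtain ⟨v, hv, hw⟩ := hc (F^[i] (init a))
      rw [← Function.iterate_succ_apply' F] at hw
      refine ⟨_, ?_, .loop_step (hgo a i (by omega)) hw hs⟩
      have := poly_mono p (hsize a i (by omega))
      have : (k + 1 + 1) * B = (k + 1) * B + B := by ring
      omega
  obtain ⟨u, hu, hs⟩ := main (n a) 0 (by omega)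
  refine ⟨_, ?_, .comp hr hs⟩
  have h1 : (n a + 1) * B ≤ (r.eval (descLength a) + 1) * B := by
    gcongr; exact hn a
  simp only [Polynomial.eval_add, Polynomial.eval_mul, Polynomial.eval_comp, Polynomial.eval_one]
  rw [← hB]
  omega

/-- A fold over a list, if all intermediate values have polynomial size. -/
theorem PolyTime.foldl {step : α × σ × β → σ} (hstep : PolyTime step) {init : α → σ}
    (hinit : PolyTime init) {l : α → List β} (hl : PolyTime l) (q : Polynomial ℕ)
    (hbound : ∀ a l₁ l₂, l a = l₁ ++ l₂ →
      descLength (l₁.foldl (fun s b => step (a, s, b)) (init a)) ≤ q.eval (descLength a)) :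
    PolyTime (fun a => (l a).foldl (fun s b => step (a, s, b)) (init a)) := by
  obtain ⟨r, hr⟩ := hl.size_le
  -- the state of the loop: the rest of the list, the parameter, the accumulated value
  let F : List β × α × σ → List β × α × σ := fun y =>
    match y.1 with
    | [] => y
    | b :: l => (l, y.2.1, step (y.2.1, y.2.2, b))
  have hF : PolyTime F := by
    refine PolyTime.cond_on (PolyTime.id.fst.isEmpty) ?_ ?_
    · refine (PolyTime.id.restrict _).congr fun a => ?_
      have := a.2
      simp only [List.isEmpty_iff] at this
      simp [F, this]
    · have e : PolyTime (fun y : {y : List β × α × σ // y.1.isEmpty = false} =>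
          ((y.1.1.head (by simpa using y.2), y.1.1.tail), y.1.2)) := by
        refine PolyTime.of_enc fun y => ?_
        obtain ⟨⟨_ | ⟨b, l⟩, a, s⟩, hy⟩ := y
        · simp at hy
        · rfl
      have k : PolyTime (fun y : (β × List β) × α × σ =>
          (y.1.2, y.2.1, step (y.2.1, y.2.2, y.1.1))) :=
        PolyTime.id.fst.snd.pair (PolyTime.id.snd.fst.pair
          (hstep.comp (PolyTime.id.snd.fst.pair (PolyTime.id.snd.snd.pair PolyTime.id.fst.fst))))
      refine (k.comp e).congr fun y => ?_
      obtain ⟨⟨_ | ⟨b, l⟩, a, s⟩, hy⟩ := y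
      · simp at hy
      · rfl
  have hit : ∀ a s l₁ l₂, F^[l₁.length] (l₁ ++ l₂, a, s) =
      (l₂, a, l₁.foldl (fun s b => step (a, s, b)) s) := by
    intro a s l₁ l₂
    induction l₁ generalizing s with
    | nil => rfl
    | cons b l₁ ih =>
      rw [List.length_cons, Function.iterate_succ_apply]
      exact ih _
  have hit' : ∀ a i, i ≤ (l a).length → F^[i] (l a, a, init a) =
      ((l a).drop i, a, ((l a).take i).foldl (fun s b => step (a, s, b)) (init a)) := by
    intro a i hi
    have := hit a (init a) ((l a).take i) ((l a).drop i)
    rwa [List.take_append_drop, List.length_take, min_eq_left hi] at this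
  have main := PolyTime.iterate hF (hl.pair (PolyTime.id.pair hinit)) (fun a => (l a).length)
    (r + .X + q + 2) r (fun a => (length_lt_descLength _).le.trans (hr a)) ?_ ?_ ?_
  · refine main.snd.snd.congr fun a => ?_
    rw [hit' a _ le_rfl, List.take_length]
  · intro a i hi
    rw [hit' a i hi]
    have h1 := hbound a _ _ (List.take_append_drop i (l a)).symm
    have h2 := descLength_append ((l a).take i) ((l a).drop i)
    rw [List.take_append_drop] at h2
    have h3 := hr a
    have h4 := descLength_pos ((l a).take i)
    simp only [descLength_pair, Polynomial.eval_add, Polynomial.eval_X, Polynomial.eval_ofNat]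
    omega
  · intro a i hi
    rw [hit' a i hi.le, List.drop_eq_getElem_cons hi]
    exact fun h => by cases h
  · intro a
    rw [hit' a _ le_rfl, List.drop_length]
    rfl

/-- A fold whose step lets the accumulated value grow by a bounded amount, as long as an invariant
holds. -/
theorem PolyTime.foldl_of_invariant {step : α × σ × β → σ} (hstep : PolyTime step) {init : α → σ}
    (hinit : PolyTime init) {l : α → List β} (hl : PolyTime l) (I : α → σ → Prop)
    (h0 : ∀ a, I a (init a)) (h1 : ∀ a s b, I a s → I a (step (a, s, b))) (r : Polynomial ℕ)
    (hr : ∀ a s b, I a s → descLength (step (a, s, b)) ≤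
      descLength s + r.eval (descLength a + descLength b)) :
    PolyTime (fun a => (l a).foldl (fun s b => step (a, s, b)) (init a)) := by
  obtain ⟨p, hp⟩ := hinit.size_le
  obtain ⟨q, hq⟩ := hl.size_le
  refine PolyTime.foldl hstep hinit hl (p + q * r.comp (.X + q)) fun a l₁ l₂ h => ?_
  have key : ∀ l' : List β, (∀ b ∈ l', b ∈ l a) → ∀ s, I a s →
      descLength (l'.foldl (fun s b => step (a, s, b)) s) ≤
        descLength s +
          l'.length * r.eval (descLength a + descLength (l a)) := by
    intro l'
    induction l' with
    | nil => intro _ s _; simp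
    | cons b l' ih =>
      intro hmem s hs
      refine (ih (fun c hc => hmem c (by simp [hc])) _ (h1 a s b hs)).trans ?_
      have h1 := hr a s b hs
      have h2 := poly_mono r (Nat.add_le_add_left
        (descLength_le_of_mem (hmem b (by simp))) (descLength a))
      have h3 : (b :: l').length * r.eval (descLength a + descLength (l a)) =
        l'.length * r.eval (descLength a + descLength (l a)) +
          r.eval (descLength a + descLength (l a)) := by
        rw [List.length_cons]; ring
      omega
  have h1 := key l₁ (fun b hb => by rw [h]; simp [hb]) (init a) (h0 a)
  have h2 := hp a
  have h3 : l₁.length * r.eval (descLength a + descLength (l a)) ≤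
      q.eval (descLength a) *
        r.eval (descLength a + q.eval (descLength a)) := by
    have h4 := hq a
    have h5 := length_lt_descLength (l a)
    have h6 : l₁.length ≤ (l a).length := by rw [h]; simp
    exact Nat.mul_le_mul (by omega) (poly_mono r (by omega))
  simp only [Polynomial.eval_add, Polynomial.eval_mul, Polynomial.eval_comp, Polynomial.eval_X]
  omega

theorem PolyTime.foldl_of_additive {step : α × σ × β → σ} (hstep : PolyTime step) {init : α → σ}
    (hinit : PolyTime init) {l : α → List β} (hl : PolyTime l) (r : Polynomial ℕ)
    (hr : ∀ a s b, descLength (step (a, s, b)) ≤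
      descLength s + r.eval (descLength a + descLength b)) :
    PolyTime (fun a => (l a).foldl (fun s b => step (a, s, b)) (init a)) :=
  PolyTime.foldl_of_invariant hstep hinit hl (fun _ _ => True) (fun _ => trivial)
    (fun _ _ _ _ => trivial) r fun a s b _ => hr a s b

theorem PolyTime.reverse {l : α → List β} (hl : PolyTime l) :
    PolyTime (fun a => (l a).reverse) := by
  refine (PolyTime.foldl_of_additive (step := fun y : α × List β × β => y.2.2 :: y.2.1)
    (PolyTime.id.snd.snd.cons PolyTime.id.snd.fst) (PolyTime.const []) hl (.X + 1)
    fun a s b => ?_).congr fun a => ?_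
  · simp only [descLength_cons, Polynomial.eval_add, Polynomial.eval_X, Polynomial.eval_one]
    omega
  · rw [← List.foldr_reverse, List.reverse_eq_iff]
    induction l a using List.reverseRecOn <;> simp_all

theorem PolyTime.append {l l' : α → List β} (hl : PolyTime l) (hl' : PolyTime l') :
    PolyTime (fun a => l a ++ l' a) := by
  refine (PolyTime.foldl_of_additive (step := fun y : α × List β × β => y.2.2 :: y.2.1)
    (PolyTime.id.snd.snd.cons PolyTime.id.snd.fst) hl' hl.reverse (.X + 1)
    fun a s b => ?_).congr fun a => ?_
  · simp only [descLength_cons, Polynomial.eval_add, Polynomial.eval_X, Polynomial.eval_one]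
    omega
  · rw [List.foldl_reverse]
    induction l a <;> simp_all

theorem PolyTime.map {l : α → List β} (hl : PolyTime l) {f : α × β → γ} (hf : PolyTime f) :
    PolyTime (fun a => (l a).map fun b => f (a, b)) := by
  obtain ⟨r, hr⟩ := hf.size_le
  refine (PolyTime.foldl_of_additive
    (step := fun y : α × List γ × β => f (y.1, y.2.2) :: y.2.1)
    ((hf.comp (PolyTime.id.fst.pair PolyTime.id.snd.snd)).cons PolyTime.id.snd.fst)
    (PolyTime.const []) hl.reverse (r.comp (.X + 1) + 1) fun a s b => ?_).congr fun a => ?_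
  · have := hr (a, b)
    rw [descLength_pair] at this
    simp only [descLength_cons, Polynomial.eval_add, Polynomial.eval_X, Polynomial.eval_one,
      Polynomial.eval_comp]
    omega
  · rw [List.foldl_reverse]
    induction l a <;> simp_all

theorem PolyTime.flatten {l : α → List (List β)} (hl : PolyTime l) :
    PolyTime (fun a => (l a).flatten) := by
  refine (PolyTime.foldl_of_additive
    (step := fun y : α × List β × List β => y.2.1 ++ y.2.2)
    (PolyTime.id.snd.fst.append PolyTime.id.snd.snd)
    (PolyTime.const []) hl .X fun a s b => ?_).congr fun a => ?_
  · have := descLength_append s b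
    simp only [Polynomial.eval_X]
    omega
  · suffices h : ∀ s, (l a).foldl (fun s b => s ++ b) s = s ++ (l a).flatten by simp [h]
    induction l a <;> simp_all

theorem PolyTime.flatMap {l : α → List β} (hl : PolyTime l) {f : α × β → List γ}
    (hf : PolyTime f) : PolyTime (fun a => (l a).flatMap fun b => f (a, b)) :=
  (hl.map hf).flatten.congr fun _ => List.flatMap_def ..

theorem PolyTime.add {m n : α → ℕ} (hm : PolyTime m) (hn : PolyTime n) :
    PolyTime (fun a => m a + n a) :=
  .of_replicate_unit <| (hm.replicate_unit.append hn.replicate_unit).congr fun _ => by simp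

theorem PolyTime.mul {m n : α → ℕ} (hm : PolyTime m) (hn : PolyTime n) :
    PolyTime (fun a => m a * n a) :=
  .of_replicate_unit <| (hm.replicate_unit.flatMap
    (f := fun y : α × Unit => List.replicate (n y.1) ())
    ((hn.comp PolyTime.id.fst).replicate_unit)).congr fun a => by
      refine (List.eq_replicate_iff.2 ⟨?_, fun _ _ => rfl⟩).symm
      simp

theorem PolyTime.length {l : α → List β} (hl : PolyTime l) : PolyTime (fun a => (l a).length) :=
  .of_replicate_unit <| (hl.map (f := fun _ => ()) (PolyTime.const ())).congr fun a => by simp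

theorem PolyTime.polynomial_eval (p : Polynomial ℕ) {n : α → ℕ} (hn : PolyTime n) :
    PolyTime (fun a => p.eval (n a)) := by
  induction p using Polynomial.induction_on with
  | C k => simpa using PolyTime.const k
  | add p q hp hq => simpa using hp.add hq
  | monomial k c h =>
    refine (h.mul hn).congr fun a => ?_
    simp [pow_succ, mul_assoc]

theorem PolyTime.drop {l : α → List β} (hl : PolyTime l) {n : α → ℕ} (hn : PolyTime n) :
    PolyTime (fun a => (l a).drop (n a)) := by
  obtain ⟨q, hq⟩ := hl.size_le
  have key : ∀ (k : ℕ) (s : List β),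
      (List.replicate k ()).foldl (fun s _ => s.tail) s = s.drop k := by
    intro k
    induction k with
    | zero => simp
    | succ k ih => intro s; rw [List.replicate_succ, List.foldl_cons, ih]; simp
  refine (PolyTime.foldl_of_additive (step := fun y : α × List β × Unit => y.2.1.tail)
    PolyTime.id.snd.fst.tail hl hn.replicate_unit 0 fun a s b => ?_).congr fun a => (key _ _).symm
  cases s
  · simp
  · simp only [List.tail_cons, descLength_cons]; omega

theorem PolyTime.sub {m n : α → ℕ} (hm : PolyTime m) (hn : PolyTime n) :
    PolyTime (fun a => m a - n a) :=
  .of_replicate_unit <| (hm.replicate_unit.drop hn).congr fun a => by simp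

theorem PolyTime.decide_eq_zero {m : α → ℕ} (hm : PolyTime m) :
    PolyTime (fun a => decide (m a = 0)) :=
  hm.replicate_unit.isEmpty.congr fun a => by
    cases h : m a <;> simp [List.replicate_succ]

theorem PolyTime.not {b : α → Bool} (hb : PolyTime b) : PolyTime (fun a => !b a) :=
  (hb.ite (PolyTime.const false) (PolyTime.const true)).congr fun a => by cases b a <;> rfl

theorem PolyTime.decide_lt {m n : α → ℕ} (hm : PolyTime m) (hn : PolyTime n) :
    PolyTime (fun a => decide (m a < n a)) :=
  (hn.sub hm).decide_eq_zero.not.congr fun a => by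
    by_cases h : m a < n a <;> simp [h] <;> omega

theorem PolyTime.natPair {m n : α → ℕ} (hm : PolyTime m) (hn : PolyTime n) :
    PolyTime (fun a => Nat.pair (m a) (n a)) :=
  ((hm.decide_lt hn).ite ((hn.mul hn).add hm) (((hm.mul hm).add hm).add hn)).congr fun a => by
    simp [Nat.pair]

theorem PolyTime.zipIdx {l : α → List β} (hl : PolyTime l) :
    PolyTime (fun a => (l a).zipIdx) := by
  obtain ⟨q, hq⟩ := hl.size_le
  -- the list is produced in reverse order, together with a counter
  have key : ∀ (l : List β) (s : List (β × ℕ)) (k : ℕ),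
      l.foldl (fun (s : List (β × ℕ) × ℕ) b => ((b, s.2) :: s.1, s.2 + 1)) (s, k) =
        ((l.zipIdx k).reverse ++ s, k + l.length) := by
    intro l
    induction l with
    | nil => simp
    | cons b l ih =>
      intro s k
      rw [List.foldl_cons, ih]
      simp [List.zipIdx_cons]; omega
  have hsize : ∀ (l : List β) (k : ℕ),
      descLength (l.zipIdx k) ≤ descLength l + l.length * (2 * (k + l.length) + 2) := by
    intro l
    induction l with
    | nil => simp [descLength_nil]
    | cons b l ih =>
      intro k
      have := ih (k + 1)
      rw [List.zipIdx_cons, descLength_cons, descLength_cons, descLength_pair, descLength_nat,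
        List.length_cons]
      have e : (l.length + 1) * (2 * (k + (l.length + 1)) + 2) =
        l.length * (2 * (k + 1 + l.length) + 2) + (2 * (k + 1 + l.length) + 2) := by ring
      omega
  have main := PolyTime.foldl
    (step := fun y : α × (List (β × ℕ) × ℕ) × β => ((y.2.2, y.2.1.2) :: y.2.1.1, y.2.1.2 + 1))
    (((PolyTime.id.snd.snd.pair PolyTime.id.snd.fst.snd).cons PolyTime.id.snd.fst.fst).pair
      PolyTime.id.snd.fst.snd.succ) (init := fun a => (([] : List (β × ℕ)), 0)) (PolyTime.const _)
      hl (q + q * (2 * q + 2) + 2 * q + 2) ?_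
  · refine main.fst.reverse.congr fun a => ?_
    simp [key]
  · intro a l₁ l₂ h
    rw [key, List.append_nil, descLength_pair, descLength_reverse, descLength_nat]
    have h1 := hsize l₁ 0
    have h2 := length_lt_descLength l₁
    have h3 := descLength_append l₁ l₂
    have h4 := hq a
    have h5 := descLength_pos l₂
    rw [h] at h4
    have h6 : l₁.length * (2 * (0 + l₁.length) + 2) ≤
        q.eval (descLength a) * (2 * q.eval (descLength a) + 2) :=
      Nat.mul_le_mul (by omega) (by omega)
    simp only [Polynomial.eval_add, Polynomial.eval_mul, Polynomial.eval_ofNat]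
    omega

theorem PolyTime.range {n : α → ℕ} (hn : PolyTime n) : PolyTime (fun a => List.range (n a)) := by
  have h := (hn.replicate_unit.zipIdx).map (f := fun y : α × Unit × ℕ => y.2.2) PolyTime.id.snd.snd
  refine h.congr fun a => ?_
  change _ = List.map Prod.snd _
  rw [List.zipIdx_map_snd]; simp [List.range_eq_range']

/-- The length of a description is computed in polynomial time, by taking the tree apart with a
stack of subtrees that are still to be counted. -/
theorem PolyTime.descLength {F : α → β} (hF : PolyTime F) :
    PolyTime (fun a => descLength (F a)) := by
  suffices h : PolyTime Tree.size from (h.comp (polyTime_enc.comp hF)).congr fun _ => rfl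
  let st : List Tree × ℕ → List Tree × ℕ := fun y =>
    match y.1 with
    | [] => y
    | .nil :: l => (l, y.2 + 1)
    | .cons a b :: l => (a :: b :: l, y.2 + 1)
  have hst : PolyTime st := by
    refine PolyTime.cond_on PolyTime.id.fst.isEmpty ?_ ?_
    · refine (PolyTime.id.restrict _).congr fun a => ?_
      have := a.2
      simp only [List.isEmpty_iff] at this
      simp [st, this]
    · have hh : PolyTime (fun y : List Tree × ℕ => y.1.headD .nil) := PolyTime.id.fst.headD
      refine PolyTime.caseNil (hh.restrict _) ?_ ?_
      · refine ((PolyTime.id.fst.tail.pair PolyTime.id.snd.succ).restrict _ |>.restrict _).congr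
          fun y => ?_
        obtain ⟨⟨⟨_ | ⟨_ | ⟨b, c⟩, l⟩, k⟩, h⟩, h'⟩ := y
        · simp at h
        · rfl
        · cases h'
      · have k1 : PolyTime (fun y : List Tree × ℕ =>
            ((y.1.headD .nil).fst :: (y.1.headD .nil).snd :: y.1.tail, y.2 + 1)) :=
          ((polyTime_treeFst.comp hh).cons
            ((polyTime_treeSnd.comp hh).cons PolyTime.id.fst.tail)).pair PolyTime.id.snd.succ
        refine (k1.restrict _ |>.restrict _).congr fun y => ?_
        obtain ⟨⟨⟨_ | ⟨_ | ⟨b, c⟩, l⟩, k⟩, h⟩, h'⟩ := y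
        · simp at h
        · exact absurd rfl h'
        · rfl
  -- each step lowers the total size of the stack by one
  let w : List Tree → ℕ := fun l => (l.map Tree.size).sum
  have hw : ∀ y, y.1 ≠ [] → w (st y).1 + 1 = w y.1 ∧ (st y).2 = y.2 + 1 := by
    rintro ⟨_ | ⟨_ | ⟨b, c⟩, l⟩, k⟩ h
    · simp at h
    · simp [st, w, Tree.size]; omega
    · simp [st, w, Tree.size]; omega
  have hwpos : ∀ l, l ≠ [] → 0 < w l := by
    rintro (_ | ⟨a, l⟩) h
    · simp at h
    · have := a.size_pos; simp [w]; omega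
  have inv : ∀ x : Tree, ∀ i ≤ x.size, w (st^[i] ([x], 0)).1 + i = x.size ∧
      (st^[i] ([x], 0)).2 = i := by
    intro x i
    induction i with
    | zero => simp [w]
    | succ i ih =>
      intro hi
      obtain ⟨h1, h2⟩ := ih (by omega)
      have hne : (st^[i] ([x], 0)).1 ≠ [] := by
        intro h; rw [h] at h1; simp [w] at h1; omega
      obtain ⟨h3, h4⟩ := hw _ hne
      rw [Function.iterate_succ_apply']
      omega
  have hlist : ∀ l : List Tree, TwoPC.descLength l ≤ 2 * w l + 1 := by
    intro l
    induction l with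
    | nil => simp [descLength_nil, w]
    | cons a l ih =>
      have := a.size_pos
      have e : TwoPC.descLength a = a.size := rfl
      simp [w, descLength_cons, e] at *; omega
  have main := PolyTime.iterate hst (init := fun x : Tree => ([x], 0))
    ((PolyTime.id.cons (PolyTime.const [])).pair (PolyTime.const 0)) Tree.size
    (4 * .X + 3) .X (fun a => by simp [TwoPC.descLength, Enc.enc]) ?_ ?_ ?_
  · exact main.snd.congr fun x => ((inv x _ le_rfl).2).symm
  · intro x i hi
    obtain ⟨h1, h2⟩ := inv x i hi
    have h3 := hlist (st^[i] ([x], 0)).1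
    rw [descLength_prod, descLength_nat, h2]
    have e : TwoPC.descLength x = x.size := rfl
    simp [e]; omega
  · intro x i hi
    obtain ⟨h1, h2⟩ := inv x i hi.le
    rcases h : st^[i] ([x], 0) with ⟨_ | ⟨b, l⟩, k⟩
    · rw [h] at h1; simp [w] at h1; omega
    · exact fun h => by cases h
  · intro x
    obtain ⟨h1, h2⟩ := inv x _ le_rfl
    rcases h : st^[x.size] ([x], 0) with ⟨_ | ⟨b, l⟩, k⟩
    · rfl
    · rw [h] at h1
      have := hwpos (b :: l) (by simp)
      simp at h1; omega

theorem PolyTime.treeFst {F : α → β} (hF : PolyTime F) : PolyTime (fun a => (Enc.enc (F a)).fst) :=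
  polyTime_treeFst.comp (polyTime_enc.comp hF)

theorem PolyTime.treeSnd {F : α → β} (hF : PolyTime F) : PolyTime (fun a => (Enc.enc (F a)).snd) :=
  polyTime_treeSnd.comp (polyTime_enc.comp hF)

theorem PolyTime.decide_eq {m : α → ℕ} (hm : PolyTime m) (k : ℕ) :
    PolyTime (fun a => decide (m a = k)) := by
  refine ((hm.decide_lt (PolyTime.const k)).ite (PolyTime.const false)
    ((hm.sub (PolyTime.const k)).decide_eq_zero)).congr fun a => ?_
  by_cases h : m a < k
  · simp [h]; omega
  · simp [h]; omega

theorem PolyTime.cond_eq {m : α → ℕ} (hm : PolyTime m) (k : ℕ) {F : α → β}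
    (h₁ : PolyTime (fun a : {a // m a = k} => F a.1))
    (h₂ : PolyTime (fun a : {a // m a ≠ k} => F a.1)) : PolyTime F := by
  refine PolyTime.cond_on (hm.decide_eq k) ?_ ?_
  · exact h₁.comp (PolyTime.of_enc (F := fun a : {a // decide (m a = k) = true} =>
      (⟨a.1, by simpa using a.2⟩ : {a // m a = k})) fun _ => rfl)
  · exact h₂.comp (PolyTime.of_enc (F := fun a : {a // decide (m a = k) = false} =>
      (⟨a.1, by simpa using a.2⟩ : {a // m a ≠ k})) fun _ => rfl)

/-- A finite family of polynomial-time functions, depending on the index as an argument. This uses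
that the number of functions is a constant. -/
theorem PolyTime.finCases : ∀ {m : ℕ} {F : Fin m → α → β}, (∀ i, PolyTime (F i)) →
    PolyTime (fun y : Fin m × α => F y.1 y.2)
  | 0, _, _ => ⟨.nil, 0, fun y => y.1.elim0⟩
  | m + 1, F, h => by
    have hv : PolyTime (fun y : Fin (m + 1) × α => y.1.val) := PolyTime.id.fst.congr_enc fun _ => rfl
    refine PolyTime.cond_eq hv 0 ?_ ?_
    · refine (((h 0).comp PolyTime.id.snd).restrict _).congr fun y => ?_
      obtain ⟨⟨i, a⟩, hi⟩ := y
      obtain rfl : i = 0 := Fin.ext hi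
      rfl
    · have ih := PolyTime.finCases (fun i => h i.succ)
      have e : PolyTime (fun y : {y : Fin (m + 1) × α // y.1.val ≠ 0} =>
          (y.1.1.pred (fun h0 => y.2 (by rw [h0]; rfl)), y.1.2)) := by
        refine ((PolyTime.id.fst.treeSnd.pair PolyTime.id.snd).restrict _).congr_enc fun y => ?_
        obtain ⟨⟨⟨_ | i, hi⟩, a⟩, hne⟩ := y
        · exact absurd rfl hne
        · rfl
      refine (ih.comp e).congr fun y => ?_
      simp

/-! ### Programs for gates, protocols and simulators -/

/-- The first component of the description of a gate. -/
def Gate.tag {W : Type} : Gate W → ℕ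
  | .flip _ => 0
  | .cnot _ _ => 1
  | .ccnot _ _ _ => 2
  | .had _ => 3
  | .phase _ => 4
  | .reset _ => 5
  | .coin _ => 6

theorem polyTime_gateTag {W : Type} [Enc W] : PolyTime (Gate.tag : Gate W → ℕ) :=
  PolyTime.id.treeFst.congr_enc fun g => by cases g <;> rfl

/-- The first wire of a gate; `wire₂` and `wire₃` are the second and the third one, or the last one
if there are fewer. -/
def Gate.wire₁ {W : Type} : Gate W → W
  | .flip w => w
  | .cnot a _ => a
  | .ccnot a _ _ => a
  | .had w => w
  | .phase w => w
  | .reset w => w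
  | .coin w => w

def Gate.wire₂ {W : Type} : Gate W → W
  | .flip w => w
  | .cnot _ w => w
  | .ccnot _ b _ => b
  | .had w => w
  | .phase w => w
  | .reset w => w
  | .coin w => w

def Gate.wire₃ {W : Type} : Gate W → W
  | .flip w => w
  | .cnot _ w => w
  | .ccnot _ _ w => w
  | .had w => w
  | .phase w => w
  | .reset w => w
  | .coin w => w

theorem PolyTime.gateMap {W W' : Type} [Enc W] [Enc W'] {e : α × W → W'} (he : PolyTime e)
    {g : α → Gate W} (hg : PolyTime g) :
    PolyTime (fun a => (g a).map (fun w => e (a, w))) := by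
  have ht := polyTime_gateTag.comp hg
  refine PolyTime.cond_eq ht 1 ?_ (PolyTime.cond_eq (ht.restrict _) 2 ?_ ?_)
  · have h1 : PolyTime (fun a : {a // (g a).tag = 1} => (g a.1).wire₁) := by
      refine (hg.treeSnd.treeFst.restrict _).congr_enc fun a => ?_
      obtain ⟨a, h⟩ := a
      dsimp only at *
      cases hh : g a <;> simp [hh, Gate.tag] at h
      rfl
    have h2 : PolyTime (fun a : {a // (g a).tag = 1} => (g a.1).wire₂) := by
      refine (hg.treeSnd.treeSnd.restrict _).congr_enc fun a => ?_
      obtain ⟨a, h⟩ := a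
      dsimp only at *
      cases hh : g a <;> simp [hh, Gate.tag] at h
      rfl
    have hv : PolyTime (fun a : {a // (g a).tag = 1} => a.1) := PolyTime.id.val
    refine ((PolyTime.const 1).pair ((he.comp (hv.pair h1)).pair
      (he.comp (hv.pair h2)))).congr_enc fun a => ?_
    obtain ⟨a, h⟩ := a
    dsimp only at *
    cases hh : g a <;> simp [hh, Gate.tag] at h
    rfl
  · have h1 : PolyTime (fun a : {a : {a // (g a).tag ≠ 1} // (g a.1).tag = 2} =>
        (g a.1.1).wire₁) := by
      refine ((hg.treeSnd.treeFst.restrict _).restrict _).congr_enc fun a => ?_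
      obtain ⟨⟨a, _⟩, h⟩ := a
      dsimp only at *
      cases hh : g a <;> simp [hh, Gate.tag] at h
      rfl
    have h2 : PolyTime (fun a : {a : {a // (g a).tag ≠ 1} // (g a.1).tag = 2} =>
        (g a.1.1).wire₂) := by
      refine ((hg.treeSnd.treeSnd.treeFst.restrict _).restrict _).congr_enc fun a => ?_
      obtain ⟨⟨a, _⟩, h⟩ := a
      dsimp only at *
      cases hh : g a <;> simp [hh, Gate.tag] at h
      rfl
    have h3 : PolyTime (fun a : {a : {a // (g a).tag ≠ 1} // (g a.1).tag = 2} =>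
        (g a.1.1).wire₃) := by
      refine ((hg.treeSnd.treeSnd.treeSnd.restrict _).restrict _).congr_enc fun a => ?_
      obtain ⟨⟨a, _⟩, h⟩ := a
      dsimp only at *
      cases hh : g a <;> simp [hh, Gate.tag] at h
      rfl
    have hv : PolyTime (fun a : {a : {a // (g a).tag ≠ 1} // (g a.1).tag = 2} => a.1.1) :=
      PolyTime.id.val.val
    refine ((PolyTime.const 2).pair ((he.comp (hv.pair h1)).pair
      ((he.comp (hv.pair h2)).pair (he.comp (hv.pair h3))))).congr_enc fun a => ?_
    obtain ⟨⟨a, _⟩, h⟩ := a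
    dsimp only at *
    cases hh : g a <;> simp [hh, Gate.tag] at h
    rfl
  · have h1 : PolyTime (fun a : {a : {a // (g a).tag ≠ 1} // (g a.1).tag ≠ 2} =>
        (g a.1.1).wire₁) := by
      refine ((hg.treeSnd.restrict _).restrict _).congr_enc fun a => ?_
      obtain ⟨⟨a, h'⟩, h⟩ := a
      dsimp only at *
      cases hh : g a <;> simp [hh, Gate.tag] at h h' <;> rfl
    have hv : PolyTime (fun a : {a : {a // (g a).tag ≠ 1} // (g a.1).tag ≠ 2} => a.1.1) :=
      PolyTime.id.val.val
    refine (((ht.restrict _).restrict _).pair (he.comp (hv.pair h1))).congr_enc fun a => ?_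
    obtain ⟨⟨a, h'⟩, h⟩ := a
    dsimp only at *
    cases hh : g a <;> simp [hh, Gate.tag] at h h' <;> rfl

theorem PolyTime.circuitMap {W W' : Type} [Enc W] [Enc W'] {e : α × W → W'} (he : PolyTime e)
    {C : α → Circuit W} (hC : PolyTime C) :
    PolyTime (fun a => (C a).map (Gate.map fun w => e (a, w))) :=
  PolyTime.map hC (f := fun y : α × Gate W => y.2.map fun w => e (y.1, w))
    (PolyTime.gateMap (e := fun z : (α × Gate W) × W => e (z.1.1, z.2))
      (he.comp (PolyTime.id.fst.fst.pair PolyTime.id.snd)) PolyTime.id.snd)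

/-- The number by which a register is described. -/
def Port.tag : Port → ℕ
  | .work => 0
  | .inp => 1
  | .out => 2
  | .msg => 3

theorem polyTime_portTag : PolyTime Port.tag :=
  PolyTime.id.congr_enc fun r => by cases r <;> rfl

theorem polyTime_inFrame : PolyTime (fun y : ℕ × PWire => inFrame y.1 y.2) := by
  have ht : PolyTime (fun y : ℕ × PWire => y.2.1.tag) := polyTime_portTag.comp PolyTime.id.snd.fst
  refine PolyTime.cond_eq ht 0 ?_ ?_
  · refine (((PolyTime.const Port.work).pair
      (PolyTime.id.fst.natPair PolyTime.id.snd.snd)).restrict _).congr fun y => ?_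
    obtain ⟨⟨j, ⟨⟩ , k⟩, h⟩ := y <;> simp [Port.tag] at h
    rfl
  · refine (PolyTime.id.snd.restrict _).congr fun y => ?_
    obtain ⟨⟨j, ⟨⟩ , k⟩, h⟩ := y <;> simp [Port.tag] at h <;> rfl

/-- The first component of the description of a step. -/
def Step.tag {m : ℕ} : Step m → ℕ
  | .send _ _ => 0
  | .call _ => 1
  | .handover => 2

theorem polyTime_stepTag {m : ℕ} : PolyTime (Step.tag : Step m → ℕ) :=
  PolyTime.id.treeFst.congr_enc fun s => by cases s <;> rfl

/-- Case distinction on the kind of a step. -/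
theorem PolyTime.stepCases {m : ℕ} {s : α → Step m} (hs : PolyTime s) {F : α → β}
    {f₁ : α × Bool × Circuit PWire → β} (h₁ : PolyTime f₁)
    (e₁ : ∀ a b C, s a = .send b C → F a = f₁ (a, b, C))
    {f₂ : α × Fin m → β} (h₂ : PolyTime f₂)
    (e₂ : ∀ a i, s a = .call i → F a = f₂ (a, i))
    {f₃ : α → β} (h₃ : PolyTime f₃) (e₃ : ∀ a, s a = .handover → F a = f₃ a) : PolyTime F := by
  have ht := polyTime_stepTag.comp hs
  refine PolyTime.cond_eq ht 0 ?_ (PolyTime.cond_eq (ht.restrict _) 1 ?_ ?_)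
  · have key : ∀ a : {a // (s a).tag = 0}, ∃ bC : Bool × Circuit PWire,
        s a.1 = .send bC.1 bC.2 := by
      rintro ⟨a, h⟩
      dsimp only
      cases hh : s a <;> simp [hh, Step.tag] at h
      exact ⟨(_, _), rfl⟩
    choose bC hbC using key
    have hb : PolyTime bC := by
      refine (hs.treeSnd.restrict _).congr_enc fun a => ?_
      rw [hbC a]; rfl
    exact (h₁.comp (PolyTime.id.val.pair hb)).congr fun a => e₁ _ _ _ (hbC a)
  · have key : ∀ a : {a : {a // (s a).tag ≠ 0} // (s a.1).tag = 1}, ∃ i : Fin m,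
        s a.1.1 = .call i := by
      rintro ⟨⟨a, _⟩, h⟩
      dsimp only at *
      cases hh : s a <;> simp [hh, Step.tag] at h
      exact ⟨_, rfl⟩
    choose i hi using key
    have hb : PolyTime i := by
      refine ((hs.treeSnd.restrict _).restrict _).congr_enc fun a => ?_
      rw [hi a]; rfl
    exact (h₂.comp (PolyTime.id.val.val.pair hb)).congr fun a => e₂ _ _ (hi a)
  · refine ((h₃.restrict _).restrict _).congr fun a => e₃ _ ?_
    obtain ⟨⟨a, h'⟩, h⟩ := a
    dsimp only at *
    cases hh : s a <;> simp [hh, Step.tag] at h h'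
    rfl

theorem PolyTime.send {m : ℕ} {b : α → Bool} {C : α → Circuit PWire} (hb : PolyTime b)
    (hC : PolyTime C) : PolyTime (fun a => (Step.send (b a) (C a) : Step m)) :=
  ((PolyTime.const (0 : ℕ)).pair (hb.pair hC)).congr_enc fun _ => rfl

theorem PolyTime.stepInFrame {m : ℕ} {j : α → ℕ} {s : α → Step m} (hj : PolyTime j)
    (hs : PolyTime s) : PolyTime (fun a => (s a).inFrame (j a)) := by
  refine PolyTime.stepCases hs
    (f₁ := fun y => .send y.2.1 (y.2.2.map (Gate.map (inFrame (j y.1)))))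
    (PolyTime.id.snd.fst.send (PolyTime.circuitMap
      (e := fun y : (α × Bool × Circuit PWire) × PWire => inFrame (j y.1.1) y.2)
      (polyTime_inFrame.comp ((hj.comp PolyTime.id.fst.fst).pair PolyTime.id.snd))
      PolyTime.id.snd.snd))
    (fun a b C h => by rw [h]; rfl) (f₂ := fun y => s y.1) (hs.comp PolyTime.id.fst)
    (fun a i h => by rw [h]; rfl) hs (fun a h => by rw [h]; rfl)

theorem Protocol.IsPPT.compose {m : ℕ} {P : Protocol m} {R : Fin m → Protocol 0}
    (hP : P.IsPPT) (hR : ∀ i, (R i).IsPPT) : Protocol.IsPPT (TwoPC.compose P R) := by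
  refine ⟨?_, ?_⟩
  · refine PolyTime.flatMap (PolyTime.zipIdx hP.1)
      (f := fun y : ℕ × Step m × ℕ => match y.2.1 with
        | .send b C => [Step.inFrame 0 (.send b C)]
        | .call i => session ((R i y.1).map (Step.inFrame (y.2.2 + 1)))
        | .handover => [.handover]) ?_
    refine PolyTime.stepCases PolyTime.id.snd.fst
      (f₁ := fun y => [Step.inFrame 0 (.send y.2.1 y.2.2)])
      (((PolyTime.const 0).stepInFrame (PolyTime.id.snd.fst.send PolyTime.id.snd.snd)).cons
        (PolyTime.const []))
      ?_ (f₂ := fun y => session ((R y.2 y.1.1).map (Step.inFrame (y.1.2.2 + 1)))) ?_ ?_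
      (PolyTime.const [.handover]) ?_
    · rintro ⟨lam, s, j⟩ b C h
      dsimp only at h; subst h; rfl
    · have h1 : PolyTime (fun y : (ℕ × Step m × ℕ) × Fin m => R y.2 y.1.1) :=
        (PolyTime.finCases fun i => (hR i).1).comp (PolyTime.id.snd.pair PolyTime.id.fst.fst)
      have h2 := h1.map (f := fun z : ((ℕ × Step m × ℕ) × Fin m) × Step 0 =>
        z.2.inFrame (z.1.1.2.2 + 1)) (PolyTime.id.fst.fst.snd.snd.succ.stepInFrame PolyTime.id.snd)
      exact (PolyTime.const Step.handover).cons (h2.append (PolyTime.const [Step.handover]))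
    · rintro ⟨lam, s, j⟩ i h
      dsimp only at h; subst h; rfl
    · rintro ⟨lam, s, j⟩ h
      dsimp only at h; subst h; rfl
  · have hmap : ∀ (e : PWire → PWire) (C : Circuit PWire), (∀ g ∈ C, g.IsClassical) →
        ∀ g ∈ C.map (Gate.map e), g.IsClassical := by
      intro e C hC g hg
      obtain ⟨g', hg', rfl⟩ := List.mem_map.1 hg
      have := hC g' hg'
      cases g' <;> simp_all [Gate.map, Gate.IsClassical]
    intro lam b C hC
    obtain ⟨⟨s, j⟩, hs, hC⟩ := List.mem_flatMap.1 hC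
    have hsP : s ∈ P lam := List.fst_mem_of_mem_zipIdx hs
    cases s with
    | send b' C' =>
      simp only [Step.inFrame, List.mem_singleton, Step.send.injEq] at hC
      rw [hC.2]
      exact hmap _ _ (hP.2 lam b' C' hsP)
    | call i =>
      simp only [session, List.mem_append, List.mem_cons, List.mem_map, reduceCtorEq,
        List.not_mem_nil, or_false, false_or] at hC
      obtain ⟨s, hs, he⟩ := hC
      cases s with
      | send b' C' =>
        simp only [Step.inFrame, Step.send.injEq] at he
        rw [← he.2]
        exact hmap _ _ ((hR i).2 lam b' C' hs)
      | call i => simp [Step.inFrame] at he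
      | handover => simp [Step.inFrame] at he
    | handover => simp at hC

/-! ### The circuits and the code of the composed simulator -/

/-- Toggles the wires of the input register that are set in the description of `v`. -/
def inputFlips (v : Val) : Circuit PWire :=
  match v with
  | none => []
  | some l => (l.zipIdx.flatMap fun bk => if bk.1 then [Gate.flip (.inp, bk.2)] else []) ++
      [.flip (.inp, l.length)]

/-- Restores the registers of a corrupted party after a simulated session: all wires of the input
and output registers and of the work space from `N` on are reset, up to the bound `M`, and the
input register receives `v` again. -/
def cleanCircuit (N M : ℕ) (v : Val) : Circuit PWire :=
  inputFlips v ++ (((List.range M).flatMap fun k =>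
    [Gate.reset (.inp, k), .reset (.out, k), .reset (.work, N + k)]) ++ inputFlips v)

/-- Exchanges two wires. -/
def swapGates {W : Type} (a b : W) : Circuit W := [.cnot a b, .cnot b a, .cnot a b]

/-- Exchanges the first `N` wires of the input and output registers with two blocks of `N` wires of
the work space. -/
def swapCircuit (N : ℕ) : Circuit PWire :=
  ((List.range N).flatMap fun k => swapGates (.inp, k) (.work, N + k)) ++
    (List.range N).flatMap fun k => swapGates (.out, k) (.work, 2 * N + k)

/-- The wire of the work space on which a packed adversary keeps a given wire. -/
def packWire (N : ℕ) : PWire → PWire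
  | (.inp, k) => (.work, N + k)
  | (.out, k) => (.work, 2 * N + k)
  | w => w

/-- The adversary of `z`, changed so that it keeps all its registers in the work space. -/
def packInput (z : SimInput) : SimInput :=
  { z with
    code := z.code.map (List.map (Gate.map (packWire (descLength z))))
    qubits := 3 * descLength z }

/-- The simulator for arbitrary adversaries obtained from one for packed adversaries. -/
def unpackedSimulator (S : SimInput → Circuit PWire × Circuit PWire) (z : SimInput) :
    Circuit PWire × Circuit PWire :=
  ((swapCircuit (descLength z) ++ inputFlips z.input) ++ (S (packInput z)).1,
    (S (packInput z)).2 ++ (inputFlips z.input ++ swapCircuit (descLength z)))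

/-- What remains of the circuits `A` of the adversary after the steps `P`. -/
def restCode {m : ℕ} (P : List (Step m)) (A : List (Circuit PWire)) : List (Circuit PWire) :=
  P.foldl (fun A s => match s with
    | .send _ _ => A.tail
    | .call _ => A.tail.tail
    | .handover => A) A

/-- The circuits of an adversary in the hybrid model that runs the circuits `A` of an adversary
against the composed protocol, and uses the circuits `call i A` when the `i`-th functionality is
called, which takes the place of the circuits that `rest i A` drops. -/
def hybridCode {m : ℕ} (call rest : Fin m → List (Circuit PWire) → List (Circuit PWire)) :
    List (Step m) → List (Circuit PWire) → List (Circuit PWire)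
  | [], _ => []
  | .send _ _ :: P, A => A.headD [] :: hybridCode call rest P A.tail
  | .call i :: P, A => call i A ++ hybridCode call rest P (rest i A)
  | .handover :: P, A => hybridCode call rest P A

/-- The input for the simulator of a subprotocol, if `A` are the remaining circuits of the adversary
and the calling protocol has `n` steps. With slack `1 / s` in `z`, the session may cost
`1 / (2 * s * (n + 1))`. -/
def subInput (n : ℕ) (z : SimInput) (A : List (Circuit PWire)) : SimInput :=
  { z with slack := 2 * z.slack * (n + 1), code := A }

/-- The circuits that play the part of the corrupted party in an ideal call, where `S` simulates the
subprotocol. -/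
def callCircuits (S : SimInput → Circuit PWire × Circuit PWire) (M n : ℕ) (z : SimInput)
    (A : List (Circuit PWire)) : List (Circuit PWire) :=
  [(S (subInput n z A)).1, (S (subInput n z A)).2 ++ cleanCircuit z.qubits M z.input]

/-- The input for the simulator of the calling protocol: the adversary in the hybrid model that
simulates all sessions of the subprotocols. The polynomial `q` bounds the wires in use. Half of the
slack is left for the calling protocol. -/
def hybridInput {m : ℕ} (S : Fin m → SimInput → Circuit PWire × Circuit PWire)
    (q : Polynomial ℕ) (π : Protocol m) (ρ : Fin m → Protocol 0) (z : SimInput) : SimInput :=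
  { z with
    slack := 2 * z.slack
    code := hybridCode
      (fun i => callCircuits (S i) (q.eval (descLength z)) (π z.lam).length z)
      (fun i => restCode (ρ i z.lam)) (π z.lam) z.code }

/-! ### Running times of the circuits and the code -/

theorem polyTime_tuple : PolyTime (fun z : SimInput =>
    (z.lam, z.slack, z.corrupted, z.input, z.code, z.qubits)) := PolyTime.of_enc fun _ => rfl

theorem PolyTime.lam {z : α → SimInput} (h : PolyTime z) : PolyTime (fun a => (z a).lam) :=
  (polyTime_tuple.comp h).fst

theorem PolyTime.slack {z : α → SimInput} (h : PolyTime z) : PolyTime (fun a => (z a).slack) :=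
  (polyTime_tuple.comp h).snd.fst

theorem PolyTime.corrupted {z : α → SimInput} (h : PolyTime z) :
    PolyTime (fun a => (z a).corrupted) := (polyTime_tuple.comp h).snd.snd.fst

theorem PolyTime.input {z : α → SimInput} (h : PolyTime z) : PolyTime (fun a => (z a).input) :=
  (polyTime_tuple.comp h).snd.snd.snd.fst

theorem PolyTime.code {z : α → SimInput} (h : PolyTime z) : PolyTime (fun a => (z a).code) :=
  (polyTime_tuple.comp h).snd.snd.snd.snd.fst

theorem PolyTime.qubits {z : α → SimInput} (h : PolyTime z) : PolyTime (fun a => (z a).qubits) :=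
  (polyTime_tuple.comp h).snd.snd.snd.snd.snd

theorem PolyTime.simInput {l s : α → ℕ} {c : α → Bool} {x : α → Val}
    {A : α → List (Circuit PWire)} {q : α → ℕ} (hl : PolyTime l) (hs : PolyTime s)
    (hc : PolyTime c) (hx : PolyTime x) (hA : PolyTime A) (hq : PolyTime q) :
    PolyTime (fun a => SimInput.mk (l a) (s a) (c a) (x a) (A a) (q a)) :=
  (hl.pair (hs.pair (hc.pair (hx.pair (hA.pair hq))))).congr_enc fun _ => rfl

theorem PolyTime.flip {W : Type} [Enc W] {w : α → W} (h : PolyTime w) :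
    PolyTime (fun a => Gate.flip (w a)) := ((PolyTime.const 0).pair h).congr_enc fun _ => rfl

theorem PolyTime.reset {W : Type} [Enc W] {w : α → W} (h : PolyTime w) :
    PolyTime (fun a => Gate.reset (w a)) := ((PolyTime.const 5).pair h).congr_enc fun _ => rfl

theorem PolyTime.cnot {W : Type} [Enc W] {v w : α → W} (h : PolyTime v) (h' : PolyTime w) :
    PolyTime (fun a => Gate.cnot (v a) (w a)) :=
  ((PolyTime.const 1).pair (h.pair h')).congr_enc fun _ => rfl

theorem PolyTime.inputFlips {v : α → Val} (h : PolyTime v) :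
    PolyTime (fun a => inputFlips (v a)) := by
  refine PolyTime.caseNil h ?_ ?_
  · refine (PolyTime.const []).congr fun a => ?_
    obtain ⟨a, ha⟩ := a
    dsimp only at *
    cases hv : v a with
    | none => rfl
    | some l => rw [hv] at ha; cases ha
  · have h1 : PolyTime (fun a : {a // Enc.enc (v a) ≠ Tree.nil} => (v a.1).getD []) := by
      refine (h.treeSnd.restrict _).congr_enc fun a => ?_
      obtain ⟨a, ha⟩ := a
      dsimp only at *
      cases hv : v a with
      | none => rw [hv] at ha; exact absurd rfl ha
      | some l => rfl
    have h2 := (h1.zipIdx.flatMap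
      (f := fun y => if y.2.1 then [Gate.flip (Port.inp, y.2.2)] else [])
      (PolyTime.id.snd.fst.ite
        ((((PolyTime.const Port.inp).pair PolyTime.id.snd.snd).flip).cons (PolyTime.const []))
        (PolyTime.const []))).append
      ((((PolyTime.const Port.inp).pair h1.length).flip).cons (PolyTime.const []))
    refine h2.congr fun a => ?_
    obtain ⟨a, ha⟩ := a
    dsimp only at *
    cases hv : v a with
    | none => rw [hv] at ha; exact absurd rfl ha
    | some l => rfl

theorem PolyTime.cleanCircuit {N M : α → ℕ} {v : α → Val} (hN : PolyTime N) (hM : PolyTime M)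
    (hv : PolyTime v) : PolyTime (fun a => cleanCircuit (N a) (M a) (v a)) :=
  hv.inputFlips.append ((hM.range.flatMap (f := fun y : α × ℕ =>
    [Gate.reset (Port.inp, y.2), .reset (Port.out, y.2), .reset (Port.work, N y.1 + y.2)])
    (((PolyTime.const Port.inp).pair PolyTime.id.snd).reset.cons
      (((PolyTime.const Port.out).pair PolyTime.id.snd).reset.cons
      (((PolyTime.const Port.work).pair ((hN.comp PolyTime.id.fst).add PolyTime.id.snd)).reset.cons
        (PolyTime.const []))))).append hv.inputFlips)

theorem PolyTime.swapGates {W : Type} [Enc W] {v w : α → W} (h : PolyTime v) (h' : PolyTime w) :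
    PolyTime (fun a => swapGates (v a) (w a)) :=
  (h.cnot h').cons ((h'.cnot h).cons ((h.cnot h').cons (PolyTime.const [])))

theorem PolyTime.swapCircuit {N : α → ℕ} (hN : PolyTime N) :
    PolyTime (fun a => swapCircuit (N a)) :=
  (hN.range.flatMap (f := fun y : α × ℕ =>
      TwoPC.swapGates (Port.inp, y.2) (Port.work, N y.1 + y.2))
    (((PolyTime.const Port.inp).pair PolyTime.id.snd).swapGates
      ((PolyTime.const Port.work).pair ((hN.comp PolyTime.id.fst).add PolyTime.id.snd)))).append
  (hN.range.flatMap (f := fun y : α × ℕ =>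
      TwoPC.swapGates (Port.out, y.2) (Port.work, 2 * N y.1 + y.2))
    (((PolyTime.const Port.out).pair PolyTime.id.snd).swapGates
      ((PolyTime.const Port.work).pair
        (((PolyTime.const 2).mul (hN.comp PolyTime.id.fst)).add PolyTime.id.snd))))

theorem polyTime_packWire : PolyTime (fun y : ℕ × PWire => packWire y.1 y.2) := by
  have ht : PolyTime (fun y : ℕ × PWire => y.2.1.tag) := polyTime_portTag.comp PolyTime.id.snd.fst
  refine PolyTime.cond_eq ht 1 ?_ (PolyTime.cond_eq (ht.restrict _) 2 ?_ ?_)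
  · refine (((PolyTime.const Port.work).pair
      (PolyTime.id.fst.add PolyTime.id.snd.snd)).restrict _).congr fun y => ?_
    obtain ⟨⟨j, ⟨⟩ , k⟩, h⟩ := y <;> simp [Port.tag] at h
    rfl
  · refine ((((PolyTime.const Port.work).pair
      (((PolyTime.const 2).mul PolyTime.id.fst).add
        PolyTime.id.snd.snd)).restrict _).restrict _).congr fun y => ?_
    obtain ⟨⟨⟨j, ⟨⟩ , k⟩, h'⟩, h⟩ := y <;> simp [Port.tag] at h
    rfl
  · refine ((PolyTime.id.snd.restrict _).restrict _).congr fun y => ?_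
    obtain ⟨⟨⟨j, ⟨⟩ , k⟩, h'⟩, h⟩ := y <;> simp [Port.tag] at h h' <;> rfl

theorem polyTime_packInput : PolyTime packInput :=
  PolyTime.simInput PolyTime.id.lam PolyTime.id.slack PolyTime.id.corrupted PolyTime.id.input
    (PolyTime.id.code.map (f := fun y : SimInput × Circuit PWire =>
        y.2.map (Gate.map fun w => packWire (descLength y.1) w))
      (PolyTime.circuitMap (e := fun y : (SimInput × Circuit PWire) × PWire =>
          packWire (descLength y.1.1) y.2)
        (polyTime_packWire.comp ((PolyTime.id.fst.fst.descLength).pair PolyTime.id.snd))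
        PolyTime.id.snd))
    ((PolyTime.const 3).mul PolyTime.id.descLength)

theorem polyTime_unpackedSimulator {S : SimInput → Circuit PWire × Circuit PWire}
    (hS : PolyTime S) : PolyTime (unpackedSimulator S) :=
  ((PolyTime.id.descLength.swapCircuit.append PolyTime.id.input.inputFlips).append
      (hS.comp polyTime_packInput).fst).pair
    ((hS.comp polyTime_packInput).snd.append
      (PolyTime.id.input.inputFlips.append PolyTime.id.descLength.swapCircuit))

theorem descLength_tail_le (l : List α) : descLength l.tail ≤ descLength l := by
  cases l
  · rfl
  · simp only [List.tail_cons, descLength_cons]; omega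

theorem descLength_restCode_le {m : ℕ} (P : List (Step m)) (A : List (Circuit PWire)) :
    descLength (restCode P A) ≤ descLength A := by
  induction P generalizing A with
  | nil => rfl
  | cons s P ih =>
    refine (ih _).trans ?_
    cases s
    · exact descLength_tail_le _
    · exact (descLength_tail_le _).trans (descLength_tail_le _)
    · rfl

theorem PolyTime.restCode {m : ℕ} {P : α → List (Step m)} {A : α → List (Circuit PWire)}
    (hP : PolyTime P) (hA : PolyTime A) : PolyTime (fun a => restCode (P a) (A a)) := by
  refine PolyTime.foldl_of_additive
    (step := fun y : α × List (Circuit PWire) × Step m => match y.2.2 with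
      | .send _ _ => y.2.1.tail
      | .call _ => y.2.1.tail.tail
      | .handover => y.2.1) ?_ hA hP 0 ?_
  · refine PolyTime.stepCases PolyTime.id.snd.snd
      (f₁ := fun y => y.1.2.1.tail) PolyTime.id.fst.snd.fst.tail ?_
      (f₂ := fun y => y.1.2.1.tail.tail) PolyTime.id.fst.snd.fst.tail.tail ?_
      PolyTime.id.snd.fst ?_
    · intro a b C h; simp [h]
    · intro a i h; simp [h]
    · intro a h; simp [h]
  · intro a A s
    exact (descLength_restCode_le [s] A).trans (by simp)

/-- One step of `hybridCode`, with the code that has been produced as an accumulator. -/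
def hybridStep {m : ℕ} (call rest : Fin m → List (Circuit PWire) → List (Circuit PWire))
    (s : List (Circuit PWire) × List (Circuit PWire)) (b : Step m) :
    List (Circuit PWire) × List (Circuit PWire) :=
  match b with
  | .send _ _ => (s.1.tail, s.2 ++ [s.1.headD []])
  | .call i => (rest i s.1, s.2 ++ call i s.1)
  | .handover => s

theorem foldl_hybridStep {m : ℕ}
    (call rest : Fin m → List (Circuit PWire) → List (Circuit PWire)) (P : List (Step m))
    (A B : List (Circuit PWire)) :
    (P.foldl (hybridStep call rest) (A, B)).2 = B ++ hybridCode call rest P A := by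
  induction P generalizing A B with
  | nil => simp [hybridCode]
  | cons s P ih =>
    rw [List.foldl_cons]
    cases s <;> simp [hybridStep, hybridCode, ih]

/-- The adversary's circuits that remain only get shorter, so that each step adds a polynomial
amount of code. -/
theorem PolyTime.hybridCode {m : ℕ} {call rest : α → Fin m → List (Circuit PWire) →
      List (Circuit PWire)} {P : α → List (Step m)} {A : α → List (Circuit PWire)}
    (hcall : PolyTime (fun y : (α × List (Circuit PWire)) × Fin m => call y.1.1 y.2 y.1.2))
    (hrest : PolyTime (fun y : (α × List (Circuit PWire)) × Fin m => rest y.1.1 y.2 y.1.2))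
    (hle : ∀ a i B, TwoPC.descLength (rest a i B) ≤ TwoPC.descLength B)
    (hP : PolyTime P) (hA : PolyTime A) :
    PolyTime (fun a => hybridCode (call a) (rest a) (P a) (A a)) := by
  obtain ⟨r, hr⟩ := hcall.size_le
  obtain ⟨p, hp⟩ := hA.size_le
  have main := PolyTime.foldl_of_invariant
    (step := fun y : α × (List (Circuit PWire) × List (Circuit PWire)) × Step m =>
      hybridStep (call y.1) (rest y.1) y.2.1 y.2.2) ?_ (hA.pair (PolyTime.const [])) hP
    (fun a s => TwoPC.descLength s.1 ≤ p.eval (TwoPC.descLength a)) hp ?_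
    (p + r.comp (.X + p + .X + 3) + 3) ?_
  · refine main.snd.congr fun a => ?_
    simp [foldl_hybridStep]
  · refine PolyTime.stepCases PolyTime.id.snd.snd
      (f₁ := fun y => (y.1.2.1.1.tail, y.1.2.1.2 ++ [y.1.2.1.1.headD []]))
      (PolyTime.id.fst.snd.fst.fst.tail.pair (PolyTime.id.fst.snd.fst.snd.append
        (PolyTime.id.fst.snd.fst.fst.headD.cons (PolyTime.const [])))) ?_
      (f₂ := fun y => (rest y.1.1 y.2 y.1.2.1.1, y.1.2.1.2 ++ call y.1.1 y.2 y.1.2.1.1))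
      ((hrest.comp ((PolyTime.id.fst.fst.pair PolyTime.id.fst.snd.fst.fst).pair
        PolyTime.id.snd)).pair (PolyTime.id.fst.snd.fst.snd.append
        (hcall.comp ((PolyTime.id.fst.fst.pair PolyTime.id.fst.snd.fst.fst).pair
        PolyTime.id.snd)))) ?_
      PolyTime.id.snd.fst ?_
    · intro a b C h; simp [h, hybridStep]
    · intro a i h; simp [h, hybridStep]
    · intro a h; simp [h, hybridStep]
  · intro a s b hs
    cases b
    · exact (descLength_tail_le _).trans hs
    · exact (hle _ _ _).trans hs
    · exact hs
  · intro a s b hs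
    simp only [Polynomial.eval_add, Polynomial.eval_comp, Polynomial.eval_X,
      Polynomial.eval_ofNat]
    cases b with
    | send b C =>
      have h1 := descLength_tail_le s.1
      have h2 := descLength_append s.2 [s.1.headD []]
      have h3 : TwoPC.descLength (s.1.headD []) ≤ TwoPC.descLength s.1 := by
        cases s.1
        · rfl
        · simp only [List.headD_cons, descLength_cons]; omega
      have h4 := poly_mono p (Nat.le_add_right (TwoPC.descLength a)
        (TwoPC.descLength (Step.send b C : Step m)))
      simp only [hybridStep, descLength_prod, descLength_cons, descLength_nil] at *
      omega
    | call i =>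
      have h1 := hle a i s.1
      have h2 := descLength_append s.2 (call a i s.1)
      have h3 := hr ((a, s.1), i)
      have h4 : TwoPC.descLength ((a, s.1), i) ≤ TwoPC.descLength a +
          TwoPC.descLength (Step.call i : Step m) + p.eval (TwoPC.descLength a +
            TwoPC.descLength (Step.call i : Step m)) +
          (TwoPC.descLength a + TwoPC.descLength (Step.call i : Step m)) + 3 := by
        have h5 : TwoPC.descLength (Step.call i : Step m) = TwoPC.descLength i + 4 := by
          change TwoPC.descLength ((1 : ℕ), i) = _
          rw [descLength_pair, descLength_nat]; omega
        have h6 := poly_mono p (Nat.le_add_right (TwoPC.descLength a)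
          (TwoPC.descLength (Step.call i : Step m)))
        rw [descLength_pair, descLength_pair]
        omega
      have h5 := poly_mono r h4
      simp only [hybridStep, descLength_prod] at *
      omega
    | handover => simp [hybridStep]

theorem PolyTime.callCircuits {S : SimInput → Circuit PWire × Circuit PWire} (hS : PolyTime S)
    {M n : α → ℕ} {z : α → SimInput} {A : α → List (Circuit PWire)} (hM : PolyTime M)
    (hn : PolyTime n) (hz : PolyTime z) (hA : PolyTime A) :
    PolyTime (fun a => callCircuits S (M a) (n a) (z a) (A a)) := by
  have h := hS.comp (PolyTime.simInput hz.lam (((PolyTime.const 2).mul hz.slack).mul hn.succ)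
    hz.corrupted hz.input hA hz.qubits)
  exact h.fst.cons ((h.snd.append (PolyTime.cleanCircuit hz.qubits hM hz.input)).cons
    (PolyTime.const []))

theorem polyTime_hybridInput {m : ℕ} {S : Fin m → SimInput → Circuit PWire × Circuit PWire}
    (hS : ∀ i, PolyTime (S i)) (q : Polynomial ℕ) {π : Protocol m} (hπ : PolyTime π)
    {ρ : Fin m → Protocol 0} (hρ : ∀ i, PolyTime (ρ i)) :
    PolyTime (hybridInput S q π ρ) := by
  refine PolyTime.simInput PolyTime.id.lam ((PolyTime.const 2).mul PolyTime.id.slack)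
    PolyTime.id.corrupted PolyTime.id.input
    (PolyTime.hybridCode
      (call := fun z i => TwoPC.callCircuits (S i) (q.eval (TwoPC.descLength z)) (π z.lam).length z)
      (rest := fun z i => TwoPC.restCode (ρ i z.lam)) ?_ ?_ (fun _ _ _ => descLength_restCode_le _ _)
      (hπ.comp PolyTime.id.lam) PolyTime.id.code) PolyTime.id.qubits
  · exact (PolyTime.finCases (F := fun i (y : SimInput × List (Circuit PWire)) =>
      TwoPC.callCircuits (S i) (q.eval (TwoPC.descLength y.1)) (π y.1.lam).length y.1 y.2)
      fun i => PolyTime.callCircuits (hS i) (PolyTime.polynomial_eval q PolyTime.id.fst.descLength)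
        (hπ.comp PolyTime.id.fst.lam).length PolyTime.id.fst PolyTime.id.snd).comp
      (PolyTime.id.snd.pair PolyTime.id.fst)
  · exact (PolyTime.finCases (F := fun i (y : SimInput × List (Circuit PWire)) =>
      TwoPC.restCode (ρ i y.1.lam) y.2)
      fun i => PolyTime.restCode ((hρ i).comp PolyTime.id.fst.lam) PolyTime.id.snd).comp
      (PolyTime.id.snd.pair PolyTime.id.fst)

end Programs

/-! ### Operators and frames -/

section Frames

variable {V W : Type}

/-- The wires that a gate acts on. -/
def Gate.wires : Gate W → List W
  | .flip w => [w]
  | .cnot a w => [a, w]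
  | .ccnot a b w => [a, b, w]
  | .had w => [w]
  | .phase w => [w]
  | .reset w => [w]
  | .coin w => [w]

theorem Gate.wires_map (e : V → W) (g : Gate V) : (g.map e).wires = g.wires.map e := by
  cases g <;> rfl

theorem Gate.map_map {U : Type} (e : V → W) (e' : U → V) (g : Gate U) :
    (g.map e').map e = g.map (e ∘ e') := by
  cases g <;> rfl

theorem Gate.map_congr {e e' : V → W} {g : Gate V} (h : ∀ w ∈ g.wires, e w = e' w) :
    g.map e = g.map e' := by
  cases g <;> simp_all [Gate.map, Gate.wires]

theorem Gate.map_id (g : Gate W) : g.map (fun w => w) = g := by cases g <;> rfl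

/-- The circuit acts on wires in `X` only. -/
def Circuit.On (X : Set W) (C : Circuit W) : Prop := ∀ g ∈ C, ∀ w ∈ g.wires, w ∈ X

theorem Circuit.On.mono {X Y : Set W} {C : Circuit W} (h : Circuit.On X C) (hXY : X ⊆ Y) :
    Circuit.On Y C := fun g hg w hw => hXY (h g hg w hw)

theorem Circuit.On.append {X : Set W} {C D : Circuit W} (h : Circuit.On X C)
    (h' : Circuit.On X D) : Circuit.On X (C ++ D : Circuit W) := fun g hg =>
  (List.mem_append.1 hg).elim (h g) (h' g)

theorem Circuit.On.map {X : Set V} {Y : Set W} {C : Circuit V} (h : Circuit.On X C) (e : V → W)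
    (he : ∀ x ∈ X, e x ∈ Y) : Circuit.On Y (C.map (Gate.map e) : Circuit W) := by
  intro g hg w hw
  obtain ⟨g', hg', rfl⟩ := List.mem_map.1 hg
  rw [Gate.wires_map] at hw
  obtain ⟨v, hv, rfl⟩ := List.mem_map.1 hw
  exact he v (h g' hg' v hv)

theorem Circuit.on_nil {X : Set W} : Circuit.On X ([] : Circuit W) := fun _ h => by simp at h

theorem Circuit.on_cons {X : Set W} {g : Gate W} {C : Circuit W} :
    Circuit.On X (g :: C : Circuit W) ↔ (∀ w ∈ g.wires, w ∈ X) ∧ Circuit.On X C := by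
  simp [Circuit.On]

variable [DecidableEq V] [DecidableEq W]

theorem mem_toggle {w x : W} {s : Finset W} : x ∈ toggle w s ↔ (x ∈ s ↔ x ≠ w) := by
  unfold toggle
  split_ifs with h
  · by_cases hx : x = w <;> simp [hx, h]
  · by_cases hx : x = w <;> simp [hx, h]

theorem toggle_toggle (w : W) (s : Finset W) : toggle w (toggle w s) = s := by
  ext x; simp only [mem_toggle]; tauto

theorem erase_eq_toggle (w : W) (s : Finset W) : s.erase w = if w ∈ s then toggle w s else s := by
  split_ifs with h <;> simp [toggle, h]

theorem insert_eq_toggle (w : W) (s : Finset W) :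
    insert w s = if w ∈ s then s else toggle w s := by
  split_ifs with h <;> simp [toggle, h]

/-- An operation that reads one matrix entry for each entry of the result. -/
def frameOp (a : Finset W → Finset W → ℂ) (φ : Finset W → Finset V) (K : Op V) : Op W :=
  fun s t => a s t * K (φ s) (φ t)

/-- The operation `frameOp a φ` embeds the wires in `X` by `r` and does not act on them otherwise.
Embeddings into larger systems, tensor products with a fixed operator, projections on values of
other wires, and relabellings are of this form. -/
structure IsFrame (X : Set V) (r : V → W) (a : Finset W → Finset W → ℂ)
    (φ : Finset W → Finset V) : Prop where
  mem : ∀ x ∈ X, ∀ s, x ∈ φ s ↔ r x ∈ s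
  toggle : ∀ x ∈ X, ∀ s, φ (TwoPC.toggle (r x) s) = TwoPC.toggle x (φ s)
  left : ∀ x ∈ X, ∀ s t, a (TwoPC.toggle (r x) s) t = a s t
  right : ∀ x ∈ X, ∀ s t, a s (TwoPC.toggle (r x) t) = a s t

namespace IsFrame

variable {X : Set V} {r : V → W} {a : Finset W → Finset W → ℂ} {φ : Finset W → Finset V}

theorem mono (h : IsFrame X r a φ) {Y : Set V} (hY : Y ⊆ X) : IsFrame Y r a φ :=
  ⟨fun x hx => h.mem x (hY hx), fun x hx => h.toggle x (hY hx), fun x hx => h.left x (hY hx),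
    fun x hx => h.right x (hY hx)⟩

theorem inj (h : IsFrame X r a φ) {x y : V} (hx : x ∈ X) (hy : y ∈ X) (e : r x = r y) : x = y := by
  by_contra hne
  have h1 := h.mem y hy (TwoPC.toggle (r x) ∅)
  have h2 := h.mem y hy ∅
  rw [h.toggle x hx, mem_toggle, e] at h1
  simp only [mem_toggle, Finset.notMem_empty, iff_false] at h1 h2
  have h3 : y ≠ x := fun h => hne h.symm
  tauto

theorem erase (h : IsFrame X r a φ) {x : V} (hx : x ∈ X) (s : Finset W) :
    φ (s.erase (r x)) = (φ s).erase x := by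
  rw [erase_eq_toggle, erase_eq_toggle, apply_ite φ, h.toggle x hx]
  simp only [h.mem x hx]

theorem insert (h : IsFrame X r a φ) {x : V} (hx : x ∈ X) (s : Finset W) :
    φ (insert (r x) s) = Insert.insert x (φ s) := by
  rw [insert_eq_toggle, insert_eq_toggle, apply_ite φ, h.toggle x hx]
  simp only [h.mem x hx]

theorem left_erase (h : IsFrame X r a φ) {x : V} (hx : x ∈ X) (s t : Finset W) :
    a (s.erase (r x)) t = a s t := by
  rw [erase_eq_toggle]; split_ifs <;> simp [h.left x hx]

theorem left_insert (h : IsFrame X r a φ) {x : V} (hx : x ∈ X) (s t : Finset W) :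
    a (Insert.insert (r x) s) t = a s t := by
  rw [insert_eq_toggle]; split_ifs <;> simp [h.left x hx]

theorem right_erase (h : IsFrame X r a φ) {x : V} (hx : x ∈ X) (s t : Finset W) :
    a s (t.erase (r x)) = a s t := by
  rw [erase_eq_toggle]; split_ifs <;> simp [h.right x hx]

theorem right_insert (h : IsFrame X r a φ) {x : V} (hx : x ∈ X) (s t : Finset W) :
    a s (Insert.insert (r x) t) = a s t := by
  rw [insert_eq_toggle]; split_ifs <;> simp [h.right x hx]

end IsFrame

theorem sum_erase_insert (w : W) (s : Finset W) (f : Finset W → ℂ) :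
    ∑ a ∈ {s.erase w, insert w s}, f a = f (s.erase w) + f (insert w s) := by
  refine Finset.sum_pair fun h => ?_
  have : w ∈ insert w s := Finset.mem_insert_self ..
  rw [← h] at this; simp at this

/-- The action of a Hadamard gate with the sums written out. -/
theorem had_apply (w : W) (K : Op W) (s t : Finset W) :
    (Gate.had w).apply K s t = (1 / 2) * (K (s.erase w) (t.erase w) +
      (if w ∈ t then -1 else 1) * K (s.erase w) (insert w t) +
      (if w ∈ s then -1 else 1) * K (insert w s) (t.erase w) +
      (if w ∈ s then -1 else 1) * (if w ∈ t then -1 else 1) * K (insert w s) (insert w t)) := by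
  simp only [Gate.apply, sum_erase_insert, Finset.mem_erase, Finset.mem_insert]
  simp only [ne_eq, not_true_eq_false, false_and, and_false, if_false, true_or, and_true]
  ring

/-- Gates commute with frames. -/
theorem IsFrame.gate_apply {X : Set V} {r : V → W} {a : Finset W → Finset W → ℂ}
    {φ : Finset W → Finset V} (h : IsFrame X r a φ) {g : Gate V} (hg : ∀ w ∈ g.wires, w ∈ X)
    (K : Op V) : (g.map r).apply (frameOp a φ K) = frameOp a φ (g.apply K) := by
  funext s t
  cases g with
  | flip w =>
    have hw : w ∈ X := hg w (by simp [Gate.wires])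
    simp only [Gate.map, Gate.apply, frameOp, h.toggle w hw, h.left w hw, h.right w hw]
  | cnot c w =>
    have hw : w ∈ X := hg w (by simp [Gate.wires])
    have hc : c ∈ X := hg c (by simp [Gate.wires])
    have hne : r c ≠ r w ↔ c ≠ w :=
      not_congr ⟨fun e => h.inj hc hw e, fun e => by rw [e]⟩
    simp only [Gate.map, Gate.apply, frameOp, hne, ← h.mem c hc]
    split_ifs <;> simp only [h.toggle w hw, h.left w hw, h.right w hw]
  | ccnot c d w =>
    have hw : w ∈ X := hg w (by simp [Gate.wires])
    have hc : c ∈ X := hg c (by simp [Gate.wires])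
    have hd : d ∈ X := hg d (by simp [Gate.wires])
    have hne : r c ≠ r w ↔ c ≠ w :=
      not_congr ⟨fun e => h.inj hc hw e, fun e => by rw [e]⟩
    have hne' : r d ≠ r w ↔ d ≠ w :=
      not_congr ⟨fun e => h.inj hd hw e, fun e => by rw [e]⟩
    simp only [Gate.map, Gate.apply, frameOp, hne, hne', ← h.mem c hc, ← h.mem d hd]
    split_ifs <;> simp only [h.toggle w hw, h.left w hw, h.right w hw]
  | had w =>
    have hw : w ∈ X := hg w (by simp [Gate.wires])
    simp only [Gate.map, had_apply, frameOp, h.erase hw, h.insert hw, h.left_erase hw,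
      h.left_insert hw, h.right_erase hw, h.right_insert hw, h.mem w hw]
    ring
  | phase w =>
    have hw : w ∈ X := hg w (by simp [Gate.wires])
    simp only [Gate.map, Gate.apply, frameOp, h.mem w hw]
    ring
  | reset w =>
    have hw : w ∈ X := hg w (by simp [Gate.wires])
    simp only [Gate.map, Gate.apply, frameOp, h.insert hw,
      h.left_insert hw, h.right_insert hw, h.mem w hw]
    split_ifs <;> ring
  | coin w =>
    have hw : w ∈ X := hg w (by simp [Gate.wires])
    simp only [Gate.map, Gate.apply, frameOp, h.erase hw, h.insert hw, h.left_erase hw,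
      h.left_insert hw, h.right_erase hw, h.right_insert hw, h.mem w hw]
    split_ifs <;> ring

/-- The gates of `C`, from left to right. -/
def Circuit.run (C : Circuit W) (K : Op W) : Op W := C.foldl (fun K g => g.apply K) K

theorem Circuit.apply_eq_run {U : Type} (e : U → W) (C : Circuit U) (K : Op W) :
    Circuit.apply e C K = Circuit.run (C.map (Gate.map e)) K := by
  rw [Circuit.apply, Circuit.run, List.foldl_map]

theorem Circuit.run_append (C D : Circuit W) (K : Op W) :
    Circuit.run (C ++ D : Circuit W) K = Circuit.run D (Circuit.run C K) := List.foldl_append ..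

theorem Circuit.run_cons (g : Gate W) (C : Circuit W) (K : Op W) :
    Circuit.run (g :: C : Circuit W) K = Circuit.run C (g.apply K) := rfl

theorem Circuit.run_nil (K : Op W) : Circuit.run ([] : Circuit W) K = K := rfl

theorem IsFrame.run {X : Set V} {r : V → W} {a : Finset W → Finset W → ℂ}
    {φ : Finset W → Finset V} (h : IsFrame X r a φ) {C : Circuit V} (hC : C.On X) (K : Op V) :
    Circuit.run (C.map (Gate.map r) : Circuit W) (frameOp a φ K) = frameOp a φ (C.run K) := by
  induction C generalizing K with
  | nil => rfl
  | cons g C ih =>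
    rw [Circuit.on_cons] at hC
    rw [List.map_cons, Circuit.run_cons, Circuit.run_cons, h.gate_apply hC.1, ih hC.2]

theorem IsFrame.run_same {X : Set W} {a : Finset W → Finset W → ℂ}
    {φ : Finset W → Finset W} (h : IsFrame X (fun w => w) a φ) {C : Circuit W} (hC : C.On X)
    (K : Op W) : C.run (frameOp a φ K) = frameOp a φ (C.run K) := by
  have := h.run hC K
  rwa [show (C.map (Gate.map fun w => w) : Circuit W) = C from by
    rw [List.map_congr_left fun g _ => Gate.map_id g]; simp] at this

/-! ### Frames and measurements -/

/-- Replaces the part of `s` on the wires with `R` by `c`. -/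
def setPart (R : W → Prop) [DecidablePred R] (s c : Finset W) : Finset W :=
  s.filter (fun w => ¬ R w) ∪ c

/-- One basis state is turned into another by toggling the wires where they differ. -/
theorem eq_foldl_toggle (s s' : Finset W) : ∃ l : List W, (∀ w ∈ l, ¬ (w ∈ s ↔ w ∈ s')) ∧
    s' = l.foldr toggle s := by
  suffices h : ∀ (n : ℕ) (s' : Finset W), (symmDiff s s').card = n → ∃ l : List W,
      (∀ w ∈ l, ¬ (w ∈ s ↔ w ∈ s')) ∧ s' = l.foldr toggle s from h _ s' rfl
  intro n
  induction n with
  | zero =>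
    intro s' h
    refine ⟨[], by simp, ?_⟩
    rw [Finset.card_eq_zero] at h
    exact (symmDiff_eq_bot.1 h).symm
  | succ n ih =>
    intro s' h
    obtain ⟨w, hw⟩ : (symmDiff s s').Nonempty := by
      rw [← Finset.card_pos]; omega
    have e : symmDiff s (toggle w s') = (symmDiff s s').erase w := by
      ext x
      simp only [Finset.mem_symmDiff, Finset.mem_erase, mem_toggle] at hw ⊢
      by_cases hx : x = w
      · subst hx; tauto
      · tauto
    obtain ⟨l, hl, hs⟩ := ih (toggle w s') (by rw [e, Finset.card_erase_of_mem hw, h]; rfl)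
    refine ⟨w :: l, ?_, ?_⟩
    · intro x hx
      rcases List.mem_cons.1 hx with rfl | hx
      · simp only [Finset.mem_symmDiff] at hw; tauto
      · have := hl x hx
        rw [mem_toggle] at this
        by_cases hxw : x = w
        · subst hxw; simp only [Finset.mem_symmDiff] at hw; tauto
        · tauto
    · rw [List.foldr_cons, ← hs, toggle_toggle]

variable {R : W → Prop} [DecidablePred R]

theorem mem_setPart {s c : Finset W} (hc : ∀ w ∈ c, R w) {x : W} :
    x ∈ setPart R s c ↔ if R x then x ∈ c else x ∈ s := by
  simp only [setPart, Finset.mem_union, Finset.mem_filter]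
  split_ifs with h
  · simp [h]
  · have : x ∉ c := fun hx => h (hc x hx)
    simp [h, this]

/-- A frame that leaves wires in place commutes with overwriting them. -/
theorem IsFrame.setPart_eq {X : Set W} {a : Finset W → Finset W → ℂ} {φ : Finset W → Finset W}
    (h : IsFrame X (fun w => w) a φ) (hR : ∀ w, R w → w ∈ X) {c : Finset W} (hc : ∀ w ∈ c, R w)
    (s : Finset W) : φ (setPart R s c) = setPart R (φ s) c ∧
      (∀ t, a (setPart R s c) t = a s t) ∧ ∀ t, a t (setPart R s c) = a t s := by
  obtain ⟨l, hl, hs⟩ := eq_foldl_toggle s (setPart R s c)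
  have hlR : ∀ w ∈ l, R w := by
    intro w hw
    have := hl w hw
    rw [mem_setPart hc] at this
    by_contra hn
    simp [hn] at this
  have key : ∀ l : List W, (∀ w ∈ l, R w) →
      φ (l.foldr TwoPC.toggle s) = l.foldr TwoPC.toggle (φ s) ∧
      (∀ t, a (l.foldr TwoPC.toggle s) t = a s t) ∧
      (∀ t, a t (l.foldr TwoPC.toggle s) = a t s) ∧ ∀ x, ¬ R x →
        (x ∈ l.foldr TwoPC.toggle (φ s) ↔ x ∈ φ s) := by
    intro l
    induction l with
    | nil => simp
    | cons w l ih =>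
      intro hl
      have hw := hR w (hl w (by simp))
      obtain ⟨h1, h2, h3, h4⟩ := ih (fun x hx => hl x (by simp [hx]))
      refine ⟨?_, fun t => ?_, fun t => ?_, fun x hx => ?_⟩
      · rw [List.foldr_cons, h.toggle w hw, h1]; rfl
      · rw [List.foldr_cons, h.left w hw, h2]
      · rw [List.foldr_cons, h.right w hw, h3]
      · rw [List.foldr_cons, mem_toggle, h4 x hx]
        have : x ≠ w := fun e => hx (e ▸ hl w (by simp))
        tauto
  obtain ⟨h1, h2, h3, h4⟩ := key l hlR
  rw [← hs] at h1 h2 h3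
  refine ⟨?_, h2, h3⟩
  ext x
  rw [mem_setPart hc]
  split_ifs with hx
  · rw [h.mem x (hR x hx), mem_setPart hc, if_pos hx]
  · rw [h1, h4 x hx]

theorem IsFrame.filter_eq {X : Set W} {a : Finset W → Finset W → ℂ} {φ : Finset W → Finset W}
    (h : IsFrame X (fun w => w) a φ) (hR : ∀ w, R w → w ∈ X) (s : Finset W) :
    (φ s).filter R = s.filter R := by
  ext x
  simp only [Finset.mem_filter]
  constructor
  · rintro ⟨h1, h2⟩; exact ⟨(h.mem x (hR x h2) s).1 h1, h2⟩
  · rintro ⟨h1, h2⟩; exact ⟨(h.mem x (hR x h2) s).2 h1, h2⟩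

/-- Measurements and replacements of wires commute with frames that do not act on these wires. -/
theorem IsFrame.transition_eq {X : Set W} {a : Finset W → Finset W → ℂ}
    {φ : Finset W → Finset W} (h : IsFrame X (fun w => w) a φ) (hR : ∀ w, R w → w ∈ X)
    (p : Finset W → Finset W → ℝ) (K : Op W) :
    transition R p (frameOp a φ K) = frameOp a φ (transition R p K) := by
  funext s t
  simp only [transition, frameOp, h.filter_eq hR]
  split_ifs with he
  · rw [← tsum_mul_left]
    refine tsum_congr fun c => ?_
    obtain ⟨h1, h2, -⟩ := h.setPart_eq hR c.2 s
    obtain ⟨h1', -, h3⟩ := h.setPart_eq hR c.2 t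
    simp only [setPart] at *
    rw [h1, h1', h2, h3]; ring
  · simp

/-- The wires with `R` are measured. -/
def dephase (R : W → Prop) [DecidablePred R] (K : Op W) : Op W :=
  fun s t => if s.filter R = t.filter R then K s t else 0

theorem IsFrame.dephase_eq {X : Set W} {a : Finset W → Finset W → ℂ}
    {φ : Finset W → Finset W} (h : IsFrame X (fun w => w) a φ) (hR : ∀ w, R w → w ∈ X)
    (K : Op W) : dephase R (frameOp a φ K) = frameOp a φ (dephase R K) := by
  funext s t
  simp only [dephase, frameOp, h.filter_eq hR]
  split_ifs <;> simp

end Frames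

/-! ### Linearity and supports -/

section Linear

variable {V W : Type} [DecidableEq V] [DecidableEq W]

/-- The linear combination of the operators `K i`, `i ∈ I`, with the coefficients `z i`. -/
def linComb {ι : Type} (I : Finset ι) (z : ι → ℂ) (K : ι → Op W) : Op W :=
  fun s t => ∑ i ∈ I, z i * K i s t

/-- The operator acts on finitely many wires, all others being `0`. -/
def FinSupp (K : Op W) : Prop := ∃ F : Finset W, ∀ s t, K s t ≠ 0 → s ⊆ F ∧ t ⊆ F

theorem gate_linComb {ι : Type} (g : Gate W) (I : Finset ι) (z : ι → ℂ) (K : ι → Op W) :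
    g.apply (linComb I z K) = linComb I z (fun i => g.apply (K i)) := by
  funext s t
  cases g with
  | had w =>
    simp only [had_apply, linComb, Finset.mul_sum, ← Finset.sum_add_distrib]
    exact Finset.sum_congr rfl fun i _ => by ring
  | flip w => rfl
  | cnot a w => rfl
  | ccnot a b w => rfl
  | phase w =>
    simp only [Gate.apply, linComb, Finset.mul_sum]
    exact Finset.sum_congr rfl fun i _ => by ring
  | reset w =>
    simp only [Gate.apply, linComb, ← Finset.sum_add_distrib]
    split_ifs
    · simp
    · exact Finset.sum_congr rfl fun i _ => by ring
  | coin w =>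
    simp only [Gate.apply, linComb, ← Finset.sum_add_distrib, Finset.mul_sum]
    split_ifs
    · exact Finset.sum_congr rfl fun i _ => by ring
    · simp

theorem run_linComb {ι : Type} (C : Circuit W) (I : Finset ι) (z : ι → ℂ) (K : ι → Op W) :
    C.run (linComb I z K) = linComb I z (fun i => C.run (K i)) := by
  induction C generalizing K with
  | nil => rfl
  | cons g C ih => simp only [Circuit.run_cons, gate_linComb, ih]

/-- Every entry of the result of a gate comes from entries that differ only on the wires of the
gate. -/
theorem gate_supp (g : Gate W) (K : Op W) {s t : Finset W} (h : g.apply K s t ≠ 0) :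
    ∃ s' t', K s' t' ≠ 0 ∧ (∀ x ∉ g.wires, x ∈ s' ↔ x ∈ s) ∧ ∀ x ∉ g.wires, x ∈ t' ↔ x ∈ t := by
  have ht : ∀ (w x : W) (s : Finset W), x ≠ w → (x ∈ toggle w s ↔ x ∈ s) := by
    intro w x s hx; rw [mem_toggle]; tauto
  have he : ∀ (w x : W) (s : Finset W), x ≠ w → (x ∈ s.erase w ↔ x ∈ s) := by
    intro w x s hx; simp [hx]
  have hi : ∀ (w x : W) (s : Finset W), x ≠ w → (x ∈ insert w s ↔ x ∈ s) := by
    intro w x s hx; simp [hx]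
  cases g with
  | flip w =>
    exact ⟨_, _, h, fun x hx => ht _ _ _ (by simpa [Gate.wires] using hx),
      fun x hx => ht _ _ _ (by simpa [Gate.wires] using hx)⟩
  | cnot a w =>
    refine ⟨_, _, h, fun x hx => ?_, fun x hx => ?_⟩ <;>
    · simp only [Gate.wires, List.mem_cons, List.not_mem_nil, or_false, not_or] at hx
      dsimp only; split_ifs
      · exact ht _ _ _ hx.2
      · rfl
  | ccnot a b w =>
    refine ⟨_, _, h, fun x hx => ?_, fun x hx => ?_⟩ <;>
    · simp only [Gate.wires, List.mem_cons, List.not_mem_nil, or_false, not_or] at hx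
      dsimp only; split_ifs
      · exact ht _ _ _ hx.2.2
      · rfl
  | had w =>
    simp only [Gate.wires, List.mem_cons, List.not_mem_nil, or_false]
    rw [had_apply] at h
    by_contra hn
    push Not at hn
    have key : ∀ s' t', (∀ x, x ≠ w → (x ∈ s' ↔ x ∈ s)) → (∀ x, x ≠ w → (x ∈ t' ↔ x ∈ t)) →
        K s' t' = 0 := by
      intro s' t' h1 h2
      by_contra h3
      obtain ⟨x, hx, hx'⟩ := hn s' t' h3 h1
      have := h2 x hx
      tauto
    refine h ?_
    rw [key _ _ (fun x hx => he _ _ _ hx) (fun x hx => he _ _ _ hx),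
      key _ _ (fun x hx => he _ _ _ hx) (fun x hx => hi _ _ _ hx),
      key _ _ (fun x hx => hi _ _ _ hx) (fun x hx => he _ _ _ hx),
      key _ _ (fun x hx => hi _ _ _ hx) (fun x hx => hi _ _ _ hx)]
    simp
  | phase w => exact ⟨s, t, right_ne_zero_of_mul h, fun _ _ => Iff.rfl, fun _ _ => Iff.rfl⟩
  | reset w =>
    simp only [Gate.wires, List.mem_cons, List.not_mem_nil, or_false]
    simp only [Gate.apply] at h
    split_ifs at h
    · simp at h
    · by_cases h1 : K s t = 0
      · rw [h1, zero_add] at h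
        exact ⟨_, _, h, fun x hx => hi _ _ _ hx, fun x hx => hi _ _ _ hx⟩
      · exact ⟨s, t, h1, fun _ _ => Iff.rfl, fun _ _ => Iff.rfl⟩
  | coin w =>
    simp only [Gate.wires, List.mem_cons, List.not_mem_nil, or_false]
    simp only [Gate.apply] at h
    split_ifs at h
    · by_cases h1 : K (s.erase w) (t.erase w) = 0
      · rw [h1, zero_add] at h
        exact ⟨_, _, right_ne_zero_of_mul h, fun x hx => hi _ _ _ hx, fun x hx => hi _ _ _ hx⟩
      · exact ⟨_, _, h1, fun x hx => he _ _ _ hx, fun x hx => he _ _ _ hx⟩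
    · simp at h

theorem FinSupp.gate {K : Op W} (h : FinSupp K) (g : Gate W) : FinSupp (g.apply K) := by
  obtain ⟨F, hF⟩ := h
  refine ⟨F ∪ g.wires.toFinset, fun s t hst => ?_⟩
  obtain ⟨s', t', h', h1, h2⟩ := gate_supp g K hst
  obtain ⟨h3, h4⟩ := hF _ _ h'
  constructor
  · intro x hx
    by_cases hg : x ∈ g.wires
    · simp [hg]
    · simp [h3 ((h1 x hg).2 hx)]
  · intro x hx
    by_cases hg : x ∈ g.wires
    · simp [hg]
    · simp [h4 ((h2 x hg).2 hx)]

theorem FinSupp.run {K : Op W} (h : FinSupp K) (C : Circuit W) : FinSupp (C.run K) := by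
  induction C generalizing K with
  | nil => exact h
  | cons g C ih => exact ih (h.gate g)

theorem FinSupp.common {ι : Type} {I : Finset ι} {K : ι → Op W} (h : ∀ i ∈ I, FinSupp (K i)) :
    ∃ F : Finset W, ∀ i ∈ I, ∀ s t, K i s t ≠ 0 → s ⊆ F ∧ t ⊆ F := by
  choose! F hF using h
  refine ⟨I.biUnion F, fun i hi s t hst => ?_⟩
  obtain ⟨h1, h2⟩ := hF i hi s t hst
  exact ⟨h1.trans (Finset.subset_biUnion_of_mem F hi), h2.trans (Finset.subset_biUnion_of_mem F hi)⟩

variable {R : W → Prop} [DecidablePred R]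

theorem FinSupp.dephase {K : Op W} (h : FinSupp K) : FinSupp (dephase R K) := by
  obtain ⟨F, hF⟩ := h
  refine ⟨F, fun s t hst => hF s t ?_⟩
  simp only [TwoPC.dephase] at hst
  split_ifs at hst
  · exact hst
  · simp at hst

theorem dephase_linComb {ι : Type} (I : Finset ι) (z : ι → ℂ) (K : ι → Op W) :
    dephase R (linComb I z K) = linComb I z (fun i => dephase R (K i)) := by
  funext s t
  simp only [dephase, linComb]
  split_ifs <;> simp

/-- The part of a transition that comes from the measured value `c`. -/
theorem isFrame_setPart (p : Finset W → Finset W → ℝ) {c : Finset W} (hc : ∀ w ∈ c, R w) :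
    IsFrame {w | ¬ R w} (fun w => w)
      (fun s t => if s.filter R = t.filter R then ((p c (s.filter R) : ℝ) : ℂ) else 0)
      (fun s => setPart R s c) := by
  have h : ∀ x, ¬ R x → ∀ s : Finset W, (toggle x s).filter R = s.filter R := by
    intro x hx s
    ext y
    simp only [Finset.mem_filter, mem_toggle]
    constructor
    · rintro ⟨h1, h2⟩
      have : y ≠ x := by rintro rfl; exact hx h2
      tauto
    · rintro ⟨h1, h2⟩
      have : y ≠ x := by rintro rfl; exact hx h2
      tauto
  refine ⟨fun x hx s => ?_, fun x hx s => ?_, fun x hx s t => ?_, fun x hx s t => ?_⟩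
  · rw [mem_setPart hc, if_neg hx]
  · ext y
    rw [mem_toggle, mem_setPart hc, mem_setPart hc, mem_toggle]
    by_cases hy : R y
    · have : y ≠ x := by rintro rfl; exact hx hy
      simp [hy, this]
    · simp [hy]
  · simp only [h x hx]
  · simp only [h x hx]

/-- A transition of an operator on finitely many wires is a finite sum. -/
theorem transition_eq_linComb (p : Finset W → Finset W → ℝ) {K : Op W} {F : Finset W}
    (hF : ∀ s t, K s t ≠ 0 → s ⊆ F ∧ t ⊆ F) :
    transition R p K = linComb (F.filter R).powerset (fun _ => 1) (fun c => frameOp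
      (fun s t => if s.filter R = t.filter R then ((p c (s.filter R) : ℝ) : ℂ) else 0)
      (fun s => setPart R s c) K) := by
  funext s t
  simp only [transition, linComb, frameOp, one_mul]
  split_ifs with h
  · let e : {c : Finset W // ∀ w ∈ c, R w} → ℂ := fun c =>
      (p c.1 (s.filter R) : ℂ) * K (setPart R s c.1) (setPart R t c.1)
    change ∑' c, e c = _
    have hsub : ∀ c ∈ (F.filter R).powerset, ∀ w ∈ c, R w := fun c hc w hw =>
      (Finset.mem_filter.1 (Finset.mem_powerset.1 hc hw)).2
    rw [tsum_eq_sum (s := ((F.filter R).powerset.attach.image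
      fun c => (⟨c.1, hsub c.1 c.2⟩ : {c : Finset W // ∀ w ∈ c, R w})))]
    · rw [Finset.sum_image, ← Finset.sum_attach (F.filter R).powerset]
      intro a _ b _ hab
      exact Subtype.ext (congrArg (fun c : {c : Finset W // ∀ w ∈ c, R w} => c.1) hab)
    · rintro ⟨c, hc⟩ hn
      by_contra h0
      refine hn (Finset.mem_image.2 ⟨⟨c, ?_⟩, Finset.mem_attach .., rfl⟩)
      rw [Finset.mem_powerset]
      intro w hw
      have := (hF _ _ (right_ne_zero_of_mul h0)).1 (show w ∈ setPart R s c by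
        rw [mem_setPart hc, if_pos (hc w hw)]; exact hw)
      simp [this, hc w hw]
  · simp

theorem transition_supp (p : Finset W → Finset W → ℝ) (K : Op W) {s t : Finset W}
    (h : transition R p K s t ≠ 0) : s.filter R = t.filter R ∧ ∃ c : Finset W, (∀ w ∈ c, R w) ∧
      p c (s.filter R) ≠ 0 ∧ K (setPart R s c) (setPart R t c) ≠ 0 := by
  simp only [transition] at h
  split_ifs at h with h1
  · refine ⟨h1, ?_⟩
    by_contra hn
    push Not at hn
    refine h ?_
    convert tsum_zero with c
    by_cases h2 : p c.1 (s.filter R) = 0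
    · simp [h2]
    · have := hn c.1 c.2 h2
      simp only [setPart] at this
      rw [this, mul_zero]
  · simp at h

theorem transition_linComb {ι : Type} (p : Finset W → Finset W → ℝ) {I : Finset ι} {z : ι → ℂ}
    {K : ι → Op W} (h : ∀ i ∈ I, FinSupp (K i)) :
    transition R p (linComb I z K) = linComb I z (fun i => transition R p (K i)) := by
  obtain ⟨F, hF⟩ := FinSupp.common h
  have hF' : ∀ s t, linComb I z K s t ≠ 0 → s ⊆ F ∧ t ⊆ F := by
    intro s t hst
    obtain ⟨i, hi, h0⟩ := Finset.exists_ne_zero_of_sum_ne_zero hst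
    exact hF i hi s t (right_ne_zero_of_mul h0)
  rw [transition_eq_linComb p hF']
  have : linComb I z (fun i => transition R p (K i)) = linComb I z (fun i =>
      linComb (F.filter R).powerset (fun _ => 1) (fun c => frameOp
      (fun s t => if s.filter R = t.filter R then ((p c (s.filter R) : ℝ) : ℂ) else 0)
      (fun s => setPart R s c) (K i))) := by
    funext s t
    refine Finset.sum_congr rfl fun i hi => ?_
    dsimp only
    rw [transition_eq_linComb p (hF i hi)]
  rw [this]
  funext s t
  simp only [linComb, frameOp, Finset.mul_sum]
  rw [Finset.sum_comm]
  exact Finset.sum_congr rfl fun i _ => Finset.sum_congr rfl fun c _ => by ring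

/-- A transition commutes with circuits on other wires. -/
theorem run_transition (p : Finset W → Finset W → ℝ) {K : Op W} (hK : FinSupp K) {C : Circuit W}
    (hC : C.On {w | ¬ R w}) : C.run (transition R p K) = transition R p (C.run K) := by
  obtain ⟨F, hF⟩ := FinSupp.common (I := (Finset.univ : Finset Bool))
    (K := fun b => if b then K else C.run K) (fun b _ => by
      cases b
      · exact hK.run C
      · exact hK)
  have h1 := transition_eq_linComb (R := R) p (hF true (Finset.mem_univ _))
  have h2 := transition_eq_linComb (R := R) p (hF false (Finset.mem_univ _))
  simp only [if_true, Bool.false_eq_true, if_false] at h1 h2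
  rw [h1, h2, run_linComb]
  funext s t
  refine Finset.sum_congr rfl fun c hc => ?_
  have hsub : ∀ w ∈ c, R w := fun w hw =>
    (Finset.mem_filter.1 (Finset.mem_powerset.1 hc hw)).2
  dsimp only
  rw [(isFrame_setPart p hsub).run_same hC K]

/-- Measuring some wires does not act on the others. -/
theorem dephase_frame : IsFrame {w | ¬ R w} (fun w => w)
    (fun s t => if s.filter R = t.filter R then (1 : ℂ) else 0) (fun s : Finset W => s) := by
  have h : ∀ x, ¬ R x → ∀ s : Finset W, (toggle x s).filter R = s.filter R := by
    intro x hx s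
    ext y
    simp only [Finset.mem_filter, mem_toggle]
    constructor
    · rintro ⟨h1, h2⟩
      have : y ≠ x := by rintro rfl; exact hx h2
      tauto
    · rintro ⟨h1, h2⟩
      have : y ≠ x := by rintro rfl; exact hx h2
      tauto
  refine ⟨fun x hx s => Iff.rfl, fun x hx s => rfl, fun x hx s t => ?_, fun x hx s t => ?_⟩
  · simp only [h x hx]
  · simp only [h x hx]

theorem dephase_eq_frameOp (K : Op W) : dephase R K = frameOp
    (fun s t => if s.filter R = t.filter R then (1 : ℂ) else 0) (fun s : Finset W => s) K := by
  funext s t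
  simp [dephase, frameOp]

theorem run_dephase (K : Op W) {C : Circuit W} (hC : C.On {w | ¬ R w}) :
    C.run (dephase R K) = dephase R (C.run K) := by
  rw [dephase_eq_frameOp, dephase_eq_frameOp, dephase_frame.run_same hC]

/-- The new values must range over finitely many wires if the old ones do. -/
theorem FinSupp.transition {p : Finset W → Finset W → ℝ} {K : Op W} (hK : FinSupp K)
    (hp : ∀ F : Finset W, ∃ G : Finset W, ∀ c d, (∀ w ∈ c, R w) → c ⊆ F → p c d ≠ 0 → d ⊆ G) :
    FinSupp (transition R p K) := by
  obtain ⟨F, hF⟩ := hK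
  obtain ⟨G, hG⟩ := hp F
  refine ⟨F ∪ G, fun s t hst => ?_⟩
  obtain ⟨h1, c, hc, h2, h3⟩ := transition_supp p K hst
  obtain ⟨h4, h5⟩ := hF _ _ h3
  have hcF : c ⊆ F := fun w hw => h4 (by rw [mem_setPart hc, if_pos (hc w hw)]; exact hw)
  have h6 := hG c _ hc hcF h2
  have key : ∀ s', setPart R s' c ⊆ F → s'.filter R ⊆ G → s' ⊆ F ∪ G := by
    intro s' h h' w hw
    by_cases hR : R w
    · exact Finset.mem_union_right _ (h' (Finset.mem_filter.2 ⟨hw, hR⟩))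
    · exact Finset.mem_union_left _ (h (by rw [mem_setPart hc, if_neg hR]; exact hw))
  exact ⟨key s h4 h6, key t h5 (h1 ▸ h6)⟩

/-- A first transition that empties some of the wires is absorbed by a second one that does not look
at them. -/
theorem transition_absorb {R' : W → Prop} [DecidablePred R'] (hRR : ∀ w, R w → R' w)
    (p' : Finset W → Finset W → ℝ) (hp : ∀ c d, p' (c.filter fun w => ¬ R w) d = p' c d) {K : Op W}
    (hK : FinSupp K) :
    transition R' p' (transition R (fun _ d => if d = ∅ then 1 else 0) K) =
      transition R' p' K := by
  have hT : FinSupp (transition R (fun _ d => if d = ∅ then 1 else 0) K) :=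
    hK.transition fun F => ⟨∅, fun c d _ _ h => by
      by_cases hd : d = ∅ <;> simp_all⟩
  obtain ⟨F, hF⟩ := hK
  obtain ⟨F', hF'⟩ := hT
  have hG : ∀ s t, K s t ≠ 0 → s ⊆ F ∪ F' ∧ t ⊆ F ∪ F' := fun s t h =>
    ⟨(hF s t h).1.trans Finset.subset_union_left, (hF s t h).2.trans Finset.subset_union_left⟩
  have hG' : ∀ s t, transition R (fun _ d => if d = ∅ then 1 else 0) K s t ≠ 0 →
      s ⊆ F ∪ F' ∧ t ⊆ F ∪ F' := fun s t h =>
    ⟨(hF' s t h).1.trans Finset.subset_union_right, (hF' s t h).2.trans Finset.subset_union_right⟩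
  rw [transition_eq_linComb p' hG, transition_eq_linComb p' hG', transition_eq_linComb _ hG]
  set G := F ∪ F'
  funext s t
  simp only [linComb, frameOp, one_mul]
  by_cases hst : s.filter R' = t.filter R'
  swap
  · simp [hst]
  have e : ∀ x : ℂ, (if s.filter R' = t.filter R' then x else 0) = x := fun x => if_pos hst
  simp only [e]
  -- the values of the second measurement with nothing on `R` contribute, and each of them collects
  -- all values that agree with it outside of `R`
  conv_rhs => rw [← Finset.sum_fiberwise_of_maps_to (s := (G.filter R').powerset)
    (t := (G.filter R').powerset) (g := fun c => c.filter fun w => ¬ R w) (fun c hc => Finset.mem_powerset.2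
      ((Finset.filter_subset _ _).trans (Finset.mem_powerset.1 hc)))]
  refine Finset.sum_congr rfl fun c hc => ?_
  have hcR' : ∀ w ∈ c, R' w := fun w hw => (Finset.mem_filter.1 (Finset.mem_powerset.1 hc hw)).2
  have hcG : c ⊆ G := (Finset.mem_powerset.1 hc).trans (Finset.filter_subset _ _)
  have hfil : ∀ u : Finset W, (setPart R' u c).filter R = c.filter R := by
    intro u
    ext x
    simp only [Finset.mem_filter, mem_setPart hcR']
    constructor
    · rintro ⟨h1, h2⟩; rw [if_pos (hRR x h2)] at h1; exact ⟨h1, h2⟩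
    · rintro ⟨h1, h2⟩; rw [if_pos (hRR x h2)]; exact ⟨h1, h2⟩
  simp only [hfil, if_true]
  by_cases hc0 : c.filter R = ∅
  · simp only [hc0, if_true, Complex.ofReal_one, one_mul]
    have hcn : ∀ x ∈ c, ¬ R x := by
      intro x hx hR
      have : x ∈ c.filter R := Finset.mem_filter.2 ⟨hx, hR⟩
      rw [hc0] at this; simp at this
    rw [Finset.mul_sum]
    refine Finset.sum_bij' (fun b _ => c ∪ b) (fun c' _ => c'.filter R) ?_ ?_ ?_ ?_ ?_
    · intro b hb
      rw [Finset.mem_powerset] at hb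
      have hbR : ∀ w ∈ b, R w := fun w hw => (Finset.mem_filter.1 (hb hw)).2
      rw [Finset.mem_filter, Finset.mem_powerset]
      refine ⟨Finset.union_subset (Finset.mem_powerset.1 hc) fun w hw => ?_, ?_⟩
      · exact Finset.mem_filter.2 ⟨(Finset.mem_filter.1 (hb hw)).1, hRR w (hbR w hw)⟩
      · ext x
        simp only [Finset.mem_filter, Finset.mem_union]
        constructor
        · rintro ⟨h1 | h1, h2⟩
          · exact h1
          · exact absurd (hbR x h1) h2
        · intro h1; exact ⟨Or.inl h1, hcn x h1⟩
    · intro c' hc'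
      rw [Finset.mem_filter, Finset.mem_powerset] at hc'
      rw [Finset.mem_powerset]
      intro w hw
      rw [Finset.mem_filter] at hw ⊢
      exact ⟨(Finset.mem_filter.1 (hc'.1 hw.1)).1, hw.2⟩
    · intro b hb
      rw [Finset.mem_powerset] at hb
      ext x
      simp only [Finset.mem_filter, Finset.mem_union]
      constructor
      · rintro ⟨h1 | h1, h2⟩
        · exact absurd h2 (hcn x h1)
        · exact h1
      · intro h1; exact ⟨Or.inr h1, (Finset.mem_filter.1 (hb h1)).2⟩
    · intro c' hc'
      rw [Finset.mem_filter] at hc'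
      rw [← hc'.2]
      ext x
      simp only [Finset.mem_filter, Finset.mem_union]
      tauto
    · intro b hb
      rw [Finset.mem_powerset] at hb
      have hbR : ∀ w ∈ b, R w := fun w hw => (Finset.mem_filter.1 (hb hw)).2
      have hcbR : ∀ w ∈ c ∪ b, R' w := fun w hw =>
        (Finset.mem_union.1 hw).elim (hcR' w) (fun h => hRR w (hbR w h))
      have h1 : (c ∪ b).filter (fun w => ¬ R w) = c := by
        ext x
        simp only [Finset.mem_filter, Finset.mem_union]
        constructor
        · rintro ⟨h1 | h1, h2⟩
          · exact h1
          · exact absurd (hbR x h1) h2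
        · intro h1; exact ⟨Or.inl h1, hcn x h1⟩
      have h2 : ∀ u, setPart R (setPart R' u c) b = setPart R' u (c ∪ b) := by
        intro u
        ext x
        rw [mem_setPart hbR, mem_setPart hcR', mem_setPart hcbR, Finset.mem_union]
        by_cases hR : R x
        · have : x ∉ c := fun h => hcn x h hR
          simp [hR, hRR x hR, this]
        · have : x ∉ b := fun h => hR (hbR x h)
          simp [hR, this]
      rw [← hp (c ∪ b), h1, h2, h2]
  · simp only [hc0, if_false, Complex.ofReal_zero, zero_mul, Finset.sum_const_zero, mul_zero]
    rw [Finset.sum_eq_zero]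
    intro c' hc'
    rw [Finset.mem_filter] at hc'
    refine absurd ?_ hc0
    rw [← hc'.2]
    ext x
    simp

/-- Emptying wires that are `0` does nothing. -/
theorem transition_empty_of_supp {K : Op W}
    (h : ∀ s t, K s t ≠ 0 → (∀ w ∈ s, ¬ R w) ∧ ∀ w ∈ t, ¬ R w) :
    transition R (fun _ d => if d = ∅ then 1 else 0) K = K := by
  funext s t
  have hf : ∀ s : Finset W, s.filter R = ∅ ↔ ∀ w ∈ s, ¬ R w := fun s => by
    rw [Finset.filter_eq_empty_iff]
  have hs : ∀ s : Finset W, (∀ w ∈ s, ¬ R w) → s.filter (fun w => ¬ R w) = s := fun s h =>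
    Finset.filter_true_of_mem h
  simp only [transition]
  by_cases h0 : s.filter R = ∅ ∧ t.filter R = ∅
  · rw [h0.1, h0.2, if_pos rfl, tsum_eq_single ⟨∅, by simp⟩]
    · simp [hs s ((hf s).1 h0.1), hs t ((hf t).1 h0.2)]
    · rintro ⟨c, hc⟩ hne
      obtain ⟨w, hw⟩ : c.Nonempty := by
        rw [Finset.nonempty_iff_ne_empty]
        exact fun h => hne (Subtype.ext h)
      have : K (s.filter (fun w => ¬ R w) ∪ c) (t.filter (fun w => ¬ R w) ∪ c) = 0 := by
        by_contra h1
        exact (h _ _ h1).1 w (Finset.mem_union_right _ hw) (hc w hw)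
      simp [this]
  · have h1 : K s t = 0 := by
      by_contra h1
      obtain ⟨h2, h3⟩ := h s t h1
      exact h0 ⟨(hf s).2 h2, (hf t).2 h3⟩
    rw [h1]
    by_cases h2 : s.filter R = t.filter R
    · have h3 : t.filter R ≠ ∅ := fun h => h0 ⟨h2 ▸ h, h⟩
      simp [h2, h3]
    · rw [if_neg h2]

end Linear

/-! ### Positivity and trace -/

section Positivity

open scoped ComplexOrder

variable {V W : Type}

/-- Positivity of an operator, as a kernel on basis states. -/
def Pos {V : Type} (K : Op V) : Prop := ∀ (ι : Type) (I : Finset ι) (φ : ι → Finset V) (x : ι → ℂ),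
  0 ≤ ∑ i ∈ I, ∑ j ∈ I, star (x i) * x j * K (φ i) (φ j)

/-- Conjugation by an operator each of whose rows is given by finitely many entries. -/
theorem Pos.kraus {K : Op V} (hK : Pos K) {κ : Type} [Fintype κ] (u : Finset W → κ → ℂ)
    (φ : Finset W → κ → Finset V) :
    Pos (fun s t => ∑ k, ∑ l, u s k * star (u t l) * K (φ s k) (φ t l)) := by
  intro ι I ψ x
  have := hK (ι × κ) (I ×ˢ Finset.univ) (fun y => φ (ψ y.1) y.2)
    (fun y => x y.1 * star (u (ψ y.1) y.2))
  simp only [Finset.sum_product] at this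
  refine this.trans_eq ?_
  refine Finset.sum_congr rfl fun i _ => ?_
  rw [Finset.sum_comm]
  refine Finset.sum_congr rfl fun j _ => ?_
  rw [Finset.mul_sum]
  refine Finset.sum_congr rfl fun k _ => ?_
  rw [Finset.mul_sum]
  refine Finset.sum_congr rfl fun l _ => ?_
  simp only [star_mul, star_star]
  ring

theorem Pos.frame {K : Op V} (hK : Pos K) (u : Finset W → ℂ) (φ : Finset W → Finset V) :
    Pos (fun s t => u s * star (u t) * K (φ s) (φ t)) := by
  have := hK.kraus (κ := Unit) (fun s _ => u s) (fun s _ => φ s)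
  simpa using this

theorem Pos.reindex {K : Op V} (hK : Pos K) (φ : Finset W → Finset V) :
    Pos (fun s t => K (φ s) (φ t)) := by
  have h := hK.frame (fun _ => 1) φ
  simp only [star_one, one_mul] at h
  exact h

theorem Pos.frame_real {K : Op V} (hK : Pos K) (u : Finset W → ℝ) (φ : Finset W → Finset V) :
    Pos (fun s t => (u s * u t : ℝ) * K (φ s) (φ t)) := by
  have := hK.frame (fun s => (u s : ℂ)) φ
  simpa using this

theorem Pos.add {K L : Op V} (hK : Pos K) (hL : Pos L) : Pos (fun s t => K s t + L s t) := by
  intro ι I φ x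
  simp only [mul_add, Finset.sum_add_distrib]
  exact add_nonneg (hK ι I φ x) (hL ι I φ x)

theorem Pos.smul {K : Op V} (hK : Pos K) {z : ℝ} (hz : 0 ≤ z) :
    Pos (fun s t => (z : ℂ) * K s t) := by
  have := hK.frame_real (fun _ => Real.sqrt z) (fun s => s)
  simpa [Real.mul_self_sqrt hz] using this

theorem Pos.sum {ι : Type} {I : Finset ι} {K : ι → Op V} (h : ∀ i ∈ I, Pos (K i)) :
    Pos (linComb I (fun _ => 1) K) := by
  intro κ J φ x
  simp only [linComb, Finset.mul_sum, one_mul]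
  have e : ∀ i ∈ J, ∑ j ∈ J, ∑ k ∈ I, star (x i) * x j * K k (φ i) (φ j) =
      ∑ k ∈ I, ∑ j ∈ J, star (x i) * x j * K k (φ i) (φ j) := fun i _ => Finset.sum_comm
  rw [Finset.sum_congr rfl e, Finset.sum_comm]
  exact Finset.sum_nonneg fun k hk => h k hk κ J φ x

/-- The diagonal blocks of a positive operator. -/
theorem Pos.blocks {K : Op V} (hK : Pos K) {B : Type} [DecidableEq B] (β : Finset V → B) :
    Pos (fun s t => if β s = β t then K s t else 0) := by
  intro ι I φ x
  have e : ∑ i ∈ I, ∑ j ∈ I, star (x i) * x j * (if β (φ i) = β (φ j) then K (φ i) (φ j) else 0) =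
      ∑ b ∈ I.image (fun i => β (φ i)), ∑ i ∈ I with β (φ i) = b, ∑ j ∈ I with β (φ j) = b,
        star (x i) * x j * K (φ i) (φ j) := by
    rw [← Finset.sum_fiberwise_of_maps_to (s := I) (t := I.image (fun i => β (φ i)))
      (g := fun i => β (φ i)) (fun i hi => Finset.mem_image_of_mem _ hi)]
    refine Finset.sum_congr rfl fun b _ => Finset.sum_congr rfl fun i hi => ?_
    rw [Finset.mem_filter] at hi
    rw [Finset.sum_filter]
    refine Finset.sum_congr rfl fun j _ => ?_
    rw [hi.2]
    by_cases h : b = β (φ j)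
    · simp [h]
    · rw [if_neg h, if_neg (fun h' => h h'.symm), mul_zero]
  rw [e]
  exact Finset.sum_nonneg fun b _ => hK ι _ φ x

theorem Pos.diag_nonneg {K : Op V} (hK : Pos K) (s : Finset V) : 0 ≤ K s s := by
  have := hK Unit Finset.univ (fun _ => s) (fun _ => 1)
  simpa using this

theorem Pos.hermitian {K : Op V} (hK : Pos K) (s t : Finset V) : star (K s t) = K t s := by
  have h1 := hK.diag_nonneg s
  have h2 := hK.diag_nonneg t
  have h3 := hK Bool Finset.univ (fun b => if b then s else t) (fun _ => 1)
  have h4 := hK Bool Finset.univ (fun b => if b then s else t) (fun b => if b then 1 else Complex.I)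
  simp only [Fintype.sum_bool, if_true, Bool.false_eq_true, if_false, star_one, one_mul,
    RCLike.star_def, Complex.conj_I, map_one, mul_one] at h3 h4
  rw [Complex.le_def] at h1 h2 h3 h4
  simp only [Complex.zero_im, Complex.zero_re, Complex.add_im, Complex.mul_im, Complex.I_re,
    Complex.I_im, Complex.neg_im, Complex.neg_re, Complex.mul_re, Complex.add_re] at h1 h2 h3 h4
  apply Complex.ext
  · simp only [RCLike.star_def, Complex.conj_re]; linarith [h4.2]
  · simp only [RCLike.star_def, Complex.conj_im]; linarith [h3.2]

/-- The trace. -/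
def tr {V : Type} (K : Op V) : ℂ := ∑' s, K s s

theorem FinSupp.summable {E : Type} [AddCommMonoid E] [TopologicalSpace E] {K : Op W}
    (h : FinSupp K) {f : Finset W → E} (hf : ∀ s, K s s = 0 → f s = 0) : Summable f := by
  obtain ⟨F, hF⟩ := h
  refine summable_of_ne_finset_zero (s := F.powerset) fun s hs => hf s ?_
  by_contra h
  exact hs (Finset.mem_powerset.2 (hF s s h).1)

theorem FinSupp.summable_diag {K : Op W} (h : FinSupp K) : Summable (fun s => K s s) :=
  h.summable fun _ h => h

variable [DecidableEq W]

theorem Pos.gate {K : Op W} (hK : Pos K) (g : Gate W) : Pos (g.apply K) := by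
  cases g with
  | flip w => exact hK.reindex (fun s => toggle w s)
  | cnot a w => exact hK.reindex (fun s => if a ∈ s ∧ a ≠ w then toggle w s else s)
  | ccnot a b w =>
    exact hK.reindex (fun s => if a ∈ s ∧ b ∈ s ∧ a ≠ w ∧ b ≠ w then toggle w s else s)
  | had w =>
    have h := (hK.kraus (κ := Bool) (W := W) (fun s b => if b ∧ w ∈ s then -1 else 1)
      (fun s b => if b then insert w s else s.erase w)).smul (z := 1 / 2) (by norm_num)
    convert h using 1
    funext s t
    rw [had_apply]
    simp only [Fintype.sum_bool, if_true, Bool.false_eq_true, if_false, true_and, false_and]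
    push_cast
    split_ifs <;> simp <;> ring
  | phase w =>
    exact hK.frame (fun s => if w ∈ s then Complex.exp (Complex.I * Real.pi / 4) else 1)
      (fun s => s)
  | reset w =>
    have h := (hK.frame_real (W := W) (fun s => if w ∈ s then 0 else 1) (fun s => s)).add
      (hK.frame_real (fun s => if w ∈ s then 0 else 1) (fun s => insert w s))
    convert h using 1
    funext s t
    by_cases h1 : w ∈ s <;> by_cases h2 : w ∈ t <;> simp [Gate.apply, h1, h2]
  | coin w =>
    have h := (((hK.frame_real (W := W) (fun s => 1) (fun s => s.erase w)).add
      (hK.frame_real (fun s => 1) (fun s => insert w s))).smul (z := 1 / 2)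
        (by norm_num)).blocks (fun s => decide (w ∈ s))
    convert h using 1
    funext s t
    simp [Gate.apply]

theorem Pos.run {K : Op W} (hK : Pos K) (C : Circuit W) : Pos (C.run K) := by
  induction C generalizing K with
  | nil => exact hK
  | cons g C ih => exact ih (hK.gate g)

variable {R : W → Prop} [DecidablePred R]

theorem Pos.dephase {K : Op W} (hK : Pos K) : Pos (dephase R K) :=
  hK.blocks (fun s => s.filter R)

theorem Pos.transition {K : Op W} (hK : Pos K) (hF : FinSupp K) {p : Finset W → Finset W → ℝ}
    (hp : ∀ c d, 0 ≤ p c d) : Pos (transition R p K) := by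
  obtain ⟨F, hF⟩ := hF
  rw [transition_eq_linComb p hF]
  refine Pos.sum fun c _ => ?_
  have h := (hK.frame_real (fun s : Finset W => Real.sqrt (p c (s.filter R)))
    (fun s => setPart R s c)).blocks (fun s => s.filter R)
  convert h using 1
  funext s t
  simp only [frameOp]
  split_ifs with h
  · rw [h, Real.mul_self_sqrt (hp _ _)]
  · simp

/-- Toggling a wire, as a permutation of the basis states. -/
def toggleEquiv (w : W) : Finset W ≃ Finset W :=
  ⟨toggle w, toggle w, toggle_toggle w, toggle_toggle w⟩

/-- Two sums over basis states agree if they agree on each pair of states that differ in `w`. -/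
theorem tsum_eq_of_toggle (w : W) {f g : Finset W → ℂ} (hf : Summable f) (hg : Summable g)
    (h : ∀ s, w ∉ s → g s + g (toggle w s) = f s + f (toggle w s)) : ∑' s, g s = ∑' s, f s := by
  have key : ∀ f : Finset W → ℂ, Summable f → ∑' s, (f s + f (toggle w s)) = 2 * ∑' s, f s := by
    intro f hf
    have h1 : Summable (fun s => f (toggle w s)) := (toggleEquiv w).summable_iff.2 hf
    rw [hf.tsum_add h1, show ∑' s, f (toggle w s) = ∑' s, f s from (toggleEquiv w).tsum_eq f]
    ring
  have h1 : ∑' s, (g s + g (toggle w s)) = ∑' s, (f s + f (toggle w s)) := by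
    refine tsum_congr fun s => ?_
    by_cases hw : w ∈ s
    · have := h (toggle w s) (by rw [mem_toggle]; tauto)
      rw [toggle_toggle] at this
      rw [add_comm, this, add_comm]
    · exact h s hw
  rw [key g hg, key f hf] at h1
  exact mul_left_cancel₀ two_ne_zero h1

theorem tr_gate {K : Op W} (hK : FinSupp K) (g : Gate W) : tr (g.apply K) = tr K := by
  have hperm : ∀ σ : Finset W → Finset W, (∀ s, σ (σ s) = s) → ∑' s, K (σ s) (σ s) = tr K :=
    fun σ h => (⟨σ, σ, h, h⟩ : Finset W ≃ Finset W).tsum_eq (fun s => K s s)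
  have hg := (hK.gate g).summable_diag
  cases g with
  | flip w => exact hperm _ (toggle_toggle w)
  | cnot a w =>
    refine hperm (fun s => if a ∈ s ∧ a ≠ w then toggle w s else s) fun s => ?_
    split_ifs with h1 h2
    · exact toggle_toggle w s
    · exact absurd ⟨by rw [mem_toggle]; tauto, h1.2⟩ h2
    · rfl
  | ccnot a b w =>
    refine hperm (fun s => if a ∈ s ∧ b ∈ s ∧ a ≠ w ∧ b ≠ w then toggle w s else s) fun s => ?_
    split_ifs with h1 h2
    · exact toggle_toggle w s
    · exact absurd ⟨by rw [mem_toggle]; tauto, by rw [mem_toggle]; tauto, h1.2.2⟩ h2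
    · rfl
  | phase w =>
    refine tsum_congr fun s => ?_
    have : Complex.exp (Complex.I * Real.pi / 4) *
        star (Complex.exp (Complex.I * Real.pi / 4)) = 1 := by
      rw [RCLike.star_def, ← Complex.exp_conj, ← Complex.exp_add]
      have h4 : (starRingEnd ℂ) 4 = 4 := Complex.conj_ofNat 4
      simp only [map_mul, map_div₀, Complex.conj_I, Complex.conj_ofReal, h4]
      rw [← Complex.exp_zero]; congr 1; ring
    simp only [Gate.apply]
    split_ifs
    · rw [this, one_mul]
    · simp
  | had w =>
    refine tsum_eq_of_toggle w hK.summable_diag hg fun s hs => ?_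
    have h1 : s.erase w = s := Finset.erase_eq_of_notMem hs
    have h2 : toggle w s = insert w s := by simp [toggle, hs]
    have h3 : (insert w s).erase w = s := Finset.erase_insert hs
    simp only [had_apply, h1, h2, h3, Finset.insert_idem, hs, Finset.mem_insert_self, if_true,
      if_false]
    ring
  | reset w =>
    refine tsum_eq_of_toggle w hK.summable_diag hg fun s hs => ?_
    have h2 : toggle w s = insert w s := by simp [toggle, hs]
    simp [Gate.apply, h2, hs]
  | coin w =>
    refine tsum_eq_of_toggle w hK.summable_diag hg fun s hs => ?_
    have h1 : s.erase w = s := Finset.erase_eq_of_notMem hs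
    have h2 : toggle w s = insert w s := by simp [toggle, hs]
    have h3 : (insert w s).erase w = s := Finset.erase_insert hs
    simp only [Gate.apply, if_true, h1, h2, h3, Finset.insert_idem]
    ring

theorem tr_run {K : Op W} (hK : FinSupp K) (C : Circuit W) : tr (C.run K) = tr K := by
  induction C generalizing K with
  | nil => rfl
  | cons g C ih => rw [Circuit.run_cons, ih (hK.gate g), tr_gate hK]

theorem tr_dephase (K : Op W) : tr (dephase R K) = tr K :=
  tsum_congr fun s => by simp [dephase]

variable (R) in
/-- A basis state consists of its part on the wires with `R` and the rest. -/
def splitEquiv : Finset W ≃ {c : Finset W // ∀ w ∈ c, R w} × {u : Finset W // ∀ w ∈ u, ¬ R w} where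
  toFun s := (⟨s.filter R, fun w hw => (Finset.mem_filter.1 hw).2⟩,
    ⟨s.filter (fun w => ¬ R w), fun w hw => (Finset.mem_filter.1 hw).2⟩)
  invFun y := y.2.1 ∪ y.1.1
  left_inv s := by
    dsimp only
    rw [Finset.union_comm]; exact Finset.filter_union_filter_not_eq R s
  right_inv y := by
    obtain ⟨⟨c, hc⟩, u, hu⟩ := y
    ext x
    · simp only [Finset.mem_filter, Finset.mem_union]
      constructor
      · rintro ⟨h1 | h1, h2⟩
        · exact absurd h2 (hu x h1)
        · exact h1
      · exact fun h => ⟨Or.inr h, hc x h⟩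
    · simp only [Finset.mem_filter, Finset.mem_union]
      constructor
      · rintro ⟨h1 | h1, h2⟩
        · exact h1
        · exact absurd (hc x h1) h2
      · exact fun h => ⟨Or.inl h, hu x h⟩

/-- Replacing measured values according to probability distributions preserves the trace. -/
theorem tr_transition {K : Op W} (hK : FinSupp K) {p : Finset W → Finset W → ℝ}
    (hp : ∀ c d, 0 ≤ p c d)
    (hp1 : ∀ c, (∀ w ∈ c, R w) → HasSum (fun d : {d : Finset W // ∀ w ∈ d, R w} => p c d) 1) :
    tr (transition R p K) = tr K := by
  obtain ⟨F, hF⟩ := hK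
  have hF' : ∀ c u, K (u ∪ c) (u ∪ c) ≠ 0 → c ⊆ F ∧ u ⊆ F := fun c u h =>
    ⟨Finset.subset_union_right.trans (hF _ _ h).1, Finset.subset_union_left.trans (hF _ _ h).1⟩
  have hsub : ∀ c ∈ (F.filter R).powerset, ∀ w ∈ c, R w := fun c hc w hw =>
    (Finset.mem_filter.1 (Finset.mem_powerset.1 hc hw)).2
  -- the entries of the rest, for a given value `c` of the measured part
  let k : Finset W → {u : Finset W // ∀ w ∈ u, ¬ R w} → ℂ := fun c u => K (u.1 ∪ c) (u.1 ∪ c)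
  have hk : ∀ c, Summable fun u => ‖k c u‖ := by
    intro c
    refine summable_of_hasFiniteSupport ((F.powerset.finite_toSet.preimage
      (Subtype.val_injective.injOn)).subset fun u hu => ?_)
    have : K (u.1 ∪ c) (u.1 ∪ c) ≠ 0 := fun h => hu (by simp [k, h])
    simpa using (hF' _ _ this).2
  have hpn : ∀ c, (∀ w ∈ c, R w) →
      Summable fun d : {d : Finset W // ∀ w ∈ d, R w} => ‖((p c d.1 : ℝ) : ℂ)‖ := by
    intro c hc
    simpa [abs_of_nonneg (hp _ _)] using (hp1 c hc).summable
  have hpk : ∀ c ∈ (F.filter R).powerset, HasSum (fun s : Finset W =>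
      ((p c (s.filter R) : ℝ) : ℂ) * K (setPart R s c) (setPart R s c)) (∑' u, k c u) := by
    intro c hc
    have h1 := summable_mul_of_summable_norm (hpn c (hsub c hc)) (hk c)
    have h2 := h1.hasSum
    have h3 : ∑' x : {d : Finset W // ∀ w ∈ d, R w} × {u : Finset W // ∀ w ∈ u, ¬ R w},
        ((p c x.1.1 : ℝ) : ℂ) * k c x.2 = ∑' u, k c u := by
      rw [← tsum_mul_tsum_of_summable_norm (hpn c (hsub c hc)) (hk c)]
      have := (hp1 c (hsub c hc)).tsum_eq
      rw [← Complex.ofReal_tsum, this]; simp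
    rw [h3] at h2
    exact (splitEquiv R).hasSum_iff.2 h2
  have htr : tr (transition R p K) = ∑ c ∈ (F.filter R).powerset, ∑' u, k c u := by
    rw [transition_eq_linComb p hF, tr]
    have e : ∀ s : Finset W, linComb (F.filter R).powerset (fun _ => 1) (fun c => frameOp
        (fun s t => if s.filter R = t.filter R then ((p c (s.filter R) : ℝ) : ℂ) else 0)
        (fun s => setPart R s c) K) s s = ∑ c ∈ (F.filter R).powerset,
        ((p c (s.filter R) : ℝ) : ℂ) * K (setPart R s c) (setPart R s c) := by
      intro s; simp [linComb, frameOp]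
    rw [tsum_congr e, Summable.tsum_finsetSum fun c hc => (hpk c hc).summable]
    exact Finset.sum_congr rfl fun c hc => (hpk c hc).tsum_eq
  rw [htr]
  have h1 : tr K = ∑' x : {d : Finset W // ∀ w ∈ d, R w} × {u : Finset W // ∀ w ∈ u, ¬ R w},
      k x.1.1 x.2 := ((splitEquiv R).symm.tsum_eq (fun s => K s s)).symm
  have h2 : Summable fun x : {d : Finset W // ∀ w ∈ d, R w} × {u : Finset W // ∀ w ∈ u, ¬ R w} =>
      k x.1.1 x.2 := ((splitEquiv R).symm.summable_iff (f := fun s => K s s)).2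
        (FinSupp.summable_diag ⟨F, hF⟩)
  rw [h1, h2.tsum_prod' (fun d => (hk d.1).of_norm)]
  rw [tsum_eq_sum (s := ((F.filter R).powerset.attach.image
      fun c => (⟨c.1, hsub c.1 c.2⟩ : {c : Finset W // ∀ w ∈ c, R w})))]
  · rw [Finset.sum_image, ← Finset.sum_attach (F.filter R).powerset]
    intro a _ b _ hab
    exact Subtype.ext (congrArg (fun c : {c : Finset W // ∀ w ∈ c, R w} => c.1) hab)
  · rintro ⟨c, hc⟩ hn
    rw [← tsum_zero (α := ℂ) (β := {u : Finset W // ∀ w ∈ u, ¬ R w})]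
    refine tsum_congr fun u => ?_
    by_contra h0
    refine hn (Finset.mem_image.2 ⟨⟨c, ?_⟩, Finset.mem_attach .., rfl⟩)
    rw [Finset.mem_powerset]
    intro w hw
    exact Finset.mem_filter.2 ⟨(hF' _ _ h0).1 hw, hc w hw⟩

end Positivity

/-! ### States -/

section States

open scoped ComplexOrder

theorem QState.op_pos (ρ : QState) : Pos ρ.op := by
  have h : Pos (fun s t : Finset ℕ => ρ.mat (fun j => decide (j.val ∈ s))
      (fun j => decide (j.val ∈ t))) := by
    intro ι I φ x
    have h1 := ρ.posSemidef.submatrix (fun i : I => (fun j : Fin ρ.qubits =>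
      decide (j.val ∈ φ i.1)))
    have h2 := h1.dotProduct_mulVec_nonneg (fun i => x i.1)
    refine h2.trans_eq ?_
    rw [← Finset.sum_attach I]
    simp only [dotProduct, Matrix.mulVec, Finset.mul_sum]
    refine Finset.sum_congr rfl fun i _ => ?_
    rw [← Finset.sum_attach I]
    refine Finset.sum_congr rfl fun j _ => ?_
    simp only [Pi.star_apply, Matrix.submatrix_apply]
    ring
  have h' := h.frame_real (fun s => if s ⊆ Finset.range ρ.qubits then 1 else 0) (fun s => s)
  convert h' using 1
  funext s t
  by_cases h1 : s ⊆ Finset.range ρ.qubits <;> by_cases h2 : t ⊆ Finset.range ρ.qubits <;>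
    simp [QState.op, h1, h2]

theorem QState.op_supp (ρ : QState) {s t : Finset ℕ} (h : ρ.op s t ≠ 0) :
    s ⊆ Finset.range ρ.qubits ∧ t ⊆ Finset.range ρ.qubits := by
  simp only [QState.op] at h
  split_ifs at h with h1
  · exact h1
  · simp at h

theorem QState.op_finSupp (ρ : QState) : FinSupp ρ.op := ⟨_, fun _ _ h => ρ.op_supp h⟩

/-- The basis state given by a bit vector. -/
def bitsSet {q : ℕ} (b : Fin q → Bool) : Finset ℕ :=
  (Finset.univ.filter (fun j => b j = true)).map Fin.valEmbedding

theorem mem_bitsSet {q : ℕ} {b : Fin q → Bool} {j : Fin q} : j.val ∈ bitsSet b ↔ b j = true := by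
  simp [bitsSet, Fin.val_inj]

theorem bitsSet_subset {q : ℕ} (b : Fin q → Bool) : bitsSet b ⊆ Finset.range q := by
  intro k hk
  simp only [bitsSet, Finset.mem_map] at hk
  obtain ⟨j, -, rfl⟩ := hk
  simp

theorem bitsSet_injective {q : ℕ} : Function.Injective (bitsSet (q := q)) := by
  intro b b' h
  funext j
  have := mem_bitsSet (b := b) (j := j)
  rw [h, mem_bitsSet] at this
  cases h1 : b j <;> cases h2 : b' j <;> simp_all

theorem bitsSet_decide {q : ℕ} {s : Finset ℕ} (hs : s ⊆ Finset.range q) :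
    bitsSet (fun j : Fin q => decide (j.val ∈ s)) = s := by
  ext k
  constructor
  · intro hk
    have hq := Finset.mem_range.1 (bitsSet_subset _ hk)
    have := (mem_bitsSet (j := ⟨k, hq⟩)).1 hk
    simpa using this
  · intro hk
    have hq := Finset.mem_range.1 (hs hk)
    exact (mem_bitsSet (j := ⟨k, hq⟩)).2 (by simpa using hk)

theorem tr_eq_sum_bits {q : ℕ} {L : Op ℕ}
    (hL : ∀ s t, L s t ≠ 0 → s ⊆ Finset.range q ∧ t ⊆ Finset.range q) :
    tr L = ∑ b : Fin q → Bool, L (bitsSet b) (bitsSet b) := by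
  rw [tr, ← bitsSet_injective.tsum_eq (f := fun s => L s s), tsum_fintype]
  intro s hs
  exact ⟨_, bitsSet_decide (hL s s hs).1⟩

theorem QState.tr_op (ρ : QState) : tr ρ.op = 1 := by
  rw [tr_eq_sum_bits fun _ _ => ρ.op_supp, ← ρ.trace_eq_one, Matrix.trace]
  refine Finset.sum_congr rfl fun b _ => ?_
  have : (fun j : Fin ρ.qubits => decide (j.val ∈ bitsSet b)) = b := by
    funext j
    rw [Bool.eq_iff_iff, decide_eq_true_iff, mem_bitsSet]
  simp [QState.op, bitsSet_subset, this]

theorem Pos.posSemidef {L : Op ℕ} (hpos : Pos L) (q : ℕ) : Matrix.PosSemidef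
    (fun b b' : Fin q → Bool => L (bitsSet b) (bitsSet b') : Matrix _ _ ℂ) := by
  refine Matrix.PosSemidef.of_dotProduct_mulVec_nonneg ?_ ?_
  · ext b b'
    exact hpos.hermitian _ _
  · intro x
    refine (hpos _ Finset.univ bitsSet x).trans_eq ?_
    simp only [dotProduct, Matrix.mulVec, Finset.mul_sum]
    refine Finset.sum_congr rfl fun i _ => Finset.sum_congr rfl fun j _ => ?_
    simp only [Pi.star_apply]
    ring

/-- Every positive operator of trace one on the wires below `q` is a state. -/
theorem exists_qstate {L : Op ℕ} {q : ℕ}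
    (hL : ∀ s t, L s t ≠ 0 → s ⊆ Finset.range q ∧ t ⊆ Finset.range q) (hpos : Pos L)
    (htr : tr L = 1) : ∃ ρ : QState, ρ.qubits = q ∧ ρ.op = L := by
  refine ⟨⟨q, fun b b' => L (bitsSet b) (bitsSet b'), hpos.posSemidef q, ?_⟩, rfl, ?_⟩
  · rw [← htr, tr_eq_sum_bits hL]; rfl
  · funext s t
    simp only [QState.op]
    split_ifs with h
    · rw [bitsSet_decide h.1, bitsSet_decide h.2]
    · by_contra h0
      exact h (hL s t (fun h' => h0 h'.symm))

theorem QState.exists_qubits (q : ℕ) : ∃ ρ : QState, ρ.qubits = q := by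
  refine ⟨⟨q, ((2 : ℝ) ^ q)⁻¹ • 1, Matrix.PosSemidef.one.smul (by positivity), ?_⟩, rfl⟩
  rw [Matrix.trace_smul, Matrix.trace_one, Fintype.card_fun, Fintype.card_bool, Fintype.card_fin,
    Complex.real_smul]
  push_cast
  exact inv_mul_cancel₀ (by positivity)

/-- Every positive operator on the wires below `q` is a multiple of a state. -/
theorem exists_qstate_smul {L : Op ℕ} {q : ℕ}
    (hL : ∀ s t, L s t ≠ 0 → s ⊆ Finset.range q ∧ t ⊆ Finset.range q) (hpos : Pos L) :
    ∃ (p : ℝ) (ρ : QState), 0 ≤ p ∧ tr L = p ∧ ρ.qubits = q ∧ ∀ s t, L s t = p * ρ.op s t := by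
  have hF : FinSupp L := ⟨_, hL⟩
  have h0 : 0 ≤ tr L := tsum_nonneg fun s => hpos.diag_nonneg s
  have hre : ((tr L).re : ℂ) = tr L := by
    rw [Complex.le_def] at h0
    exact Complex.ext rfl h0.2
  have hp : 0 ≤ (tr L).re := (Complex.le_def.1 h0).1
  by_cases ht : tr L = 0
  · obtain ⟨ρ, hρ⟩ := QState.exists_qubits q
    refine ⟨0, ρ, le_rfl, by rw [ht, Complex.ofReal_zero], hρ, fun s t => ?_⟩
    rw [Complex.ofReal_zero, zero_mul]
    by_contra hst
    obtain ⟨h1, h2⟩ := hL s t hst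
    have h3 := (hpos.posSemidef q).trace_eq_zero_iff.1 (by rw [← ht, tr_eq_sum_bits hL]; rfl)
    have h4 := congr_fun (congr_fun h3 fun j => decide (j.val ∈ s)) fun j => decide (j.val ∈ t)
    rw [bitsSet_decide h1, bitsSet_decide h2] at h4
    exact hst h4
  · have hne : ((tr L).re : ℂ) ≠ 0 := by rw [hre]; exact ht
    obtain ⟨ρ, h1, h2⟩ := exists_qstate (L := fun s t => (((tr L).re⁻¹ : ℝ) : ℂ) * L s t) (q := q)
      (fun s t h => hL s t (right_ne_zero_of_mul h)) (hpos.smul (inv_nonneg.2 hp))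
      (by rw [tr, tsum_mul_left, ← tr, Complex.ofReal_inv, hre, inv_mul_cancel₀ ht])
    refine ⟨(tr L).re, ρ, hp, hre.symm, h1, fun s t => ?_⟩
    rw [h2, Complex.ofReal_inv, mul_inv_cancel_left₀ hne]

end States

/-! ### Values and registers -/

theorem Val.ofWires_toWires (v : Val) : Val.ofWires v.toWires = v := by
  cases v with
  | none => simp [Val.ofWires, Val.toWires]
  | some l =>
    have hsup : (Val.toWires (some l)).sup id = l.length := by
      apply le_antisymm
      · refine Finset.sup_le fun k hk => ?_
        simp only [Val.toWires, Finset.mem_insert, Finset.mem_filter, Finset.mem_range] at hk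
        rcases hk with rfl | hk
        · rfl
        · exact hk.1.le
      · exact Finset.le_sup (f := id) (by simp [Val.toWires] : l.length ∈ Val.toWires (some l))
    have hne : Val.toWires (some l) ≠ ∅ := Finset.insert_ne_empty _ _
    rw [Val.ofWires, if_neg hne, hsup]
    congr 1
    refine List.ext_getElem (by simp) fun k h1 h2 => ?_
    simp only [List.getElem_map, List.getElem_range, Val.toWires, Finset.mem_insert,
      Finset.mem_filter, Finset.mem_range]
    have : k ≠ l.length := by omega
    simp [this, h2]

theorem Val.toWires_ofWires (s : Finset ℕ) : Val.toWires (Val.ofWires s) = s := by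
  by_cases hs : s = ∅
  · simp [Val.ofWires, hs, Val.toWires]
  · obtain ⟨k0, hk0, hk1⟩ := Finset.exists_mem_eq_sup s (Finset.nonempty_iff_ne_empty.2 hs) id
    simp only [id] at hk1
    rw [Val.ofWires, if_neg hs]
    ext k
    simp only [Val.toWires, List.length_map, List.length_range, Finset.mem_insert,
      Finset.mem_filter, Finset.mem_range]
    constructor
    · rintro (rfl | ⟨h1, h2⟩)
      · have : s.sup id ∈ s := by rw [show s.sup id = k0 from hk1]; exact hk0
        exact this
      · simpa [h1] using h2
    · intro hk
      have : k ≤ s.sup id := Finset.le_sup (f := id) hk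
      rcases this.eq_or_lt with h | h
      · exact Or.inl h
      · exact Or.inr ⟨h, by simp [h, hk]⟩

theorem Val.le_length_of_mem {s : Finset ℕ} {k : ℕ} (hk : k ∈ s) : k ≤ (Val.ofWires s).length := by
  have hs : s ≠ ∅ := by rintro rfl; simp at hk
  rw [Val.ofWires, if_neg hs]
  simp only [Val.length, List.length_map, List.length_range]
  exact Finset.le_sup (f := id) hk

theorem Val.length_ofWires_le {s : Finset ℕ} {M : ℕ} (h : ∀ k ∈ s, k < M) :
    (Val.ofWires s).length ≤ M := by
  by_cases hs : s = ∅
  · simp [Val.ofWires, hs, Val.length]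
  · rw [Val.ofWires, if_neg hs]
    simp only [Val.length, List.length_map, List.length_range]
    exact Finset.sup_le fun k hk => (h k hk).le

theorem Val.lt_of_mem_toWires {v : Val} {k : ℕ} (h : k ∈ v.toWires) : k < v.length + 1 := by
  cases v with
  | none => simp [Val.toWires] at h
  | some l =>
    simp only [Val.toWires, Finset.mem_insert, Finset.mem_filter, Finset.mem_range] at h
    simp only [Val.length]
    omega

theorem mem_content {r : Reg} {s : Finset Wire} {k : ℕ} : k ∈ content r s ↔ (r, k) ∈ s := by
  simp only [content, Finset.mem_image, Finset.mem_filter]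
  constructor
  · rintro ⟨⟨r', k'⟩, ⟨h1, h2⟩, h3⟩
    dsimp only at h2 h3
    subst h2; subst h3; exact h1
  · intro h; exact ⟨(r, k), ⟨h, rfl⟩, rfl⟩

theorem mem_fill {r : Reg} {a : Finset ℕ} {w : Wire} : w ∈ fill r a ↔ w.1 = r ∧ w.2 ∈ a := by
  simp only [fill, Finset.mem_image]
  constructor
  · rintro ⟨k, hk, rfl⟩; exact ⟨rfl, hk⟩
  · rintro ⟨h1, h2⟩; exact ⟨w.2, h2, by rw [← h1]⟩

theorem content_eq_iff {r : Reg} {s t : Finset Wire} :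
    content r s = content r t ↔ s.filter (fun w => w.1 = r) = t.filter (fun w => w.1 = r) := by
  constructor
  · intro h
    ext ⟨r', k⟩
    simp only [Finset.mem_filter]
    constructor
    · rintro ⟨h1, h2⟩
      subst h2
      exact ⟨mem_content.1 (h ▸ mem_content.2 h1), rfl⟩
    · rintro ⟨h1, h2⟩
      subst h2
      exact ⟨mem_content.1 (h ▸ mem_content.2 h1), rfl⟩
  · intro h
    simp only [content, h]

/-! ### Executions -/

/-- Replaces the wires of the honest party by means of `h`. -/
def Step.mapWires {m : ℕ} (h : PWire → PWire) : Step m → Step m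
  | .send b C => .send b (C.map (Gate.map h))
  | .call i => .call i
  | .handover => .handover

theorem Step.inFrame_eq {m : ℕ} (j : ℕ) :
    (Step.inFrame j : Step m → Step m) = Step.mapWires (TwoPC.inFrame j) := by
  funext s; cases s <;> rfl

theorem activate_eq (e : PWire → Wire) (C : Circuit PWire) (K : Op Wire) :
    activate e C K =
      dephase (fun w : Wire => w.1 = Reg.msg) (Circuit.run (C.map (Gate.map e)) K) := by
  funext s t
  simp only [activate, dephase, Circuit.apply_eq_run, content_eq_iff]

/-- An ideal call with the circuits `C` and `D` of the adversary. -/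
def idealCall (g : Functionality) (lam : ℕ) (c : Bool) (C D : Circuit PWire) (K : Op Wire) :
    Op Wire :=
  deliver (activate advWire D (trusted g lam c (activate advWire C (clearChannel K))))

section Exec

variable {m : ℕ} (f : Fin m → Functionality) (lam : ℕ) (c : Bool)

/-- The circuits of the adversary that are used up depend on the steps only. -/
theorem exec_append (P Q : List (Step m)) (A : List (Circuit PWire)) (K : Op Wire) :
    exec f lam c (P ++ Q) A K = exec f lam c Q (restCode P A) (exec f lam c P A K) := by
  induction P generalizing A K with
  | nil => rfl
  | cons s P ih => cases s <;> exact ih _ _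

/-- An induction principle for executions: a property of operators that is preserved by every step
holds at the end. -/
theorem exec_induction (Ψ : Op Wire → Prop) (P : List (Step m)) (A : List (Circuit PWire))
    (hhon : ∀ b C K, Step.send b C ∈ P → b ≠ c → Ψ K → Ψ (activate honWire C K))
    (hadv : ∀ C, (C ∈ A ∨ C = []) → ∀ K, Ψ K → Ψ (activate advWire C K))
    (hcall : ∀ i, Step.call i ∈ P → (∀ K, Ψ K → Ψ (clearChannel K)) ∧
      (∀ K, Ψ K → Ψ (trusted (f i) lam c K)) ∧ ∀ K, Ψ K → Ψ (deliver K))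
    (hover : Step.handover ∈ P → ∀ K, Ψ K → Ψ (handover K)) :
    ∀ K, Ψ K → Ψ (exec f lam c P A K) := by
  have hhead : ∀ A : List (Circuit PWire), A.headD [] ∈ A ∨ A.headD [] = [] := by
    intro A; cases A <;> simp
  induction P generalizing A with
  | nil => exact fun K h => h
  | cons s P ih =>
    intro K hK
    have ih' := fun A hA => ih A (fun b C K hb => hhon b C K (by simp [hb])) hA
      (fun i hi => hcall i (by simp [hi])) (fun h => hover (by simp [h]))
    cases s with
    | send b C =>
      refine ih' _ (fun C hC => hadv C (hC.imp_left List.mem_of_mem_tail)) _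
        (hadv _ (hhead A) _ ?_)
      split_ifs with hb
      · exact hK
      · exact hhon b C K (by simp) hb hK
    | call i =>
      obtain ⟨h1, h2, h3⟩ := hcall i (by simp)
      refine ih' _ (fun C hC => hadv C (hC.imp_left
        fun h => List.mem_of_mem_tail (List.mem_of_mem_tail h))) _ (h3 _ (hadv _ ?_ _
          (h2 _ (hadv _ (hhead A) _ (h1 _ hK)))))
      exact (hhead A.tail).imp_left List.mem_of_mem_tail
    | handover => exact ih' _ hadv _ (hover (by simp) _ hK)

theorem IsFrame.congr_map {V W : Type} [DecidableEq V] [DecidableEq W] {X : Set V} {r r' : V → W}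
    {a : Finset W → Finset W → ℂ} {φ : Finset W → Finset V} (h : IsFrame X r a φ)
    (hr : ∀ x ∈ X, r x = r' x) : IsFrame X r' a φ :=
  ⟨fun x hx => by rw [← hr x hx]; exact h.mem x hx,
    fun x hx => by rw [← hr x hx]; exact h.toggle x hx,
    fun x hx => by rw [← hr x hx]; exact h.left x hx,
    fun x hx => by rw [← hr x hx]; exact h.right x hx⟩

theorem IsFrame.activate_eq {X : Set Wire} {r : Wire → Wire} {a : Finset Wire → Finset Wire → ℂ}
    {φ : Finset Wire → Finset Wire} (hT : IsFrame X r a φ)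
    (hmsg : ∀ w : Wire, w.1 = Reg.msg → w ∈ X ∧ r w = w) {Y : Set PWire} {e : PWire → Wire}
    {h : PWire → PWire} (he : ∀ w ∈ Y, e w ∈ X ∧ r (e w) = e (h w)) {C : Circuit PWire}
    (hC : C.On Y) (K : Op Wire) :
    activate e (C.map (Gate.map h)) (frameOp a φ K) = frameOp a φ (activate e C K) := by
  rw [TwoPC.activate_eq, TwoPC.activate_eq]
  have h1 : (C.map (Gate.map h)).map (Gate.map e) = (C.map (Gate.map e)).map (Gate.map r) := by
    rw [List.map_map, List.map_map]
    refine List.map_congr_left fun g hg => ?_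
    simp only [Function.comp, Gate.map_map]
    exact Gate.map_congr fun w hw => ((he w (hC g hg w hw)).2).symm
  rw [h1, hT.run (hC.map e fun w hw => (he w hw).1)]
  exact ((hT.mono (Y := {w | w.1 = Reg.msg}) (fun w hw => (hmsg w hw).1)).congr_map
    (r' := fun w => w) (fun w hw => (hmsg w hw).2)).dephase_eq (R := fun w : Wire => w.1 = Reg.msg)
      (fun w hw => hw) _

/-- Executions commute with frames that relabel the work space of the parties. -/
theorem IsFrame.exec_eq {X : Set Wire} {r : Wire → Wire} {a : Finset Wire → Finset Wire → ℂ}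
    {φ : Finset Wire → Finset Wire} (hT : IsFrame X r a φ)
    (hfix : ∀ w : Wire, w.1 = Reg.msg ∨ w.1 = Reg.honInp ∨ w.1 = Reg.honOut → w ∈ X ∧ r w = w)
    {h hA : PWire → PWire} (hhon : ∀ w, honWire w ∈ X ∧ r (honWire w) = honWire (h w))
    {Y : Set PWire} (hadv : ∀ w ∈ Y, advWire w ∈ X ∧ r (advWire w) = advWire (hA w))
    (P : List (Step m))
    (hcall : ∀ i, Step.call i ∈ P → ∀ w : Wire, w.1 = Reg.advInp ∨ w.1 = Reg.advOut →
      w ∈ X ∧ r w = w)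
    (A : List (Circuit PWire)) (hAY : ∀ C ∈ A, C.On Y) (K : Op Wire) :
    exec f lam c (P.map (Step.mapWires h)) (A.map (List.map (Gate.map hA))) (frameOp a φ K) =
      frameOp a φ (exec f lam c P A K) := by
  have htr : ∀ (R : Wire → Prop) [DecidablePred R] (p : Finset Wire → Finset Wire → ℝ)
      (_ : ∀ w, R w → w ∈ X ∧ r w = w) (K : Op Wire),
      transition R p (frameOp a φ K) = frameOp a φ (transition R p K) := fun R _ p hR K =>
    ((hT.mono (Y := {w | R w}) (fun w hw => (hR w hw).1)).congr_map (r' := fun w => w)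
      (fun w hw => (hR w hw).2)).transition_eq (fun w hw => hw) p K
  have hact : ∀ C, C.On Y → ∀ K, activate advWire (C.map (Gate.map hA)) (frameOp a φ K) =
      frameOp a φ (activate advWire C K) := fun C hC K =>
    hT.activate_eq (fun w hw => hfix w (Or.inl hw)) hadv hC K
  have hhead : ∀ A : List (Circuit PWire), (∀ C ∈ A, C.On Y) →
      (A.map (List.map (Gate.map hA))).headD [] = (A.headD []).map (Gate.map hA) ∧
        (A.headD []).On Y ∧ ∀ C ∈ A.tail, C.On Y := by
    intro A hA
    cases A with
    | nil => exact ⟨rfl, Circuit.on_nil, by simp⟩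
    | cons C A => exact ⟨rfl, hA C (by simp), fun D hD => hA D (by simp at hD; simp [hD])⟩
  induction P generalizing A K with
  | nil => rfl
  | cons s P ih =>
    have ih' := ih (fun i hi => hcall i (by simp [hi]))
    obtain ⟨h1, h2, h3⟩ := hhead A hAY
    cases s with
    | send b C =>
      simp only [List.map_cons, Step.mapWires, exec]
      rw [← List.map_tail, h1]
      have : (if b = c then frameOp a φ K
          else activate honWire (C.map (Gate.map h)) (frameOp a φ K)) =
          frameOp a φ (if b = c then K else activate honWire C K) := by
        split_ifs
        · rfl
        · exact hT.activate_eq (Y := Set.univ) (fun w hw => hfix w (Or.inl hw))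
            (fun w _ => hhon w) (fun _ _ _ _ => trivial) K
      rw [this, hact _ h2, ih' _ h3]
    | call i =>
      obtain ⟨h4, h5, h6⟩ := hhead A.tail h3
      have hc := hcall i (by simp)
      simp only [List.map_cons, Step.mapWires, exec]
      rw [← List.map_tail, ← List.map_tail, h1, h4, clearChannel,
        htr _ _ (fun w hw => hfix w (Or.inl hw)), hact _ h2, trusted, htr, hact _ h5, deliver, htr,
        ih' _ h6]
      · exact fun w hw => hfix w (hw.imp_right Or.inl)
      · rintro w (hw | hw | hw | hw)
        · exact hc w (Or.inl hw)
        · exact hc w (Or.inr hw)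
        · exact hfix w (Or.inr (Or.inl hw))
        · exact hfix w (Or.inr (Or.inr hw))
    | handover =>
      simp only [List.map_cons, Step.mapWires, exec]
      rw [handover, htr _ _ (fun w hw => hfix w hw)]
      exact ih' _ hAY _

/-! ### Wires in use during executions -/

/-- All basis states in the support have the property `Φ`. -/
def Supp {W : Type} (Φ : Finset W → Prop) (K : Op W) : Prop := ∀ s t, K s t ≠ 0 → Φ s ∧ Φ t

theorem Supp.mono {W : Type} {Φ Φ' : Finset W → Prop} {K : Op W} (h : Supp Φ K)
    (hΦ : ∀ s, Φ s → Φ' s) : Supp Φ' K := fun s t hst => ⟨hΦ s (h s t hst).1, hΦ t (h s t hst).2⟩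

theorem Supp.run {W : Type} [DecidableEq W] {Φ : Finset W → Prop} {X : Set W} {K : Op W}
    (h : Supp Φ K) (hΦ : ∀ s s', Φ s' → (∀ w ∉ X, w ∈ s' ↔ w ∈ s) → Φ s) {C : Circuit W}
    (hC : C.On X) : Supp Φ (C.run K) := by
  induction C generalizing K with
  | nil => exact h
  | cons g C ih =>
    rw [Circuit.on_cons] at hC
    refine ih (fun s t hst => ?_) hC.2
    obtain ⟨s', t', h0, h1, h2⟩ := gate_supp g K hst
    exact ⟨hΦ _ _ (h _ _ h0).1 fun w hw => h1 w fun hg => hw (hC.1 w hg),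
      hΦ _ _ (h _ _ h0).2 fun w hw => h2 w fun hg => hw (hC.1 w hg)⟩

theorem Supp.dephase {W : Type} [DecidableEq W] {Φ : Finset W → Prop} {K : Op W}
    {R : W → Prop} [DecidablePred R] (h : Supp Φ K) : Supp Φ (dephase R K) := by
  intro s t hst
  simp only [TwoPC.dephase] at hst
  split_ifs at hst
  · exact h s t hst
  · simp at hst

theorem Supp.activate {Φ : Finset Wire → Prop} {X : Set Wire} {K : Op Wire}
    (h : Supp Φ K) (hΦ : ∀ s s', Φ s' → (∀ w ∉ X, w ∈ s' ↔ w ∈ s) → Φ s) {e : PWire → Wire}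
    {C : Circuit PWire} (hC : C.On {w | e w ∈ X}) : Supp Φ (activate e C K) := by
  rw [activate_eq]
  exact (h.run hΦ (hC.map e fun w hw => hw)).dephase

theorem Supp.transition {W : Type} [DecidableEq W] {Φ Φ' : Finset W → Prop} {K : Op W}
    {R : W → Prop} [DecidablePred R] {p : Finset W → Finset W → ℝ} (h : Supp Φ K)
    (hΦ : ∀ s c, (∀ w ∈ c, R w) → p c (s.filter R) ≠ 0 → Φ (setPart R s c) → Φ' s) :
    Supp Φ' (transition R p K) := by
  intro s t hst
  obtain ⟨h1, c, hc, h2, h3⟩ := transition_supp p K hst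
  exact ⟨hΦ s c hc h2 (h _ _ h3).1, hΦ t c hc (h1 ▸ h2) (h _ _ h3).2⟩

/-- All wires in use have an index below `M`. -/
def Bdd (M : ℕ) (K : Op Wire) : Prop := Supp (fun s => ∀ w ∈ s, w.2 < M) K

theorem Bdd.mono {M M' : ℕ} {K : Op Wire} (h : Bdd M K) (hM : M ≤ M') : Bdd M' K :=
  Supp.mono h fun _ hs w hw => (hs w hw).trans_le hM

theorem Bdd.finSupp {M : ℕ} {K : Op Wire} (h : Bdd M K) : FinSupp K := by
  let rs : Finset Reg := {.advWork, .advInp, .advOut, .honWork, .honInp, .honOut, .msg, .dist}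
  have hrs : ∀ r, r ∈ rs := by intro r; cases r <;> simp [rs]
  refine ⟨rs ×ˢ Finset.range M, fun s t hst => ?_⟩
  obtain ⟨h1, h2⟩ := h s t hst
  exact ⟨fun w hw => Finset.mem_product.2 ⟨hrs _, Finset.mem_range.2 (h1 w hw)⟩,
    fun w hw => Finset.mem_product.2 ⟨hrs _, Finset.mem_range.2 (h2 w hw)⟩⟩

theorem FinSupp.exists_bdd {K : Op Wire} (h : FinSupp K) : ∃ M, Bdd M K := by
  obtain ⟨F, hF⟩ := h
  refine ⟨F.sup Prod.snd + 1, fun s t hst => ?_⟩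
  obtain ⟨h1, h2⟩ := hF s t hst
  exact ⟨fun w hw => Nat.lt_succ_of_le (Finset.le_sup (f := Prod.snd) (h1 hw)),
    fun w hw => Nat.lt_succ_of_le (Finset.le_sup (f := Prod.snd) (h2 hw))⟩

theorem Bdd.activate {M : ℕ} {K : Op Wire} (h : Bdd M K) {e : PWire → Wire}
    (he : ∀ w, (e w).2 = w.2) {C : Circuit PWire} (hC : C.On {w | w.2 < M}) :
    Bdd M (activate e C K) := by
  refine Supp.activate (X := {w | w.2 < M}) h (fun s s' h1 h2 w hw => ?_)
    (hC.mono fun w hw => by simpa [he] using hw)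
  by_cases hM : w.2 < M
  · exact hM
  · exact h1 w ((h2 w hM).2 hw)

theorem advWire_snd (w : PWire) : (advWire w).2 = w.2 := by
  obtain ⟨⟨⟩, k⟩ := w <;> rfl

theorem honWire_snd (w : PWire) : (honWire w).2 = w.2 := by
  obtain ⟨⟨⟩, k⟩ := w <;> rfl

theorem Bdd.handover {M : ℕ} {K : Op Wire} (h : Bdd M K) : Bdd M (handover K) := by
  refine Supp.transition h fun s c hc hp h1 w hw => ?_
  by_cases hR : w.1 = Reg.msg ∨ w.1 = Reg.honInp ∨ w.1 = Reg.honOut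
  · split_ifs at hp with h2
    · have : w ∈ fill .honInp (content .honOut c) := h2 ▸ Finset.mem_filter.2 ⟨hw, hR⟩
      rw [mem_fill, mem_content] at this
      have h3 := h1 (Reg.honOut, w.2) ((mem_setPart hc).2 (by simp [this.2]))
      exact h3
    · simp at hp
  · exact h1 w ((mem_setPart hc).2 (by rw [if_neg hR]; exact hw))

theorem Bdd.clearChannel {M : ℕ} {K : Op Wire} (h : Bdd M K) : Bdd M (clearChannel K) := by
  refine Supp.transition h fun s c hc hp h1 w hw => ?_
  by_cases hR : w.1 = Reg.msg
  · split_ifs at hp with h2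
    · have : w ∈ (∅ : Finset Wire) := h2 ▸ Finset.mem_filter.2 ⟨hw, hR⟩
      simp at this
    · simp at hp
  · exact h1 w ((mem_setPart hc).2 (by rw [if_neg hR]; exact hw))

theorem Bdd.deliver {M : ℕ} {K : Op Wire} (h : Bdd M K) : Bdd M (deliver K) := by
  refine Supp.transition h fun s c hc hp h1 w hw => ?_
  by_cases hR : w.1 = Reg.msg ∨ w.1 = Reg.honInp
  · have hws : w ∈ s.filter (fun w => w.1 = Reg.msg ∨ w.1 = Reg.honInp) :=
      Finset.mem_filter.2 ⟨hw, hR⟩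
    rw [ite_ne_right_iff] at hp
    rw [hp.1] at hws
    split_ifs at hws
    · exact h1 w ((mem_setPart hc).2 (by rw [if_pos hR]; exact hws))
    · simp at hws
  · exact h1 w ((mem_setPart hc).2 (by rw [if_neg hR]; exact hw))

/-- The values that the trusted party writes have bounded length. -/
theorem trusted_length {g : Functionality} {q : Polynomial ℕ}
    (hq : ∀ lam x, ∀ y ∈ (g.eval lam x).support, ∀ b,
      (y b).length ≤ q.eval (lam + (x false).length + (x true).length))
    {M : ℕ} {a d : Finset Wire} (ha : ∀ w ∈ a, w.1 = Reg.advOut ∨ w.1 = Reg.honOut → w.2 < M)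
    (hd : (if content .advOut d = ∅ ∧ content .honOut d = ∅ then
        (g.eval lam
          (fun b => Val.ofWires (content (if b = c then .advOut else .honOut) a))
          (fun b => Val.ofWires (content (if b = c then .advInp else .honInp) d))).toReal
      else 0) ≠ 0) :
    content .advOut d = ∅ ∧ content .honOut d = ∅ ∧
      ∀ w ∈ d, w.1 = Reg.advInp ∨ w.1 = Reg.honInp → w.2 ≤ q.eval (lam + 2 * M) := by
  split_ifs at hd with h
  · refine ⟨h.1, h.2, ?_⟩
    have hsupp := (PMF.mem_support_iff (p := g.eval lam
      (fun b => Val.ofWires (content (if b = c then .advOut else .honOut) a)))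
      (fun b => Val.ofWires (content (if b = c then .advInp else .honInp) d))).2
        (fun h0 => hd (by rw [h0]; rfl))
    have hlen : ∀ b, (Val.ofWires (content (if b = c then Reg.advOut else .honOut) a)).length
        ≤ M := by
      intro b
      refine Val.length_ofWires_le fun k hk => ?_
      rw [mem_content] at hk
      exact ha _ hk (by split_ifs <;> simp)
    have key : ∀ b, (Val.ofWires (content (if b = c then Reg.advInp else .honInp) d)).length ≤
        q.eval (lam + 2 * M) := by
      intro b
      refine (hq _ _ _ hsupp b).trans (poly_mono q ?_)
      have := hlen false
      have := hlen true
      omega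
    rintro ⟨r, k⟩ hw (rfl | rfl)
    · have := key c
      simp only [if_true] at this
      exact (Val.le_length_of_mem (mem_content.2 hw)).trans this
    · have := key (!c)
      have hne : (!c) ≠ c := by cases c <;> simp
      simp only [hne, if_false] at this
      exact (Val.le_length_of_mem (mem_content.2 hw)).trans this
  · simp at hd

/-- The result of a call to the trusted party is bounded in terms of the inputs only. -/
theorem Bdd.trusted {M M' : ℕ} {K : Op Wire} (h : Bdd M' K)
    (hs : Supp (fun s => ∀ w ∈ s, w.1 = Reg.advOut ∨ w.1 = Reg.honOut → w.2 < M) K)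
    {g : Functionality} {q : Polynomial ℕ} (hq : ∀ lam x, ∀ y ∈ (g.eval lam x).support, ∀ b,
      (y b).length ≤ q.eval (lam + (x false).length + (x true).length))
    (hM' : q.eval (lam + 2 * M) < M') : Bdd M' (trusted g lam c K) := by
  have h' : Supp (fun s => (∀ w ∈ s, w.2 < M') ∧
      ∀ w ∈ s, w.1 = Reg.advOut ∨ w.1 = Reg.honOut → w.2 < M) K := fun s t hst =>
    ⟨⟨(h s t hst).1, (hs s t hst).1⟩, ⟨(h s t hst).2, (hs s t hst).2⟩⟩
  refine Supp.transition h' fun s a ha hp h1 w hw => ?_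
  by_cases hR : w.1 = Reg.advInp ∨ w.1 = Reg.advOut ∨ w.1 = Reg.honInp ∨ w.1 = Reg.honOut
  · obtain ⟨h2, h3, h4⟩ := trusted_length lam c hq (M := M) (fun w hw hr =>
      h1.2 w ((mem_setPart ha).2 (by rw [if_pos (ha w hw)]; exact hw)) hr) hp
    have hwd : w ∈ s.filter (fun w => w.1 = .advInp ∨ w.1 = .advOut ∨ w.1 = .honInp ∨
        w.1 = .honOut) := Finset.mem_filter.2 ⟨hw, hR⟩
    obtain ⟨r, k⟩ := w
    rcases hR with hr | hr | hr | hr <;> dsimp only at hr <;> subst hr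
    · exact (h4 _ hwd (Or.inl rfl)).trans_lt hM'
    · have := mem_content.2 hwd; rw [h2] at this; simp at this
    · exact (h4 _ hwd (Or.inr rfl)).trans_lt hM'
    · have := mem_content.2 hwd; rw [h3] at this; simp at this
  · exact h1.1 w ((mem_setPart ha).2 (by rw [if_neg hR]; exact hw))

theorem FinSupp.activate {K : Op Wire} (h : FinSupp K) (e : PWire → Wire) (C : Circuit PWire) :
    FinSupp (activate e C K) := by
  rw [activate_eq]; exact (h.run _).dephase

theorem FinSupp.handover {K : Op Wire} (h : FinSupp K) : FinSupp (handover K) := by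
  obtain ⟨M, hM⟩ := h.exists_bdd
  exact hM.handover.finSupp

theorem FinSupp.clearChannel {K : Op Wire} (h : FinSupp K) : FinSupp (clearChannel K) := by
  obtain ⟨M, hM⟩ := h.exists_bdd
  exact hM.clearChannel.finSupp

theorem FinSupp.deliver {K : Op Wire} (h : FinSupp K) : FinSupp (deliver K) := by
  obtain ⟨M, hM⟩ := h.exists_bdd
  exact hM.deliver.finSupp

theorem FinSupp.trusted {K : Op Wire} (h : FinSupp K) (g : Functionality) :
    FinSupp (trusted g lam c K) := by
  obtain ⟨M, hM⟩ := h.exists_bdd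
  obtain ⟨q, hq⟩ := g.poly_length
  exact ((hM.mono (M' := M + q.eval (lam + 2 * M) + 1) (by omega)).trusted (M := M) lam c
    (Supp.mono hM fun _ h w hw _ => h w hw) hq (by omega)).finSupp

theorem FinSupp.exec {K : Op Wire} (h : FinSupp K) (P : List (Step m)) (A : List (Circuit PWire)) :
    FinSupp (exec f lam c P A K) :=
  exec_induction f lam c FinSupp P A (fun _ C _ _ _ h => h.activate _ C)
    (fun C _ _ h => h.activate _ C)
    (fun _ _ => ⟨fun _ h => h.clearChannel, fun _ h => h.trusted lam c _, fun _ h => h.deliver⟩)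
    (fun _ _ h => h.handover) K h

theorem activate_linComb {ι : Type} (e : PWire → Wire) (C : Circuit PWire) (I : Finset ι)
    (z : ι → ℂ) (K : ι → Op Wire) :
    activate e C (linComb I z K) = linComb I z (fun i => activate e C (K i)) := by
  simp only [activate_eq, run_linComb, dephase_linComb]

theorem clearChannel_linComb {ι : Type} (I : Finset ι) (z : ι → ℂ) (K : ι → Op Wire)
    (hK : ∀ i, FinSupp (K i)) :
    clearChannel (linComb I z K) = linComb I z (fun i => clearChannel (K i)) :=
  transition_linComb _ fun i _ => hK i

theorem handover_linComb {ι : Type} (I : Finset ι) (z : ι → ℂ) (K : ι → Op Wire)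
    (hK : ∀ i, FinSupp (K i)) :
    handover (linComb I z K) = linComb I z (fun i => handover (K i)) :=
  transition_linComb _ fun i _ => hK i

theorem deliver_linComb {ι : Type} (I : Finset ι) (z : ι → ℂ) (K : ι → Op Wire)
    (hK : ∀ i, FinSupp (K i)) :
    deliver (linComb I z K) = linComb I z (fun i => deliver (K i)) :=
  transition_linComb _ fun i _ => hK i

theorem trusted_linComb {ι : Type} (g : Functionality) (I : Finset ι) (z : ι → ℂ)
    (K : ι → Op Wire) (hK : ∀ i, FinSupp (K i)) :
    trusted g lam c (linComb I z K) = linComb I z (fun i => trusted g lam c (K i)) :=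
  transition_linComb _ fun i _ => hK i

/-- Executions are linear in the initial state. -/
theorem exec_linComb {ι : Type} (P : List (Step m)) (A : List (Circuit PWire)) (I : Finset ι)
    (z : ι → ℂ) (K : ι → Op Wire) (hK : ∀ i, FinSupp (K i)) :
    exec f lam c P A (linComb I z K) = linComb I z (fun i => exec f lam c P A (K i)) := by
  induction P generalizing A K with
  | nil => rfl
  | cons s P ih =>
    cases s with
    | send b C =>
      simp only [exec]
      split_ifs with hb
      · rw [activate_linComb, ih _ _ fun i => (hK i).activate _ _]
      · rw [activate_linComb, activate_linComb,
          ih _ _ fun i => ((hK i).activate _ _).activate _ _]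
    | call i =>
      simp only [exec]
      have h1 := fun j => (hK j).clearChannel.activate advWire (A.headD [])
      have h2 := fun j => ((h1 j).trusted lam c (f i)).activate advWire (A.tail.headD [])
      rw [clearChannel_linComb _ _ _ hK, activate_linComb, trusted_linComb _ _ _ _ _ _ h1,
        activate_linComb, deliver_linComb _ _ _ h2]
      exact ih _ _ fun i => (h2 i).deliver
    | handover =>
      simp only [exec]
      rw [handover_linComb _ _ _ hK]
      exact ih _ _ fun i => (hK i).handover

end Exec

/-! ### Embeddings of registers -/

section Embed

variable {U V W : Type}

/-- The wires of `s` outside the range of `r`. -/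
def outer (r : V ↪ W) (s : Finset W) : Finset W :=
  open Classical in s.filter (fun w => w ∉ Set.range r)

theorem mem_outer {r : V ↪ W} {s : Finset W} {w : W} : w ∈ outer r s ↔ w ∈ s ∧ ∀ v, r v ≠ w := by
  simp [outer]

/-- The part of `s` in the range of `r`. -/
def inner (r : V ↪ W) (s : Finset W) : Finset V := s.preimage r r.injective.injOn

theorem mem_inner {r : V ↪ W} {s : Finset W} {v : V} : v ∈ inner r s ↔ r v ∈ s := by
  simp [inner]

theorem tr_linComb {ι : Type} {I : Finset ι} (z : ι → ℂ) {K : ι → Op W}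
    (hK : ∀ i ∈ I, FinSupp (K i)) : tr (linComb I z K) = ∑ i ∈ I, z i * tr (K i) := by
  simp only [tr, ← tsum_mul_left]
  rw [← Summable.tsum_finsetSum fun i hi => (hK i hi).summable fun s h => by simp [h]]
  rfl

variable [DecidableEq W]

/-- The basis state that is `u` on the range of `r` and `h` elsewhere. -/
def join (r : V ↪ W) (h : Finset W) (u : Finset V) : Finset W := u.map r ∪ h

/-- The wires of `K` are embedded by `r`; the other wires are in the basis state `h`. -/
def embed (r : V ↪ W) (h : Finset W) (K : Op V) : Op W := fun s t =>
  if outer r s = h ∧ outer r t = h then K (inner r s) (inner r t) else 0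

theorem inner_join {r : V ↪ W} {h : Finset W} (hh : ∀ w ∈ h, ∀ v, r v ≠ w) (u : Finset V) :
    inner r (join r h u) = u := by
  ext v
  simp only [mem_inner, join, Finset.mem_union, Finset.mem_map']
  exact ⟨fun hv => hv.elim id fun hv => absurd rfl (hh _ hv v), Or.inl⟩

theorem outer_join {r : V ↪ W} {h : Finset W} (hh : ∀ w ∈ h, ∀ v, r v ≠ w) (u : Finset V) :
    outer r (join r h u) = h := by
  ext w
  simp only [mem_outer, join, Finset.mem_union, Finset.mem_map]
  constructor
  · rintro ⟨⟨v, -, hv⟩ | hw, h2⟩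
    · exact absurd hv (h2 v)
    · exact hw
  · exact fun hw => ⟨Or.inr hw, hh w hw⟩

theorem join_outer_inner (r : V ↪ W) (s : Finset W) : join r (outer r s) (inner r s) = s := by
  ext w
  simp only [join, Finset.mem_union, Finset.mem_map, mem_inner, mem_outer]
  constructor
  · rintro (⟨v, hv, rfl⟩ | hw)
    · exact hv
    · exact hw.1
  · intro hw
    by_cases h : ∃ v, r v = w
    · obtain ⟨v, rfl⟩ := h
      exact Or.inl ⟨v, hw, rfl⟩
    · push Not at h
      exact Or.inr ⟨hw, h⟩

theorem embed_join {r : V ↪ W} {h : Finset W} (hh : ∀ w ∈ h, ∀ v, r v ≠ w) (K : Op V)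
    (u v : Finset V) : embed r h K (join r h u) (join r h v) = K u v := by
  simp only [embed, outer_join hh, inner_join hh, and_self, if_true]

/-- An operator is an embedded one if its entries are as they should be. -/
theorem eq_embed {r : V ↪ W} {h : Finset W} {K : Op V} {L : Op W}
    (h1 : ∀ u v, L (join r h u) (join r h v) = K u v)
    (h2 : ∀ s t, L s t ≠ 0 → outer r s = h ∧ outer r t = h) : L = embed r h K := by
  funext s t
  simp only [embed]
  split_ifs with hst
  · rw [← h1, ← hst.1, join_outer_inner, hst.1, ← hst.2, join_outer_inner]
  · exact not_not.1 fun h0 => hst (h2 s t h0)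

theorem isFrame_embed [DecidableEq V] (r : V ↪ W) (h : Finset W) : IsFrame Set.univ r
    (fun s t => if outer r s = h ∧ outer r t = h then (1 : ℂ) else 0) (inner r) := by
  have key : ∀ x s, outer r (toggle (r x) s) = outer r s := by
    intro x s
    ext w
    simp only [mem_outer, mem_toggle]
    constructor
    · rintro ⟨h1, h2⟩; exact ⟨h1.2 (h2 x).symm, h2⟩
    · rintro ⟨h1, h2⟩; exact ⟨⟨fun _ => (h2 x).symm, fun _ => h1⟩, h2⟩
  refine ⟨fun x _ s => mem_inner, fun x _ s => ?_, fun x _ s t => by simp only [key],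
    fun x _ s t => by simp only [key]⟩
  ext v
  simp only [mem_inner, mem_toggle, ne_eq, r.injective.eq_iff]

theorem embed_eq_frameOp (r : V ↪ W) (h : Finset W) (K : Op V) : embed r h K =
    frameOp (fun s t => if outer r s = h ∧ outer r t = h then (1 : ℂ) else 0) (inner r) K := by
  funext s t
  simp [embed, frameOp]

theorem run_embed [DecidableEq V] (r : V ↪ W) (h : Finset W) (K : Op V) (C : Circuit V) :
    Circuit.run (C.map (Gate.map r) : Circuit W) (embed r h K) = embed r h (C.run K) := by
  rw [embed_eq_frameOp, embed_eq_frameOp]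
  exact (isFrame_embed r h).run (fun _ _ _ _ => trivial) K

theorem embed_embed [DecidableEq V] (r : V ↪ W) (h : Finset W) (hh : ∀ w ∈ h, ∀ v, r v ≠ w)
    (r' : U ↪ V) (h' : Finset V) (K : Op U) :
    embed r h (embed r' h' K) = embed (r'.trans r) (h ∪ h'.map r) K := by
  have key : ∀ s, (outer r s = h ∧ outer r' (inner r s) = h') ↔
      outer (r'.trans r) s = h ∪ h'.map r := by
    intro s
    have e : outer (r'.trans r) s = outer r s ∪ (outer r' (inner r s)).map r := by
      ext w
      simp only [mem_outer, Finset.mem_union, Finset.mem_map, mem_inner, Function.Embedding.trans_apply]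
      constructor
      · rintro ⟨h1, h2⟩
        by_cases hw : ∃ v, r v = w
        · obtain ⟨v, rfl⟩ := hw
          exact Or.inr ⟨v, ⟨h1, fun u e => h2 u (by rw [e])⟩, rfl⟩
        · push Not at hw; exact Or.inl ⟨h1, hw⟩
      · rintro (⟨h1, h2⟩ | ⟨v, ⟨h1, h2⟩, rfl⟩)
        · exact ⟨h1, fun u => h2 _⟩
        · exact ⟨h1, fun u e => h2 u (r.injective e)⟩
    constructor
    · rintro ⟨h1, h2⟩; rw [e, h1, h2]
    · intro h1
      rw [e] at h1
      have h2 : ∀ w, (w ∈ outer r s ∨ w ∈ (outer r' (inner r s)).map r) ↔ (w ∈ h ∨ w ∈ h'.map r) :=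
        fun w => by rw [← Finset.mem_union, ← Finset.mem_union, h1]
      constructor
      · ext w
        have := h2 w
        simp only [mem_outer, Finset.mem_map, mem_inner] at this ⊢
        constructor
        · intro hw
          rcases this.1 (Or.inl hw) with h | ⟨v, -, rfl⟩
          · exact h
          · exact absurd rfl (hw.2 v)
        · intro hw
          rcases this.2 (Or.inl hw) with h | ⟨v, -, rfl⟩
          · exact h
          · exact absurd rfl (hh _ hw v)
      · ext v
        have := h2 (r v)
        simp only [Finset.mem_map'] at this
        constructor
        · intro hv
          rcases this.1 (Or.inr hv) with h | h
          · exact absurd rfl (hh _ h v)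
          · exact h
        · intro hv
          rcases this.2 (Or.inr hv) with h | h
          · exact absurd rfl ((mem_outer.1 h).2 v)
          · exact h
  have e : ∀ s, inner r' (inner r s) = inner (r'.trans r) s := by
    intro s; ext u; simp [mem_inner]
  funext s t
  simp only [embed, ← key, e]
  split_ifs <;> first | rfl | (exfalso; tauto)

theorem Pos.embed {K : Op V} (hK : Pos K) (r : V ↪ W) (h : Finset W) : Pos (embed r h K) := by
  classical
  have := hK.frame_real (fun s : Finset W => if outer r s = h then 1 else 0) (inner r)
  convert this using 1
  funext s t
  simp only [TwoPC.embed]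
  by_cases h1 : outer r s = h <;> by_cases h2 : outer r t = h <;> simp [h1, h2]

theorem Supp.embed {Φ : Finset V → Prop} {K : Op V} (hK : Supp Φ K) (r : V ↪ W) (h : Finset W) :
    Supp (fun s => outer r s = h ∧ Φ (inner r s)) (TwoPC.embed r h K) := by
  intro s t hst
  simp only [TwoPC.embed] at hst
  split_ifs at hst with h1
  · exact ⟨⟨h1.1, (hK _ _ hst).1⟩, ⟨h1.2, (hK _ _ hst).2⟩⟩
  · simp at hst

theorem FinSupp.embed {K : Op V} (hK : FinSupp K) (r : V ↪ W) (h : Finset W) :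
    FinSupp (embed r h K) := by
  obtain ⟨F, hF⟩ := hK
  have key : ∀ s : Finset W, outer r s = h → inner r s ⊆ F → s ⊆ join r h F := by
    intro s h1 h2
    rw [← join_outer_inner r s, h1]
    exact Finset.union_subset_union (Finset.map_subset_map.2 h2) subset_rfl
  refine ⟨join r h F, fun s t hst => ?_⟩
  obtain ⟨h1, h2⟩ := Supp.embed (Φ := fun s => s ⊆ F) hF r h s t hst
  exact ⟨key s h1.1 h1.2, key t h2.1 h2.2⟩

theorem tsum_embed {r : V ↪ W} {h : Finset W} (hh : ∀ w ∈ h, ∀ v, r v ≠ w) {K : Op V} {E : Type}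
    [AddCommMonoid E] [TopologicalSpace E] (f : Finset W → ℂ → E)
    (hf : ∀ s, f s 0 = 0) :
    ∑' s, f s (embed r h K s s) = ∑' u, f (join r h u) (K u u) := by
  have hinj : Function.Injective (join r h) := fun u v e => by
    rw [← inner_join hh u, e, inner_join hh]
  rw [← hinj.tsum_eq (f := fun s => f s (embed r h K s s))]
  · exact tsum_congr fun u => by rw [embed_join hh]
  · intro s hs
    by_cases h1 : outer r s = h
    · exact ⟨inner r s, by rw [← h1, join_outer_inner]⟩
    · exact absurd (by simp only [embed, h1, false_and, if_false, hf]) hs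

theorem tr_embed {r : V ↪ W} {h : Finset W} (hh : ∀ w ∈ h, ∀ v, r v ≠ w) (K : Op V) :
    tr (embed r h K) = tr K := tsum_embed hh (fun _ z => z) fun _ => rfl

/-- The part of `K` in which the wires outside the range of `r` are in the basis state `h`. -/
def compress (r : V ↪ W) (h : Finset W) (K : Op W) : Op V := fun u v => K (join r h u) (join r h v)

theorem Pos.compress {K : Op W} (hK : Pos K) (r : V ↪ W) (h : Finset W) : Pos (compress r h K) :=
  hK.reindex (join r h)

/-- An operator that is diagonal outside the range of `r` is a sum of embedded operators. -/
theorem eq_linComb_embed (r : V ↪ W) {K : Op W} {F : Finset W}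
    (hF : ∀ s t, K s t ≠ 0 → s ⊆ F ∧ t ⊆ F) (hK : ∀ s t, K s t ≠ 0 → outer r s = outer r t) :
    K = linComb (outer r F).powerset (fun _ => 1) (fun h => embed r h (compress r h K)) := by
  funext s t
  simp only [linComb, one_mul]
  by_cases h0 : K s t = 0
  · rw [h0, Finset.sum_eq_zero]
    intro h _
    simp only [embed, compress]
    split_ifs with h1
    · nth_rewrite 1 [← h1.1]
      rw [← h1.2, join_outer_inner, join_outer_inner, h0]
    · rfl
  · rw [Finset.sum_eq_single (outer r s)]
    · simp only [embed, compress]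
      rw [if_pos ⟨trivial, (hK s t h0).symm⟩, join_outer_inner, hK s t h0, join_outer_inner]
    · intro h _ hne
      simp only [embed]
      exact if_neg fun h1 => hne h1.1.symm
    · intro hn
      refine absurd (Finset.mem_powerset.2 fun w hw => ?_) hn
      rw [mem_outer] at hw ⊢
      exact ⟨(hF s t h0).1 hw.1, hw.2⟩

/-! ### Probabilities of outcomes -/

/-- The probability that the wire `w` is measured as `1`. -/
def weight (w : W) (K : Op W) : ℝ := ∑' s : Finset W, if w ∈ s then (K s s).re else 0

theorem weight_embed [DecidableEq V] {r : V ↪ W} {h : Finset W} (hh : ∀ w ∈ h, ∀ v, r v ≠ w)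
    (K : Op V) (v : V) :
    weight (r v) (embed r h K) = weight v K := by
  rw [weight, tsum_embed hh (fun s z => if r v ∈ s then z.re else 0) fun s => by simp]
  refine tsum_congr fun u => ?_
  have : r v ∈ join r h u ↔ v ∈ u := by rw [← mem_inner, inner_join hh]
  simp only [this]

theorem weight_linComb {ι : Type} (w : W) {I : Finset ι} (z : ι → ℝ) {K : ι → Op W}
    (hK : ∀ i ∈ I, FinSupp (K i)) :
    weight w (linComb I (fun i => (z i : ℂ)) K) = ∑ i ∈ I, z i * weight w (K i) := by
  simp only [weight, ← tsum_mul_left]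
  rw [← Summable.tsum_finsetSum fun i hi => (hK i hi).summable fun s h => by simp [h]]
  refine tsum_congr fun s => ?_
  simp only [linComb, Complex.re_sum, Complex.re_ofReal_mul]
  split_ifs <;> simp

end Embed

/-! ### Distinguishers -/

theorem acceptProb_eq (D : Circuit DWire) (σ : QState) (K : Op Wire) : acceptProb D σ K =
    weight ((Reg.dist, 0) : Wire) (Circuit.run (D.map (Gate.map distWire)) (adjoin σ K)) := by
  simp only [acceptProb, weight, Circuit.apply_eq_run]

theorem content_toggle {r : Reg} {w : Wire} (hw : w.1 ≠ r) (s : Finset Wire) :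
    content r (toggle w s) = content r s := by
  ext k
  simp only [mem_content, mem_toggle]
  have : (r, k) ≠ w := fun e => hw (by rw [← e])
  simp [this]

theorem isFrame_adjoin (σ : QState) : IsFrame {w : Wire | w.1 ≠ Reg.dist} (fun w => w)
    (fun s t => σ.op (content .dist s) (content .dist t))
    (fun s : Finset Wire => s.filter (fun w => w.1 ≠ Reg.dist)) := by
  refine ⟨fun x hx s => by simp only [Finset.mem_filter]; exact and_iff_left hx, fun x hx s => ?_,
    fun x hx s t => by rw [content_toggle hx], fun x hx s t => by rw [content_toggle hx]⟩
  ext w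
  simp only [Finset.mem_filter, mem_toggle]
  by_cases hwx : w = x
  · subst hwx
    have : w.1 ≠ Reg.dist := hx
    simp [this]
  · simp [hwx]

theorem Step.map_mapWires_id {m : ℕ} (P : List (Step m)) : P.map (Step.mapWires fun w => w) = P := by
  conv_rhs => rw [← List.map_id P]
  refine List.map_congr_left fun s _ => ?_
  cases s with
  | send b C =>
    simp only [Step.mapWires, List.map_congr_left fun g (_ : g ∈ C) => Gate.map_id g]
    simp
  | call i => rfl
  | handover => rfl

theorem Circuit.map_map_id (A : List (Circuit PWire)) :
    A.map (List.map (Gate.map fun w => w)) = A := by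
  conv_rhs => rw [← List.map_id A]
  refine List.map_congr_left fun C _ => ?_
  rw [List.map_congr_left fun g (_ : g ∈ C) => Gate.map_id g]
  simp

theorem exec_adjoin {m : ℕ} (f : Fin m → Functionality) (lam : ℕ) (c : Bool) (σ : QState)
    (P : List (Step m)) (A : List (Circuit PWire)) (K : Op Wire) :
    exec f lam c P A (adjoin σ K) = adjoin σ (exec f lam c P A K) := by
  have h := (isFrame_adjoin σ).exec_eq f lam c (h := fun w => w) (hA := fun w => w)
    (Y := Set.univ) (fun w hw => ⟨by rcases hw with h | h | h <;> simp [h], rfl⟩)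
    (fun w => ⟨by obtain ⟨⟨⟩, k⟩ := w <;> simp [honWire], rfl⟩)
    (fun w _ => ⟨by obtain ⟨⟨⟩, k⟩ := w <;> simp [advWire], rfl⟩) P
    (fun i _ w hw => ⟨by rcases hw with h | h <;> simp [h], rfl⟩) A (fun _ _ _ _ _ _ => trivial) K
  rwa [Step.map_mapWires_id, Circuit.map_map_id] at h

theorem run_adjoin (σ : QState) {C : Circuit Wire} (hC : C.On {w | w.1 ≠ Reg.dist})
    (K : Op Wire) : C.run (adjoin σ K) = adjoin σ (C.run K) :=
  (isFrame_adjoin σ).run_same hC K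

theorem Bdd.adjoin {M : ℕ} {K : Op Wire} (hK : Bdd M K) {σ : QState} (hσ : σ.qubits ≤ M) :
    Bdd M (adjoin σ K) := by
  intro s t hst
  have h1 := σ.op_supp (left_ne_zero_of_mul hst)
  have h2 := hK _ _ (right_ne_zero_of_mul hst)
  have key : ∀ s : Finset Wire, content .dist s ⊆ Finset.range σ.qubits →
      (∀ w ∈ s.filter (fun w => w.1 ≠ Reg.dist), w.2 < M) → ∀ w ∈ s, w.2 < M := by
    intro s h1 h2 w hw
    by_cases hd : w.1 = Reg.dist
    · have := h1 (mem_content.2 (by rw [← hd]; exact hw))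
      exact (Finset.mem_range.1 this).trans_le hσ
    · exact h2 w (Finset.mem_filter.2 ⟨hw, hd⟩)
  exact ⟨key s h1.1 h2.1, key t h1.2 h2.2⟩

theorem FinSupp.adjoin {K : Op Wire} (hK : FinSupp K) (σ : QState) : FinSupp (adjoin σ K) := by
  obtain ⟨M, hM⟩ := hK.exists_bdd
  exact ((hM.mono (Nat.le_add_right M σ.qubits)).adjoin (Nat.le_add_left ..)).finSupp

theorem adjoin_linComb {ι : Type} (σ : QState) (I : Finset ι) (z : ι → ℂ) (K : ι → Op Wire) :
    adjoin σ (linComb I z K) = linComb I z (fun i => adjoin σ (K i)) := by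
  funext s t
  simp only [adjoin, linComb, Finset.mul_sum]
  exact Finset.sum_congr rfl fun i _ => by ring

/-! ### Classical steps as circuits -/

section Unit

variable {W : Type} [DecidableEq W]

/-- The matrix unit at `(u, v)`. -/
def matrixUnit (u v : Finset W) : Op W := fun s t => if s = u ∧ t = v then 1 else 0

theorem eq_linComb_unit {K : Op W} {F : Finset W} (hF : ∀ s t, K s t ≠ 0 → s ⊆ F ∧ t ⊆ F) :
    K = linComb ((F.powerset ×ˢ F.powerset).filter fun y => K y.1 y.2 ≠ 0)
      (fun y => K y.1 y.2) (fun y => matrixUnit y.1 y.2) := by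
  funext s t
  simp only [linComb, matrixUnit]
  by_cases h : K s t = 0
  · rw [h, Finset.sum_eq_zero]
    rintro ⟨u, v⟩ -
    split_ifs with hst
    · rw [← hst.1, ← hst.2, h, zero_mul]
    · exact mul_zero _
  · rw [Finset.sum_eq_single (s, t)]
    · simp
    · rintro ⟨u, v⟩ - hne
      rw [if_neg, mul_zero]
      rintro ⟨rfl, rfl⟩
      exact hne rfl
    · intro hn
      refine absurd (Finset.mem_filter.2 ⟨Finset.mem_product.2 ⟨?_, ?_⟩, h⟩) hn
      · exact Finset.mem_powerset.2 (hF s t h).1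
      · exact Finset.mem_powerset.2 (hF s t h).2

theorem finSupp_unit (u v : Finset W) : FinSupp (matrixUnit u v) := by
  refine ⟨u ∪ v, fun s t h => ?_⟩
  simp only [matrixUnit, ne_eq, ite_eq_right_iff, one_ne_zero, imp_false, not_not] at h
  rw [h.1, h.2]
  exact ⟨Finset.subset_union_left, Finset.subset_union_right⟩

theorem cnot_unit {a b : W} (hab : a ≠ b) (u v : Finset W) :
    (Gate.cnot a b).apply (matrixUnit u v) =
      matrixUnit (if a ∈ u then toggle b u else u) (if a ∈ v then toggle b v else v) := by
  have h : ∀ s u : Finset W, (if a ∈ s ∧ a ≠ b then toggle b s else s) = u ↔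
      s = if a ∈ u then toggle b u else u := by
    intro s u
    have ha : ∀ s : Finset W, a ∈ toggle b s ↔ a ∈ s := fun s => by
      rw [mem_toggle]; tauto
    simp only [ne_eq, hab, not_false_eq_true, and_true]
    constructor
    · rintro rfl
      split_ifs with h1 <;> simp_all [toggle_toggle]
    · rintro rfl
      split_ifs with h1 <;> simp_all [toggle_toggle]
  funext s t
  simp only [Gate.apply, matrixUnit, h]

theorem reset_unit (w : W) (u v : Finset W) : (Gate.reset w).apply (matrixUnit u v) =
    if (w ∈ u ↔ w ∈ v) then matrixUnit (u.erase w) (v.erase w) else 0 := by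
  have e2 : ∀ s u : Finset W, w ∉ s → w ∈ u → (s = u.erase w ↔ insert w s = u) := by
    intro s u h1 h2
    constructor
    · rintro rfl; exact Finset.insert_erase h2
    · rintro rfl; exact (Finset.erase_insert h1).symm
  have e3 : ∀ s u : Finset W, w ∉ s → w ∈ u → s ≠ u := by rintro s u h1 h2 rfl; exact h1 h2
  have e4 : ∀ s u : Finset W, w ∉ u → insert w s ≠ u := by
    rintro s u h1 rfl; exact h1 (Finset.mem_insert_self ..)
  funext s t
  simp only [Gate.apply]
  by_cases hs : w ∈ s ∨ w ∈ t
  · rw [if_pos hs]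
    split_ifs
    · simp only [matrixUnit]
      rw [if_neg]
      rintro ⟨rfl, rfl⟩
      simp at hs
    · rfl
  · rw [if_neg hs]
    push Not at hs
    by_cases hu : w ∈ u <;> by_cases hv : w ∈ v
    · simp [matrixUnit, hu, hv, e2 s u hs.1 hu, e2 t v hs.2 hv, e3 s u hs.1 hu]
    · simp [matrixUnit, hu, hv, e3 s u hs.1 hu, e4 t v hv]
    · simp [matrixUnit, hu, hv, e3 t v hs.2 hv, e4 s u hu]
    · simp [matrixUnit, hu, hv, e4 s u hu]

variable {R : W → Prop} [DecidablePred R]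

theorem setPart_eq_iff {s u c : Finset W} (hc : ∀ w ∈ c, R w) :
    setPart R s c = u ↔ c = u.filter R ∧ s = setPart R u (s.filter R) := by
  have hs : ∀ w ∈ s.filter R, R w := fun w hw => (Finset.mem_filter.1 hw).2
  constructor
  · rintro rfl
    constructor
    · ext w
      rw [Finset.mem_filter, mem_setPart hc]
      by_cases h : R w
      · simp [h]
      · simp only [h, if_false, and_false, iff_false]; exact fun hw => h (hc w hw)
    · ext w
      rw [mem_setPart hs, Finset.mem_filter, mem_setPart hc]
      by_cases h : R w <;> simp [h]
  · rintro ⟨rfl, h⟩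
    ext w
    rw [mem_setPart hc, Finset.mem_filter]
    by_cases hw : R w
    · simp [hw]
    · rw [if_neg hw, h, mem_setPart hs, if_neg hw]

/-- A transition that replaces the measured value by a function of it. -/
theorem transition_unit {δ : Finset W → Finset W} (hδ : ∀ c, ∀ w ∈ δ c, R w) (u v : Finset W) :
    transition R (fun c d => if d = δ c then 1 else 0) (matrixUnit u v) =
      if u.filter R = v.filter R then
        matrixUnit (setPart R u (δ (u.filter R))) (setPart R v (δ (v.filter R))) else 0 := by
  have hfilt : ∀ s c : Finset W, (∀ w ∈ c, R w) → (setPart R s c).filter R = c := by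
    intro s c hc
    exact ((setPart_eq_iff hc).1 rfl).1.symm
  funext s t
  simp only [transition]
  by_cases hst : s.filter R = t.filter R
  · rw [if_pos hst, tsum_eq_single ⟨u.filter R, fun w hw => (Finset.mem_filter.1 hw).2⟩]
    · simp only [matrixUnit]
      have hu : ∀ w ∈ u.filter R, R w := fun w hw => (Finset.mem_filter.1 hw).2
      have h1 := setPart_eq_iff (s := s) (u := u) hu
      have h2 := setPart_eq_iff (s := t) (u := v) hu
      rw [setPart] at h1 h2
      simp only [h1, h2, true_and]
      by_cases huv : u.filter R = v.filter R
      · rw [if_pos huv]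
        by_cases hd : s.filter R = δ (u.filter R)
        · rw [if_pos hd]
          simp only [matrixUnit, huv, true_and, ← hst, hd]
          simp
        · rw [if_neg hd]
          have : s ≠ setPart R u (δ (u.filter R)) := by
            rintro rfl
            exact hd (hfilt _ _ (hδ _))
          simp [matrixUnit, this]
      · simp [huv]
    · rintro ⟨c, hc⟩ hne
      have h1 := setPart_eq_iff (s := s) (u := u) hc
      rw [setPart] at h1
      have : ¬ (s.filter (fun w => ¬ R w) ∪ c = u) := fun h => hne (Subtype.ext (h1.1 h).1)
      simp only [matrixUnit, this, false_and, if_false, mul_zero]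
  · rw [if_neg hst]
    split_ifs with huv
    · simp only [matrixUnit]
      rw [if_neg]
      rintro ⟨rfl, rfl⟩
      rw [hfilt _ _ (hδ _), hfilt _ _ (hδ _), huv] at hst
      exact hst rfl
    · rfl

/-- A circuit performs a transition if it does so on matrix units. -/
theorem run_eq_transition {p : Finset W → Finset W → ℝ} {Φ : Finset W → Prop} {K : Op W}
    (hF : FinSupp K) (hK : Supp Φ K) {C : Circuit W}
    (h : ∀ u v, Φ u → Φ v → C.run (matrixUnit u v) = transition R p (matrixUnit u v)) :
    C.run K = transition R p K := by
  obtain ⟨F, hF⟩ := hF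
  rw [eq_linComb_unit hF, run_linComb, transition_linComb _ fun i _ => finSupp_unit _ _]
  funext s t
  refine Finset.sum_congr rfl fun y hy => ?_
  obtain ⟨h1, h2⟩ := hK _ _ (Finset.mem_filter.1 hy).2
  dsimp only
  rw [h _ _ h1 h2]

end Unit

/-- Discards messages, and moves what the honest party has handed over to its input register, as far
as the first `M` wires of each register are concerned. -/
def handoverCircuit (M : ℕ) : Circuit Wire :=
  (List.range M).flatMap fun k => [.reset (.msg, k), .reset (.honInp, k),
    .cnot (.honOut, k) (.honInp, k), .reset (.honOut, k)]

theorem run_zero {W : Type} [DecidableEq W] (C : Circuit W) : C.run 0 = 0 := by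
  have := run_linComb C (∅ : Finset ℕ) (fun _ => 0) (fun _ => (0 : Op W))
  have e : ∀ K : ℕ → Op W, linComb ∅ (fun _ => 0) K = 0 := fun K => by
    funext s t; simp [linComb]
  rwa [e, e] at this

/-- On a matrix unit, `handoverCircuit M` moves the first `M` wires as described by `g`, and the
result vanishes if a wire that is reset has different values on both sides. -/
theorem run_handoverCircuit_unit (M : ℕ) (u v : Finset Wire) :
    ∃ g : Finset Wire → Finset Wire,
      (∀ s r k, ((r, k) ∈ g s ↔ if k < M then (if r = .honInp then (Reg.honOut, k) ∈ s else
        r ≠ .msg ∧ r ≠ .honOut ∧ (r, k) ∈ s) else (r, k) ∈ s)) ∧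
      (handoverCircuit M).run (matrixUnit u v) =
        if ∀ k < M, ((Reg.msg, k) ∈ u ↔ (Reg.msg, k) ∈ v) ∧
            ((Reg.honInp, k) ∈ u ↔ (Reg.honInp, k) ∈ v) ∧
            ((Reg.honOut, k) ∈ u ↔ (Reg.honOut, k) ∈ v) then
          matrixUnit (g u) (g v) else 0 := by
  induction M with
  | zero => exact ⟨id, fun s r k => by simp, by simp [handoverCircuit, Circuit.run]⟩
  | succ M ih =>
    obtain ⟨g, hg, hrun⟩ := ih
    let g1 : Finset Wire → Finset Wire := fun s => ((s.erase (.msg, M)).erase (.honInp, M))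
    let g' : Finset Wire → Finset Wire := fun s =>
      (if ((.honOut, M) : Wire) ∈ g1 s then toggle (.honInp, M) (g1 s) else g1 s).erase (.honOut, M)
    have hg' : ∀ s r k, ((r, k) ∈ g' s ↔ if k = M then (if r = .honInp then (Reg.honOut, k) ∈ s else
        r ≠ .msg ∧ r ≠ .honOut ∧ (r, k) ∈ s) else (r, k) ∈ s) := by
      intro s r k
      by_cases hk : k = M
      · subst hk
        simp only [g', g1, Finset.mem_erase, apply_ite (fun x : Finset Wire => (r, k) ∈ x),
          mem_toggle]
        cases r <;> simp
      · simp only [g', g1, Finset.mem_erase, apply_ite (fun x : Finset Wire => (r, k) ∈ x),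
          mem_toggle]
        simp [hk]
    refine ⟨fun s => g' (g s), fun s r k => ?_, ?_⟩
    · rw [hg', hg, hg]
      by_cases h1 : k = M
      · subst h1; simp
      · have : k < M + 1 ↔ k < M := by omega
        simp [h1, this]
    · rw [handoverCircuit, List.range_succ, List.flatMap_append, Circuit.run_append,
        show (List.range M).flatMap _ = handoverCircuit M from rfl, hrun]
      simp only [List.flatMap_cons, List.flatMap_nil, List.append_nil]
      have hlt : ∀ Q : ℕ → Prop, (∀ k < M + 1, Q k) ↔ (∀ k < M, Q k) ∧ Q M := by
        intro Q
        constructor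
        · exact fun h => ⟨fun k hk => h k (by omega), h M (by omega)⟩
        · rintro ⟨h1, h2⟩ k hk
          rcases Nat.lt_succ_iff_lt_or_eq.1 hk with h | rfl
          · exact h1 k h
          · exact h2
      refine Eq.trans ?_ (if_congr (hlt _) rfl rfl).symm
      by_cases h0 : ∀ k < M, ((Reg.msg, k) ∈ u ↔ (Reg.msg, k) ∈ v) ∧
            ((Reg.honInp, k) ∈ u ↔ (Reg.honInp, k) ∈ v) ∧
            ((Reg.honOut, k) ∈ u ↔ (Reg.honOut, k) ∈ v)
      · rw [if_pos h0]
        have hM : ∀ s r, (r, M) ∈ g s ↔ (r, M) ∈ s := fun s r => by rw [hg]; simp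
        simp only [Circuit.run_cons, Circuit.run_nil, reset_unit, hM]
        by_cases ha : (Reg.msg, M) ∈ u ↔ (Reg.msg, M) ∈ v
        · rw [if_pos ha]
          simp only [reset_unit]
          have e : ∀ s, (Reg.honInp, M) ∈ (g s).erase (.msg, M) ↔ (Reg.honInp, M) ∈ s := by
            intro s; simp [hM]
          by_cases hb : (Reg.honInp, M) ∈ u ↔ (Reg.honInp, M) ∈ v
          · rw [if_pos (by rw [e, e]; exact hb), cnot_unit (by simp), reset_unit]
            have e' : ∀ s, ((Reg.honOut, M) ∈ if ((Reg.honOut, M) : Wire) ∈ ((g s).erase (.msg, M)).erase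
                (.honInp, M) then toggle ((Reg.honInp, M) : Wire) (((g s).erase (.msg, M)).erase
                (.honInp, M)) else ((g s).erase (.msg, M)).erase (.honInp, M)) ↔
                (Reg.honOut, M) ∈ s := by
              intro s
              split_ifs with h <;> simp_all [mem_toggle]
            simp only [ha, hb, true_and]
            by_cases hc : (Reg.honOut, M) ∈ u ↔ (Reg.honOut, M) ∈ v
            · exact (if_pos ((e' _).trans (hc.trans (e' _).symm))).trans (if_pos ⟨h0, hc⟩).symm
            · exact (if_neg fun h => hc ((e' _).symm.trans (h.trans (e' _)))).trans
                (if_neg (by tauto)).symm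
          · rw [if_neg (by rw [e, e]; exact hb), if_neg (by tauto)]
            exact run_zero [.cnot ((Reg.honOut, M) : Wire) (Reg.honInp, M), .reset (Reg.honOut, M)]
        · rw [if_neg ha, if_neg (by tauto)]
          exact run_zero [.reset ((Reg.honInp, M) : Wire), .cnot (Reg.honOut, M) (Reg.honInp, M),
            .reset (Reg.honOut, M)]
      · rw [if_neg h0, if_neg (by tauto)]
        exact run_zero _

theorem run_handoverCircuit {M : ℕ} {K : Op Wire} (hK : Bdd M K) :
    (handoverCircuit M).run K = handover K := by
  refine run_eq_transition hK.finSupp hK fun u v hu hv => ?_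
  have hδ : ∀ c : Finset Wire, ∀ w ∈ fill .honInp (content .honOut c),
      w.1 = Reg.msg ∨ w.1 = Reg.honInp ∨ w.1 = Reg.honOut := fun c w hw =>
    Or.inr (Or.inl (mem_fill.1 hw).1)
  obtain ⟨g, hg, hrun⟩ := run_handoverCircuit_unit M u v
  rw [hrun, transition_unit hδ]
  have hgs : ∀ s : Finset Wire, (∀ w ∈ s, w.2 < M) → g s =
      setPart (fun w => w.1 = Reg.msg ∨ w.1 = Reg.honInp ∨ w.1 = Reg.honOut) s
        (fill .honInp (content .honOut
          (s.filter fun w => w.1 = Reg.msg ∨ w.1 = Reg.honInp ∨ w.1 = Reg.honOut))) := by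
    intro s hs
    ext ⟨r, k⟩
    rw [hg, mem_setPart (hδ _), mem_fill, mem_content, Finset.mem_filter]
    have hk : ∀ r, (r, k) ∈ s → k < M := fun r h => hs _ h
    by_cases hM : k < M
    · cases r <;> simp [hM]
    · have : ∀ r, (r, k) ∉ s := fun r h => hM (hk r h)
      simp [hM, this]
  rw [← hgs u hu, ← hgs v hv]
  refine if_congr ?_ rfl rfl
  constructor
  · intro h
    ext ⟨r, k⟩
    simp only [Finset.mem_filter]
    by_cases hM : k < M
    · obtain ⟨h1, h2, h3⟩ := h k hM
      constructor
      · rintro ⟨h4, h5⟩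
        refine ⟨?_, h5⟩
        rcases h5 with rfl | rfl | rfl
        exacts [h1.1 h4, h2.1 h4, h3.1 h4]
      · rintro ⟨h4, h5⟩
        refine ⟨?_, h5⟩
        rcases h5 with rfl | rfl | rfl
        exacts [h1.2 h4, h2.2 h4, h3.2 h4]
    · exact ⟨fun h => absurd (hu _ h.1) hM, fun h => absurd (hv _ h.1) hM⟩
  · intro h k _
    have key : ∀ r, (r = Reg.msg ∨ r = Reg.honInp ∨ r = Reg.honOut) →
        ((r, k) ∈ u ↔ (r, k) ∈ v) := by
      intro r hr
      have := Finset.ext_iff.1 h (r, k)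
      simpa only [Finset.mem_filter, hr, and_true] using this
    exact ⟨key _ (Or.inl rfl), key _ (Or.inr (Or.inl rfl)), key _ (Or.inr (Or.inr rfl))⟩

/-- Measures the first `M` wires of the message channel, with the help of an unused wire. -/
def dephaseCircuit (M : ℕ) : Circuit Wire :=
  (List.range M).flatMap fun k => [.cnot (.msg, k) (.dist, M), .reset (.dist, M)]

/-- Copying a wire to an unused one and discarding the copy is a measurement. -/
theorem run_cnot_reset {W : Type} [DecidableEq W] {a b : W} (hab : a ≠ b) {K : Op W}
    (hK : Supp (fun s => b ∉ s) K) : Circuit.run [.cnot a b, .reset b] K =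
      fun s t => if (a ∈ s ↔ a ∈ t) then K s t else 0 := by
  have h0 : ∀ s t, b ∈ s ∨ b ∈ t → K s t = 0 := fun s t h => by
    by_contra hn
    have := hK s t hn
    tauto
  have hins : ∀ s : Finset W, b ∉ s → toggle b (insert b s) = s := fun s hs => by
    simp [toggle, hs]
  have htog : ∀ s : Finset W, b ∉ s → b ∈ toggle b s := fun s hs => by simp [mem_toggle, hs]
  have ha : ∀ s : Finset W, a ∈ insert b s ↔ a ∈ s := fun s => by simp [hab]
  funext s t
  simp only [Circuit.run_cons, Circuit.run_nil, Gate.apply, ne_eq, hab, not_false_eq_true, and_true,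
    ha]
  by_cases hb : b ∈ s ∨ b ∈ t
  · simp [hb, h0 s t hb]
  · rw [if_neg hb]
    push Not at hb
    by_cases h1 : a ∈ s <;> by_cases h2 : a ∈ t
    · simp only [h1, h2, if_true, hins s hb.1, hins t hb.2, h0 _ _ (Or.inl (htog s hb.1)), zero_add]
    · simp only [h1, h2, if_true, if_false, hins s hb.1, h0 _ _ (Or.inl (htog s hb.1)), zero_add,
        h0 s (insert b t) (Or.inr (Finset.mem_insert_self ..))]
      simp
    · simp only [h1, h2, if_true, if_false, hins t hb.2, h0 _ _ (Or.inr (htog t hb.2)), zero_add,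
        h0 (insert b s) t (Or.inl (Finset.mem_insert_self ..))]
      simp
    · simp only [h1, h2, if_false, if_true, h0 (insert b s) _ (Or.inl (Finset.mem_insert_self ..)),
        add_zero]

theorem run_dephaseCircuit {M : ℕ} {K : Op Wire} (hK : Bdd M K) :
    (dephaseCircuit M).run K = dephase (fun w : Wire => w.1 = Reg.msg) K := by
  have key : ∀ n, Circuit.run ((List.range n).flatMap fun k =>
      [.cnot (.msg, k) (.dist, M), .reset (.dist, M)] : Circuit Wire) K =
      fun s t => if ∀ k < n, ((Reg.msg, k) ∈ s ↔ (Reg.msg, k) ∈ t) then K s t else 0 := by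
    intro n
    induction n with
    | zero => simp [Circuit.run]
    | succ n ih =>
      rw [List.range_succ, List.flatMap_append, Circuit.run_append, ih]
      simp only [List.flatMap_cons, List.flatMap_nil, List.append_nil]
      rw [run_cnot_reset (by simp)]
      · funext s t
        have : (∀ k < n + 1, ((Reg.msg, k) ∈ s ↔ (Reg.msg, k) ∈ t)) ↔
            ((Reg.msg, n) ∈ s ↔ (Reg.msg, n) ∈ t) ∧
              ∀ k < n, ((Reg.msg, k) ∈ s ↔ (Reg.msg, k) ∈ t) := by
          constructor
          · exact fun h => ⟨h n (by omega), fun k hk => h k (by omega)⟩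
          · rintro ⟨h1, h2⟩ k hk
            rcases Nat.lt_succ_iff_lt_or_eq.1 hk with h | rfl
            · exact h2 k h
            · exact h1
        rw [← ite_and]
        exact if_congr this.symm rfl rfl
      · intro s t hst
        dsimp only at hst
        split_ifs at hst
        · have := hK s t hst
          exact ⟨fun h => lt_irrefl M (this.1 _ h), fun h => lt_irrefl M (this.2 _ h)⟩
        · simp at hst
  rw [dephaseCircuit, key]
  funext s t
  simp only [dephase]
  by_cases h0 : K s t = 0
  · simp [h0]
  · obtain ⟨hs, ht⟩ := hK s t h0
    refine if_congr ?_ rfl rfl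
    constructor
    · intro h
      ext ⟨r, k⟩
      simp only [Finset.mem_filter]
      constructor
      · rintro ⟨h1, rfl⟩; exact ⟨(h k (hs _ h1)).1 h1, rfl⟩
      · rintro ⟨h1, rfl⟩; exact ⟨(h k (ht _ h1)).2 h1, rfl⟩
    · intro h k _
      have := Finset.ext_iff.1 h (.msg, k)
      simpa only [Finset.mem_filter, and_true] using this

/-- A circuit that performs all steps of an execution in the plain model, where party `c` is
corrupted and all wires in use have an index below `M`. -/
def execCircuit (M : ℕ) (c : Bool) : List (Step 0) → List (Circuit PWire) → Circuit Wire
  | [], _ => []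
  | .send b C :: P, A =>
      (if b = c then [] else C.map (Gate.map honWire) ++ dephaseCircuit M) ++
        (((A.headD []).map (Gate.map advWire) ++ dephaseCircuit M) ++ execCircuit M c P A.tail)
  | .call _ :: _, _ => []
  | .handover :: P, A => handoverCircuit M ++ execCircuit M c P A

theorem headD_of_forall {α : Type} {p : List α → Prop} (hp : p []) {A : List (List α)}
    (hA : ∀ C ∈ A, p C) : p (A.headD []) := by
  cases A with
  | nil => exact hp
  | cons C A => exact hA C (by simp)

/-- Executions in the plain model are performed by circuits, as long as all wires in use are
bounded. -/
theorem run_execCircuit {M : ℕ} (f : Fin 0 → Functionality) (lam : ℕ) (c : Bool)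
    {P : List (Step 0)} {A : List (Circuit PWire)}
    (hP : ∀ b C, Step.send b C ∈ P → C.On {w | w.2 < M}) (hA : ∀ C ∈ A, C.On {w | w.2 < M})
    {K : Op Wire} (hK : Bdd M K) :
    (execCircuit M c P A).run K = exec f lam c P A K := by
  have hact : ∀ (e : PWire → Wire), (∀ w, (e w).2 = w.2) → ∀ C : Circuit PWire,
      C.On {w | w.2 < M} → ∀ K, Bdd M K →
      Circuit.run (C.map (Gate.map e) ++ dephaseCircuit M : Circuit Wire) K = activate e C K := by
    intro e he C hC K hK
    rw [Circuit.run_append, activate_eq, run_dephaseCircuit]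
    refine Supp.run (X := {w | w.2 < M}) hK (fun s s' h1 h2 w hw => ?_)
      (hC.map e fun w hw => by have := he w; simp_all)
    by_cases hM : w.2 < M
    · exact hM
    · exact h1 w ((h2 w hM).2 hw)
  induction P generalizing A K with
  | nil => rfl
  | cons s P ih =>
    have ih' := fun {A} {K} => @ih A (fun b C h => hP b C (by simp [h])) (K := K)
    cases s with
    | call i => exact i.elim0
    | handover =>
      rw [execCircuit, Circuit.run_append, run_handoverCircuit hK]
      exact ih' hA hK.handover
    | send b C =>
      have hhead : Circuit.On {w | w.2 < M} (A.headD []) :=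
        headD_of_forall Circuit.on_nil hA
      have htail : ∀ C ∈ A.tail, C.On {w | w.2 < M} := fun C hC => hA C (List.mem_of_mem_tail hC)
      rw [execCircuit, exec, Circuit.run_append, Circuit.run_append]
      by_cases hb : b = c
      · simp only [hb, if_true]
        rw [Circuit.run_nil, hact _ advWire_snd _ hhead _ hK]
        exact ih' htail (hK.activate advWire_snd hhead)
      · simp only [hb, if_false]
        have hC := hP b C (by simp)
        have h1 := hK.activate honWire_snd hC
        rw [hact _ honWire_snd _ hC _ hK, hact _ advWire_snd _ hhead _ h1]
        exact ih' htail (h1.activate advWire_snd hhead)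

/-! ### Writing and erasing values -/

section Flips

variable {W : Type} [DecidableEq W]

theorem run_flips (L : List W) (hL : L.Nodup) (K : Op W) :
    Circuit.run (L.map Gate.flip) K =
      fun s t => K (symmDiff s L.toFinset) (symmDiff t L.toFinset) := by
  induction L generalizing K with
  | nil =>
    funext s t
    show K s t = K (symmDiff s ∅) (symmDiff t ∅)
    simp only [← Finset.bot_eq_empty, symmDiff_bot]
  | cons w L ih =>
    rw [List.nodup_cons] at hL
    rw [List.map_cons, Circuit.run_cons, ih hL.2]
    have : ∀ s, toggle w (symmDiff s L.toFinset) = symmDiff s (w :: L).toFinset := by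
      intro s
      ext x
      simp only [mem_toggle, Finset.mem_symmDiff, List.mem_toFinset, List.mem_cons]
      by_cases hx : x = w
      · subst hx; have := hL.1; tauto
      · tauto
    simp only [Gate.apply, this]

theorem Supp.resets {Φ : Finset W → Prop} {K : Op W} (hK : Supp Φ K) (L : List W) :
    Supp (fun s => (∀ w ∈ L, w ∉ s) ∧ ∃ u, Φ u ∧ ∀ x ∉ L, (x ∈ s ↔ x ∈ u))
      (Circuit.run (L.map Gate.reset) K) := by
  induction L generalizing Φ K with
  | nil => exact hK.mono fun s hs => ⟨by simp, s, hs, fun _ _ => Iff.rfl⟩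
  | cons w L ih =>
    have h1 : Supp (fun s => w ∉ s ∧ ∃ u, Φ u ∧ ∀ x ≠ w, (x ∈ s ↔ x ∈ u))
        ((Gate.reset w).apply K) := by
      intro s t hst
      simp only [Gate.apply] at hst
      split_ifs at hst with h
      · exact absurd rfl hst
      · push Not at h
        by_cases h0 : K s t = 0
        · rw [h0, zero_add] at hst
          obtain ⟨h3, h4⟩ := hK _ _ hst
          exact ⟨⟨h.1, _, h3, fun x hx => by simp [hx]⟩, ⟨h.2, _, h4, fun x hx => by simp [hx]⟩⟩
        · obtain ⟨h3, h4⟩ := hK _ _ h0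
          exact ⟨⟨h.1, _, h3, fun x hx => Iff.rfl⟩, ⟨h.2, _, h4, fun x hx => Iff.rfl⟩⟩
    refine (ih h1).mono ?_
    rintro s ⟨h2, u, ⟨h3, u', h4, h5⟩, h6⟩
    refine ⟨fun x hx => ?_, u', h4, fun x hx => ?_⟩
    · by_cases hxL : x ∈ L
      · exact h2 x hxL
      · obtain rfl : x = w := by simpa [hxL] using hx
        rw [h6 x hxL]; exact h3
    · simp only [List.mem_cons, not_or] at hx
      rw [h6 x hx.2, h5 x hx.1]

theorem run_resets_eq {K : Op W} (L : List W) (hK : Supp (fun s => ∀ w ∈ L, w ∉ s) K) :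
    Circuit.run (L.map Gate.reset) K = K := by
  induction L with
  | nil => rfl
  | cons w L ih =>
    have h1 : (Gate.reset w).apply K = K := by
      have h0 : ∀ s t, w ∈ s ∨ w ∈ t → K s t = 0 := fun s t h => by
        by_contra hn
        obtain ⟨h2, h3⟩ := hK s t hn
        exact h.elim (h2 w (by simp)) (h3 w (by simp))
      funext s t
      simp only [Gate.apply]
      split_ifs with h
      · exact (h0 s t h).symm
      · rw [h0 _ _ (Or.inl (Finset.mem_insert_self w s)), add_zero]
    rw [List.map_cons, Circuit.run_cons, h1]
    exact ih (hK.mono fun s hs x hx => hs x (by simp [hx]))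

end Flips

/-- The circuit `inputFlips v` flips each wire that is set in the description of `v` exactly once.
-/
theorem exists_inputFlips_list (v : Val) : ∃ L : List Wire, L.Nodup ∧
    (∀ w, w ∈ L ↔ w ∈ fill .advInp v.toWires) ∧
    (inputFlips v).map (Gate.map advWire) = L.map Gate.flip := by
  cases v with
  | none => exact ⟨[], List.nodup_nil, by simp [Val.toWires, fill], rfl⟩
  | some l =>
    refine ⟨((l.zipIdx.filter (fun y => y.1)).map (fun y => ((Reg.advInp, y.2) : Wire))) ++
      [(Reg.advInp, l.length)], ?_, ?_, ?_⟩
    · rw [List.nodup_append]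
      refine ⟨?_, List.nodup_singleton _, ?_⟩
      · have h1 : ((l.zipIdx.filter (fun y => y.1)).map Prod.snd).Nodup := by
          refine List.Nodup.sublist (List.filter_sublist.map _) ?_
          rw [List.zipIdx_map_snd]
          exact List.nodup_range'
        have h2 := h1.map (f := fun k => ((Reg.advInp, k) : Wire)) (fun a b h => (Prod.ext_iff.1 h).2)
        rwa [List.map_map] at h2
      · rintro w hw w' hw' rfl
        simp only [List.mem_map, List.mem_filter, List.mem_singleton] at hw hw'
        obtain ⟨y, ⟨hy, -⟩, rfl⟩ := hw
        have := List.snd_lt_of_mem_zipIdx hy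
        simp only [Prod.mk.injEq, true_and] at hw'
        omega
    · rintro ⟨r, k⟩
      simp only [List.mem_append, List.mem_map, List.mem_filter, List.mem_singleton, mem_fill,
        Val.toWires, Finset.mem_insert, Finset.mem_filter, Finset.mem_range]
      constructor
      · rintro (⟨⟨b, k'⟩, ⟨h1, h2⟩, h3⟩ | h)
        · simp only [Prod.mk.injEq] at h3
          obtain ⟨rfl, rfl⟩ := h3
          dsimp only at h2
          subst h2
          rw [List.mem_zipIdx_iff_getElem?] at h1
          obtain ⟨h4, -⟩ := List.getElem?_eq_some_iff.1 h1
          exact ⟨rfl, Or.inr ⟨h4, h1⟩⟩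
        · simp only [Prod.mk.injEq] at h
          exact ⟨h.1, Or.inl h.2⟩
      · rintro ⟨rfl, rfl | ⟨h1, h2⟩⟩
        · exact Or.inr rfl
        · exact Or.inl ⟨(true, k), ⟨List.mem_zipIdx_iff_getElem?.2 h2, rfl⟩, rfl⟩
    · have key : ∀ L : List (Bool × ℕ),
          (L.flatMap fun bk => if bk.1 then [Gate.flip ((Port.inp, bk.2) : PWire)] else []).map
            (Gate.map advWire) =
          ((L.filter (fun y => y.1)).map (fun y => ((Reg.advInp, y.2) : Wire))).map Gate.flip := by
        intro L
        induction L with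
        | nil => rfl
        | cons y L ih =>
          obtain ⟨b, k⟩ := y
          rw [List.flatMap_cons, List.map_append, ih]
          cases b <;> rfl
      rw [inputFlips, List.map_append, key, List.map_append]
      rfl

theorem run_inputFlips (v : Val) (K : Op Wire) :
    Circuit.run ((inputFlips v).map (Gate.map advWire) : Circuit Wire) K = fun s t =>
      K (symmDiff s (fill .advInp v.toWires)) (symmDiff t (fill .advInp v.toWires)) := by
  obtain ⟨L, h1, h2, h3⟩ := exists_inputFlips_list v
  have : L.toFinset = fill .advInp v.toWires := by ext w; simp [h2]
  rw [h3, run_flips L h1, this]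

theorem on_inputFlips (v : Val) :
    (inputFlips v).On {w : PWire | w.1 = Port.inp ∧ w.2 < v.length + 1} := by
  cases v with
  | none => exact Circuit.on_nil
  | some l =>
    intro g hg w hw
    simp only [inputFlips, List.mem_append, List.mem_flatMap, List.mem_singleton] at hg
    rcases hg with ⟨⟨b, k⟩, hk, hg⟩ | rfl
    · cases b
      · simp at hg
      · obtain rfl : g = Gate.flip (Port.inp, k) := by simpa using hg
        obtain rfl : w = (Port.inp, k) := by simpa [Gate.wires] using hw
        have := List.snd_lt_of_mem_zipIdx hk
        dsimp only at this
        exact ⟨rfl, show k < l.length + 1 by omega⟩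
    · obtain rfl : w = (Port.inp, l.length) := by simpa [Gate.wires] using hw
      exact ⟨rfl, Nat.lt_succ_self _⟩

/-- The state of the registers of a packed adversary between the steps of an execution: the input
register holds the input `v`, the output register is empty, and work space is used up to `N`. -/
def AdvReady (N : ℕ) (v : Val) (s : Finset Wire) : Prop :=
  (∀ k, (Reg.advInp, k) ∈ s ↔ k ∈ v.toWires) ∧ (∀ k, (Reg.advOut, k) ∉ s) ∧
    ∀ k, (Reg.advWork, k) ∈ s → k < N

/-- The wires that are reset by `cleanCircuit`. -/
def cleanWires (N M : ℕ) : List Wire :=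
  (List.range M).flatMap fun k => [(.advInp, k), (.advOut, k), (.advWork, N + k)]

theorem mem_cleanWires {N M : ℕ} {r : Reg} {k : ℕ} : (r, k) ∈ cleanWires N M ↔
    (r = .advInp ∧ k < M) ∨ (r = .advOut ∧ k < M) ∨ (r = .advWork ∧ N ≤ k ∧ k < N + M) := by
  simp only [cleanWires, List.mem_flatMap, List.mem_range, List.mem_cons, Prod.mk.injEq,
    List.not_mem_nil, or_false]
  constructor
  · rintro ⟨k', h, ⟨rfl, rfl⟩ | ⟨rfl, rfl⟩ | ⟨rfl, rfl⟩⟩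
    · exact Or.inl ⟨rfl, h⟩
    · exact Or.inr (Or.inl ⟨rfl, h⟩)
    · exact Or.inr (Or.inr ⟨rfl, by omega, by omega⟩)
  · rintro (⟨rfl, h⟩ | ⟨rfl, h⟩ | ⟨rfl, h, h'⟩)
    · exact ⟨k, h, Or.inl ⟨rfl, rfl⟩⟩
    · exact ⟨k, h, Or.inr (Or.inl ⟨rfl, rfl⟩)⟩
    · exact ⟨k - N, by omega, Or.inr (Or.inr ⟨rfl, by omega⟩)⟩

theorem cleanCircuit_map (N M : ℕ) (v : Val) : (cleanCircuit N M v).map (Gate.map advWire) =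
    (inputFlips v).map (Gate.map advWire) ++ ((cleanWires N M).map Gate.reset ++
      (inputFlips v).map (Gate.map advWire)) := by
  rw [cleanCircuit, List.map_append, List.map_append]
  congr 2
  rw [cleanWires, List.map_flatMap, List.map_flatMap]
  rfl

theorem advReady_symmDiff {N : ℕ} {v : Val} {s : Finset Wire}
    (h : (∀ k, (Reg.advInp, k) ∉ s) ∧ (∀ k, (Reg.advOut, k) ∉ s) ∧
      ∀ k, (Reg.advWork, k) ∈ s → k < N) : AdvReady N v (symmDiff s (fill .advInp v.toWires)) := by
  obtain ⟨h1, h2, h3⟩ := h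
  refine ⟨fun k => ?_, fun k => ?_, fun k => ?_⟩
  · simp [Finset.mem_symmDiff, mem_fill, h1]
  · simp [Finset.mem_symmDiff, mem_fill, h2]
  · simp only [Finset.mem_symmDiff, mem_fill]
    rintro (⟨h, -⟩ | ⟨⟨h, -⟩, -⟩)
    · exact h3 k h
    · simp at h

theorem symmDiff_symmDiff (s a : Finset Wire) : symmDiff (symmDiff s a) a = s :=
  symmDiff_symmDiff_cancel_right a s

theorem Supp.inputFlips {Φ : Finset Wire → Prop} {K : Op Wire} (hK : Supp Φ K) (v : Val) :
    Supp (fun s => ∃ u, Φ u ∧ s = symmDiff u (fill .advInp v.toWires))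
      (Circuit.run ((inputFlips v).map (Gate.map advWire) : Circuit Wire) K) := by
  rw [run_inputFlips]
  intro s t hst
  obtain ⟨h1, h2⟩ := hK _ _ hst
  exact ⟨⟨_, h1, (symmDiff_symmDiff _ _).symm⟩, ⟨_, h2, (symmDiff_symmDiff _ _).symm⟩⟩

/-- Cleaning does nothing if there is nothing to be cleaned. -/
theorem run_clean_eq {N M : ℕ} {v : Val} {K : Op Wire} (hK : Supp (AdvReady N v) K) :
    Circuit.run ((cleanCircuit N M v).map (Gate.map advWire) : Circuit Wire) K = K := by
  rw [cleanCircuit_map, Circuit.run_append, Circuit.run_append, run_resets_eq]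
  · rw [run_inputFlips, run_inputFlips]
    simp only [symmDiff_symmDiff]
  · refine (hK.inputFlips v).mono ?_
    rintro s ⟨u, ⟨h1, h2, h3⟩, rfl⟩ ⟨r, k⟩ hw
    rw [mem_cleanWires] at hw
    simp only [Finset.mem_symmDiff, mem_fill]
    rcases hw with ⟨rfl, -⟩ | ⟨rfl, -⟩ | ⟨rfl, h4, -⟩
    · simp [h1]
    · simp [h2]
    · simp only [reduceCtorEq, false_and, not_false_eq_true, and_true, or_false]
      exact fun h => absurd (h3 k h) (by omega)

/-- All wires of the adversary that are in use have an index below `M`. -/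
def AdvBdd (M : ℕ) (K : Op Wire) : Prop :=
  Supp (fun s => ∀ w ∈ s, w.1 = Reg.advInp ∨ w.1 = Reg.advOut ∨ w.1 = Reg.advWork → w.2 < M) K

/-- Cleaning restores the state between steps. -/
theorem Supp.clean {N M : ℕ} {v : Val} (hv : v.length < M) {K : Op Wire} (hK : AdvBdd M K) :
    Supp (AdvReady N v) (Circuit.run ((cleanCircuit N M v).map (Gate.map advWire) : Circuit Wire) K) := by
  rw [cleanCircuit_map, Circuit.run_append, Circuit.run_append]
  refine (((Supp.inputFlips hK v).resets (cleanWires N M)).inputFlips v).mono ?_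
  rintro s ⟨u, ⟨h1, u', ⟨u'', h2, rfl⟩, h3⟩, rfl⟩
  have hM : ∀ w ∈ u, w.1 = Reg.advInp ∨ w.1 = Reg.advOut ∨ w.1 = Reg.advWork → w.2 < M := by
    intro w hw hr
    by_contra hn
    have hc : w ∈ cleanWires N M → False := fun h => h1 w h hw
    rw [h3 w hc, Finset.mem_symmDiff] at hw
    rcases hw with ⟨h, -⟩ | ⟨h, -⟩
    · exact hn (h2 w h hr)
    · have := Val.lt_of_mem_toWires (mem_fill.1 h).2
      omega
  refine advReady_symmDiff ⟨fun k hk => ?_, fun k hk => ?_, fun k hk => ?_⟩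
  · exact h1 _ (mem_cleanWires.2 (Or.inl ⟨rfl, hM _ hk (by simp)⟩)) hk
  · exact h1 _ (mem_cleanWires.2 (Or.inr (Or.inl ⟨rfl, hM _ hk (by simp)⟩))) hk
  · by_contra hn
    have := hM _ hk (by simp)
    dsimp only at this
    exact h1 _ (mem_cleanWires.2 (Or.inr (Or.inr ⟨rfl, by omega, by omega⟩))) hk

theorem on_cleanCircuit {N M : ℕ} {v : Val} (hv : v.length < M) : (cleanCircuit N M v).On
    {w : PWire | w.1 ≠ Port.msg ∧ w.2 < N + M} := by
  have h1 : (inputFlips v).On {w : PWire | w.1 ≠ Port.msg ∧ w.2 < N + M} :=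
    (on_inputFlips v).mono fun w hw => ⟨by rw [hw.1]; simp, by have := hw.2; omega⟩
  refine h1.append (Circuit.On.append ?_ h1)
  intro g hg w hw
  simp only [List.mem_flatMap, List.mem_range] at hg
  obtain ⟨k, hk, hg⟩ := hg
  simp only [List.mem_cons, List.not_mem_nil, or_false] at hg
  rcases hg with rfl | rfl | rfl
  · obtain rfl : w = (Port.inp, k) := by simpa [Gate.wires] using hw
    exact ⟨by simp, show k < N + M by omega⟩
  · obtain rfl : w = (Port.out, k) := by simpa [Gate.wires] using hw
    exact ⟨by simp, show k < N + M by omega⟩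
  · obtain rfl : w = (Port.work, N + k) := by simpa [Gate.wires] using hw
    exact ⟨by simp, show N + k < N + M by omega⟩

/-! ### The view of a distinguisher during a session -/

/-- The adversary's work space. -/
def advEmb : ℕ ↪ Wire := ⟨fun k => (.advWork, k), fun _ _ h => (Prod.ext_iff.1 h).2⟩

theorem outer_advEmb (s : Finset Wire) : outer advEmb s = s.filter (fun w => w.1 ≠ Reg.advWork) := by
  ext ⟨r, k⟩
  rw [mem_outer, Finset.mem_filter]
  refine and_congr_right fun _ => ⟨?_, fun h v e => h (Prod.ext_iff.1 e).1.symm⟩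
  rintro h rfl
  exact h k rfl

theorem inner_advEmb (s : Finset Wire) : inner advEmb s = content .advWork s := by
  ext k
  rw [mem_inner, mem_content]; rfl

theorem start_eq_embed (c : Bool) (x : Bool → Val) (ρ : QState) : start c x ρ =
    embed advEmb (fill .advInp (x c).toWires ∪ fill .honOut (x (!c)).toWires) ρ.op := by
  funext s t
  simp only [start, embed, outer_advEmb, inner_advEmb]

/-- Moves the work space of the honest party to the `j`-th frame. -/
def frameEmb (j : ℕ) : Wire ↪ Wire where
  toFun w := match w with
    | (.honWork, k) => (.honWork, Nat.pair j k)
    | w => w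
  inj' := by
    rintro ⟨⟨⟩, k⟩ ⟨⟨⟩, l⟩ h <;> simp_all [Nat.pair_eq_pair]

theorem frameEmb_honWork (j k : ℕ) :
    frameEmb j ((Reg.honWork, k) : Wire) = (Reg.honWork, Nat.pair j k) := rfl

theorem frameEmb_of_ne {j : ℕ} {w : Wire} (h : w.1 ≠ Reg.honWork) : frameEmb j w = w := by
  obtain ⟨⟨⟩, k⟩ := w <;> first | rfl | exact absurd rfl h

/-- A wire of a suspended frame. -/
def IsSuspended (j : ℕ) (w : Wire) : Prop := w.1 = Reg.honWork ∧ (Nat.unpair w.2).1 ≠ j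

theorem isSuspended_iff {j : ℕ} {w : Wire} : IsSuspended j w ↔ ∀ v, frameEmb j v ≠ w := by
  obtain ⟨r, k⟩ := w
  constructor
  · rintro ⟨h1, h2⟩ ⟨r', l⟩ h
    dsimp only at h1 h2
    subst h1
    by_cases hr : r' = Reg.honWork
    · subst hr
      rw [frameEmb_honWork] at h
      have := (Prod.ext_iff.1 h).2
      dsimp only at this
      rw [← this, Nat.unpair_pair] at h2
      exact h2 rfl
    · rw [frameEmb_of_ne hr] at h
      exact hr (Prod.ext_iff.1 h).1
  · intro h
    have hr : r = Reg.honWork := by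
      by_contra hr
      exact h (r, k) (frameEmb_of_ne hr)
    subst hr
    refine ⟨rfl, fun hj => h (Reg.honWork, (Nat.unpair k).2) ?_⟩
    rw [frameEmb_honWork, ← hj, Nat.pair_unpair]

theorem mem_outer_frameEmb {j : ℕ} {s : Finset Wire} {w : Wire} :
    w ∈ outer (frameEmb j) s ↔ w ∈ s ∧ IsSuspended j w := by
  rw [mem_outer, isSuspended_iff]

/-- A distinguisher that observes a session keeps in its own register everything that belongs to the
suspended computation: the own register of the distinguisher that observes the whole protocol, the
suspended frames, the message channel and the register of values handed over. -/
def viewPort : Wire → DWire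
  | (.advWork, k) => (.advWork, k)
  | (.advInp, k) => (.advInp, k)
  | (.advOut, k) => (.advOut, k)
  | (.honInp, k) => (.hon, k)
  | (.dist, k) => (.own, 4 * k)
  | (.honWork, k) => (.own, 4 * k + 1)
  | (.msg, k) => (.own, 4 * k + 2)
  | (.honOut, k) => (.own, 4 * k + 3)

/-- The wires that correspond to those of the suspended computation in an isolated execution of a
session in frame `j`. -/
def viewEmb (j : ℕ) : Wire ↪ Wire where
  toFun w := match w with
    | (.honWork, n) => if (Nat.unpair n).1 = j then (.honWork, (Nat.unpair n).2)
        else (.dist, 4 * n + 1)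
    | w => distWire (viewPort w)
  inj' := by
    have hp : ∀ {k l : ℕ}, (Nat.unpair k).1 = j → (Nat.unpair l).1 = j →
        (Nat.unpair k).2 = (Nat.unpair l).2 → k = l := fun {k l} h1 h2 h3 => by
      rw [← Nat.pair_unpair k, ← Nat.pair_unpair l, h1, h2, h3]
    rintro ⟨⟨⟩, k⟩ ⟨⟨⟩, l⟩ h <;> simp only [viewPort, distWire] at h <;> (try split_ifs at h) <;>
      simp only [Prod.mk.injEq, true_and, reduceCtorEq, false_and] at h ⊢ <;>
      first | omega | (exact hp ‹_› ‹_› h)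

theorem viewEmb_eq {j : ℕ} {w : Wire} (h : w.1 = Reg.honWork → (Nat.unpair w.2).1 ≠ j) :
    viewEmb j w = distWire (viewPort w) := by
  obtain ⟨⟨⟩, k⟩ := w <;> first | rfl | exact if_neg (h rfl)

theorem viewEmb_frame (j k : ℕ) : viewEmb j ((Reg.honWork, Nat.pair j k) : Wire) =
    (Reg.honWork, k) := by
  show (if (Nat.unpair (Nat.pair j k)).1 = j then ((Reg.honWork, (Nat.unpair (Nat.pair j k)).2) : Wire)
    else (.dist, 4 * Nat.pair j k + 1)) = _
  rw [Nat.unpair_pair, if_pos rfl]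

/-- Every fourth wire of the own register of a distinguisher that observes a session holds the own
register of the distinguisher that observes the whole protocol, see `viewPort`. -/
def quadEmb : ℕ ↪ ℕ := ⟨fun k => 4 * k, fun _ _ h => by dsimp only at h; omega⟩

theorem quadEmb_apply (k : ℕ) : quadEmb k = 4 * k := rfl

/-- The advice of a distinguisher that observes a session, while the suspended part of the honest
party's work space is in the basis state `h`. -/
theorem exists_view_advice (σ : QState) {h : Finset Wire} {M : ℕ} (hM : ∀ w ∈ h, w.2 < M)
    (hσ : σ.qubits ≤ M) : ∃ σ' : QState, σ'.qubits = 4 * M ∧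
      σ'.op = embed quadEmb (h.image fun w => 4 * w.2 + 1) σ.op := by
  have hh : ∀ w ∈ h.image (fun w : Wire => 4 * w.2 + 1), ∀ v, quadEmb v ≠ w := by
    intro w hw v e
    obtain ⟨w', -, rfl⟩ := Finset.mem_image.1 hw
    rw [quadEmb_apply] at e
    omega
  refine exists_qstate (fun s t hst => ?_) (σ.op_pos.embed _ _) (by rw [tr_embed hh, σ.tr_op])
  have key : ∀ s : Finset ℕ, outer quadEmb s = h.image (fun w => 4 * w.2 + 1) →
      inner quadEmb s ⊆ Finset.range σ.qubits → s ⊆ Finset.range (4 * M) := by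
    intro s h1 h2 k hk
    rw [Finset.mem_range]
    by_cases hq : ∃ l, quadEmb l = k
    · obtain ⟨l, rfl⟩ := hq
      have := Finset.mem_range.1 (h2 (mem_inner.2 hk))
      rw [quadEmb_apply]; omega
    · push Not at hq
      have : k ∈ outer quadEmb s := mem_outer.2 ⟨hk, hq⟩
      rw [h1] at this
      obtain ⟨w, hw, rfl⟩ := Finset.mem_image.1 this
      have := hM w hw
      omega
  obtain ⟨h1, h2⟩ := Supp.embed (Φ := fun s => s ⊆ Finset.range σ.qubits)
    (fun _ _ h => σ.op_supp h) _ _ s t hst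
  exact ⟨key s h1.1 h1.2, key t h2.1 h2.2⟩

theorem viewEmb_of_ne {j : ℕ} {r : Reg} {k : ℕ} (h1 : r ≠ .honWork) (h2 : r ≠ .msg)
    (h3 : r ≠ .honOut) (h4 : r ≠ .dist) : viewEmb j ((r, k) : Wire) = (r, k) := by
  cases r <;> first | rfl | exact absurd rfl ‹_›

theorem viewEmb_dist (j k : ℕ) : viewEmb j ((Reg.dist, k) : Wire) = (Reg.dist, 4 * k) := rfl

theorem viewEmb_msg (j k : ℕ) : viewEmb j ((Reg.msg, k) : Wire) = (Reg.dist, 4 * k + 2) := rfl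

theorem viewEmb_honOut (j k : ℕ) : viewEmb j ((Reg.honOut, k) : Wire) = (Reg.dist, 4 * k + 3) := rfl

theorem viewEmb_suspended {j : ℕ} {w : Wire} (h : IsSuspended j w) :
    viewEmb j w = (Reg.dist, 4 * w.2 + 1) := by
  obtain ⟨r, k⟩ := w
  obtain ⟨rfl, h2⟩ := h
  exact if_neg h2

theorem viewEmb_mem_join {j : ℕ} {u : Finset Wire} {w : Wire} :
    viewEmb j w ∈ join (viewEmb j) ∅ u ↔ w ∈ u := by
  rw [← mem_inner, inner_join (by simp)]

theorem inner_content_view (j : ℕ) :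
    ∀ u : Finset Wire, inner quadEmb (content .dist (join (viewEmb j) ∅ u)) =
    content .dist u := by
  intro u
  ext k
  rw [mem_inner, mem_content, mem_content, quadEmb_apply, ← viewEmb_dist j, viewEmb_mem_join]

theorem filter_view (j : ℕ) :
    ∀ u : Finset Wire, (∀ w ∈ u, w.1 ≠ Reg.msg ∧ w.1 ≠ Reg.honOut) →
    (join (viewEmb j) ∅ u).filter (fun w => w.1 ≠ Reg.dist) =
      inner (frameEmb j) (u.filter (fun w => w.1 ≠ Reg.dist)) := by
  have hnd : ∀ (u : Finset Wire) (w : Wire), w.1 ≠ Reg.msg ∧ w.1 ≠ Reg.honOut ∧ w.1 ≠ Reg.dist →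
      (w ∈ (join (viewEmb j) ∅ u).filter (fun w => w.1 ≠ Reg.dist) ↔
        w ∈ inner (frameEmb j) (u.filter (fun w => w.1 ≠ Reg.dist))) := by
    rintro u ⟨r, k⟩ ⟨h1, h2, h3⟩
    rw [mem_inner, Finset.mem_filter, Finset.mem_filter]
    by_cases hr : r = Reg.honWork
    · subst hr
      rw [frameEmb_honWork, ← viewEmb_frame j, viewEmb_mem_join]
      simp [viewEmb_frame]
    · rw [frameEmb_of_ne hr]
      have : viewEmb j (r, k) = (r, k) := viewEmb_of_ne hr h1 h2 h3
      rw [← this, viewEmb_mem_join]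
      simp only [this]
  have hbad : ∀ (u : Finset Wire) (w : Wire), w.1 = Reg.msg ∨ w.1 = Reg.honOut →
      (w ∉ (join (viewEmb j) ∅ u).filter (fun w => w.1 ≠ Reg.dist)) := by
    intro u w hw hm
    obtain ⟨h1, h2⟩ := Finset.mem_filter.1 hm
    simp only [join, Finset.union_empty, Finset.mem_map] at h1
    obtain ⟨⟨r, k⟩, -, rfl⟩ := h1
    have hv : ∀ w : Wire, (viewEmb j w).1 ≠ Reg.msg ∧ (viewEmb j w).1 ≠ Reg.honOut := by
      rintro ⟨r, k⟩
      by_cases hr : r = Reg.honWork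
      · subst hr
        have : viewEmb j ((Reg.honWork, k) : Wire) = if (Nat.unpair k).1 = j then
          (Reg.honWork, (Nat.unpair k).2) else (Reg.dist, 4 * k + 1) := rfl
        rw [this]
        split_ifs <;> simp
      · rw [viewEmb_eq (fun h => absurd h hr)]
        cases r <;> simp [viewPort, distWire]
    rcases hw with hw | hw
    · exact (hv _).1 hw
    · exact (hv _).2 hw
  intro u hu
  ext w
  by_cases hw : w.1 ≠ Reg.msg ∧ w.1 ≠ Reg.honOut ∧ w.1 ≠ Reg.dist
  · exact hnd u w hw
  · by_cases hd : w.1 = Reg.dist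
    · have : frameEmb j w = w := frameEmb_of_ne (by rw [hd]; simp)
      simp [mem_inner, this, hd]
    · have h1 : w.1 = Reg.msg ∨ w.1 = Reg.honOut := by tauto
      have h2 : frameEmb j w = w := frameEmb_of_ne (by rcases h1 with h | h <;> rw [h] <;> simp)
      refine iff_of_false (hbad u w h1) fun h => ?_
      rw [mem_inner, h2] at h
      have := hu w (Finset.mem_filter.1 h).1
      tauto

theorem outer_content_view {j : ℕ} {h : Finset Wire} (hh : ∀ w ∈ h, IsSuspended j w) :
    ∀ u : Finset Wire, (∀ w ∈ u, w.1 ≠ Reg.msg ∧ w.1 ≠ Reg.honOut) →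
    (outer quadEmb (content .dist (join (viewEmb j) ∅ u)) = h.image (fun w => 4 * w.2 + 1) ↔
      outer (frameEmb j) (u.filter (fun w => w.1 ≠ Reg.dist)) = h) := by
  intro u hu
  have e1 : ∀ n, n ∈ outer quadEmb (content .dist (join (viewEmb j) ∅ u)) ↔
      ∃ w, w ∈ u ∧ IsSuspended j w ∧ 4 * w.2 + 1 = n := by
    intro n
    rw [mem_outer, mem_content]
    constructor
    · rintro ⟨h1, h2⟩
      simp only [join, Finset.union_empty, Finset.mem_map] at h1
      obtain ⟨w, hw, he⟩ := h1
      by_cases hs : IsSuspended j w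
      · rw [viewEmb_suspended hs] at he
        exact ⟨w, hw, hs, (Prod.ext_iff.1 he).2⟩
      · exfalso
        rw [isSuspended_iff] at hs
        push Not at hs
        obtain ⟨⟨r, k⟩, rfl⟩ := hs
        by_cases hr : r = Reg.honWork
        · subst hr
          rw [frameEmb_honWork, viewEmb_frame] at he
          simp at he
        · have h3 := hu _ hw
          rw [frameEmb_of_ne hr] at he h3
          by_cases hd : r = Reg.dist
          · subst hd
            rw [viewEmb_dist] at he
            exact h2 k (Prod.ext_iff.1 he).2
          · rw [viewEmb_of_ne hr h3.1 h3.2 hd] at he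
            exact hd (Prod.ext_iff.1 he).1
    · rintro ⟨w, h1, h2, rfl⟩
      rw [← viewEmb_suspended h2, viewEmb_mem_join]
      refine ⟨h1, fun k => ?_⟩
      rw [quadEmb_apply]; omega
  have e2 : ∀ w, w ∈ outer (frameEmb j) (u.filter (fun w => w.1 ≠ Reg.dist)) ↔
      w ∈ u ∧ IsSuspended j w := by
    intro w
    rw [mem_outer_frameEmb, Finset.mem_filter]
    constructor
    · rintro ⟨⟨h1, -⟩, h2⟩; exact ⟨h1, h2⟩
    · rintro ⟨h1, h2⟩; exact ⟨⟨h1, by rw [h2.1]; simp⟩, h2⟩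
  have hinj : ∀ w w' : Wire, IsSuspended j w → IsSuspended j w' →
      4 * w.2 + 1 = 4 * w'.2 + 1 → w = w' := fun w w' h1 h2 h3 =>
    Prod.ext (h1.1.trans h2.1.symm) (by omega)
  constructor
  · intro h1
    ext w
    rw [e2]
    constructor
    · rintro ⟨h2, h3⟩
      have : 4 * w.2 + 1 ∈ h.image (fun w => 4 * w.2 + 1) := h1 ▸ (e1 _).2 ⟨w, h2, h3, rfl⟩
      obtain ⟨w', h4, h5⟩ := Finset.mem_image.1 this
      rw [hinj w w' h3 (hh w' h4) h5.symm]
      exact h4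
    · intro h2
      have : 4 * w.2 + 1 ∈ outer quadEmb (content .dist (join (viewEmb j) ∅ u)) := by
        rw [h1]; exact Finset.mem_image_of_mem _ h2
      obtain ⟨w', h3, h4, h5⟩ := (e1 _).1 this
      rw [← hinj w' w h4 (hh w h2) h5]
      exact ⟨h3, h4⟩
  · intro h1
    ext n
    rw [e1, Finset.mem_image]
    constructor
    · rintro ⟨w, h2, h3, rfl⟩; exact ⟨w, h1 ▸ (e2 w).2 ⟨h2, h3⟩, rfl⟩
    · rintro ⟨w, h2, rfl⟩
      obtain ⟨h3, h4⟩ := (e2 w).1 (h1.symm ▸ h2)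
      exact ⟨w, h3, h4, rfl⟩

/-- Pending messages and values that are handed over occur in the own register of the distinguisher.
-/
theorem outer_content_view_ne (j : ℕ) (h : Finset Wire) :
    ∀ u : Finset Wire, (¬ ∀ w ∈ u, w.1 ≠ Reg.msg ∧ w.1 ≠ Reg.honOut) →
    outer quadEmb (content .dist (join (viewEmb j) ∅ u)) ≠ h.image (fun w => 4 * w.2 + 1) ∧
    ∃ w ∈ inner (frameEmb j) (u.filter (fun w => w.1 ≠ Reg.dist)),
      ¬ (w.1 ≠ Reg.msg ∧ w.1 ≠ Reg.honOut ∧ w.1 ≠ Reg.dist) := by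
  intro u hu
  push Not at hu
  obtain ⟨⟨r, k⟩, hw, hr⟩ := hu
  dsimp only at hr
  have hr' : r = Reg.msg ∨ r = Reg.honOut := by tauto
  constructor
  · intro he
    have hmem : ∀ n, (∃ i, i = 2 ∨ i = 3 ∧ n = 4 * k + i) → ((Reg.dist, n) : Wire) ∈
        join (viewEmb j) ∅ u → (n = 4 * k + 2 ∨ n = 4 * k + 3) → False := by
      intro n _ h1 h2
      have h3 : n ∈ outer quadEmb (content .dist (join (viewEmb j) ∅ u)) := by
        rw [mem_outer, mem_content]
        exact ⟨h1, fun l => by rw [quadEmb_apply]; omega⟩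
      rw [he] at h3
      obtain ⟨w, -, h4⟩ := Finset.mem_image.1 h3
      omega
    rcases hr' with rfl | rfl
    · exact hmem (4 * k + 2) ⟨2, Or.inl rfl⟩ (by rw [← viewEmb_msg j, viewEmb_mem_join]; exact hw)
        (Or.inl rfl)
    · exact hmem (4 * k + 3) ⟨2, Or.inl rfl⟩ (by rw [← viewEmb_honOut j, viewEmb_mem_join]; exact hw)
        (Or.inr rfl)
  · refine ⟨(r, k), ?_, by dsimp only; tauto⟩
    rw [mem_inner, frameEmb_of_ne (by rcases hr' with rfl | rfl <;> simp), Finset.mem_filter]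
    exact ⟨hw, by rcases hr' with rfl | rfl <;> simp⟩

/-- An isolated execution of a session, together with the advice from `exists_view_advice`, is what
a distinguisher sees of an execution in frame `j` while the rest is suspended. -/
theorem adjoin_eq_embed {j : ℕ} {h : Finset Wire} (hh : ∀ w ∈ h, IsSuspended j w) {σ σ' : QState}
    (hσ : σ'.op = embed quadEmb (h.image fun w => 4 * w.2 + 1) σ.op) {K : Op Wire}
    (hK : Supp (fun s => ∀ w ∈ s, w.1 ≠ Reg.msg ∧ w.1 ≠ Reg.honOut ∧ w.1 ≠ Reg.dist) K) :
    adjoin σ' K = embed (viewEmb j) ∅ (adjoin σ (embed (frameEmb j) h K)) := by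
  refine eq_embed (fun u v => ?_) (fun s t hst => ?_)
  · have hgood := filter_view j
    have hout := outer_content_view hh
    have hneg := outer_content_view_ne j h
    simp only [adjoin, hσ, embed, inner_content_view]
    by_cases hu : ∀ w ∈ u, w.1 ≠ Reg.msg ∧ w.1 ≠ Reg.honOut
    · by_cases hv : ∀ w ∈ v, w.1 ≠ Reg.msg ∧ w.1 ≠ Reg.honOut
      · rw [hgood u hu, hgood v hv]
        simp only [hout u hu, hout v hv]
        split_ifs <;> simp
      · obtain ⟨h1, w, h2, h3⟩ := hneg v hv
        rw [if_neg (fun h => h1 h.2), zero_mul]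
        symm
        refine mul_eq_zero_of_right _ ?_
        split_ifs
        · by_contra hn
          exact h3 ((hK _ _ hn).2 w h2)
        · rfl
    · obtain ⟨h1, w, h2, h3⟩ := hneg u hu
      rw [if_neg (fun h => h1 h.1), zero_mul]
      symm
      refine mul_eq_zero_of_right _ ?_
      split_ifs
      · by_contra hn
        exact h3 ((hK _ _ hn).1 w h2)
      · rfl
  · have h1 := left_ne_zero_of_mul hst
    rw [hσ] at h1
    obtain ⟨h3, h4⟩ := Supp.embed (Φ := fun _ => True) (fun _ _ _ => ⟨trivial, trivial⟩) _ _ _ _ h1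
    obtain ⟨h5, h6⟩ := hK _ _ (right_ne_zero_of_mul hst)
    have key : ∀ s : Finset Wire,
        outer quadEmb (content .dist s) = h.image (fun w => 4 * w.2 + 1) →
        (∀ w ∈ s.filter (fun w => w.1 ≠ Reg.dist),
          w.1 ≠ Reg.msg ∧ w.1 ≠ Reg.honOut ∧ w.1 ≠ Reg.dist) → outer (viewEmb j) s = ∅ := by
      intro s h1 h2
      rw [Finset.eq_empty_iff_forall_notMem]
      rintro ⟨r, k⟩ hw
      obtain ⟨hw, hr⟩ := mem_outer.1 hw
      by_cases hd : r = Reg.dist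
      · subst hd
        by_cases hq : ∃ l, quadEmb l = k
        · obtain ⟨l, rfl⟩ := hq
          exact hr _ (viewEmb_dist j l)
        · push Not at hq
          have : k ∈ outer quadEmb (content .dist s) := mem_outer.2 ⟨mem_content.2 hw, hq⟩
          rw [h1] at this
          obtain ⟨w, hwh, rfl⟩ := Finset.mem_image.1 this
          exact hr w (viewEmb_suspended (hh w hwh))
      · have h3 := h2 (r, k) (Finset.mem_filter.2 ⟨hw, hd⟩)
        by_cases hr' : r = Reg.honWork
        · subst hr'
          exact hr _ (viewEmb_frame j k)
        · exact hr _ (viewEmb_of_ne hr' h3.1 h3.2.1 hd)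
    exact ⟨key s h3.1 h5, key t h4.1 h6⟩

/-- The acceptance probability of a distinguisher that continues the suspended computation after a
session. -/
theorem acceptProb_view {j : ℕ} {h : Finset Wire} (hh : ∀ w ∈ h, IsSuspended j w) {σ σ' : QState}
    (hσ : σ'.op = embed quadEmb (h.image fun w => 4 * w.2 + 1) σ.op) {K : Op Wire}
    (hK : Supp (fun s => ∀ w ∈ s, w.1 ≠ Reg.msg ∧ w.1 ≠ Reg.honOut ∧ w.1 ≠ Reg.dist) K)
    {C : Circuit Wire} (hC : C.On {w | w.1 = Reg.honWork → (Nat.unpair w.2).1 ≠ j}) :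
    acceptProb (C.map (Gate.map viewPort)) σ' K =
      weight ((Reg.dist, 0) : Wire) (C.run (adjoin σ (embed (frameEmb j) h K))) := by
  have e : (C.map (Gate.map viewPort)).map (Gate.map distWire) = C.map (Gate.map (viewEmb j)) := by
    rw [List.map_map]
    refine List.map_congr_left fun g hg => ?_
    simp only [Function.comp, Gate.map_map]
    exact Gate.map_congr fun w hw => (viewEmb_eq (hC g hg w hw)).symm
  rw [acceptProb_eq, e, adjoin_eq_embed hh hσ hK, run_embed]
  have := viewEmb_dist j 0
  rw [mul_zero] at this
  have h0 := weight_embed (r := viewEmb j) (h := ∅) (by simp)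
    (C.run (adjoin σ (embed (frameEmb j) h K))) (Reg.dist, 0)
  rwa [this] at h0

/-! ### States of executions -/

section Agree

variable {W : Type} [DecidableEq W]

/-- The wires in `H` are classical: matrix entries between different values of them vanish. -/
def Agree (H : Set W) (K : Op W) : Prop := ∀ s t, K s t ≠ 0 → ∀ w ∈ H, w ∈ s ↔ w ∈ t

variable {H : Set W} {K : Op W}

theorem Agree.gate_off (hK : Agree H K) {g : Gate W} (hg : ∀ w ∈ g.wires, w ∉ H) :
    Agree H (g.apply K) := by
  intro s t hst w hw
  obtain ⟨s', t', h0, h1, h2⟩ := gate_supp g K hst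
  have hw' : w ∉ g.wires := fun h => hg w h hw
  rw [← h1 w hw', ← h2 w hw']
  exact hK _ _ h0 w hw

theorem Agree.run_off (hK : Agree H K) {C : Circuit W} (hC : C.On Hᶜ) : Agree H (C.run K) := by
  induction C generalizing K with
  | nil => exact hK
  | cons g C ih =>
    rw [Circuit.on_cons] at hC
    exact ih (hK.gate_off hC.1) hC.2

/-- Classical gates do not create superpositions. -/
theorem Agree.gate_classical (hK : Agree H K) {g : Gate W} (hg : g.IsClassical)
    (hH : ∀ w ∈ g.wires, w ∈ H) : Agree H (g.apply K) := by
  intro s t hst x hx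
  cases g with
  | had w => exact hg.elim
  | phase w => exact hg.elim
  | flip w =>
    have := hK _ _ hst x hx
    simp only [mem_toggle] at this
    tauto
  | cnot a w =>
    have ha : a ∈ H := hH a (by simp [Gate.wires])
    simp only [Gate.apply] at hst
    have h1 := hK _ _ hst x hx
    have h2 := hK _ _ hst a ha
    by_cases haw : a = w
    · simpa [haw] using h1
    · have e : ∀ s : Finset W, (a ∈ if a ∈ s ∧ a ≠ w then toggle w s else s) ↔ a ∈ s := by
        intro s; split_ifs <;> simp [mem_toggle, haw]
      rw [e, e] at h2
      simp only [h2] at h1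
      split_ifs at h1 with h3
      · simp only [mem_toggle] at h1; tauto
      · exact h1
  | ccnot a b w =>
    have ha : a ∈ H := hH a (by simp [Gate.wires])
    have hb : b ∈ H := hH b (by simp [Gate.wires])
    simp only [Gate.apply] at hst
    have h1 := hK _ _ hst x hx
    have h2 := hK _ _ hst a ha
    have h3 := hK _ _ hst b hb
    by_cases hn : a ≠ w ∧ b ≠ w
    · have e : ∀ s : Finset W, (a ∈ if a ∈ s ∧ b ∈ s ∧ a ≠ w ∧ b ≠ w then toggle w s else s) ↔
          a ∈ s := by
        intro s; split_ifs <;> simp [mem_toggle, hn.1]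
      have e' : ∀ s : Finset W, (b ∈ if a ∈ s ∧ b ∈ s ∧ a ≠ w ∧ b ≠ w then toggle w s else s) ↔
          b ∈ s := by
        intro s; split_ifs <;> simp [mem_toggle, hn.2]
      rw [e, e] at h2
      rw [e', e'] at h3
      simp only [h2, h3] at h1
      split_ifs at h1 with h4
      · simp only [mem_toggle] at h1; tauto
      · exact h1
    · simpa [hn] using h1
  | reset w =>
    simp only [Gate.apply] at hst
    split_ifs at hst with h
    · exact absurd rfl hst
    · push Not at h
      by_cases h0 : K s t = 0
      · rw [h0, zero_add] at hst
        have := hK _ _ hst x hx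
        by_cases hxw : x = w
        · subst hxw; exact iff_of_false h.1 h.2
        · simpa [hxw] using this
      · exact hK _ _ h0 x hx
  | coin w =>
    simp only [Gate.apply] at hst
    split_ifs at hst with h
    · by_cases hxw : x = w
      · subst hxw; exact h
      · by_cases h0 : K (s.erase w) (t.erase w) = 0
        · rw [h0, zero_add] at hst
          have := hK _ _ (right_ne_zero_of_mul hst) x hx
          simpa [hxw] using this
        · have := hK _ _ h0 x hx
          simpa [hxw] using this
    · exact absurd rfl hst

theorem Agree.run_classical (hK : Agree H K) {C : Circuit W} (hC : ∀ g ∈ C, g.IsClassical)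
    (hH : C.On H) : Agree H (C.run K) := by
  induction C generalizing K with
  | nil => exact hK
  | cons g C ih =>
    rw [Circuit.on_cons] at hH
    exact ih (hK.gate_classical (hC g (by simp)) hH.1) (fun g hg => hC g (by simp [hg])) hH.2

variable {R : W → Prop} [DecidablePred R]

theorem Agree.dephase (hK : Agree H K) : Agree (H ∪ {w | R w}) (dephase R K) := by
  intro s t hst w hw
  simp only [TwoPC.dephase] at hst
  split_ifs at hst with h
  · rcases hw with hw | hw
    · exact hK s t hst w hw
    · have := Finset.ext_iff.1 h w
      have hR : R w := hw
      simpa only [Finset.mem_filter, hR, and_true] using this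
  · exact absurd rfl hst

theorem Agree.transition (hK : Agree H K) (p : Finset W → Finset W → ℝ) :
    Agree H (transition R p K) := by
  intro s t hst w hw
  obtain ⟨h1, c, hc, -, h3⟩ := transition_supp p K hst
  by_cases hR : R w
  · have := Finset.ext_iff.1 h1 w
    simpa only [Finset.mem_filter, hR, and_true] using this
  · have := hK _ _ h3 w hw
    rwa [mem_setPart hc, mem_setPart hc, if_neg hR, if_neg hR] at this

end Agree

/-- The registers of the honest party and the message channel. -/
def honSet : Set Wire :=
  {w | w.1 = Reg.honWork ∨ w.1 = Reg.honInp ∨ w.1 = Reg.honOut ∨ w.1 = Reg.msg}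

/-- A density operator for which the registers of the honest party are classical. -/
structure IsState (K : Op Wire) : Prop where
  pos : Pos K
  tr : tr K = 1
  finSupp : FinSupp K
  agree : Agree honSet K

theorem IsState.activate_adv {K : Op Wire} (h : IsState K) (C : Circuit PWire) :
    IsState (activate advWire C K) := by
  rw [activate_eq]
  refine ⟨(h.pos.run _).dephase, ?_, (h.finSupp.run _).dephase, ?_⟩
  · rw [tr_dephase, tr_run h.finSupp, h.tr]
  · have h1 : Agree (honSet \ {w | w.1 = Reg.msg}) K := fun s t hst w hw => h.agree s t hst w hw.1
    have h2 := (h1.run_off (C := C.map (Gate.map advWire)) ?_).dephase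
      (R := fun w : Wire => w.1 = Reg.msg)
    · intro s t hst w hw
      refine h2 s t hst w ?_
      by_cases hm : w.1 = Reg.msg
      · exact Or.inr hm
      · exact Or.inl ⟨hw, hm⟩
    · refine Circuit.On.map (X := Set.univ) (fun _ _ _ _ => trivial) _ ?_
      rintro ⟨⟨⟩, k⟩ - <;> simp [advWire, honSet]

theorem IsState.activate_hon {K : Op Wire} (h : IsState K) {C : Circuit PWire}
    (hC : ∀ g ∈ C, g.IsClassical) : IsState (activate honWire C K) := by
  rw [activate_eq]
  refine ⟨(h.pos.run _).dephase, ?_, (h.finSupp.run _).dephase, ?_⟩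
  · rw [tr_dephase, tr_run h.finSupp, h.tr]
  · have h2 := (h.agree.run_classical (C := C.map (Gate.map honWire)) ?_ ?_).dephase
      (R := fun w : Wire => w.1 = Reg.msg)
    · exact fun s t hst w hw => h2 s t hst w (Or.inl hw)
    · intro g hg
      obtain ⟨g', hg', rfl⟩ := List.mem_map.1 hg
      have := hC g' hg'
      cases g' <;> trivial
    · refine Circuit.On.map (X := Set.univ) (fun _ _ _ _ => trivial) _ ?_
      rintro ⟨⟨⟩, k⟩ - <;> simp [honWire, honSet]

theorem IsState.transition {K : Op Wire} (h : IsState K) {R : Wire → Prop} [DecidablePred R]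
    {p : Finset Wire → Finset Wire → ℝ} (hp : ∀ c d, 0 ≤ p c d)
    (hp1 : ∀ c, (∀ w ∈ c, R w) → HasSum (fun d : {d : Finset Wire // ∀ w ∈ d, R w} => p c d) 1)
    (hF : FinSupp (transition R p K)) : IsState (transition R p K) :=
  ⟨h.pos.transition h.finSupp hp, by rw [tr_transition h.finSupp hp hp1, h.tr], hF,
    h.agree.transition p⟩

theorem hasSum_deterministic {R : Wire → Prop} {δ : Finset Wire → Finset Wire} {c : Finset Wire}
    (hδ : ∀ w ∈ δ c, R w) :
    HasSum (fun d : {d : Finset Wire // ∀ w ∈ d, R w} => if d.1 = δ c then (1 : ℝ) else 0) 1 := by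
  have := hasSum_ite_eq (⟨δ c, hδ⟩ : {d : Finset Wire // ∀ w ∈ d, R w}) (1 : ℝ)
  convert this using 3
  exact (Subtype.ext_iff (a1 := _) (a2 := ⟨δ c, hδ⟩)).symm

theorem ite_one_nonneg (p : Prop) [Decidable p] : (0 : ℝ) ≤ if p then 1 else 0 := by
  split_ifs <;> norm_num

theorem IsState.clearChannel {K : Op Wire} (h : IsState K) : IsState (clearChannel K) :=
  h.transition (fun _ _ => ite_one_nonneg _)
    (fun c _ => hasSum_deterministic (δ := fun _ => ∅) (c := c) (by simp)) h.finSupp.clearChannel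

theorem IsState.handover {K : Op Wire} (h : IsState K) : IsState (handover K) :=
  h.transition (fun _ _ => ite_one_nonneg _)
    (fun _ _ => hasSum_deterministic (δ := fun c => fill .honInp (content .honOut c))
      fun _ hw => Or.inr (Or.inl (mem_fill.1 hw).1)) h.finSupp.handover

theorem IsState.deliver {K : Op Wire} (h : IsState K) : IsState (deliver K) :=
  h.transition (fun _ _ => ite_one_nonneg _)
    (fun c hc => hasSum_deterministic (δ := fun a => if content .msg a = ∅ then a else ∅)
      (by split_ifs; exacts [hc, by simp])) h.finSupp.deliver

/-- The trusted party chooses the new values with probabilities that add up to `1`. -/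
theorem hasSum_trusted (c : Bool) (μ : PMF (Bool → Val)) :
    HasSum (fun d : {d : Finset Wire // ∀ w ∈ d, w.1 = Reg.advInp ∨ w.1 = Reg.advOut ∨
        w.1 = Reg.honInp ∨ w.1 = Reg.honOut} =>
      if content .advOut d.1 = ∅ ∧ content .honOut d.1 = ∅ then
        (μ (fun b => Val.ofWires (content (if b = c then .advInp else .honInp) d.1))).toReal
      else 0) 1 := by
  have h1 : HasSum (fun y => (μ y).toReal) 1 := by
    have h := ENNReal.hasSum_toReal (f := fun y => μ y) (by rw [μ.tsum_coe]; exact ENNReal.one_ne_top)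
    rwa [← ENNReal.tsum_toReal_eq (fun y => μ.apply_ne_top y), μ.tsum_coe, ENNReal.toReal_one] at h
  let e : (Bool → Val) → {d : Finset Wire // ∀ w ∈ d, w.1 = Reg.advInp ∨ w.1 = Reg.advOut ∨
        w.1 = Reg.honInp ∨ w.1 = Reg.honOut} := fun y =>
    ⟨fill .advInp (y c).toWires ∪ fill .honInp (y (!c)).toWires, fun w hw => by
      rcases Finset.mem_union.1 hw with h | h
      · exact Or.inl (mem_fill.1 h).1
      · exact Or.inr (Or.inr (Or.inl (mem_fill.1 h).1))⟩
  have hc : (!c) ≠ c := by cases c <;> simp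
  have hval : ∀ y, (fun b => Val.ofWires (content (if b = c then .advInp else .honInp) (e y).1)) = y := by
    intro y
    have ha : content .advInp (e y).1 = (y c).toWires := by
      ext k; simp [e, mem_content, mem_fill]
    have hb : content .honInp (e y).1 = (y (!c)).toWires := by
      ext k; simp [e, mem_content, mem_fill]
    funext b
    by_cases h : b = c
    · subst h
      rw [if_pos rfl, ha, Val.ofWires_toWires]
    · obtain rfl : b = !c := by cases b <;> cases c <;> simp_all
      rw [if_neg h, hb, Val.ofWires_toWires]
  have hout : ∀ y, content .advOut (e y).1 = ∅ ∧ content .honOut (e y).1 = ∅ := by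
    intro y
    constructor <;> (ext k; simp [e, mem_content, mem_fill])
  have hinj : Function.Injective e := fun y y' h => by rw [← hval y, h, hval]
  rw [← hinj.hasSum_iff]
  · convert h1 using 1
    funext y
    simp only [Function.comp, hval, hout, and_self, if_true]
  · rintro ⟨d, hd⟩ hn
    dsimp only
    split_ifs with h
    · refine absurd ⟨fun b => Val.ofWires (content (if b = c then .advInp else .honInp) d), ?_⟩ hn
      apply Subtype.ext
      ext ⟨r, k⟩
      have h2 : ∀ r, (r, k) ∈ d → r = Reg.advInp ∨ r = Reg.honInp := by
        intro r hr
        rcases hd _ hr with h' | h' | h' | h' <;> dsimp only at h' <;> subst h'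
        · exact Or.inl rfl
        · have := mem_content.2 hr; rw [h.1] at this; simp at this
        · exact Or.inr rfl
        · have := mem_content.2 hr; rw [h.2] at this; simp at this
      simp only [e, if_true, hc, if_false, Val.toWires_ofWires, Finset.mem_union, mem_fill,
        mem_content]
      constructor
      · rintro (⟨rfl, h'⟩ | ⟨rfl, h'⟩) <;> exact h'
      · intro h'
        rcases h2 r h' with rfl | rfl
        · exact Or.inl ⟨rfl, h'⟩
        · exact Or.inr ⟨rfl, h'⟩
    · rfl

theorem IsState.trusted {K : Op Wire} (h : IsState K) (g : Functionality) (lam : ℕ) (c : Bool) :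
    IsState (trusted g lam c K) :=
  h.transition (fun a d => by split_ifs <;> simp)
    (fun a _ => hasSum_trusted c _) (h.finSupp.trusted lam c g)

theorem IsState.idealCall {K : Op Wire} (h : IsState K) (g : Functionality) (lam : ℕ) (c : Bool)
    (C D : Circuit PWire) : IsState (idealCall g lam c C D K) :=
  (((h.clearChannel.activate_adv C).trusted g lam c).activate_adv D).deliver

theorem isState_start (c : Bool) (x : Bool → Val) (ρ : QState) : IsState (start c x ρ) := by
  have hh : ∀ w ∈ fill .advInp (x c).toWires ∪ fill .honOut (x (!c)).toWires,
      ∀ v, advEmb v ≠ w := by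
    rintro w hw v rfl
    rcases Finset.mem_union.1 hw with h | h <;> simpa [advEmb] using (mem_fill.1 h).1
  refine ⟨?_, ?_, ?_, ?_⟩
  · rw [start_eq_embed]; exact ρ.op_pos.embed _ _
  · rw [start_eq_embed, tr_embed hh, ρ.tr_op]
  · rw [start_eq_embed]; exact ρ.op_finSupp.embed _ _
  · intro s t hst w hw
    simp only [start] at hst
    split_ifs at hst with h
    · have h1 := Finset.ext_iff.1 (h.1.trans h.2.symm) w
      have : w.1 ≠ Reg.advWork := by rintro e; simp [honSet, e] at hw
      simpa only [Finset.mem_filter, this, ne_eq, not_false_eq_true, and_true] using h1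
    · exact absurd rfl hst

/-- Ideal calls preserve a bound `M'` on the wires in use if the inputs for the trusted party are
bounded by `M`. -/
theorem Bdd.idealCall {M M' : ℕ} {K : Op Wire} (h : Bdd M' K)
    (hs : Supp (fun s => ∀ w ∈ s, w.1 = Reg.advOut ∨ w.1 = Reg.honOut → w.2 < M) K)
    {g : Functionality} {lam : ℕ} {c : Bool} {C D : Circuit PWire} (hC : C.On {w | w.2 < M})
    (hM : M ≤ M') (hD : D.On {w | w.2 < M'}) {q : Polynomial ℕ}
    (hq : ∀ lam x, ∀ y ∈ (g.eval lam x).support, ∀ b,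
      (y b).length ≤ q.eval (lam + (x false).length + (x true).length))
    (hM' : q.eval (lam + 2 * M) < M') : Bdd M' (idealCall g lam c C D K) := by
  have h1 : Supp (fun s : Finset Wire => ∀ w ∈ s, w.1 = Reg.advOut ∨ w.1 = Reg.honOut → w.2 < M)
      (TwoPC.activate advWire C (TwoPC.clearChannel K)) := by
    refine Supp.activate (X := {w | w.2 < M}) (hs.transition fun s c hc _ h w hw hr => ?_)
      (fun s s' h h' w hw hr => ?_) (hC.mono fun w hw => by simpa [advWire_snd] using hw)
    · refine h w ((mem_setPart hc).2 ?_) hr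
      rw [if_neg (by rcases hr with e | e <;> simp [e])]
      exact hw
    · by_cases hM : w.2 < M
      · exact hM
      · exact h w ((h' w hM).2 hw) hr
  exact (((h.clearChannel.activate advWire_snd (hC.mono fun w hw => lt_of_lt_of_le hw hM)).trusted lam c
    h1 hq hM').activate advWire_snd hD).deliver

/-! ### Replacing one session by an ideal call -/

section Empty

variable {W : Type} [DecidableEq W] {R : W → Prop} [DecidablePred R]

theorem Supp.empty {Φ : Finset W → Prop} {K : Op W} (hK : Supp Φ K) :
    Supp (fun s => (∀ w ∈ s, ¬ R w) ∧ ∃ u, Φ u ∧ ∀ w, ¬ R w → (w ∈ s ↔ w ∈ u))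
      (TwoPC.transition R (fun _ d => if d = ∅ then 1 else 0) K) := by
  refine hK.transition fun s c hc hp h => ?_
  split_ifs at hp with h1
  · refine ⟨fun w hw hR => ?_, _, h, fun w hw => ?_⟩
    · have : w ∈ s.filter R := Finset.mem_filter.2 ⟨hw, hR⟩
      rw [h1] at this
      simp at this
    · rw [mem_setPart hc, if_neg hw]
  · simp at hp

end Empty

/-- The state of an execution between two steps of the calling protocol: the adversary is packed
into `N` wires and holds the input `v`, the honest party uses the frame `0` of its work space, and
what it hands over has length less than `M₁`. -/
structure Ready (N M₁ : ℕ) (v : Val) (K : Op Wire) : Prop where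
  state : IsState K
  supp : Supp (fun s => AdvReady N v s ∧ ∀ w ∈ s, w.1 ≠ Reg.dist ∧ ¬ IsSuspended 0 w ∧
    (w.1 = Reg.honOut → w.2 < M₁)) K

/-- The state in which a session or an ideal call begins: pending messages and the last value that
the honest party has received are discarded, which makes no difference to either. -/
def fresh (K : Op Wire) : Op Wire :=
  transition (fun w => w.1 = Reg.honInp) (fun _ d => if d = ∅ then 1 else 0) (clearChannel K)

theorem IsState.fresh {K : Op Wire} (h : IsState K) : IsState (fresh K) := by
  refine h.clearChannel.transition (fun _ _ => ite_one_nonneg _)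
    (fun c _ => hasSum_deterministic (δ := fun _ => ∅) (c := c) (by simp)) ?_
  refine h.clearChannel.finSupp.transition fun F => ⟨∅, fun c d _ _ h => ?_⟩
  split_ifs at h with h1
  · exact h1.subset
  · simp at h

theorem handover_fresh {K : Op Wire} (hK : FinSupp K) : handover (fresh K) = handover K := by
  have hc : ∀ (r : Reg) (hr : r ≠ .honOut) (c : Finset Wire),
      content .honOut (c.filter fun w => ¬ w.1 = r) = content .honOut c := by
    intro r hr c
    ext k
    simp only [mem_content, Finset.mem_filter, and_iff_left_iff_imp]
    exact fun _ e => hr e.symm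
  rw [fresh, handover, transition_absorb (fun w hw => Or.inr (Or.inl hw)) _
    (fun c d => by rw [hc _ (by simp)]) hK.clearChannel, clearChannel,
    transition_absorb (fun w hw => Or.inl hw) _ (fun c d => by rw [hc _ (by simp)]) hK]

theorem dephase_transition {R R' : Wire → Prop} [DecidablePred R] [DecidablePred R']
    (h : ∀ w, R' w → ¬ R w) (p : Finset Wire → Finset Wire → ℝ) (K : Op Wire) :
    dephase R (transition R' p K) = transition R' p (dephase R K) := by
  rw [dephase_eq_frameOp, dephase_eq_frameOp]
  exact (dephase_frame.transition_eq (R := R') h p K).symm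

/-- An ideal call begins by discarding messages and overwrites the register of received values. -/
theorem idealCall_fresh {K : Op Wire} (hK : FinSupp K) (g : Functionality) (lam : ℕ) (c : Bool)
    (C D : Circuit PWire) : idealCall g lam c C D (fresh K) = idealCall g lam c C D K := by
  have h1 : clearChannel (fresh K) = fresh K := by
    refine transition_empty_of_supp ?_
    have h2 : Supp (fun s : Finset Wire => ∀ w ∈ s, ¬ w.1 = Reg.msg) (fresh K) := by
      refine (Supp.empty (R := fun w : Wire => w.1 = Reg.honInp)
        (Supp.empty (R := fun w : Wire => w.1 = Reg.msg) (Φ := fun _ => True)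
          (fun _ _ _ => ⟨trivial, trivial⟩))).mono ?_
      rintro s ⟨h1, u, ⟨h2, -⟩, h3⟩ w hw
      exact h2 w ((h3 w (h1 w hw)).1 hw)
    exact h2
  have h2 : activate advWire C (fresh K) = transition (fun w => w.1 = Reg.honInp)
      (fun _ d => if d = ∅ then 1 else 0) (activate advWire C (clearChannel K)) := by
    rw [fresh, activate_eq, activate_eq, run_transition _ hK.clearChannel, dephase_transition]
    · intro w hw; rw [hw]; simp
    · refine Circuit.On.map (X := Set.univ) (fun _ _ _ _ => trivial) _ ?_
      rintro ⟨⟨⟩, k⟩ - <;> simp [advWire]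
  rw [idealCall, h1, h2, trusted, transition_absorb (fun w hw => Or.inr (Or.inr (Or.inl hw)))]
  · rfl
  · intro a d
    have hc : ∀ r : Reg, r ≠ .honInp →
        content r (a.filter fun w => ¬ w.1 = Reg.honInp) = content r a := by
      intro r hr
      ext k
      simp only [mem_content, Finset.mem_filter, and_iff_left_iff_imp]
      exact fun _ e => hr e
    have : ∀ b, content (if b = c then Reg.advOut else .honOut)
        (a.filter fun w => ¬ w.1 = Reg.honInp) = content (if b = c then .advOut else .honOut) a :=
      fun b => hc _ (by split_ifs <;> simp)
    simp only [this]
  · exact hK.clearChannel.activate _ _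

theorem exec_session_fresh {m : ℕ} (f : Fin m → Functionality) (lam : ℕ) (c : Bool)
    (P : List (Step m)) (A : List (Circuit PWire)) {K : Op Wire} (hK : FinSupp K) :
    exec f lam c (session P) A (fresh K) = exec f lam c (session P) A K := by
  rw [session, List.cons_append, exec, exec, handover_fresh hK]

/-- In the state `fresh K` everything but the work space of the adversary is classical, and the
registers for inputs of the honest party and for messages are empty. -/
theorem Ready.fresh_supp {N M₁ : ℕ} {v : Val} {K : Op Wire} (hK : Ready N M₁ v K) :
    Supp (fun s => AdvReady N v s ∧ ∀ w ∈ s, w.1 ≠ Reg.dist ∧ ¬ IsSuspended 0 w ∧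
      (w.1 = Reg.honOut → w.2 < M₁) ∧ w.1 ≠ Reg.msg ∧ w.1 ≠ Reg.honInp) (fresh K) := by
  refine (Supp.empty (R := fun w : Wire => w.1 = Reg.honInp)
    (Supp.empty (R := fun w : Wire => w.1 = Reg.msg) hK.supp)).mono ?_
  rintro s ⟨h1, u, ⟨h2, u', ⟨h3, h4⟩, h5⟩, h6⟩
  have hadv : ∀ r k, r ≠ Reg.msg → r ≠ Reg.honInp → ((r, k) ∈ s ↔ (r, k) ∈ u') := fun r k h h' =>
    (h6 (r, k) h').trans (h5 (r, k) h)
  refine ⟨⟨fun k => ?_, fun k => ?_, fun k => ?_⟩, fun w hw => ?_⟩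
  · rw [hadv _ _ (by simp) (by simp)]; exact h3.1 k
  · rw [hadv _ _ (by simp) (by simp)]; exact h3.2.1 k
  · rw [hadv _ _ (by simp) (by simp)]; exact h3.2.2 k
  · have h7 := h1 w hw
    have h8 := h2 w ((h6 w h7).1 hw)
    obtain ⟨h9, h10, h11⟩ := h4 w ((hadv w.1 w.2 h8 h7).1 hw)
    exact ⟨h9, h10, h11, h8, h7⟩

theorem advEmb_ne {w : Wire} (h : w.1 ≠ Reg.advWork) (k : ℕ) : advEmb k ≠ w := by
  rintro rfl; exact h rfl

theorem embed_frameEmb_start {j : ℕ} {h : Finset Wire} (hh : ∀ w ∈ h, IsSuspended j w) (c : Bool)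
    (x : Bool → Val) (ρ : QState) : embed (frameEmb j) h (start c x ρ) =
      embed advEmb (h ∪ (fill .advInp (x c).toWires ∪ fill .honOut (x (!c)).toWires)) ρ.op := by
  rw [start_eq_embed, embed_embed _ _ (fun w hw => isSuspended_iff.1 (hh w hw))]
  have h1 : advEmb.trans (frameEmb j) = advEmb := by ext k : 1; rfl
  have h2 : ∀ (r : Reg) (a : Finset ℕ), r ≠ .honWork → (fill r a).map (frameEmb j) = fill r a := by
    intro r a hr
    ext w
    rw [Finset.mem_map]
    constructor
    · rintro ⟨w', hw, rfl⟩
      rw [frameEmb_of_ne (by rw [(mem_fill.1 hw).1]; exact hr)]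
      exact hw
    · intro hw
      exact ⟨w, hw, frameEmb_of_ne (by rw [(mem_fill.1 hw).1]; exact hr)⟩
  rw [h1, Finset.map_union, h2 _ _ (by simp), h2 _ _ (by simp)]

/-- The state in which a session begins is a mixture of initial states of isolated sessions. The
components correspond to the values `h` of all wires outside of the adversary's work space: those of
suspended frames, the input `v` and the value that the honest party hands over. -/
theorem Ready.exists_mixture {N M₁ : ℕ} {v : Val} {K : Op Wire} (hK : Ready N M₁ v K) {j : ℕ}
    (hj : j ≠ 0) {M : ℕ} (hM : Bdd M K) (c : Bool) :
    ∃ (I : Finset (Finset Wire)) (p : Finset Wire → ℝ) (ρ : Finset Wire → QState),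
      (∀ h ∈ I, 0 ≤ p h) ∧ ∑ h ∈ I, p h = 1 ∧ (∀ h, (ρ h).qubits = N) ∧
      fresh K = linComb I (fun h => (p h : ℂ)) (fun h => embed advEmb h (ρ h).op) ∧
      ∀ h ∈ I, p h ≠ 0 → ∃ (a : Finset Wire) (x : Bool → Val), (∀ w ∈ a, IsSuspended j w) ∧
        (∀ w ∈ a, w.2 < M) ∧ x c = v ∧ (x (!c)).length ≤ M₁ ∧
        embed advEmb h (ρ h).op = embed (frameEmb j) a (start c x (ρ h)) := by
  have hst := hK.state.fresh
  have hsupp := hK.fresh_supp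
  have hbdd : Bdd M (fresh K) := by
    refine (Supp.empty (R := fun w : Wire => w.1 = Reg.honInp)
      (Supp.empty (R := fun w : Wire => w.1 = Reg.msg) hM)).mono ?_
    rintro s ⟨h1, u, ⟨h2, u', h3, h5⟩, h6⟩ w hw
    have h7 := (h6 w (h1 w hw)).1 hw
    exact h3 w ((h5 w (h2 w h7)).1 h7)
  obtain ⟨F, hF⟩ := hst.finSupp
  -- all wires outside of the adversary's work space are classical
  have hdiag : ∀ s t, fresh K s t ≠ 0 → outer advEmb s = outer advEmb t := by
    intro s t hst0
    obtain ⟨⟨⟨h1, h2, h3⟩, h4⟩, ⟨⟨h5, h6, h7⟩, h8⟩⟩ := hsupp s t hst0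
    have h9 := hst.agree s t hst0
    rw [outer_advEmb, outer_advEmb]
    ext ⟨r, k⟩
    simp only [Finset.mem_filter]
    refine and_congr_left fun hr => ?_
    cases r with
    | advWork => exact absurd rfl hr
    | advInp => rw [h1, h5]
    | advOut => exact iff_of_false (h2 k) (h6 k)
    | honWork => exact h9 _ (Or.inl rfl)
    | honInp => exact h9 _ (Or.inr (Or.inl rfl))
    | honOut => exact h9 _ (Or.inr (Or.inr (Or.inl rfl)))
    | msg => exact h9 _ (Or.inr (Or.inr (Or.inr rfl)))
    | dist => exact iff_of_false (fun h => (h4 _ h).1 rfl) (fun h => (h8 _ h).1 rfl)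
  have hmem : ∀ (h : Finset Wire) (u : Finset ℕ) (k : ℕ), k ∈ u → advEmb k ∈ join advEmb h u :=
    fun h u k hk => Finset.mem_union_left _ (Finset.mem_map_of_mem _ hk)
  have hcs : ∀ (h : Finset Wire) (s t : Finset ℕ), compress advEmb h (fresh K) s t ≠ 0 →
      s ⊆ Finset.range N ∧ t ⊆ Finset.range N := by
    intro h s t h0
    obtain ⟨⟨⟨-, -, h1⟩, -⟩, ⟨⟨-, -, h2⟩, -⟩⟩ := hsupp _ _ h0
    exact ⟨fun k hk => Finset.mem_range.2 (h1 k (hmem h s k hk)),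
      fun k hk => Finset.mem_range.2 (h2 k (hmem h t k hk))⟩
  have hex := fun h => exists_qstate_smul (hcs h) (hst.pos.compress advEmb h)
  choose p ρ hp htr hq hρ using hex
  have hdec : fresh K = linComb (outer advEmb F).powerset (fun h => (p h : ℂ))
      (fun h => embed advEmb h (ρ h).op) := by
    conv_lhs => rw [eq_linComb_embed advEmb hF hdiag]
    funext s t
    refine Finset.sum_congr rfl fun h _ => ?_
    simp only [embed, one_mul, hρ]
    split_ifs <;> simp
  have houter : ∀ h ∈ (outer advEmb F).powerset, ∀ w ∈ h, ∀ v, advEmb v ≠ w := fun h hh w hw =>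
    (mem_outer.1 (Finset.mem_powerset.1 hh hw)).2
  refine ⟨(outer advEmb F).powerset, p, ρ, fun h _ => hp h, ?_, hq, hdec, ?_⟩
  · have h1 := hst.tr
    rw [hdec, tr_linComb _ fun h _ => (ρ h).op_finSupp.embed _ _] at h1
    rw [Finset.sum_congr rfl fun h hh => by rw [tr_embed (houter h hh), (ρ h).tr_op, mul_one]] at h1
    exact_mod_cast h1
  · intro h hh hp0
    obtain ⟨u, hu⟩ : ∃ u, compress advEmb h (fresh K) u u ≠ 0 := by
      by_contra hn
      push Not at hn
      have := htr h
      rw [tr, tsum_congr hn, tsum_zero] at this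
      exact hp0 (by exact_mod_cast this.symm)
    obtain ⟨⟨⟨h1, h2, -⟩, h4⟩, -⟩ := hsupp _ _ hu
    obtain ⟨h5, -⟩ := hbdd _ _ hu
    have hin : ∀ w, w.1 ≠ Reg.advWork → (w ∈ join advEmb h u ↔ w ∈ h) := by
      intro w hw
      rw [join, Finset.mem_union, Finset.mem_map]
      refine or_iff_right ?_
      rintro ⟨k, -, hk⟩
      exact advEmb_ne hw k hk
    have hmemh : ∀ w ∈ h, w ∈ join advEmb h u := fun w hw => Finset.mem_union_right _ hw
    -- the frame `0` of the calling protocol is the only one in use, and it is suspended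
    have hsus : ∀ w ∈ h, w.1 = Reg.honWork → IsSuspended j w := by
      intro w hw hr
      refine ⟨hr, fun e => ?_⟩
      have := (h4 w (hmemh w hw)).2.1
      exact this ⟨hr, by rw [e]; exact hj⟩
    let x : Bool → Val := fun b => if b = c then v else Val.ofWires (content .honOut h)
    have hxc : x c = v := if_pos rfl
    have hxn : x (!c) = Val.ofWires (content .honOut h) := if_neg (by cases c <;> simp)
    refine ⟨h.filter (fun w => w.1 = Reg.honWork), x, ?_, ?_, hxc, ?_, ?_⟩
    · intro w hw
      obtain ⟨hw, hr⟩ := Finset.mem_filter.1 hw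
      exact hsus w hw hr
    · intro w hw
      exact h5 w (hmemh w (Finset.mem_filter.1 hw).1)
    · rw [hxn]
      refine Val.length_ofWires_le fun k hk => ?_
      exact (h4 _ (hmemh _ (mem_content.1 hk))).2.2.1 rfl
    · rw [embed_frameEmb_start fun w hw => hsus w (Finset.mem_filter.1 hw).1 (Finset.mem_filter.1 hw).2,
        hxc, hxn, Val.toWires_ofWires]
      congr 1
      ext ⟨r, k⟩
      simp only [Finset.mem_union, Finset.mem_filter, mem_fill, mem_content]
      constructor
      · intro hw
        have h6 := h4 _ (hmemh _ hw)
        cases r with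
        | advWork => exact absurd rfl (houter h hh _ hw k)
        | advInp => exact Or.inr (Or.inl ⟨rfl, (h1 k).1 (hmemh _ hw)⟩)
        | advOut => exact absurd (hmemh _ hw) (h2 k)
        | honWork => exact Or.inl ⟨hw, rfl⟩
        | honInp => exact absurd rfl h6.2.2.2.2
        | honOut => exact Or.inr (Or.inr ⟨rfl, hw⟩)
        | msg => exact absurd rfl h6.2.2.2.1
        | dist => exact absurd rfl h6.1
      · rintro (⟨hw, -⟩ | ⟨rfl, hw⟩ | ⟨rfl, hw⟩)
        · exact hw
        · exact (hin _ (by simp)).1 ((h1 k).2 hw)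
        · exact hw

section Session

variable {m : ℕ} (f : Fin m → Functionality) (lam : ℕ) (c : Bool)

/-- An execution in frame `j` does not touch what is suspended. -/
theorem exec_embed_frame (j : ℕ) (h : Finset Wire) (P : List (Step m)) (A : List (Circuit PWire))
    (K : Op Wire) : exec f lam c (P.map (Step.inFrame j)) A (embed (frameEmb j) h K) =
      embed (frameEmb j) h (exec f lam c P A K) := by
  have := (isFrame_embed (frameEmb j) h).exec_eq f lam c (h := inFrame j) (hA := fun w => w)
    (Y := Set.univ)
    (fun w hw => ⟨trivial, frameEmb_of_ne (by rcases hw with h | h | h <;> rw [h] <;> simp)⟩)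
    (fun w => ⟨trivial, by obtain ⟨⟨⟩, k⟩ := w <;> rfl⟩)
    (fun w _ => ⟨trivial, by obtain ⟨⟨⟩, k⟩ := w <;> rfl⟩) P
    (fun _ _ w hw => ⟨trivial, frameEmb_of_ne (by rcases hw with h | h <;> rw [h] <;> simp)⟩) A
    (fun _ _ _ _ _ _ => trivial) K
  rwa [Circuit.map_map_id, ← Step.inFrame_eq, ← embed_eq_frameOp, ← embed_eq_frameOp] at this

theorem Supp.transition_of {W : Type} [DecidableEq W] {Φ : Finset W → Prop} {R : W → Prop}
    [DecidablePred R] {K : Op W} (hK : Supp Φ K)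
    (hΦ : ∀ s s', Φ s' → (∀ w, ¬ R w → (w ∈ s' ↔ w ∈ s)) → Φ s) (p : Finset W → Finset W → ℝ) :
    Supp Φ (TwoPC.transition R p K) :=
  hK.transition fun s _ hc _ h => hΦ s _ h fun w hw => by rw [mem_setPart hc, if_neg hw]

/-- A property of basis states is preserved by executions in the plain model if it does not depend
on the wires that are in use. -/
theorem Supp.exec_plain {Φ : Finset Wire → Prop} {X : Set Wire} (hX : honSet ⊆ X)
    (hΦ : ∀ s s', Φ s' → (∀ w ∉ X, w ∈ s' ↔ w ∈ s) → Φ s) (f : Fin 0 → Functionality)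
    (P : List (Step 0)) {A : List (Circuit PWire)} (hA : ∀ C ∈ A, C.On {w | advWire w ∈ X})
    {K : Op Wire} (hK : Supp Φ K) : Supp Φ (exec f lam c P A K) := by
  refine exec_induction f lam c (Supp Φ) P A (fun b C K _ _ h => h.activate hΦ ?_)
    (fun C hC K h => h.activate hΦ ?_) (fun i => i.elim0)
    (fun _ K h => h.transition_of (fun s s' h1 h2 => hΦ s s' h1 fun w hw => h2 w ?_) _) K hK
  · rintro g - ⟨⟨⟩, k⟩ - <;> exact hX (by simp [honWire, honSet])
  · rcases hC with hC | rfl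
    · exact hA C hC
    · exact Circuit.on_nil
  · intro hR
    refine hw (hX ?_)
    rcases hR with h | h | h <;> simp [honSet, h]

/-- The circuit acts on the message channel and the first `N` wires of the work space. -/
def Packed (N : ℕ) (C : Circuit PWire) : Prop :=
  C.On {w | w.1 = Port.msg ∨ w.1 = Port.work ∧ w.2 < N}

theorem advReady_congr {N : ℕ} {v : Val} {s s' : Finset Wire} (h : AdvReady N v s')
    (hs : ∀ w ∉ honSet ∪ {w : Wire | w.1 = Reg.advWork ∧ w.2 < N}, w ∈ s' ↔ w ∈ s) :
    AdvReady N v s := by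
  obtain ⟨h1, h2, h3⟩ := h
  refine ⟨fun k => ?_, fun k => ?_, fun k hk => ?_⟩
  · rw [← hs _ (by simp [honSet])]; exact h1 k
  · rw [← hs _ (by simp [honSet])]; exact h2 k
  · by_contra hn
    exact hn (h3 k ((hs _ (by simp [honSet]; omega)).2 hk))

theorem Packed.on_adv {N : ℕ} {C : Circuit PWire} (h : Packed N C) :
    C.On {w | advWire w ∈ honSet ∪ {w : Wire | w.1 = Reg.advWork ∧ w.2 < N}} := by
  refine h.mono ?_
  rintro ⟨p, k⟩ (hw | ⟨hw, hk⟩)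
  · dsimp only at hw; subst hw
    exact Or.inl (by simp [advWire, honSet])
  · dsimp only at hw; subst hw
    exact Or.inr ⟨rfl, hk⟩

/-- Packed adversaries stay ready during sessions. -/
theorem Supp.advReady_exec {N : ℕ} {v : Val} (f : Fin 0 → Functionality) (P : List (Step 0))
    {A : List (Circuit PWire)} (hA : ∀ C ∈ A, Packed N C) {K : Op Wire}
    (hK : Supp (AdvReady N v) K) : Supp (AdvReady N v) (exec f lam c P A K) :=
  hK.exec_plain lam c Set.subset_union_left (fun _ _ h h' => advReady_congr h h') f P
    fun C hC => (hA C hC).on_adv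

theorem supp_handover (K : Op Wire) :
    Supp (fun s => ∀ w ∈ s, w.1 ≠ Reg.msg ∧ w.1 ≠ Reg.honOut) (handover K) := by
  refine Supp.transition (Φ := fun _ => True) (fun _ _ _ => ⟨trivial, trivial⟩) ?_
  intro s c' _ hp _ w hw
  split_ifs at hp with h
  · have key : ¬ (w.1 = Reg.msg ∨ w.1 = Reg.honOut) := by
      intro hr
      have : w ∈ fill .honInp (content .honOut c') :=
        h ▸ Finset.mem_filter.2 ⟨hw, by tauto⟩
      have := (mem_fill.1 this).1
      rcases hr with hr | hr <;> rw [hr] at this <;> simp at this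
    tauto
  · simp at hp

theorem supp_noDist_start (c : Bool) (x : Bool → Val) (ρ : QState) :
    Supp (fun s => ∀ w ∈ s, w.1 ≠ Reg.dist) (start c x ρ) := by
  have key : ∀ s : Finset Wire, s.filter (fun w => w.1 ≠ Reg.advWork) =
      fill .advInp (x c).toWires ∪ fill .honOut (x (!c)).toWires → ∀ w ∈ s, w.1 ≠ Reg.dist := by
    intro s hs w hw hd
    have : w ∈ fill .advInp (x c).toWires ∪ fill .honOut (x (!c)).toWires :=
      hs ▸ Finset.mem_filter.2 ⟨hw, by rw [hd]; simp⟩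
    rcases Finset.mem_union.1 this with h | h <;>
      (have := (mem_fill.1 h).1; rw [hd] at this; simp at this)
  intro s t hst
  simp only [start] at hst
  split_ifs at hst with h
  · exact ⟨key s h.1, key t h.2⟩
  · exact absurd rfl hst

theorem supp_advReady_start (c : Bool) (x : Bool → Val) (ρ : QState) :
    Supp (AdvReady ρ.qubits (x c)) (start c x ρ) := by
  have key : ∀ s : Finset Wire, s.filter (fun w => w.1 ≠ Reg.advWork) =
      fill .advInp (x c).toWires ∪ fill .honOut (x (!c)).toWires →
      content .advWork s ⊆ Finset.range ρ.qubits → AdvReady ρ.qubits (x c) s := by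
    intro s hs hq
    have hmem : ∀ w : Wire, w.1 ≠ Reg.advWork →
        (w ∈ s ↔ w ∈ fill .advInp (x c).toWires ∪ fill .honOut (x (!c)).toWires) := by
      intro w hw
      rw [← hs, Finset.mem_filter]
      exact (and_iff_left hw).symm
    refine ⟨fun k => ?_, fun k => ?_, fun k hk => Finset.mem_range.1 (hq (mem_content.2 hk))⟩
    · rw [hmem _ (by simp)]; simp [mem_fill]
    · rw [hmem _ (by simp)]; simp [mem_fill]
  intro s t hst
  simp only [start] at hst
  split_ifs at hst with h
  · obtain ⟨h1, h2⟩ := ρ.op_supp hst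
    exact ⟨key s h.1 h1, key t h.2 h2⟩
  · exact absurd rfl hst

/-- After a session, no messages are pending and no value is being handed over. -/
theorem supp_session (f : Fin 0 → Functionality) (P : List (Step 0)) {A : List (Circuit PWire)}
    {K : Op Wire} (hK : Supp (fun s => ∀ w ∈ s, w.1 ≠ Reg.dist) K) :
    Supp (fun s => ∀ w ∈ s, w.1 ≠ Reg.msg ∧ w.1 ≠ Reg.honOut ∧ w.1 ≠ Reg.dist)
      (exec f lam c (session P) A K) := by
  have h1 : Supp (fun s => ∀ w ∈ s, w.1 ≠ Reg.dist) (exec f lam c (session P) A K) := by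
    refine hK.exec_plain lam c (X := {w | w.1 ≠ Reg.dist}) ?_ ?_ f _ ?_
    · rintro w (h | h | h | h) <;> simp [h]
    · intro s s' h h' w hw hd
      exact h w ((h' w (by simpa using hd)).2 hw) hd
    · rintro C - g - ⟨⟨⟩, k⟩ - <;> simp [advWire]
  have h2 : Supp (fun s => ∀ w ∈ s, w.1 ≠ Reg.msg ∧ w.1 ≠ Reg.honOut)
      (exec f lam c (session P) A K) := by
    rw [session, exec_append]
    exact supp_handover _
  intro s t hst
  exact ⟨fun w hw => ⟨((h2 s t hst).1 w hw).1, ((h2 s t hst).1 w hw).2, (h1 s t hst).1 w hw⟩,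
    fun w hw => ⟨((h2 s t hst).2 w hw).1, ((h2 s t hst).2 w hw).2, (h1 s t hst).2 w hw⟩⟩

/-- After an ideal call, no messages are pending and no value is being handed over. -/
theorem supp_idealCall (g : Functionality) (C D : Circuit PWire) {Φ : Finset Wire → Prop}
    (hΦ : ∀ s s', Φ s' → (∀ w : Wire, w.1 = Reg.dist ∨ w.1 = Reg.honWork → (w ∈ s' ↔ w ∈ s)) → Φ s)
    {K : Op Wire} (hK : Supp Φ K) :
    Supp (fun s => Φ s ∧ ∀ w ∈ s, w.1 ≠ Reg.msg ∧ w.1 ≠ Reg.honOut)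
      (idealCall g lam c C D K) := by
  have hadv : ∀ C : Circuit PWire,
      C.On {w | advWire w ∈ {w : Wire | w.1 ≠ Reg.dist ∧ w.1 ≠ Reg.honWork ∧ w.1 ≠ Reg.honOut}} := by
    rintro C g - ⟨⟨⟩, k⟩ - <;> simp [advWire]
  have h1 : Supp Φ (activate advWire C (clearChannel K)) := by
    refine Supp.activate (hK.transition_of (fun s s' h h' => hΦ s s' h fun w hw => h' w ?_) _)
      (fun s s' h h' => hΦ s s' h fun w hw => h' w ?_) (hadv C)
    · rcases hw with hw | hw <;> simp [hw]
    · rcases hw with hw | hw <;> simp [hw]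
  have h2 : Supp (fun s => Φ s ∧ ∀ w ∈ s, w.1 ≠ Reg.honOut)
      (trusted g lam c (activate advWire C (clearChannel K))) := by
    refine h1.transition fun s a ha hp h => ⟨hΦ s _ h fun w hw => ?_, fun w hw hr => ?_⟩
    · rw [mem_setPart ha, if_neg]
      rcases hw with hw | hw <;> simp [hw]
    · split_ifs at hp with h3
      · have : w.2 ∈ content .honOut (s.filter fun w => w.1 = .advInp ∨ w.1 = .advOut ∨
            w.1 = .honInp ∨ w.1 = .honOut) := by
          rw [mem_content, ← hr]
          exact Finset.mem_filter.2 ⟨hw, by tauto⟩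
        rw [h3.2] at this
        simp at this
      · simp at hp
  have h3 : Supp (fun s => Φ s ∧ ∀ w ∈ s, w.1 ≠ Reg.honOut)
      (activate advWire D (trusted g lam c (activate advWire C (clearChannel K)))) := by
    refine h2.activate (fun s s' h h' => ⟨hΦ s s' h.1 fun w hw => h' w ?_, fun w hw hr => ?_⟩)
      (hadv D)
    · rcases hw with hw | hw <;> simp [hw]
    · exact h.2 w ((h' w (by simp [hr])).2 hw) hr
  rw [idealCall, deliver]
  refine h3.transition fun s a ha hp h =>
    ⟨hΦ s _ h.1 fun w hw => ?_, fun w hw => ⟨fun hr => ?_, fun hr => ?_⟩⟩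
  · rw [mem_setPart ha, if_neg]
    rcases hw with hw | hw <;> simp [hw]
  · rw [ite_ne_right_iff] at hp
    have hw' : w ∈ s.filter (fun w => w.1 = Reg.msg ∨ w.1 = Reg.honInp) :=
      Finset.mem_filter.2 ⟨hw, Or.inl hr⟩
    rw [hp.1] at hw'
    split_ifs at hw' with h4
    · have : w.2 ∈ content .msg a := by rw [mem_content, ← hr]; exact hw'
      rw [h4] at this
      simp at this
    · simp at hw'
  · exact h.2 w ((mem_setPart ha).2 (by rw [if_neg (by simp [hr])]; exact hw)) hr

theorem idealCall_append (g : Functionality) {C D E : Circuit PWire}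
    (hE : E.On {w | w.1 ≠ Port.msg}) {K : Op Wire} (hK : FinSupp K) :
    idealCall g lam c C (D ++ E) K =
      Circuit.run (E.map (Gate.map advWire) : Circuit Wire) (idealCall g lam c C D K) := by
  have h1 : Circuit.On {w : Wire | ¬ w.1 = Reg.msg} (E.map (Gate.map advWire)) := by
    refine hE.map _ ?_
    rintro ⟨⟨⟩, k⟩ h <;> simp_all [advWire]
  have h2 : Circuit.On {w : Wire | ¬ (w.1 = Reg.msg ∨ w.1 = Reg.honInp)}
      (E.map (Gate.map advWire)) := by
    refine hE.map _ ?_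
    rintro ⟨⟨⟩, k⟩ h <;> simp_all [advWire]
  have h3 : ∀ K : Op Wire, activate advWire (D ++ E) K =
      Circuit.run (E.map (Gate.map advWire) : Circuit Wire) (activate advWire D K) := by
    intro K
    rw [activate_eq, activate_eq, List.map_append, Circuit.run_append, run_dephase _ h1]
  rw [idealCall, idealCall, h3, deliver, run_transition _ _ h2]
  exact ((hK.clearChannel.activate _ _).trusted lam c g).activate _ _

end Session

theorem session_inFrame {m : ℕ} (j : ℕ) (R : List (Step m)) :
    session (R.map (Step.inFrame j)) = (session R).map (Step.inFrame j) := by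
  simp only [session, List.cons_append, List.map_cons, List.map_append, List.map_nil]
  rfl

/-- The simulator of a subprotocol is good enough for a distinguisher that continues the suspended
computation. -/
theorem weight_session_diff {g : Functionality} {lam : ℕ} {c : Bool} {f : Fin 0 → Functionality}
    {R : List (Step 0)} {N M₁ M Mc j : ℕ} (hj : j ≠ 0) {v : Val} {K : Op Wire}
    (hK : Ready N M₁ v K) (hM : Bdd M K) {A : List (Circuit PWire)} (hA : ∀ C ∈ A, Packed N C)
    {C D : Circuit PWire} (hv : v.length < Mc) {U : Circuit Wire}
    (hU : U.On {w | w.1 = Reg.honWork → (Nat.unpair w.2).1 ≠ j}) {σ : QState} (hσ : σ.qubits ≤ M)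
    {η : ℝ}
    (hsec : ∀ (x : Bool → Val) (ρ σ' : QState), x c = v → (x (!c)).length ≤ M₁ → ρ.qubits = N →
      σ'.qubits = 4 * M →
      |acceptProb (((cleanCircuit N Mc v).map (Gate.map advWire) ++ U).map (Gate.map viewPort)) σ'
          (exec f lam c (session R) A (start c x ρ)) -
        acceptProb (((cleanCircuit N Mc v).map (Gate.map advWire) ++ U).map (Gate.map viewPort)) σ'
          (idealCall g lam c C D (start c x ρ))| ≤ η) :
    |weight ((Reg.dist, 0) : Wire)
        (U.run (adjoin σ (exec f lam c (session (R.map (Step.inFrame j))) A K))) -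
      weight ((Reg.dist, 0) : Wire)
        (U.run (adjoin σ (idealCall g lam c C (D ++ cleanCircuit N Mc v) K)))| ≤ η := by
  obtain ⟨I, p, ρ, hp, hp1, hq, hdec, hmix⟩ := hK.exists_mixture hj hM c
  have hFin := fun h => (ρ h).op_finSupp.embed advEmb h
  have hcl : (cleanCircuit N Mc v).On {w | w.1 ≠ Port.msg} :=
    (on_cleanCircuit hv).mono fun w hw => hw.1
  -- both sides are linear in the state in which the session begins
  have hreal : exec f lam c (session (R.map (Step.inFrame j))) A K =
      linComb I (fun h => (p h : ℂ)) (fun h => exec f lam c (session (R.map (Step.inFrame j))) A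
        (embed advEmb h (ρ h).op)) := by
    rw [← exec_session_fresh f lam c _ A hK.state.finSupp, hdec, exec_linComb _ _ _ _ _ _ _ _ hFin]
  have hidealFin : ∀ h (D : Circuit PWire),
      FinSupp (idealCall g lam c C D (embed advEmb h (ρ h).op)) := fun h D =>
    ((((hFin h).clearChannel.activate _ _).trusted lam c g).activate _ _).deliver
  have hideal : idealCall g lam c C (D ++ cleanCircuit N Mc v) K =
      linComb I (fun h => (p h : ℂ)) (fun h => idealCall g lam c C (D ++ cleanCircuit N Mc v)
        (embed advEmb h (ρ h).op)) := by
    have := exec_linComb (fun _ : Fin 1 => g) lam c [.call 0] [C, D ++ cleanCircuit N Mc v] I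
      (fun h => (p h : ℂ)) _ hFin
    rw [← idealCall_fresh hK.state.finSupp, hdec]
    exact this
  rw [hreal, hideal, adjoin_linComb, adjoin_linComb, run_linComb, run_linComb,
    weight_linComb _ _ fun h _ => (((hFin h).exec f lam c _ A).adjoin σ).run U,
    weight_linComb _ _ fun h _ => ((hidealFin h _).adjoin σ).run U, ← Finset.sum_sub_distrib]
  refine (Finset.abs_sum_le_sum_abs _ _).trans ?_
  have hbound : ∀ h ∈ I, |p h * weight ((Reg.dist, 0) : Wire) (U.run (adjoin σ
      (exec f lam c (session (R.map (Step.inFrame j))) A (embed advEmb h (ρ h).op)))) -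
      p h * weight ((Reg.dist, 0) : Wire) (U.run (adjoin σ
        (idealCall g lam c C (D ++ cleanCircuit N Mc v) (embed advEmb h (ρ h).op))))| ≤
      p h * η := by
    intro h hh
    rw [← mul_sub, abs_mul, abs_of_nonneg (hp h hh)]
    by_cases hp0 : p h = 0
    · rw [hp0, zero_mul, zero_mul]
    refine mul_le_mul_of_nonneg_left ?_ (hp h hh)
    obtain ⟨a, x, ha, haM, hxc, hxn, hemb⟩ := hmix h hh hp0
    obtain ⟨σ', hσ'q, hσ'⟩ := exists_view_advice σ haM hσ
    have hon : Circuit.On {w : Wire | w.1 = Reg.honWork → (Nat.unpair w.2).1 ≠ j}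
        ((cleanCircuit N Mc v).map (Gate.map advWire) ++ U : Circuit Wire) := by
      refine Circuit.On.append (Circuit.On.map (X := Set.univ) (fun _ _ _ _ => trivial) _ ?_) hU
      rintro ⟨⟨⟩, k⟩ - <;> simp [advWire]
    have hclw : Circuit.On {w : Wire | w.1 ≠ Reg.dist}
        ((cleanCircuit N Mc v).map (Gate.map advWire)) := by
      refine Circuit.On.map (X := Set.univ) (fun _ _ _ _ => trivial) _ ?_
      rintro ⟨⟨⟩, k⟩ - <;> simp [advWire]
    have hready : Supp (AdvReady N v) (start c x (ρ h)) := by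
      have := supp_advReady_start c x (ρ h)
      rwa [hq, hxc] at this
    -- the state after the session, and after the simulated session
    have e1 : exec f lam c (session (R.map (Step.inFrame j))) A (embed advEmb h (ρ h).op) =
        embed (frameEmb j) a (exec f lam c (session R) A (start c x (ρ h))) := by
      rw [hemb, session_inFrame, exec_embed_frame]
    have e2 : idealCall g lam c C D (embed advEmb h (ρ h).op) =
        embed (frameEmb j) a (idealCall g lam c C D (start c x (ρ h))) := by
      rw [hemb]
      exact exec_embed_frame (fun _ : Fin 1 => g) lam c j a [.call 0] [C, D] _
    have hr : Supp (AdvReady N v)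
        (embed (frameEmb j) a (exec f lam c (session R) A (start c x (ρ h)))) := by
      refine ((hready.advReady_exec lam c f (session R) hA).embed (frameEmb j) a).mono ?_
      rintro s ⟨-, h1, h2, h3⟩
      have hfix : ∀ r k, r ≠ Reg.honWork → ((r, k) ∈ inner (frameEmb j) s ↔ (r, k) ∈ s) := by
        intro r k hr
        rw [mem_inner, frameEmb_of_ne hr]
      refine ⟨fun k => ?_, fun k => ?_, fun k => ?_⟩
      · rw [← hfix _ _ (by simp)]; exact h1 k
      · rw [← hfix _ _ (by simp)]; exact h2 k
      · rw [← hfix _ _ (by simp)]; exact h3 k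
    have hsec' := hsec x (ρ h) σ' hxc hxn (hq h) hσ'q
    rw [acceptProb_view ha hσ' (supp_session lam c f R (supp_noDist_start c x (ρ h))) hon,
      acceptProb_view ha hσ' _ hon, Circuit.run_append, Circuit.run_append, run_adjoin σ hclw,
      run_adjoin σ hclw, run_clean_eq hr, ← e1, ← e2,
      ← idealCall_append lam c g hcl (hFin h)] at hsec'
    · exact hsec'
    · refine (supp_idealCall lam c g C D ?_ (supp_noDist_start c x (ρ h))).mono ?_
      · intro s s' h1 h2 w hw hd
        exact h1 w ((h2 w (Or.inl hd)).2 hw) hd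
      · rintro s ⟨h1, h2⟩ w hw
        exact ⟨(h2 w hw).1, (h2 w hw).2, h1 w hw⟩
  calc _ ≤ ∑ h ∈ I, p h * η := Finset.sum_le_sum hbound
    _ = η := by rw [← Finset.sum_mul, hp1, one_mul]

/-! ### Replacing all sessions by ideal calls -/

section Hybrid

variable {m : ℕ}

/-- The steps of the composed protocol for the steps `P`, the first of which has the number `n`. -/
def composeFrom (R : Fin m → List (Step 0)) (n : ℕ) (P : List (Step m)) : List (Step 0) :=
  (P.zipIdx n).flatMap fun sj =>
    match sj.1 with
    | .send b C => [Step.inFrame 0 (.send b C)]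
    | .call i => session ((R i).map (Step.inFrame (sj.2 + 1)))
    | .handover => [.handover]

theorem composeFrom_nil (R : Fin m → List (Step 0)) (n : ℕ) : composeFrom R n [] = [] := rfl

theorem composeFrom_send (R : Fin m → List (Step 0)) (n : ℕ) (b : Bool) (C : Circuit PWire)
    (P : List (Step m)) : composeFrom R n (.send b C :: P) =
      .send b (C.map (Gate.map (inFrame 0))) :: composeFrom R (n + 1) P := rfl

theorem composeFrom_call (R : Fin m → List (Step 0)) (n : ℕ) (i : Fin m) (P : List (Step m)) :
    composeFrom R n (.call i :: P) =
      session ((R i).map (Step.inFrame (n + 1))) ++ composeFrom R (n + 1) P := rfl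

theorem composeFrom_handover (R : Fin m → List (Step 0)) (n : ℕ) (P : List (Step m)) :
    composeFrom R n (.handover :: P) = .handover :: composeFrom R (n + 1) P := rfl

theorem restCode_append (P Q : List (Step m)) (A : List (Circuit PWire)) :
    restCode (P ++ Q) A = restCode Q (restCode P A) := List.foldl_append ..

theorem restCode_map_inFrame (j : ℕ) (P : List (Step m)) (A : List (Circuit PWire)) :
    restCode (P.map (Step.inFrame j)) A = restCode P A := by
  induction P generalizing A with
  | nil => rfl
  | cons s P ih => cases s <;> exact ih _

theorem restCode_session (P : List (Step m)) (A : List (Circuit PWire)) :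
    restCode (session P) A = restCode P A := by
  rw [session, List.cons_append]
  change restCode (P ++ [.handover]) A = _
  rw [restCode_append]
  rfl

theorem restCode_suffix (P : List (Step m)) (A : List (Circuit PWire)) : restCode P A <:+ A := by
  induction P generalizing A with
  | nil => exact List.suffix_rfl
  | cons s P ih =>
    refine (ih _).trans ?_
    cases s
    · exact List.tail_suffix _
    · exact (List.tail_suffix _).trans (List.tail_suffix _)
    · exact List.suffix_rfl

theorem execCircuit_append (M : ℕ) (c : Bool) (P Q : List (Step 0)) (A : List (Circuit PWire)) :
    execCircuit M c (P ++ Q) A = execCircuit M c P A ++ execCircuit M c Q (restCode P A) := by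
  induction P generalizing A with
  | nil => rfl
  | cons s P ih =>
    cases s with
    | send b C =>
      simp only [List.cons_append, execCircuit, ih, List.append_assoc]
      rfl
    | call i => exact i.elim0
    | handover =>
      simp only [List.cons_append, execCircuit, ih, List.append_assoc]
      rfl

theorem on_dephaseCircuit {M : ℕ} {X : Set Wire} (h : ∀ k < M, ((Reg.msg, k) : Wire) ∈ X)
    (hM : ((Reg.dist, M) : Wire) ∈ X) : (dephaseCircuit M).On X := by
  intro g hg w hw
  simp only [dephaseCircuit, List.mem_flatMap, List.mem_range, List.mem_cons, List.not_mem_nil,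
    or_false] at hg
  obtain ⟨k, hk, rfl | rfl⟩ := hg <;> simp only [Gate.wires, List.mem_cons, List.not_mem_nil,
    or_false] at hw
  · rcases hw with rfl | rfl
    exacts [h k hk, hM]
  · subst hw; exact hM

theorem on_handoverCircuit {M : ℕ} {X : Set Wire} (h : ∀ r, r ≠ Reg.honWork → ∀ k < M, (r, k) ∈ X) :
    (handoverCircuit M).On X := by
  intro g hg w hw
  simp only [handoverCircuit, List.mem_flatMap, List.mem_range, List.mem_cons, List.not_mem_nil,
    or_false] at hg
  obtain ⟨k, hk, rfl | rfl | rfl | rfl⟩ := hg <;> simp only [Gate.wires, List.mem_cons,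
    List.not_mem_nil, or_false] at hw
  · subst hw; exact h _ (by simp) k hk
  · subst hw; exact h _ (by simp) k hk
  · rcases hw with rfl | rfl <;> exact h _ (by simp) k hk
  · subst hw; exact h _ (by simp) k hk

/-- The measurements of the channel use the register `dist` up to the wire `M`, hence the bound `k ≤
M`. -/
theorem on_execCircuit {M : ℕ} {c : Bool} {X : Set Wire} {P : List (Step 0)}
    {A : List (Circuit PWire)} (hX : ∀ r, r ≠ Reg.honWork → ∀ k ≤ M, (r, k) ∈ X)
    (hP : ∀ b C, Step.send b C ∈ P → C.On {w | honWire w ∈ X})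
    (hA : ∀ C ∈ A, C.On {w | advWire w ∈ X}) : (execCircuit M c P A).On X := by
  have hd : (dephaseCircuit M).On X :=
    on_dephaseCircuit (fun k hk => hX _ (by simp) k hk.le) (hX _ (by simp) M le_rfl)
  induction P generalizing A with
  | nil => exact Circuit.on_nil
  | cons s P ih =>
    cases s with
    | send b C =>
      refine Circuit.On.append ?_ (Circuit.On.append (Circuit.On.append
        (Circuit.On.map (headD_of_forall Circuit.on_nil hA) _ fun w hw => hw) hd)
        (ih (fun b C h => hP b C (by simp [h])) fun C hC => hA C (List.mem_of_mem_tail hC)))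
      split_ifs
      · exact Circuit.on_nil
      · exact Circuit.On.append ((hP b C (by simp)).map _ fun w hw => hw) hd
    | call i => exact i.elim0
    | handover =>
      exact (on_handoverCircuit fun r hr k hk => hX r hr k hk.le).append
        (ih (fun b C h => hP b C (by simp [h])) hA)

/-- The call with number `j` is replaced by a session in frame `j + 1`. -/
theorem mem_composeFrom {R : Fin m → List (Step 0)} {n : ℕ} {P : List (Step m)} {s : Step 0}
    (h : s ∈ composeFrom R n P) : s = .handover ∨
      (∃ b C, Step.send b C ∈ P ∧ s = .send b (C.map (Gate.map (inFrame 0)))) ∨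
      ∃ i j, j < n + P.length ∧ n ≤ j ∧ ∃ b C, Step.send b C ∈ R i ∧
        s = .send b (C.map (Gate.map (inFrame (j + 1)))) := by
  rw [composeFrom, List.mem_flatMap] at h
  obtain ⟨⟨s', j⟩, h1, h2⟩ := h
  have h3 := List.mem_zipIdx h1
  have h4 : s' ∈ P := by rw [h3.2.2]; exact List.getElem_mem _
  cases s' with
  | send b C =>
    simp only [List.mem_singleton] at h2
    exact Or.inr (Or.inl ⟨b, C, h4, h2⟩)
  | call i =>
    simp only [session, List.cons_append, List.mem_cons, List.mem_append, List.mem_map,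
      List.not_mem_nil, or_false] at h2
    rcases h2 with h2 | ⟨s', h5, h6⟩ | h2
    · exact Or.inl h2
    · cases s' with
      | send b C => exact Or.inr (Or.inr ⟨i, j, by omega, h3.1, b, C, h5, h6.symm⟩)
      | call i => exact i.elim0
      | handover => exact Or.inl h6.symm
    · exact Or.inl h2
  | handover => exact Or.inl (by simpa using h2)

/-- The composed protocol does not touch the frames of earlier sessions. -/
theorem composeFrom_avoids {R : Fin m → List (Step 0)} {n j : ℕ} {P : List (Step m)} (hj0 : j ≠ 0)
    (hj : j ≤ n) {b : Bool} {C : Circuit PWire} (h : Step.send b C ∈ composeFrom R n P) :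
    C.On {w | honWire w ∈ {w : Wire | w.1 = Reg.honWork → (Nat.unpair w.2).1 ≠ j}} := by
  have key : ∀ (C' : Circuit PWire) (i : ℕ), i ≠ j → Circuit.On
      {w | honWire w ∈ {w : Wire | w.1 = Reg.honWork → (Nat.unpair w.2).1 ≠ j}}
      (C'.map (Gate.map (inFrame i))) := by
    intro C' i hi
    refine Circuit.On.map (X := Set.univ) (fun _ _ _ _ => trivial) _ ?_
    rintro ⟨⟨⟩, k⟩ - <;> simp [inFrame, honWire, hi]
  rcases mem_composeFrom h with h | ⟨b', C', -, h⟩ | ⟨i, j', -, hj', b', C', -, h⟩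
  · cases h
  · cases h; exact key _ _ hj0.symm
  · cases h; exact key _ (j' + 1) (by omega)

theorem Bdd.exec_plain {M : ℕ} {K : Op Wire} (hK : Bdd M K) (f : Fin 0 → Functionality) (lam : ℕ)
    (c : Bool) {P : List (Step 0)} {A : List (Circuit PWire)}
    (hP : ∀ b C, Step.send b C ∈ P → C.On {w | w.2 < M}) (hA : ∀ C ∈ A, C.On {w | w.2 < M}) :
    Bdd M (exec f lam c P A K) :=
  exec_induction f lam c (Bdd M) P A
    (fun b C _ h _ hK => hK.activate honWire_snd (hP b C h))
    (fun C hC _ hK => hK.activate advWire_snd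
      (hC.elim (hA C) fun h => h ▸ Circuit.on_nil))
    (fun i => i.elim0) (fun _ _ hK => hK.handover) K hK

theorem Supp.and {W : Type} {Φ Ψ : Finset W → Prop} {K : Op W} (h : Supp Φ K) (h' : Supp Ψ K) :
    Supp (fun s => Φ s ∧ Ψ s) K := fun s t hst =>
  ⟨⟨(h s t hst).1, (h' s t hst).1⟩, ⟨(h s t hst).2, (h' s t hst).2⟩⟩

/-- What an activation may change between the steps of the calling protocol. -/
def readyWires (N M₁ : ℕ) : Set Wire :=
  {w | w.1 = Reg.advWork ∧ w.2 < N ∨ w.1 = Reg.msg ∨ w.1 = Reg.honInp ∨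
    (w.1 = Reg.honOut ∧ w.2 < M₁) ∨ w.1 = Reg.honWork ∧ (Nat.unpair w.2).1 = 0}

theorem ready_congr {N M₁ : ℕ} {v : Val} {s s' : Finset Wire}
    (h : AdvReady N v s' ∧ ∀ w ∈ s', w.1 ≠ Reg.dist ∧ ¬ IsSuspended 0 w ∧
      (w.1 = Reg.honOut → w.2 < M₁))
    (hs : ∀ w ∉ readyWires N M₁, w ∈ s' ↔ w ∈ s) :
    AdvReady N v s ∧ ∀ w ∈ s, w.1 ≠ Reg.dist ∧ ¬ IsSuspended 0 w ∧
      (w.1 = Reg.honOut → w.2 < M₁) := by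
  refine ⟨advReady_congr h.1 fun w hw => hs w fun h => hw ?_, fun w hw => ?_⟩
  · rcases h with h | h | h | h | h
    · exact Or.inr h
    · exact Or.inl (by simp [honSet, h])
    · exact Or.inl (by simp [honSet, h])
    · exact Or.inl (by simp [honSet, h])
    · exact Or.inl (by simp [honSet, h])
  · by_cases hX : w ∈ readyWires N M₁
    · rcases hX with h | h | h | h | h
      · simp [h, IsSuspended]
      · simp [h, IsSuspended]
      · simp [h, IsSuspended]
      · simp [h, IsSuspended]
      · simp [h, IsSuspended]
    · exact h.2 w ((hs w hX).2 hw)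

theorem Ready.activate_adv {N M₁ : ℕ} {v : Val} {K : Op Wire} (hK : Ready N M₁ v K)
    {C : Circuit PWire} (hC : Packed N C) : Ready N M₁ v (activate advWire C K) :=
  ⟨hK.state.activate_adv C, hK.supp.activate (X := readyWires N M₁)
    (fun _ _ h h' => ready_congr h h') (hC.mono fun w hw => by
      obtain ⟨r, k⟩ := w
      rcases hw with hw | ⟨hw, hk⟩ <;> dsimp only at hw <;> subst hw <;>
        simp_all [readyWires, advWire])⟩

theorem Ready.activate_hon {N M₁ : ℕ} {v : Val} {K : Op Wire} (hK : Ready N M₁ v K)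
    {C : Circuit PWire} (hC : ∀ g ∈ C, g.IsClassical) (hout : C.On {w | w.1 = Port.out → w.2 < M₁}) :
    Ready N M₁ v (activate honWire (C.map (Gate.map (inFrame 0))) K) := by
  refine ⟨hK.state.activate_hon ?_, hK.supp.activate (X := readyWires N M₁)
    (fun _ _ h h' => ready_congr h h') (hout.map _ fun w hw => ?_)⟩
  · intro g hg
    obtain ⟨g', hg', rfl⟩ := List.mem_map.1 hg
    have := hC g' hg'
    cases g' <;> exact this
  · obtain ⟨⟨⟩, k⟩ := w <;> simp_all [readyWires, honWire, inFrame]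

theorem Ready.of_empty {N M₁ : ℕ} {v : Val} {K : Op Wire} (hst : IsState K)
    (h1 : Supp (AdvReady N v) K)
    (h2 : Supp (fun s => (∀ w ∈ s, w.1 ≠ Reg.dist ∧ ¬ IsSuspended 0 w) ∧
      ∀ w ∈ s, w.1 ≠ Reg.msg ∧ w.1 ≠ Reg.honOut) K) : Ready N M₁ v K :=
  ⟨hst, (h1.and h2).mono fun _ h => ⟨h.1, fun w hw => ⟨(h.2.1 w hw).1, (h.2.1 w hw).2,
    fun hr => absurd hr (h.2.2 w hw).2⟩⟩⟩

/-- Handing over values turns a state that is ready except for what is handed over into a ready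
one. -/
theorem ready_handover {N M₁ : ℕ} {v : Val} {K : Op Wire} (hst : IsState K)
    (h1 : Supp (AdvReady N v) K)
    (h2 : Supp (fun s => ∀ w ∈ s, w.1 ≠ Reg.dist ∧ ¬ IsSuspended 0 w) K) :
    Ready N M₁ v (handover K) := by
  refine Ready.of_empty hst.handover (h1.transition_of (fun s s' h h' => advReady_congr h
    fun w hw => h' w fun hr => hw (Or.inl ?_)) _) ((h2.transition_of (fun s s' h h' w hw => ?_) _).and
      (supp_handover K))
  · rcases hr with h | h | h <;> simp [honSet, h]
  · by_cases hR : w.1 = Reg.msg ∨ w.1 = Reg.honInp ∨ w.1 = Reg.honOut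
    · rcases hR with h | h | h <;> simp [h, IsSuspended]
    · exact h w ((h' w hR).2 hw)

theorem Ready.handover {N M₁ : ℕ} {v : Val} {K : Op Wire} (hK : Ready N M₁ v K) :
    Ready N M₁ v (handover K) :=
  ready_handover hK.state (hK.supp.mono fun _ h => h.1)
    (hK.supp.mono fun _ h w hw => ⟨(h.2 w hw).1, (h.2 w hw).2.1⟩)

/-- In an ideal call the adversary only uses wires below the bound `M`, however long the input of
the honest party was. -/
theorem AdvBdd.idealCall {Ms M : ℕ} {K : Op Wire} (hK : AdvBdd M K)
    (hs : Supp (fun s => ∀ w ∈ s, w.1 = Reg.advOut ∨ w.1 = Reg.honOut → w.2 < Ms) K)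
    (hMs : Ms ≤ M) {g : Functionality} {lam : ℕ} {c : Bool} {C D : Circuit PWire}
    (hC : C.On {w | w.2 < Ms}) (hD : D.On {w | w.2 < M}) {q : Polynomial ℕ}
    (hq : ∀ lam x, ∀ y ∈ (g.eval lam x).support, ∀ b,
      (y b).length ≤ q.eval (lam + (x false).length + (x true).length))
    (hqM : q.eval (lam + 2 * Ms) < M) : AdvBdd M (idealCall g lam c C D K) := by
  let Φ : Finset Wire → Prop := fun s => (∀ w ∈ s, w.1 = Reg.advInp ∨ w.1 = Reg.advOut ∨
    w.1 = Reg.advWork → w.2 < M) ∧ ∀ w ∈ s, w.1 = Reg.advOut ∨ w.1 = Reg.honOut → w.2 < Ms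
  have h0 : Supp Φ (clearChannel K) := by
    refine Supp.transition_of (hK.and hs)
      (fun s s' h h' => ⟨fun w hw hr => ?_, fun w hw hr => ?_⟩) _
    · exact h.1 w ((h' w (by rcases hr with e | e | e <;> simp [e])).2 hw) hr
    · exact h.2 w ((h' w (by rcases hr with e | e <;> simp [e])).2 hw) hr
  have h1 : Supp Φ (activate advWire C (clearChannel K)) := by
    refine Supp.activate (X := {w | w.2 < Ms}) h0
      (fun s s' h h' => ⟨fun w hw hr => ?_, fun w hw hr => ?_⟩)
      (hC.mono fun w hw => by simpa [advWire_snd] using hw)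
    · by_cases hM : w.2 < Ms
      · exact hM.trans_le hMs
      · exact h.1 w ((h' w hM).2 hw) hr
    · by_cases hM : w.2 < Ms
      · exact hM
      · exact h.2 w ((h' w hM).2 hw) hr
  have h2 : AdvBdd M (trusted g lam c (activate advWire C (clearChannel K))) := by
    refine h1.transition fun s a ha hp h w hw hr => ?_
    obtain ⟨h3, -, h4⟩ := trusted_length lam c hq (M := Ms) (fun w hw hr =>
      h.2 w ((mem_setPart ha).2 (by rw [if_pos (ha w hw)]; exact hw)) hr) hp
    obtain ⟨r, k⟩ := w
    rcases hr with hr | hr | hr <;> dsimp only at hr <;> subst hr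
    · exact (h4 _ (Finset.mem_filter.2 ⟨hw, by simp⟩) (Or.inl rfl)).trans_lt hqM
    · have hk : k ∈ content .advOut (s.filter fun w => w.1 = .advInp ∨ w.1 = .advOut ∨
          w.1 = .honInp ∨ w.1 = .honOut) := mem_content.2 (Finset.mem_filter.2 ⟨hw, by simp⟩)
      rw [h3] at hk
      simp at hk
    · exact h.1 _ ((mem_setPart ha).2 (by rw [if_neg (by simp)]; exact hw)) (by simp)
  have h3 : AdvBdd M (activate advWire D (trusted g lam c
      (activate advWire C (clearChannel K)))) := by
    refine Supp.activate (X := {w | w.2 < M}) h2 (fun s s' h h' w hw hr => ?_)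
      (hD.mono fun w hw => by simpa [advWire_snd] using hw)
    by_cases hM : w.2 < M
    · exact hM
    · exact h w ((h' w hM).2 hw) hr
  rw [TwoPC.idealCall, deliver]
  refine Supp.transition_of h3 (fun s s' h h' w hw hr => h w ((h' w ?_).2 hw) hr) _
  rcases hr with e | e | e <;> simp [e]

/-- After a simulated session the state is as before a session. -/
theorem Ready.idealCall {N M₁ Ms M L : ℕ} {v : Val} {K : Op Wire} (hK : Ready N M₁ v K)
    (hL : Bdd L K) (hv : v.length < M) (hN : N ≤ M) (hMs : M₁ ≤ Ms) (hMs' : Ms ≤ M)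
    (hML : N + M ≤ L) {g : Functionality} {lam : ℕ} {c : Bool} {C D : Circuit PWire}
    (hC : C.On {w | w.2 < Ms}) (hD : D.On {w | w.2 < M}) {q : Polynomial ℕ}
    (hq : ∀ lam x, ∀ y ∈ (g.eval lam x).support, ∀ b,
      (y b).length ≤ q.eval (lam + (x false).length + (x true).length))
    (hqM : q.eval (lam + 2 * Ms) < M) :
    Ready N M₁ v (idealCall g lam c C (D ++ cleanCircuit N M v) K) ∧
      Bdd L (TwoPC.idealCall g lam c C (D ++ cleanCircuit N M v) K) := by
  have hs : Supp (fun s => ∀ w ∈ s, w.1 = Reg.advOut ∨ w.1 = Reg.honOut → w.2 < Ms) K := by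
    refine hK.supp.mono fun s h w hw hr => ?_
    rcases hr with hr | hr
    · exact absurd (show (Reg.advOut, w.2) ∈ s by rw [← hr]; exact hw) (h.1.2.1 w.2)
    · exact ((h.2 w hw).2.2 hr).trans_le hMs
  have hb : AdvBdd M (TwoPC.idealCall g lam c C D K) := by
    refine AdvBdd.idealCall (hK.supp.mono ?_) hs hMs' hC hD hq hqM
    rintro s ⟨⟨h1, h2, h3⟩, -⟩ ⟨r, k⟩ hw hr
    rcases hr with hr | hr | hr <;> dsimp only at hr <;> subst hr
    · have := Val.lt_of_mem_toWires ((h1 k).1 hw)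
      dsimp only
      omega
    · exact absurd hw (h2 k)
    · exact (h3 k hw).trans_le hN
  have heq := idealCall_append lam c g (C := C) (D := D)
    ((on_cleanCircuit (N := N) hv).mono fun w hw => hw.1) hK.state.finSupp
  have hadv : Supp (AdvReady N v) (TwoPC.idealCall g lam c C (D ++ cleanCircuit N M v) K) := by
    rw [heq]
    exact Supp.clean hv hb
  refine ⟨Ready.of_empty (hK.state.idealCall g lam c C _) hadv (supp_idealCall lam c g C _ ?_
    (hK.supp.mono fun s h w hw => ⟨(h.2 w hw).1, (h.2 w hw).2.1⟩)), ?_⟩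
  · intro s s' h h' w hw
    by_cases hR : w.1 = Reg.dist ∨ w.1 = Reg.honWork
    · exact h w ((h' w hR).2 hw)
    · push Not at hR
      exact ⟨hR.1, fun hs => hR.2 hs.1⟩
  · exact hL.idealCall hs hC (by omega) (Circuit.On.append (hD.mono fun w hw => by
      simp only [Set.mem_ofPred_eq] at hw ⊢; omega) ((on_cleanCircuit hv).mono fun w hw => by
      simp only [Set.mem_ofPred_eq] at hw ⊢; omega)) hq (by omega)

/-- The hybrid argument. The calls are replaced from the first to the last; the sessions that remain
are part of the distinguisher, whose size is bounded in terms of `B`. -/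
theorem abs_hybrid_diff_le (f₀ : Fin 0 → Functionality) (f : Fin m → Functionality) (lam : ℕ)
    (c : Bool) (R : Fin m → List (Step 0))
    (S : Fin m → List (Circuit PWire) → Circuit PWire × Circuit PWire)
    {N M₁ Ms M L B : ℕ} {v : Val} {D : Circuit DWire} {σ : QState} {A₀ : List (Circuit PWire)}
    {η : ℝ} (hη : 0 ≤ η) (hv : v.length < M) (hN : N ≤ M) (hMs : M₁ ≤ Ms) (hMs' : Ms ≤ M)
    (hML : N + M ≤ L) (hσ : σ.qubits ≤ L) (hD : D.On {w | w.2 < L})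
    (hA₀ : ∀ C ∈ A₀, Packed N C ∧ C.On {w | w.2 < M})
    (hS : ∀ i A, A <:+ A₀ → (S i A).1.On {w | w.2 < Ms} ∧ (S i A).2.On {w | w.2 < M})
    (hf : ∀ i, ∃ q : Polynomial ℕ, (∀ lam x, ∀ y ∈ ((f i).eval lam x).support, ∀ b,
      (y b).length ≤ q.eval (lam + (x false).length + (x true).length)) ∧
        q.eval (lam + 2 * Ms) < M)
    (hsec : ∀ i A (U : Circuit Wire), A <:+ A₀ → U.On {w | w.2 ≤ L} → U.length ≤ B + D.length →
      ∀ (x : Bool → Val) (ρ σ' : QState), x c = v → (x (!c)).length ≤ M₁ → ρ.qubits = N →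
      σ'.qubits = 4 * L →
      |acceptProb (((cleanCircuit N M v).map (Gate.map advWire) ++ U).map (Gate.map viewPort)) σ'
          (exec f₀ lam c (session (R i)) A (start c x ρ)) -
        acceptProb (((cleanCircuit N M v).map (Gate.map advWire) ++ U).map (Gate.map viewPort)) σ'
          (idealCall (f i) lam c (S i A).1 (S i A).2 (start c x ρ))| ≤ η)
    (P : List (Step m)) (n : ℕ) (A : List (Circuit PWire)) (K : Op Wire)
    (hP : ∀ b C, Step.send b C ∈ P → (∀ g ∈ C, g.IsClassical) ∧
      C.On {w | w.1 = Port.out → w.2 < M₁} ∧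
        Circuit.On {w | w.2 < M} (C.map (Gate.map (inFrame 0))))
    (hQ : ∀ b C, Step.send b C ∈ composeFrom R n P → C.On {w | w.2 < L})
    (hB : (execCircuit L c (composeFrom R n P ++ [.handover]) A).length ≤ B)
    (hA : A <:+ A₀) (hK : Ready N M₁ v K) (hL : Bdd L K) :
    |acceptProb D σ (exec f₀ lam c (composeFrom R n P ++ [.handover]) A K) -
      acceptProb D σ (exec f lam c (P.map (Step.inFrame 0) ++ [.handover])
        (hybridCode (fun i A => [(S i A).1, (S i A).2 ++ cleanCircuit N M v])
          (fun i => restCode (R i)) P A) K)| ≤ P.length * η := by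
  induction P generalizing n A K with
  | nil => simp [composeFrom_nil, exec]
  | cons s P ih =>
    have hP' : ∀ b C, Step.send b C ∈ P → (∀ g ∈ C, g.IsClassical) ∧
      C.On {w | w.1 = Port.out → w.2 < M₁} ∧
        Circuit.On {w | w.2 < M} (C.map (Gate.map (inFrame 0))) :=
      fun b C h => hP b C (by simp [h])
    have hlen : (P.length : ℝ) * η ≤ ((s :: P).length : ℝ) * η := by
      refine mul_le_mul_of_nonneg_right ?_ hη
      simp
    cases s with
    | send b C =>
      obtain ⟨h1, h2, h3⟩ := hP b C (by simp)
      have hhead : Packed N (A.headD []) ∧ Circuit.On {w | w.2 < M} (A.headD []) :=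
        headD_of_forall (p := fun C => Packed N C ∧ Circuit.On {w | w.2 < M} C)
          ⟨Circuit.on_nil, Circuit.on_nil⟩ fun C hC => hA₀ C (hA.subset hC)
      have hsub : ∀ b' C', Step.send b' C' ∈ composeFrom R (n + 1) P →
          Step.send b' C' ∈ composeFrom R n (.send b C :: P) := fun b' C' h => by
        rw [composeFrom_send]; exact List.mem_cons_of_mem _ h
      refine (ih (n + 1) A.tail hP' (fun b' C' h => hQ b' C' (hsub b' C' h)) ?_
        ((List.tail_suffix _).trans hA) (K := activate advWire (A.headD []) (if b = c then K else
          activate honWire (C.map (Gate.map (inFrame 0))) K)) ?_ ?_).trans hlen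
      · refine le_trans ?_ hB
        rw [composeFrom_send]
        simp only [List.cons_append, execCircuit, List.length_append]
        omega
      · refine Ready.activate_adv ?_ hhead.1
        split_ifs
        · exact hK
        · exact hK.activate_hon h1 h2
      · refine Bdd.activate ?_ advWire_snd (Circuit.On.mono hhead.2 fun w hw => by
          simp only [Set.mem_ofPred_eq] at hw ⊢; omega)
        split_ifs
        · exact hL
        · exact hL.activate honWire_snd (Circuit.On.mono h3 fun w hw => by
            simp only [Set.mem_ofPred_eq] at hw ⊢; omega)
    | call i =>
      have hrest := restCode_suffix (R i) A
      have hrest' : restCode (session ((R i).map (Step.inFrame (n + 1)))) A = restCode (R i) A := by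
        rw [restCode_session, restCode_map_inFrame]
      obtain ⟨hS1, hS2⟩ := hS i A hA
      obtain ⟨q, hq, hqM⟩ := hf i
      obtain ⟨hR, hRM⟩ := hK.idealCall hL hv hN hMs hMs' hML hS1 hS2 hq hqM (c := c)
      have hAL : ∀ C ∈ A, C.On {w | w.2 < L} := fun C hC =>
        (hA₀ C (hA.subset hC)).2.mono fun w hw => by
          simp only [Set.mem_ofPred_eq] at hw ⊢; omega
      have hQ1 : ∀ b' C', Step.send b' C' ∈ session ((R i).map (Step.inFrame (n + 1))) →
          C'.On {w | w.2 < L} := fun b' C' h => hQ b' C' (by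
        rw [composeFrom_call]; exact List.mem_append_left _ h)
      have hQ2 : ∀ b' C', Step.send b' C' ∈ composeFrom R (n + 1) P → C'.On {w | w.2 < L} :=
        fun b' C' h => hQ b' C' (by
          rw [composeFrom_call]; exact List.mem_append_right _ h)
      have hQ3 : ∀ b' C', Step.send b' C' ∈ composeFrom R (n + 1) P ++ [.handover] →
          C'.On {w | w.2 < L} := fun b' C' h => hQ2 b' C' (by simpa using h)
      have hAL' : ∀ C ∈ restCode (R i) A, C.On {w | w.2 < L} := fun C hC =>
        hAL C (hrest.subset hC)
      rw [composeFrom_call, List.append_assoc, execCircuit_append, hrest', List.length_append] at hB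
      -- the rest of the execution as a part of the distinguisher
      have hacc : ∀ K : Op Wire, Bdd L K → acceptProb D σ
          (exec f₀ lam c (composeFrom R (n + 1) P ++ [.handover]) (restCode (R i) A) K) =
          weight ((Reg.dist, 0) : Wire) (Circuit.run
            (execCircuit L c (composeFrom R (n + 1) P ++ [.handover]) (restCode (R i) A) ++
              D.map (Gate.map distWire) : Circuit Wire) (adjoin σ K)) := by
        intro K hK
        rw [acceptProb_eq, Circuit.run_append,
          run_execCircuit f₀ lam c hQ3 hAL' (hK.adjoin hσ), exec_adjoin]
      -- the session and the ideal call are followed by the same execution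
      have hsess := weight_session_diff (f := f₀) (g := f i) (lam := lam) (c := c) (R := R i)
        (j := n + 1) (Nat.succ_ne_zero n) hK hL (A := A)
        (fun C hC => (hA₀ C (hA.subset hC)).1) (C := (S i A).1) (D := (S i A).2) (Mc := M) hv
        (U := execCircuit L c (composeFrom R (n + 1) P ++ [.handover]) (restCode (R i) A) ++
              D.map (Gate.map distWire)) ?_ hσ (η := η) ?_
      · rw [← hacc _ (hL.exec_plain f₀ lam c hQ1 hAL), ← hacc _ hRM] at hsess
        have hih := ih (n + 1) (restCode (R i) A) _ hP' hQ2 (by omega) (hrest.trans hA) hR hRM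
        rw [composeFrom_call, List.append_assoc, exec_append, hrest']
        have e : exec f lam c ((Step.call i :: P).map (Step.inFrame 0) ++ [.handover])
            (hybridCode (fun i A => [(S i A).1, (S i A).2 ++ cleanCircuit N M v])
              (fun i => restCode (R i)) (.call i :: P) A) K =
            exec f lam c (P.map (Step.inFrame 0) ++ [.handover])
            (hybridCode (fun i A => [(S i A).1, (S i A).2 ++ cleanCircuit N M v])
              (fun i => restCode (R i)) P (restCode (R i) A))
              (idealCall (f i) lam c (S i A).1 ((S i A).2 ++ cleanCircuit N M v) K) := rfl
        rw [e]
        -- through the execution in which only the present call is ideal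
        refine (abs_sub_le _ _ _).trans ((add_le_add hsess hih).trans (le_of_eq ?_))
        simp only [List.length_cons]
        push_cast
        ring
      · refine Circuit.On.append (on_execCircuit (by simp_all) (fun b' C' h => ?_) ?_) ?_
        · exact composeFrom_avoids (Nat.succ_ne_zero n) le_rfl (by simpa using h)
        · rintro C - g - ⟨⟨⟩, k⟩ - <;> simp [advWire]
        · refine Circuit.On.map (X := Set.univ) (fun _ _ _ _ => trivial) _ ?_
          rintro ⟨⟨⟩, k⟩ - <;> simp [distWire]
      · intro x ρ σ' hx hx' hρ hσ'
        refine hsec i A _ hA (Circuit.On.append (on_execCircuit (fun r _ k hk => hk)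
          (fun b' C' h => (hQ3 b' C' h).mono fun w hw => ?_)
          fun C hC => (hAL' C hC).mono fun w hw => ?_) (hD.map _ fun w hw => ?_)) ?_ x ρ σ' hx hx' hρ hσ'
        · exact (honWire_snd w).trans_le (le_of_lt hw)
        · exact (advWire_snd w).trans_le (le_of_lt hw)
        · obtain ⟨⟨⟩, k⟩ := w <;> exact le_of_lt (show k < L from hw)
        · rw [List.length_append, List.length_map]
          omega
    | handover =>
      refine (ih (n + 1) A (K := handover K) hP' (fun b' C' h => hQ b' C' ?_) ?_ hA hK.handover
        hL.handover).trans hlen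
      · rw [composeFrom_handover]; exact List.mem_cons_of_mem _ h
      · refine le_trans ?_ hB
        rw [composeFrom_handover]
        simp only [List.cons_append, execCircuit, List.length_append]
        omega

end Hybrid

/-! ### Polynomial bounds and asymptotics -/

theorem exists_pow_bound (p : Polynomial ℕ) : ∃ a : ℕ, ∀ n, 2 ≤ n → p.eval n ≤ n ^ a := by
  induction p using Polynomial.induction_on' with
  | add p q hp hq =>
    obtain ⟨a, ha⟩ := hp
    obtain ⟨b, hb⟩ := hq
    refine ⟨max a b + 1, fun n hn => ?_⟩
    rw [Polynomial.eval_add, pow_succ]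
    have h1 := (ha n hn).trans (Nat.pow_le_pow_right (by omega) (le_max_left a b))
    have h2 := (hb n hn).trans (Nat.pow_le_pow_right (by omega) (le_max_right a b))
    nlinarith [Nat.zero_le (n ^ max a b)]
  | monomial d c =>
    refine ⟨c + d, fun n hn => ?_⟩
    rw [Polynomial.eval_monomial, pow_add]
    exact Nat.mul_le_mul_right _ ((Nat.lt_two_pow_self).le.trans (Nat.pow_le_pow_left hn c))

theorem PolyBounded.mono {u v : ℕ → ℕ} (h : PolyBounded v) (huv : ∀ n, u n ≤ v n) :
    PolyBounded u := by
  obtain ⟨p, hp⟩ := h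
  exact ⟨p, fun n => (huv n).trans (hp n)⟩

theorem polyBounded_const (k : ℕ) : PolyBounded (fun _ => k) := ⟨.C k, fun n => by simp⟩

theorem polyBounded_id : PolyBounded (fun n => n) := ⟨.X, fun n => by simp⟩

theorem PolyBounded.add {u v : ℕ → ℕ} (hu : PolyBounded u) (hv : PolyBounded v) :
    PolyBounded (fun n => u n + v n) := by
  obtain ⟨p, hp⟩ := hu
  obtain ⟨q, hq⟩ := hv
  exact ⟨p + q, fun n => by rw [Polynomial.eval_add]; exact add_le_add (hp n) (hq n)⟩

theorem PolyBounded.mul {u v : ℕ → ℕ} (hu : PolyBounded u) (hv : PolyBounded v) :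
    PolyBounded (fun n => u n * v n) := by
  obtain ⟨p, hp⟩ := hu
  obtain ⟨q, hq⟩ := hv
  exact ⟨p * q, fun n => by rw [Polynomial.eval_mul]; exact Nat.mul_le_mul (hp n) (hq n)⟩

theorem PolyBounded.eval {u : ℕ → ℕ} (hu : PolyBounded u) (q : Polynomial ℕ) :
    PolyBounded (fun n => q.eval (u n)) := by
  obtain ⟨p, hp⟩ := hu
  exact ⟨q.comp p, fun n => by rw [Polynomial.eval_comp]; exact poly_mono q (hp n)⟩

theorem PolyBounded.of_eventually {u v : ℕ → ℕ} (hv : PolyBounded v)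
    (h : ∀ᶠ n in Filter.atTop, u n ≤ v n) : PolyBounded u := by
  obtain ⟨n₀, hn₀⟩ := Filter.eventually_atTop.1 h
  refine (hv.add (polyBounded_const (∑ k ∈ Finset.range n₀, u k))).mono fun n => ?_
  by_cases hn : n₀ ≤ n
  · exact (hn₀ n hn).trans (Nat.le_add_right _ _)
  · exact (Finset.single_le_sum (f := u) (fun _ _ => Nat.zero_le _)
      (Finset.mem_range.2 (by omega))).trans (Nat.le_add_left _ _)

/-- The slackness parameter of a simulator is polynomially bounded. -/
theorem Noticeable.polyBounded_ceil {ε : ℕ → ℝ} (h : Noticeable ε) :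
    PolyBounded (fun n => ⌈1 / ε n⌉₊) := by
  obtain ⟨-, k, hk⟩ := h
  refine PolyBounded.of_eventually (v := fun n => n ^ k) ⟨.X ^ k, fun n => by simp⟩ ?_
  filter_upwards [hk, Filter.eventually_gt_atTop 0] with n hn hn0
  have hpos : (0 : ℝ) < (n : ℝ) ^ k := by positivity
  rw [Nat.ceil_le]
  push_cast
  exact (one_div_le_one_div_of_le (by positivity) hn).trans (by rw [one_div_one_div])

/-- The reciprocal of a polynomially bounded integer is noticeable. -/
theorem noticeable_one_div {u : ℕ → ℕ} (hu : PolyBounded u) (h0 : ∀ᶠ n in Filter.atTop, u n ≠ 0) :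
    Noticeable (fun n => 1 / (u n : ℝ)) := by
  refine ⟨fun n => ⟨by positivity, ?_⟩, ?_⟩
  · rcases Nat.eq_zero_or_pos (u n) with h | h
    · simp [h]
    · rw [div_le_one (by exact_mod_cast h)]
      exact_mod_cast h
  · obtain ⟨p, hp⟩ := hu
    obtain ⟨a, ha⟩ := exists_pow_bound p
    refine ⟨a, ?_⟩
    filter_upwards [h0, Filter.eventually_ge_atTop 2] with n hn hn2
    refine one_div_le_one_div_of_le (by exact_mod_cast Nat.pos_of_ne_zero hn) ?_
    exact_mod_cast (hp n).trans (ha n hn2)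

theorem IndistUpTo.eventually {δ : ℕ → ℝ} {X Y : ℕ → Op Wire} (h : IndistUpTo δ X Y)
    (D : NonUniformQPT (Circuit DWire)) (k : ℕ) : ∀ᶠ lam : ℕ in Filter.atTop,
    |acceptProb (D.code lam) (D.advice lam) (X lam) - acceptProb (D.code lam) (D.advice lam) (Y lam)|
      ≤ δ lam + 1 / (lam : ℝ) ^ k := by
  obtain ⟨μ, hμ, hD⟩ := h D
  filter_upwards [hμ k] with lam hlam
  have := hD lam
  have := le_abs_self (μ lam)
  linarith

/-- It suffices to bound the advantage of each distinguisher up to each inverse power. -/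
theorem indistUpTo_of_eventually {δ : ℕ → ℝ} {X Y : ℕ → Op Wire}
    (h : ∀ (D : NonUniformQPT (Circuit DWire)) (k : ℕ), ∀ᶠ lam : ℕ in Filter.atTop,
      |acceptProb (D.code lam) (D.advice lam) (X lam) -
        acceptProb (D.code lam) (D.advice lam) (Y lam)| ≤ δ lam + 1 / (lam : ℝ) ^ k) :
    IndistUpTo δ X Y := by
  intro D
  refine ⟨fun lam => max 0 (|acceptProb (D.code lam) (D.advice lam) (X lam) -
    acceptProb (D.code lam) (D.advice lam) (Y lam)| - δ lam), fun k => ?_, fun lam => ?_⟩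
  -- one exponent more than needed makes the inequality strict
  · filter_upwards [h D (k + 1), Filter.eventually_ge_atTop 2] with n hn hn2
    have hn' : (2 : ℝ) ≤ n := by exact_mod_cast hn2
    have h1 : (0 : ℝ) < (n : ℝ) ^ k := by positivity
    have h2 : 1 / (n : ℝ) ^ (k + 1) < 1 / (n : ℝ) ^ k := by
      refine one_div_lt_one_div_of_lt h1 ?_
      rw [pow_succ]
      nlinarith
    rw [abs_of_nonneg (le_max_left _ _)]
    refine max_lt (by positivity) ?_
    linarith
  · have := le_max_right 0 (|acceptProb (D.code lam) (D.advice lam) (X lam) -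
      acceptProb (D.code lam) (D.advice lam) (Y lam)| - δ lam)
    linarith

/-- Indistinguishability against all sequences of adversaries, inputs and distinguishers of
polynomial size is uniform in these sequences: otherwise one could choose a bad one for every
security parameter. -/
theorem eventually_uniform {X Y : ℕ → List (Circuit PWire) → QState → (Bool → Val) → Op Wire}
    {δ : ℕ → ℝ} (h : ∀ (A : NonUniformQPT (List (Circuit PWire))) (x : ℕ → Bool → Val),
      (∀ b, PolyBounded (fun lam => (x lam b).length)) →
      IndistUpTo δ (fun lam => X lam (A.code lam) (A.advice lam) (x lam))
        (fun lam => Y lam (A.code lam) (A.advice lam) (x lam)))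
    {u : ℕ → ℕ} (hu : PolyBounded u) (k : ℕ) :
    ∀ᶠ lam : ℕ in Filter.atTop, ∀ (A : List (Circuit PWire)) (ρ : QState) (x : Bool → Val)
      (D : Circuit DWire) (σ : QState), descLength A ≤ u lam → ρ.qubits ≤ u lam →
      (∀ b, (x b).length ≤ u lam) → descLength D ≤ u lam → σ.qubits ≤ u lam →
      |acceptProb D σ (X lam A ρ x) - acceptProb D σ (Y lam A ρ x)| ≤ δ lam + 1 / (lam : ℝ) ^ k := by
  obtain ⟨ρ₀, hρ₀⟩ := QState.exists_qubits 0
  let T := List (Circuit PWire) × QState × (Bool → Val) × Circuit DWire × QState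
  let small : ℕ → T → Prop := fun lam y => descLength y.1 ≤ u lam + 1 ∧ y.2.1.qubits ≤ u lam + 1 ∧
    (∀ b, (y.2.2.1 b).length ≤ u lam + 1) ∧ descLength y.2.2.2.1 ≤ u lam + 1 ∧
    y.2.2.2.2.qubits ≤ u lam + 1
  let good : ℕ → T → Prop := fun lam y =>
    |acceptProb y.2.2.2.1 y.2.2.2.2 (X lam y.1 y.2.1 y.2.2.1) -
      acceptProb y.2.2.2.1 y.2.2.2.2 (Y lam y.1 y.2.1 y.2.2.1)| ≤ δ lam + 1 / (lam : ℝ) ^ k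
  -- for every security parameter a bad choice, if there is one
  have hbad : ∀ lam, ∃ y : T, small lam y ∧ ((∃ y', small lam y' ∧ ¬ good lam y') → ¬ good lam y) := by
    intro lam
    by_cases hex : ∃ y', small lam y' ∧ ¬ good lam y'
    · obtain ⟨y, h1, h2⟩ := hex
      exact ⟨y, h1, fun _ => h2⟩
    · refine ⟨([], ρ₀, fun _ => none, [], ρ₀), ⟨?_, ?_, ?_, ?_, ?_⟩, fun h => absurd h hex⟩
      · rw [descLength_nil]; omega
      · dsimp only; omega
      · intro b; exact Nat.zero_le _
      · rw [descLength_nil]; omega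
      · dsimp only; omega
  choose y hy hy' using hbad
  have hu1 := hu.add (polyBounded_const 1)
  let A : NonUniformQPT (List (Circuit PWire)) :=
    ⟨fun lam => (y lam).1, fun lam => (y lam).2.1, hu1.mono fun lam => (hy lam).1,
      hu1.mono fun lam => (hy lam).2.1⟩
  let D : NonUniformQPT (Circuit DWire) :=
    ⟨fun lam => (y lam).2.2.2.1, fun lam => (y lam).2.2.2.2, hu1.mono fun lam => (hy lam).2.2.2.1,
      hu1.mono fun lam => (hy lam).2.2.2.2⟩
  filter_upwards [(h A (fun lam => (y lam).2.2.1)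
    fun b => hu1.mono fun lam => (hy lam).2.2.1 b).eventually D k] with lam hlam
  intro A' ρ' x' D' σ' h1 h2 h3 h4 h5
  by_contra hn
  exact hy' lam ⟨(A', ρ', x', D', σ'), ⟨by dsimp only; omega, by dsimp only; omega,
    fun b => (h3 b).trans (Nat.le_succ _), by dsimp only; omega, by dsimp only; omega⟩, hn⟩ hlam

/-! ### Sizes of circuits -/

theorem lt_descLength_wire (w : PWire) : w.2 < descLength w := by
  rw [descLength_prod, descLength_nat]; omega

theorem lt_descLength_dwire (w : DWire) : w.2 < descLength w := by
  rw [descLength_prod, descLength_nat]; omega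

theorem descLength_wire_le_gate {W : Type} [Enc W] {g : Gate W} {w : W} (h : w ∈ g.wires) :
    descLength w ≤ descLength g := by
  cases g <;> simp only [Gate.wires, List.mem_cons, List.not_mem_nil, or_false] at h
  case flip v => subst h; change _ ≤ descLength ((0 : ℕ), w); rw [descLength_pair]; omega
  case cnot a v =>
    change _ ≤ descLength ((1 : ℕ), a, v); rw [descLength_pair, descLength_pair]
    rcases h with rfl | rfl <;> omega
  case ccnot a b v =>
    change _ ≤ descLength ((2 : ℕ), a, b, v)
    rw [descLength_pair, descLength_pair, descLength_pair]
    rcases h with rfl | rfl | rfl <;> omega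
  case had v => subst h; change _ ≤ descLength ((3 : ℕ), w); rw [descLength_pair]; omega
  case phase v => subst h; change _ ≤ descLength ((4 : ℕ), w); rw [descLength_pair]; omega
  case reset v => subst h; change _ ≤ descLength ((5 : ℕ), w); rw [descLength_pair]; omega
  case coin v => subst h; change _ ≤ descLength ((6 : ℕ), w); rw [descLength_pair]; omega

theorem Circuit.on_descLength {W : Type} [Enc W] (C : Circuit W) {M : ℕ} (hM : descLength C ≤ M)
    {i : W → ℕ} (hi : ∀ w, i w < descLength w) : C.On {w | i w < M} := fun _ hg w hw =>
  ((hi w).trans_le ((descLength_wire_le_gate hw).trans (descLength_le_of_mem hg))).trans_le hM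

theorem descLength_le_of_mem_code {A : List (Circuit PWire)} {C : Circuit PWire} (h : C ∈ A) :
    descLength C ≤ descLength A := descLength_le_of_mem h

theorem descLength_le_of_send {m : ℕ} {P : List (Step m)} {b : Bool} {C : Circuit PWire}
    (h : Step.send b C ∈ P) : descLength C ≤ descLength P := by
  refine le_trans ?_ (descLength_le_of_mem h)
  change _ ≤ descLength ((0 : ℕ), b, C)
  rw [descLength_pair, descLength_pair]
  omega

theorem descLength_suffix_le {α : Type} [Enc α] {l l' : List α} (h : l <:+ l') :
    descLength l ≤ descLength l' := by
  obtain ⟨l₀, rfl⟩ := h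
  have := descLength_append l₀ l
  have := descLength_pos l₀
  omega

theorem descLength_dwire_le (w : DWire) : descLength w ≤ 2 * w.2 + 11 := by
  obtain ⟨r, k⟩ := w
  rw [descLength_pair, descLength_nat]
  have : descLength r ≤ 9 := by cases r <;> decide
  dsimp only
  omega

theorem descLength_dgate_le {g : Gate DWire} {Y : ℕ} (h : ∀ w ∈ g.wires, w.2 ≤ Y) :
    descLength g ≤ 6 * Y + 60 := by
  have key : ∀ w ∈ g.wires, descLength w ≤ 2 * Y + 11 := fun w hw =>
    (descLength_dwire_le w).trans (by have := h w hw; omega)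
  cases g <;> simp only [Gate.wires, List.mem_cons, List.not_mem_nil, or_false,
    forall_eq_or_imp, forall_eq] at key
  case flip w => change descLength ((0 : ℕ), w) ≤ _; simp only [descLength_pair, descLength_nat]; omega
  case cnot a w =>
    change descLength ((1 : ℕ), a, w) ≤ _; simp only [descLength_pair, descLength_nat]; omega
  case ccnot a b w =>
    change descLength ((2 : ℕ), a, b, w) ≤ _; simp only [descLength_pair, descLength_nat]; omega
  case had w => change descLength ((3 : ℕ), w) ≤ _; simp only [descLength_pair, descLength_nat]; omega
  case phase w => change descLength ((4 : ℕ), w) ≤ _; simp only [descLength_pair, descLength_nat]; omega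
  case reset w => change descLength ((5 : ℕ), w) ≤ _; simp only [descLength_pair, descLength_nat]; omega
  case coin w => change descLength ((6 : ℕ), w) ≤ _; simp only [descLength_pair, descLength_nat]; omega

theorem descLength_dcircuit_le {C : Circuit DWire} {Y : ℕ} (h : C.On {w | w.2 ≤ Y}) :
    descLength C ≤ C.length * (6 * Y + 61) + 1 := by
  induction C with
  | nil => simp [descLength_nil]
  | cons g C ih =>
    rw [Circuit.on_cons] at h
    have h1 := descLength_dgate_le h.1
    have h2 := ih h.2
    rw [descLength_cons, List.length_cons]
    nlinarith

theorem length_dephaseCircuit (M : ℕ) : (dephaseCircuit M).length = 2 * M := by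
  simp [dephaseCircuit, List.length_flatMap, mul_comm]

theorem length_handoverCircuit (M : ℕ) : (handoverCircuit M).length = 4 * M := by
  simp [handoverCircuit, List.length_flatMap, mul_comm]

theorem length_inputFlips (v : Val) : (inputFlips v).length ≤ v.length + 1 := by
  have h1 : ∀ (l : List Bool) (n : ℕ), ((l.zipIdx n).flatMap fun bk : Bool × ℕ =>
      if bk.1 then [Gate.flip ((Port.inp, bk.2) : PWire)] else []).length ≤ l.length := by
    intro l
    induction l with
    | nil => simp
    | cons b l ih =>
      intro n
      have := ih (n + 1)
      cases b <;> simp [List.zipIdx_cons] at * <;> omega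
  cases v with
  | none => simp [inputFlips]
  | some l => simpa [inputFlips, Val.length] using h1 l 0

theorem length_cleanCircuit (N M : ℕ) (v : Val) :
    (cleanCircuit N M v).length ≤ 2 * (v.length + 1) + 3 * M := by
  have h := length_inputFlips v
  have h2 : ((List.range M).flatMap fun k => [Gate.reset ((Port.inp, k) : PWire),
      .reset (.out, k), .reset (.work, N + k)]).length = 3 * M := by
    simp [List.length_flatMap, mul_comm]
  rw [cleanCircuit, List.length_append, List.length_append, h2]
  omega

theorem length_execCircuit (L : ℕ) (c : Bool) (P : List (Step 0)) (A : List (Circuit PWire)) :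
    (execCircuit L c P A).length ≤ descLength P + descLength A + 4 * L * P.length := by
  induction P generalizing A with
  | nil => simp [execCircuit]
  | cons s P ih =>
    rw [descLength_cons, List.length_cons]
    cases s with
    | send b C =>
      have h1 := ih A.tail
      have h2 : descLength C ≤ descLength (Step.send b C : Step 0) := by
        change _ ≤ descLength ((0 : ℕ), b, C)
        rw [descLength_pair, descLength_pair]
        omega
      have h3 := length_lt_descLength C
      have h4 : (A.headD []).length + descLength A.tail ≤ descLength A := by
        cases A with
        | nil => simp
        | cons C A =>
          have := length_lt_descLength C
          simp only [List.headD_cons, List.tail_cons, descLength_cons]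
          omega
      have h5 : (if b = c then ([] : Circuit Wire) else
          C.map (Gate.map honWire) ++ dephaseCircuit L).length ≤ C.length + 2 * L := by
        split_ifs
        · simp
        · simp [length_dephaseCircuit]
      simp only [execCircuit, List.length_append, List.length_map, length_dephaseCircuit]
      rw [mul_add]
      omega
    | call i => exact i.elim0
    | handover =>
      have h1 := ih A
      simp only [execCircuit, List.length_append, length_handoverCircuit]
      rw [mul_add]
      omega

/-! ### The calling protocol runs in its own frame -/

/-- The frame of the honest party's work space does not concern the distinguisher. -/
theorem adjoin_embed_frame (σ : QState) (j : ℕ) (K : Op Wire) :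
    adjoin σ (embed (frameEmb j) ∅ K) = embed (frameEmb j) ∅ (adjoin σ K) := by
  have hc : ∀ s : Finset Wire, content .dist (inner (frameEmb j) s) = content .dist s := by
    intro s
    ext k
    rw [mem_content, mem_inner, frameEmb_of_ne (by simp), mem_content]
  have ho : ∀ s : Finset Wire, outer (frameEmb j) (s.filter fun w => w.1 ≠ Reg.dist) =
      outer (frameEmb j) s := by
    intro s
    ext w
    rw [mem_outer_frameEmb, mem_outer_frameEmb, Finset.mem_filter]
    refine ⟨fun h => ⟨h.1.1, h.2⟩, fun h => ⟨⟨h.1, ?_⟩, h.2⟩⟩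
    rw [h.2.1]; simp
  have hi : ∀ s : Finset Wire, inner (frameEmb j) (s.filter fun w => w.1 ≠ Reg.dist) =
      (inner (frameEmb j) s).filter fun w => w.1 ≠ Reg.dist := by
    intro s
    ext w
    rw [mem_inner, Finset.mem_filter, Finset.mem_filter, mem_inner]
    refine and_congr_right fun _ => ?_
    by_cases hr : w.1 = Reg.honWork
    · obtain ⟨r, k⟩ := w
      dsimp only at hr
      subst hr
      simp [frameEmb_honWork]
    · rw [frameEmb_of_ne hr]
  funext s t
  simp only [adjoin, embed, hc, ho, hi]
  split_ifs <;> simp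

theorem acceptProb_embed_frame (D : Circuit DWire) (σ : QState) (j : ℕ) (K : Op Wire) :
    acceptProb D σ (embed (frameEmb j) ∅ K) = acceptProb D σ K := by
  have hD : (D.map (Gate.map distWire)).map (Gate.map (frameEmb j)) = D.map (Gate.map distWire) := by
    rw [List.map_map]
    refine List.map_congr_left fun g _ => ?_
    simp only [Function.comp, Gate.map_map]
    refine Gate.map_congr fun w _ => ?_
    obtain ⟨⟨⟩, k⟩ := w <;> rfl
  have hw : frameEmb j ((Reg.dist, 0) : Wire) = (Reg.dist, 0) := frameEmb_of_ne (by simp)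
  rw [acceptProb_eq, acceptProb_eq, adjoin_embed_frame, ← hD, run_embed, hD]
  conv_lhs => rw [← hw]
  exact weight_embed (by simp) _ _

/-- It does not matter in which frame a protocol is executed. -/
theorem acceptProb_session_inFrame {m : ℕ} (f : Fin m → Functionality) (lam : ℕ) (c : Bool)
    (D : Circuit DWire) (σ : QState) (j : ℕ) (P : List (Step m)) (A : List (Circuit PWire))
    (x : Bool → Val) (ρ : QState) :
    acceptProb D σ (exec f lam c (session (P.map (Step.inFrame j))) A (start c x ρ)) =
      acceptProb D σ (exec f lam c (session P) A (start c x ρ)) := by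
  have h := embed_frameEmb_start (j := j) (h := ∅) (by simp) c x ρ
  rw [Finset.empty_union, ← start_eq_embed] at h
  conv_lhs => rw [← h]
  rw [session_inFrame, exec_embed_frame, acceptProb_embed_frame]

theorem supp_start (c : Bool) (x : Bool → Val) (ρ : QState) :
    Supp (fun s => ∀ w ∈ s, w.1 = Reg.advWork ∧ w.2 < ρ.qubits ∨
      w.1 = Reg.advInp ∧ w.2 < (x c).length + 1 ∨ w.1 = Reg.honOut ∧ w.2 < (x (!c)).length + 1)
      (start c x ρ) := by
  have key : ∀ s : Finset Wire, s.filter (fun w => w.1 ≠ Reg.advWork) =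
      fill .advInp (x c).toWires ∪ fill .honOut (x (!c)).toWires →
      content .advWork s ⊆ Finset.range ρ.qubits →
      ∀ w ∈ s, w.1 = Reg.advWork ∧ w.2 < ρ.qubits ∨
        w.1 = Reg.advInp ∧ w.2 < (x c).length + 1 ∨
        w.1 = Reg.honOut ∧ w.2 < (x (!c)).length + 1 := by
    intro s hs hq w hw
    by_cases hr : w.1 = Reg.advWork
    · refine Or.inl ⟨hr, Finset.mem_range.1 (hq (mem_content.2 ?_))⟩
      rw [← hr]; exact hw
    · have : w ∈ fill .advInp (x c).toWires ∪ fill .honOut (x (!c)).toWires :=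
        hs ▸ Finset.mem_filter.2 ⟨hw, hr⟩
      rcases Finset.mem_union.1 this with h | h
      · exact Or.inr (Or.inl ⟨(mem_fill.1 h).1, Val.lt_of_mem_toWires (mem_fill.1 h).2⟩)
      · exact Or.inr (Or.inr ⟨(mem_fill.1 h).1, Val.lt_of_mem_toWires (mem_fill.1 h).2⟩)
  intro s t hst
  simp only [start] at hst
  split_ifs at hst with h
  · obtain ⟨h1, h2⟩ := ρ.op_supp hst
    exact ⟨key s h.1 h1, key t h.2 h2⟩
  · exact absurd rfl hst

theorem ready_start {M₁ : ℕ} (c : Bool) (x : Bool → Val) (ρ : QState) :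
    Ready ρ.qubits M₁ (x c) (handover (start c x ρ)) := by
  refine ready_handover (isState_start c x ρ) (supp_advReady_start c x ρ)
    ((supp_start c x ρ).mono fun s h w hw => ?_)
  rcases h w hw with h | h | h <;> simp [h.1, IsSuspended]

theorem bdd_start {L : ℕ} (c : Bool) (x : Bool → Val) {ρ : QState} (hρ : ρ.qubits ≤ L)
    (hx : ∀ b, (x b).length < L) : Bdd L (handover (start c x ρ)) := by
  refine Bdd.handover ((supp_start c x ρ).mono fun s h w hw => ?_)
  have h1 := hx c
  have h2 := hx (!c)
  rcases h w hw with h | h | h <;> omega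

/-! ### Composition with packed adversaries -/

section Bounds

theorem descLength_simInput (z : SimInput) : descLength z = descLength z.lam + (descLength z.slack +
    (descLength z.corrupted + (descLength z.input + (descLength z.code + descLength z.qubits + 1)
      + 1) + 1) + 1) + 1 := rfl

theorem length_le_descLength_val (v : Val) : v.length ≤ descLength v := by
  cases v with
  | none => exact Nat.zero_le _
  | some l =>
    have : descLength (some l : Val) = 1 + descLength l + 1 := rfl
    have := length_lt_descLength l
    simp only [Val.length]
    omega

theorem descLength_val_le (v : Val) : descLength v ≤ 4 * v.length + 3 := by
  have key : ∀ l : List Bool, descLength l ≤ 4 * l.length + 1 := by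
    intro l
    induction l with
    | nil => rfl
    | cons b l ih =>
      have : descLength b ≤ 3 := by cases b <;> decide
      rw [descLength_cons, List.length_cons]
      omega
  cases v with
  | none => simp [Val.length, descLength, Enc.enc, Tree.size]
  | some l =>
    have h1 : descLength (some l : Val) = 1 + descLength l + 1 := rfl
    have := key l
    simp only [Val.length]
    omega

variable {m : ℕ}

/-- Bounds on the wires that are used in an execution in which all sessions of subprotocols are
simulated. They are polynomials in the length of what the composed simulator is given: `P₁` bounds
the circuits of the calling protocol, and hence the values that the honest party hands over, `P₂`
bounds the simulators of the subprotocols, and `q` also bounds the outputs of the ideal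
functionalities and the frame `0` of the honest party's work space. -/
structure HybridBounds (f : Fin m → Functionality) (π : Protocol m)
    (S : Fin m → SimInput → Circuit PWire × Circuit PWire) (P₁ P₂ q : Polynomial ℕ) : Prop where
  protocol : ∀ z : SimInput, descLength (π z.lam) ≤ P₁.eval (descLength z)
  sim : ∀ (z : SimInput) (i : Fin m) (A : List (Circuit PWire)), A <:+ z.code →
    descLength (S i (subInput (π z.lam).length z A)) ≤ P₂.eval (descLength z)
  le₁ : ∀ d, P₁.eval d ≤ P₂.eval d
  le₂ : ∀ d, P₂.eval d ≤ q.eval d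
  lt : ∀ d, d < q.eval d
  sq : ∀ d, (P₁.eval d + 1) ^ 2 ≤ q.eval d
  functionality : ∀ i, ∃ r : Polynomial ℕ, (∀ lam x, ∀ y ∈ ((f i).eval lam x).support, ∀ b,
    (y b).length ≤ r.eval (lam + (x false).length + (x true).length)) ∧
      ∀ z : SimInput, r.eval (z.lam + 2 * P₂.eval (descLength z)) < q.eval (descLength z)

/-- The slack that a simulator of a subprotocol is given is of length `2 * s * (n + 1)` in unary,
which is where the product with `P₁ + 1` comes from. -/
theorem exists_hybridBounds (f : Fin m → Functionality) {π : Protocol m} (hπ : PolyTime π)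
    {S : Fin m → SimInput → Circuit PWire × Circuit PWire} (hS : ∀ i, PolyTime (S i)) :
    ∃ P₁ P₂ q : Polynomial ℕ, HybridBounds f π S P₁ P₂ q := by
  obtain ⟨P₁, hP₁⟩ := hπ.size_le
  choose p hp using fun i => (hS i).size_le
  choose r hr using fun i => (f i).poly_length
  have hz : ∀ z : SimInput, descLength (π z.lam) ≤ P₁.eval (descLength z) := fun z =>
    (hP₁ z.lam).trans (poly_mono P₁ (by rw [descLength_simInput]; omega))
  have hsum : ∀ (p : Fin m → Polynomial ℕ) (i : Fin m) (k : ℕ),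
      (p i).eval k ≤ (∑ i, p i).eval k := fun p i k => by
    rw [Polynomial.eval_finsetSum]
    exact Finset.single_le_sum (f := fun i => (p i).eval k) (fun _ _ => Nat.zero_le _)
      (Finset.mem_univ i)
  refine ⟨P₁, P₁ + (∑ i, p i).comp (.X + 4 * .X * (P₁ + 1)),
    .X + 1 + (P₁ + 1) ^ 2 + (P₁ + (∑ i, p i).comp (.X + 4 * .X * (P₁ + 1))) +
      (∑ i, r i).comp (.X + 2 * (P₁ + (∑ i, p i).comp (.X + 4 * .X * (P₁ + 1)))),
    hz, ?_, ?_, ?_, ?_, ?_, ?_⟩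
  · intro z i A hA
    refine (hp i _).trans ((poly_mono (p i)
      (b := descLength z + 4 * descLength z * (P₁.eval (descLength z) + 1)) ?_).trans
      ((hsum p i _).trans ?_))
    · have h1 := descLength_suffix_le hA
      have h2 : (π z.lam).length ≤ P₁.eval (descLength z) :=
        (length_lt_descLength _).le.trans (hz z)
      have h3 : z.slack ≤ descLength z := by
        rw [descLength_simInput, descLength_nat z.slack]; omega
      have h4 : z.slack * ((π z.lam).length + 1) ≤
          descLength z * (P₁.eval (descLength z) + 1) :=
        Nat.mul_le_mul h3 (by omega)
      have h5 : descLength (subInput (π z.lam).length z A) + descLength z.slack +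
          descLength z.code = descLength z + descLength (2 * z.slack * ((π z.lam).length + 1)) +
          descLength A := by
        rw [descLength_simInput, descLength_simInput z]
        simp only [subInput]
        omega
      rw [descLength_nat, descLength_nat] at h5
      have h6 : 2 * z.slack * ((π z.lam).length + 1) = 2 * (z.slack * ((π z.lam).length + 1)) := by
        ring
      have h7 : 4 * descLength z * (P₁.eval (descLength z) + 1) =
          4 * (descLength z * (P₁.eval (descLength z) + 1)) := by ring
      omega
    · simp only [Polynomial.eval_add, Polynomial.eval_comp, Polynomial.eval_X, Polynomial.eval_mul,
        Polynomial.eval_ofNat, Polynomial.eval_one]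
      omega
  · intro d; rw [Polynomial.eval_add]; omega
  · intro d; simp only [Polynomial.eval_add]; omega
  · intro d
    simp only [Polynomial.eval_add, Polynomial.eval_X, Polynomial.eval_one]; omega
  · intro d
    simp only [Polynomial.eval_add, Polynomial.eval_X, Polynomial.eval_one, Polynomial.eval_pow]
    omega
  · intro i
    refine ⟨r i, hr i, fun z => ?_⟩
    refine lt_of_le_of_lt ((poly_mono (r i) ?_).trans (hsum r i _)) (b :=
      (∑ i, r i).eval (descLength z + 2 * (P₁ + (∑ i, p i).comp (.X + 4 * .X * (P₁ + 1))).eval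
        (descLength z))) ?_
    · have : z.lam ≤ descLength z := by rw [descLength_simInput, descLength_nat z.lam]; omega
      omega
    · simp only [Polynomial.eval_add, Polynomial.eval_comp, Polynomial.eval_X, Polynomial.eval_mul,
        Polynomial.eval_ofNat, Polynomial.eval_one, Polynomial.eval_pow]
      omega

end Bounds

section Packed

variable {m : ℕ}

/-- A bound on the length of the descriptions of the distinguishers in the hybrid argument, if all
wires have an index below `L`: the first factor bounds the number of gates, the second one the
length of the description of a gate by `descLength_dgate_le`. -/
def viewSize (L : ℕ) : ℕ := (8 * L + 9 + 4 * L * (L + 1)) * (24 * L + 79) + 1 + 4 * L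

theorem PolyBounded.viewSize {u : ℕ → ℕ} (hu : PolyBounded u) :
    PolyBounded (fun n => viewSize (u n)) :=
  (((((((polyBounded_const 8).mul hu).add (polyBounded_const 9)).add
    (((polyBounded_const 4).mul hu).mul (hu.add (polyBounded_const 1)))).mul
      (((polyBounded_const 24).mul hu).add (polyBounded_const 79))).add (polyBounded_const 1)).add
        ((polyBounded_const 4).mul hu))

/-- For a fixed security parameter, replacing the sessions of the composed protocol by ideal calls
costs the distinguishing advantage `η` per session. -/
theorem abs_composed_diff_le {f : Fin m → Functionality} {π : Protocol m}
    {S : Fin m → SimInput → Circuit PWire × Circuit PWire} {P₁ P₂ q : Polynomial ℕ}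
    (hb : HybridBounds f π S P₁ P₂ q)
    (hπ : ∀ lam b C, Step.send b C ∈ π lam → ∀ g ∈ C, g.IsClassical) (ρ : Fin m → Protocol 0)
    (f₀ : Fin 0 → Functionality) {lam s : ℕ} {c : Bool} {x : Bool → Val}
    {A : List (Circuit PWire)} {ρ₀ : QState} (hA : ∀ C ∈ A, Packed ρ₀.qubits C)
    {D : Circuit DWire} {σ : QState} {L : ℕ}
    (hL : 2 * q.eval (descLength (SimInput.mk lam s c (x c) A ρ₀.qubits)) + σ.qubits +
      descLength D + descLength (compose π ρ lam) + (x false).length + (x true).length + 1 ≤ L)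
    {η : ℝ} (hη : 0 ≤ η)
    (hsec : ∀ i (A' : List (Circuit PWire)) (ρ' : QState) (x' : Bool → Val) (D' : Circuit DWire)
      (σ' : QState), descLength A' ≤ viewSize L → ρ'.qubits ≤ viewSize L →
      (∀ b, (x' b).length ≤ viewSize L) → descLength D' ≤ viewSize L → σ'.qubits ≤ viewSize L →
      |acceptProb D' σ' (hybridExec f₀ (ρ i) c lam x' A' ρ') -
        acceptProb D' σ' (idealExec (f i) c lam x'
          (S i (SimInput.mk lam (2 * s * ((π lam).length + 1)) c (x' c) A' ρ'.qubits)) ρ')| ≤ η) :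
    |acceptProb D σ (hybridExec f₀ (compose π ρ) c lam x A ρ₀) -
      acceptProb D σ (hybridExec f π c lam x
        (hybridInput S q π ρ (SimInput.mk lam s c (x c) A ρ₀.qubits)).code ρ₀)| ≤
      (π lam).length * η := by
  set z := SimInput.mk lam s c (x c) A ρ₀.qubits with hz
  have hzd := descLength_simInput z
  have hlt := hb.lt (descLength z)
  have hP₁ := hb.protocol z
  have hle₁ := hb.le₁ (descLength z)
  have hle₂ := hb.le₂ (descLength z)
  have hsq := hb.sq (descLength z)
  have hv : (x c).length < q.eval (descLength z) := by
    have : (x c).length ≤ descLength z.input := length_le_descLength_val (x c)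
    omega
  have hN : ρ₀.qubits ≤ q.eval (descLength z) := by
    have : descLength z.qubits = 2 * ρ₀.qubits + 1 := descLength_nat _
    omega
  have hAd : descLength A ≤ descLength z := by
    have : descLength z.code = descLength A := rfl
    omega
  have hD : D.On {w | w.2 < L} := D.on_descLength (by omega) lt_descLength_dwire
  have hview : L ≤ viewSize L ∧ 4 * L ≤ viewSize L := by
    rw [viewSize]; constructor <;> omega
  have hQd := length_lt_descLength (compose π ρ lam)
  set Q := compose π ρ lam with hQ
  have main := abs_hybrid_diff_le f₀ f lam c (fun i => ρ i lam)
    (fun i A => S i (subInput (π lam).length z A)) (N := ρ₀.qubits)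
    (M₁ := P₁.eval (descLength z)) (Ms := P₂.eval (descLength z)) (M := q.eval (descLength z))
    (L := L) (B := 2 * L + 9 + 4 * L * (L + 1)) (v := x c) (D := D) (σ := σ) (A₀ := A) hη
    hv hN hle₁ hle₂ (by omega) (by omega) hD ?_ ?_ ?_ ?_ (π lam) 0 A (handover (start c x ρ₀))
    ?_ ?_ ?_ List.suffix_rfl (ready_start c x ρ₀) (bdd_start c x (by omega) (by
      intro b; cases b <;> omega))
  · have h1 : hybridExec f₀ (compose π ρ) c lam x A ρ₀ = exec f₀ lam c
        (composeFrom (fun i => ρ i lam) 0 (π lam) ++ [.handover]) A (handover (start c x ρ₀)) := rfl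
    have h2 := acceptProb_session_inFrame f lam c D σ 0 (π lam)
      (hybridInput S q π ρ z).code x ρ₀
    rw [h1, hybridExec, ← h2]
    exact main
  · intro C hC
    exact ⟨hA C hC, C.on_descLength ((descLength_le_of_mem_code hC).trans (by omega))
      lt_descLength_wire⟩
  · intro i A' hA'
    have h1 := hb.sim z i A' hA'
    rw [descLength_prod] at h1
    change descLength (S i (subInput (π lam).length z A')).1 +
      descLength (S i (subInput (π lam).length z A')).2 + 1 ≤ _ at h1
    exact ⟨Circuit.on_descLength _ (by omega) lt_descLength_wire,
      Circuit.on_descLength _ (by omega) lt_descLength_wire⟩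
  · intro i
    obtain ⟨r, h1, h2⟩ := hb.functionality i
    exact ⟨r, h1, h2 z⟩
  · intro i A' U hA' hU hUl x' ρ' σ' hx hx' hρ hσ'
    have h1 : (D.length : ℕ) ≤ L := (length_lt_descLength D).le.trans (by omega)
    have h2 := length_cleanCircuit ρ₀.qubits (q.eval (descLength z)) (x c)
    have h3 := hsec i A' ρ' x' (((cleanCircuit ρ₀.qubits (q.eval (descLength z)) (x c)).map
      (Gate.map advWire) ++ U).map (Gate.map viewPort)) σ'
      ((descLength_suffix_le hA').trans (by omega)) (by omega) ?_ ?_ (by omega)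
    · rw [hx, hρ] at h3
      exact h3
    · intro b
      by_cases hbc : b = c
      · rw [hbc, hx]; omega
      · have : b = !c := by cases b <;> cases c <;> simp_all
        rw [this]; omega
    · refine (descLength_dcircuit_le (Y := 4 * L + 3) ?_).trans ?_
      · refine Circuit.On.map (X := {w : Wire | w.2 ≤ L}) (Circuit.On.append ?_ hU) _ ?_
        · refine (on_cleanCircuit hv).map _ fun w hw => ?_
          have := advWire_snd w
          have := hw.2
          change (advWire w).2 ≤ L
          omega
        · rintro ⟨⟨⟩, k⟩ hk <;> change k ≤ L at hk <;>
            simp only [viewPort, Set.mem_ofPred_eq] <;> omega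
      · rw [List.length_map, List.length_append, List.length_map, viewSize]
        refine (Nat.add_le_add_right (Nat.mul_le_mul ?_ ?_) 1).trans (Nat.le_add_right _ _)
        · omega
        · omega
  · intro b C h
    have h1 := descLength_le_of_send h
    refine ⟨hπ lam b C h, (C.on_descLength (h1.trans hP₁) lt_descLength_wire).mono
      fun w hw _ => hw, (C.on_descLength (h1.trans hP₁) lt_descLength_wire).map _ ?_⟩
    rintro ⟨r, k⟩ hk
    change k < _ at hk
    change (inFrame 0 (r, k)).2 < _
    have h2 : k < q.eval (descLength z) := by omega
    cases r
    · have h3 := Nat.pair_lt_max_add_one_sq 0 k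
      have h4 : (max 0 k + 1) ^ 2 ≤ (P₁.eval (descLength z) + 1) ^ 2 :=
        Nat.pow_le_pow_left (by simp; omega) 2
      exact h3.trans_le (h4.trans hsq)
    · exact h2
    · exact h2
    · exact h2
  · intro b C h
    exact C.on_descLength ((descLength_le_of_send (P := Q) h).trans (by omega)) lt_descLength_wire
  · refine (length_execCircuit _ _ _ _).trans ?_
    have h1 := descLength_append Q [Step.handover]
    have h2 : descLength [(Step.handover : Step 0)] = 9 := rfl
    have h3 : (Q ++ [Step.handover]).length ≤ L + 1 := by
      rw [List.length_append, List.length_singleton]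
      omega
    have h4 := Nat.mul_le_mul_left (4 * L) h3
    change descLength (Q ++ [Step.handover]) + descLength A +
      4 * L * (Q ++ [Step.handover]).length ≤ _
    omega

theorem Noticeable.eventually_ceil_ne_zero {ε : ℕ → ℝ} (h : Noticeable ε) :
    ∀ᶠ n in Filter.atTop, ⌈1 / ε n⌉₊ ≠ 0 := by
  obtain ⟨-, k, hk⟩ := h
  filter_upwards [hk, Filter.eventually_gt_atTop 0] with n hn hn0
  have hpos : (0 : ℝ) < 1 / (n : ℝ) ^ k := by positivity
  exact (Nat.ceil_pos.2 (one_div_pos.2 (hpos.trans_le hn))).ne'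

/-- The simulator is given a description of polynomial length. -/
theorem polyBounded_simInput (A : NonUniformQPT (List (Circuit PWire))) (c : Bool)
    {x : ℕ → Val} (hx : PolyBounded (fun lam => (x lam).length)) {s : ℕ → ℕ} (hs : PolyBounded s) :
    PolyBounded (fun lam =>
      descLength (SimInput.mk lam (s lam) c (x lam) (A.code lam) (A.advice lam).qubits)) := by
  refine (((((polyBounded_const 2).mul polyBounded_id).add (polyBounded_const 1)).add
    (((polyBounded_const 2).mul hs).add (((polyBounded_const 4).mul hx).add (A.poly_code.add
      ((polyBounded_const 2).mul A.poly_advice))))).add (polyBounded_const 20)).mono fun lam => ?_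
  have h1 : descLength c ≤ 3 := by cases c <;> decide
  have h2 := descLength_val_le (x lam)
  rw [descLength_simInput]
  simp only [descLength_nat]
  omega

/-- The composed protocol is secure against adversaries that keep all their qubits in the work
space. Half of the slack is spent on the calling protocol, and the other half is shared equally
between the sessions of the subprotocols. -/
theorem indistUpTo_of_packed {f : Fin m → Functionality} {g : Functionality} {π : Protocol m}
    {S : Fin m → SimInput → Circuit PWire × Circuit PWire}
    {Sπ : SimInput → Circuit PWire × Circuit PWire} {P₁ P₂ q : Polynomial ℕ}
    (hb : HybridBounds f π S P₁ P₂ q) (hπ : π.IsPPT) {ρ : Fin m → Protocol 0}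
    (hρ : ∀ i, (ρ i).IsPPT) (hS : ∀ i, PolyTime (S i)) {f₀ : Fin 0 → Functionality}
    (hπsec : ∀ (A : NonUniformQPT (List (Circuit PWire))) (c : Bool) (x : ℕ → Bool → Val),
      (∀ b, PolyBounded (fun lam => (x lam b).length)) → ∀ ε : ℕ → ℝ, Noticeable ε →
        IndistUpTo ε (fun lam => hybridExec f π c lam (x lam) (A.code lam) (A.advice lam))
          (fun lam => idealExec g c lam (x lam)
            (Sπ (SimInput.mk lam ⌈1 / ε lam⌉₊ c (x lam c) (A.code lam) (A.advice lam).qubits))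
            (A.advice lam)))
    (hρsec : ∀ (i : Fin m) (A : NonUniformQPT (List (Circuit PWire))) (c : Bool)
      (x : ℕ → Bool → Val), (∀ b, PolyBounded (fun lam => (x lam b).length)) →
      ∀ ε : ℕ → ℝ, Noticeable ε →
        IndistUpTo ε (fun lam => hybridExec f₀ (ρ i) c lam (x lam) (A.code lam) (A.advice lam))
          (fun lam => idealExec (f i) c lam (x lam)
            (S i (SimInput.mk lam ⌈1 / ε lam⌉₊ c (x lam c) (A.code lam) (A.advice lam).qubits))
            (A.advice lam)))
    (A : NonUniformQPT (List (Circuit PWire)))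
    (hA : ∀ lam, ∀ C ∈ A.code lam, Packed (A.advice lam).qubits C) (c : Bool)
    (x : ℕ → Bool → Val) (hx : ∀ b, PolyBounded (fun lam => (x lam b).length)) (s : ℕ → ℕ)
    {ε : ℕ → ℝ} (hε : Noticeable ε) (hs : ∀ lam, s lam = ⌈1 / ε lam⌉₊) :
    IndistUpTo ε (fun lam => hybridExec f₀ (compose π ρ) c lam (x lam) (A.code lam) (A.advice lam))
      (fun lam => idealExec g c lam (x lam) (Sπ (hybridInput S q π ρ
        (SimInput.mk lam (s lam) c (x lam c) (A.code lam) (A.advice lam).qubits)))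
        (A.advice lam)) := by
  refine indistUpTo_of_eventually fun D k => ?_
  have hspoly : PolyBounded s := hε.polyBounded_ceil.mono fun lam => (hs lam).le
  have hs0 : ∀ᶠ lam in Filter.atTop, s lam ≠ 0 := by
    filter_upwards [hε.eventually_ceil_ne_zero] with lam h
    rwa [hs]
  have hlam : PolyBounded (fun lam => descLength lam) :=
    (((polyBounded_const 2).mul polyBounded_id).add (polyBounded_const 1)).mono fun lam =>
      (descLength_nat lam).le
  let z : ℕ → SimInput := fun lam =>
    SimInput.mk lam (s lam) c (x lam c) (A.code lam) (A.advice lam).qubits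
  have hz : PolyBounded (fun lam => descLength (z lam)) :=
    polyBounded_simInput A c (hx c) hspoly
  have hn : PolyBounded (fun lam => (π lam).length + 1) := by
    obtain ⟨p, hp⟩ := hπ.1.size_le
    exact (hlam.eval p).mono fun lam => (length_lt_descLength (π lam)).trans_le (hp lam)
  have hQ : PolyBounded (fun lam => descLength (compose π ρ lam)) := by
    obtain ⟨p, hp⟩ := (hπ.compose hρ).1.size_le
    exact (hlam.eval p).mono fun lam => hp lam
  let L : ℕ → ℕ := fun lam => 2 * q.eval (descLength (z lam)) + (D.advice lam).qubits +
      descLength (D.code lam) + descLength (compose π ρ lam) + (x lam false).length +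
      (x lam true).length + 1
  have hL : PolyBounded L :=
    ((((((((polyBounded_const 2).mul (hz.eval q)).add D.poly_advice).add D.poly_code).add hQ).add
      (hx false)).add (hx true)).add (polyBounded_const 1))
  -- the slack of the sessions, and that of the calling protocol
  let δ : ℕ → ℝ := fun lam => 1 / ((2 * s lam * ((π lam).length + 1) : ℕ) : ℝ)
  have hδ : Noticeable δ := by
    refine noticeable_one_div (((polyBounded_const 2).mul hspoly).mul hn) ?_
    filter_upwards [hs0] with lam h
    simp [h]
  let δ' : ℕ → ℝ := fun lam => 1 / ((2 * s lam : ℕ) : ℝ)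
  have hδ' : Noticeable δ' := by
    refine noticeable_one_div ((polyBounded_const 2).mul hspoly) ?_
    filter_upwards [hs0] with lam h
    simp [h]
  obtain ⟨a, ha⟩ : ∃ a : ℕ, ∀ᶠ lam in Filter.atTop, (π lam).length + 1 ≤ lam ^ a := by
    obtain ⟨p, hp⟩ := hn
    obtain ⟨a, ha⟩ := exists_pow_bound p
    refine ⟨a, ?_⟩
    filter_upwards [Filter.eventually_ge_atTop 2] with lam h
    exact (hp lam).trans (ha lam h)
  have hsub : ∀ᶠ lam : ℕ in Filter.atTop, ∀ i, ∀ (A : List (Circuit PWire)) (ρ' : QState)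
      (x : Bool → Val) (D : Circuit DWire) (σ : QState), descLength A ≤ viewSize (L lam) →
      ρ'.qubits ≤ viewSize (L lam) → (∀ b, (x b).length ≤ viewSize (L lam)) →
      descLength D ≤ viewSize (L lam) → σ.qubits ≤ viewSize (L lam) →
      |acceptProb D σ (hybridExec f₀ (ρ i) c lam x A ρ') -
        acceptProb D σ (idealExec (f i) c lam x
          (S i (SimInput.mk lam ⌈1 / δ lam⌉₊ c (x c) A ρ'.qubits)) ρ')| ≤
        δ lam + 1 / (lam : ℝ) ^ (a + k) :=
    Filter.eventually_all.2 fun i => eventually_uniform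
      (X := fun lam A ρ' x => hybridExec f₀ (ρ i) c lam x A ρ')
      (Y := fun lam A ρ' x => idealExec (f i) c lam x
        (S i (SimInput.mk lam ⌈1 / δ lam⌉₊ c (x c) A ρ'.qubits)) ρ')
      (fun A x hx => hρsec i A c x hx δ hδ) hL.viewSize (a + k)
  let B : NonUniformQPT (List (Circuit PWire)) :=
    { code := fun lam => (hybridInput S q π ρ (z lam)).code
      advice := A.advice
      poly_code := by
        obtain ⟨p, hp⟩ := (polyTime_hybridInput hS q hπ.1 fun i => (hρ i).1).size_le
        refine (hz.eval p).mono fun lam => le_trans ?_ (hp (z lam))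
        rw [descLength_simInput]
        omega
      poly_advice := A.poly_advice }
  have hsup := (hπsec B c x hx δ' hδ').eventually D (a + k)
  filter_upwards [hsub, hsup, ha, hs0, Filter.eventually_gt_atTop 0] with lam h1 h2 h3 h4 h5
  have hceil : ∀ n : ℕ, ⌈1 / (1 / (n : ℝ))⌉₊ = n := fun n => by
    rw [one_div_one_div, Nat.ceil_natCast]
  have hη : 0 ≤ δ lam + 1 / (lam : ℝ) ^ (a + k) := by
    have : 0 ≤ δ lam := (hδ.1 lam).1
    positivity
  have key := abs_composed_diff_le hb hπ.2 ρ f₀ (lam := lam) (s := s lam) (c := c) (x := x lam)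
    (hA lam) (D := D.code lam) (σ := D.advice lam) (L := L lam) le_rfl hη
    (fun i A' ρ' x' D' σ' e1 e2 e3 e4 e5 => by
      have := h1 i A' ρ' x' D' σ' e1 e2 e3 e4 e5
      rwa [show ⌈1 / δ lam⌉₊ = 2 * s lam * ((π lam).length + 1) from hceil _] at this)
  simp only [show ⌈1 / δ' lam⌉₊ = 2 * s lam from hceil _] at h2
  refine (abs_sub_le _ _ _).trans ((add_le_add key h2).trans ?_)
  have hε' : 1 / (s lam : ℝ) ≤ ε lam := by
    have hs' : (1 : ℝ) / ε lam ≤ s lam := by rw [hs]; exact Nat.le_ceil _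
    have hpos : 0 < ε lam := by
      rcases (hε.1 lam).1.lt_or_eq with h | h
      · exact h
      · exact absurd (by rw [hs, ← h]; simp) h4
    have hspos : (0 : ℝ) < s lam := by exact_mod_cast Nat.pos_of_ne_zero h4
    rw [div_le_iff₀ hpos] at hs'
    rw [div_le_iff₀ hspos]
    linarith
  have hn1 : ((π lam).length : ℝ) + 1 ≤ (lam : ℝ) ^ a := by exact_mod_cast h3
  have hspos : (0 : ℝ) < s lam := by exact_mod_cast Nat.pos_of_ne_zero h4
  have hlpos : (0 : ℝ) < lam := by exact_mod_cast h5
  have hnn : (0 : ℝ) ≤ (π lam).length := Nat.cast_nonneg _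
  have e1 : ((π lam).length : ℝ) * δ lam ≤ 1 / (2 * s lam) := by
    simp only [δ]
    push_cast
    rw [mul_one_div, div_le_div_iff₀ (by positivity) (by positivity)]
    nlinarith
  have e2 : δ' lam = 1 / (2 * s lam) := by simp only [δ']; push_cast; rfl
  have e3 : (((π lam).length : ℝ) + 1) * (1 / (lam : ℝ) ^ (a + k)) ≤ 1 / (lam : ℝ) ^ k := by
    rw [mul_one_div, div_le_div_iff₀ (by positivity) (by positivity), pow_add]
    nlinarith [pow_pos hlpos k]
  have e4 : 1 / (2 * (s lam : ℝ)) + 1 / (2 * s lam) = 1 / s lam := by field_simp; norm_num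
  rw [e2]
  linarith

end Packed

/-! ### Packing the registers of an adversary into its work space -/

section Swap

variable {W : Type} [DecidableEq W]

theorem cnot_apply {a b : W} (hab : a ≠ b) (K : Op W) : (Gate.cnot a b).apply K = fun s t =>
    K (if a ∈ s then toggle b s else s) (if a ∈ t then toggle b t else t) := by
  simp [Gate.apply, hab]

theorem run_swapGates {a b : W} (hab : a ≠ b) (K : Op W) : (swapGates a b).run K = fun s t =>
    K (s.image (Equiv.swap a b)) (t.image (Equiv.swap a b)) := by
  have key : ∀ s : Finset W,
      (fun s => if a ∈ s then toggle b s else s) ((fun s => if b ∈ s then toggle a s else s)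
        ((fun s => if a ∈ s then toggle b s else s) s)) = s.image (Equiv.swap a b) := by
    intro s
    ext x
    have hx : x ∈ s.image (Equiv.swap a b) ↔ Equiv.swap a b x ∈ s := by
      rw [Finset.mem_image]
      constructor
      · rintro ⟨y, hy, rfl⟩; simpa using hy
      · intro h; exact ⟨_, h, by simp⟩
    rw [hx, Equiv.swap_apply_def]
    have hba := hab.symm
    by_cases h1 : a ∈ s <;> by_cases h2 : b ∈ s <;> by_cases h3 : x = a <;> by_cases h4 : x = b <;>
      simp_all [mem_toggle]
  simp only [swapGates, Circuit.run_cons, Circuit.run_nil, cnot_apply hab, cnot_apply hab.symm]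
  funext s t
  exact congrArg₂ K (key s) (key t)

end Swap

/-- Exchanges the first `n` wires of the register `r` with a block of the work space. -/
def blockSwap (r : Reg) (O n : ℕ) (w : Wire) : Wire :=
  if w.1 = r ∧ w.2 < n then (.advWork, O + w.2)
  else if w.1 = .advWork ∧ O ≤ w.2 ∧ w.2 < O + n then (r, w.2 - O) else w

/-- Swapping the first `n` wires of a register one by one with those of a block of the work space.
-/
theorem run_blockSwap {p : Port} {r : Reg} (hp : ∀ k, advWire (p, k) = (r, k)) (hr : r ≠ .advWork)
    (O n : ℕ) (K : Op Wire) :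
    Circuit.run ((((List.range n).flatMap fun k => swapGates ((p, k) : PWire) (.work, O + k))).map
      (Gate.map advWire) : Circuit Wire) K =
      fun s t => K (s.image (blockSwap r O n)) (t.image (blockSwap r O n)) := by
  induction n generalizing K with
  | zero =>
    have : blockSwap r O 0 = fun w => w := by
      funext w
      simp only [blockSwap, Nat.not_lt_zero, and_false, if_false]
      rw [if_neg (by omega)]
    simp [this, Circuit.run_nil]
  | succ n ih =>
    have hne : ((r, n) : Wire) ≠ (.advWork, O + n) := fun h => hr (congrArg Prod.fst h)
    have h1 : (swapGates ((p, n) : PWire) (.work, O + n)).map (Gate.map advWire) =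
        swapGates ((r, n) : Wire) (.advWork, O + n) := by
      have hw : advWire (.work, O + n) = (.advWork, O + n) := rfl
      simp only [swapGates, List.map_cons, List.map_nil, Gate.map, hp, hw]
    have h2 : ∀ w, blockSwap r O n (Equiv.swap ((r, n) : Wire) (.advWork, O + n) w) =
        blockSwap r O (n + 1) w := by
      rintro ⟨r', k⟩
      rw [Equiv.swap_apply_def]
      simp only [blockSwap, Prod.mk.injEq]
      by_cases e1 : r' = r
      · subst e1
        by_cases e2 : k = n
        · subst e2
          simp [hr.symm]
        · simp only [true_and, e2, and_false, if_false, hr, false_and]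
          by_cases e3 : k < n
          · simp [e3, Nat.lt_succ_of_lt e3]
          · simp [e3, show ¬ k < n + 1 by omega]
      · by_cases e2 : r' = .advWork
        · subst e2
          by_cases e3 : k = O + n
          · subst e3
            simp [e1, hr]
          · simp only [e1, false_and, if_false, e3, and_false, true_and]
            by_cases e4 : O ≤ k ∧ k < O + n
            · rw [if_pos e4, if_pos (by omega)]
            · rw [if_neg e4, if_neg (by omega)]
        · simp [e1, e2]
    rw [List.range_succ, List.flatMap_append, List.map_append, Circuit.run_append, ih]
    simp only [List.flatMap_cons, List.flatMap_nil, List.append_nil]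
    rw [h1, run_swapGates hne]
    funext s t
    simp only [Finset.image_image]
    congr 2 <;> exact funext h2

/-- The exchange of registers that `swapCircuit N` performs. -/
def packPerm (N : ℕ) : Wire → Wire
  | (.advInp, k) => if k < N then (.advWork, N + k) else (.advInp, k)
  | (.advOut, k) => if k < N then (.advWork, 2 * N + k) else (.advOut, k)
  | (.advWork, k) => if k < N then (.advWork, k) else if k < 2 * N then (.advInp, k - N) else
      if k < 3 * N then (.advOut, k - 2 * N) else (.advWork, k)
  | w => w

theorem packPerm_packPerm (N : ℕ) (w : Wire) : packPerm N (packPerm N w) = w := by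
  obtain ⟨r, k⟩ := w
  cases r
  case advWork =>
    simp only [packPerm]
    split_ifs <;> simp only <;> split_ifs <;> simp only [Prod.mk.injEq, true_and,
      reduceCtorEq, false_and] <;> omega
  case advInp =>
    simp only [packPerm]
    split_ifs <;> simp only <;> split_ifs <;> simp only [Prod.mk.injEq, true_and,
      reduceCtorEq, false_and] <;> omega
  case advOut =>
    simp only [packPerm]
    split_ifs <;> simp only <;> split_ifs <;> simp only [Prod.mk.injEq, true_and,
      reduceCtorEq, false_and] <;> omega
  all_goals rfl

theorem mem_image_packPerm {N : ℕ} {s : Finset Wire} {w : Wire} :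
    w ∈ s.image (packPerm N) ↔ packPerm N w ∈ s := by
  rw [Finset.mem_image]
  constructor
  · rintro ⟨y, hy, rfl⟩; rwa [packPerm_packPerm]
  · intro h; exact ⟨_, h, packPerm_packPerm N w⟩

theorem run_swapCircuit (N : ℕ) (K : Op Wire) :
    Circuit.run ((swapCircuit N).map (Gate.map advWire) : Circuit Wire) K =
      fun s t => K (s.image (packPerm N)) (t.image (packPerm N)) := by
  have h : ∀ w, blockSwap .advInp N N (blockSwap .advOut (2 * N) N w) = packPerm N w := by
    rintro ⟨r, k⟩
    cases r
    case advWork =>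
      rcases lt_or_ge k N with h1 | h1
      · simp [packPerm, blockSwap, h1, show ¬ 2 * N ≤ k by omega, show ¬ N ≤ k by omega]
      rcases lt_or_ge k (2 * N) with h2 | h2
      · simp [packPerm, blockSwap, h1, h2, show ¬ k < N by omega, show ¬ 2 * N ≤ k by omega,
          show k < N + N by omega]
      rcases lt_or_ge k (3 * N) with h3 | h3
      · simp [packPerm, blockSwap, h2, h3, show ¬ k < N by omega, show ¬ k < 2 * N by omega,
          show k < 2 * N + N by omega]
      · simp [packPerm, blockSwap, show ¬ k < N by omega, show ¬ k < 2 * N by omega,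
          show ¬ k < 3 * N by omega, show ¬ k < 2 * N + N by omega, show ¬ k < N + N by omega]
    case advInp =>
      simp only [packPerm, blockSwap, reduceCtorEq, false_and, if_false, true_and]
    case advOut =>
      simp only [packPerm, blockSwap, reduceCtorEq, false_and, if_false, true_and]
      split_ifs <;> simp_all
      omega
    all_goals simp [packPerm, blockSwap]
  rw [swapCircuit, List.map_append, Circuit.run_append,
    run_blockSwap (r := .advOut) (fun _ => rfl) (by simp),
    run_blockSwap (r := .advInp) (fun _ => rfl) (by simp)]
  funext s t
  simp only [Finset.image_image]
  congr 2 <;> exact funext h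

/-- The circuit that packs the registers of an adversary with input `v`. -/
def packCircuit (N : ℕ) (v : Val) : Circuit PWire := swapCircuit N ++ inputFlips v

/-- The inverse of `packCircuit`. -/
def unpackCircuit (N : ℕ) (v : Val) : Circuit PWire := inputFlips v ++ swapCircuit N

theorem run_packCircuit (N : ℕ) (v : Val) (K : Op Wire) :
    Circuit.run ((packCircuit N v).map (Gate.map advWire) : Circuit Wire) K = fun s t =>
      K ((symmDiff s (fill .advInp v.toWires)).image (packPerm N))
        ((symmDiff t (fill .advInp v.toWires)).image (packPerm N)) := by
  rw [packCircuit, List.map_append, Circuit.run_append, run_inputFlips, run_swapCircuit]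

theorem run_unpack_pack (N : ℕ) (v : Val) (K : Op Wire) :
    Circuit.run ((unpackCircuit N v).map (Gate.map advWire) : Circuit Wire)
      (Circuit.run ((packCircuit N v).map (Gate.map advWire) : Circuit Wire) K) = K := by
  have h : ∀ s : Finset Wire, (symmDiff (symmDiff (s.image (packPerm N)) (fill .advInp v.toWires))
      (fill .advInp v.toWires)).image (packPerm N) = s := by
    intro s
    rw [symmDiff_symmDiff]
    ext w
    rw [mem_image_packPerm, mem_image_packPerm, packPerm_packPerm]
  rw [unpackCircuit, List.map_append, Circuit.run_append, run_swapCircuit, run_inputFlips,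
    run_packCircuit]
  funext s t
  simp only [h]

theorem on_swapCircuit (N : ℕ) : (swapCircuit N).On {w | w.1 ≠ Port.msg ∧ w.2 < 3 * N} := by
  refine Circuit.On.append ?_ ?_ <;>
  · intro g hg w hw
    simp only [List.mem_flatMap, List.mem_range, swapGates, List.mem_cons, List.not_mem_nil,
      or_false] at hg
    obtain ⟨k, hk, rfl | rfl | rfl⟩ := hg <;>
      simp only [Gate.wires, List.mem_cons, List.not_mem_nil, or_false] at hw <;>
      rcases hw with rfl | rfl <;> simp <;> omega

theorem on_unpackCircuit {N : ℕ} {v : Val} (hv : v.length < N) :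
    (unpackCircuit N v).On {w | w.1 ≠ Port.msg ∧ w.2 < 3 * N} := by
  refine ((on_inputFlips v).mono ?_).append (on_swapCircuit N)
  rintro ⟨r, k⟩ ⟨h1, h2⟩
  dsimp only at h1 h2
  subst h1
  simp
  omega

theorem on_packCircuit {N : ℕ} {v : Val} (hv : v.length < N) :
    (packCircuit N v).On {w | w.1 ≠ Port.msg ∧ w.2 < 3 * N} := by
  refine (on_swapCircuit N).append ((on_inputFlips v).mono ?_)
  rintro ⟨r, k⟩ ⟨h1, h2⟩
  dsimp only at h1 h2
  subst h1
  simp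
  omega

theorem length_unpackCircuit {N : ℕ} {v : Val} (hv : v.length < N) :
    (unpackCircuit N v).length ≤ 7 * N := by
  have h := length_inputFlips v
  have h2 : (swapCircuit N).length = 6 * N := by
    simp [swapCircuit, swapGates, List.length_flatMap]
    ring
  rw [unpackCircuit, List.length_append, h2]
  omega

/-- A packed adversary does in the work space what the original adversary does in its registers. -/
theorem exec_packed (f : Fin 0 → Functionality) (lam : ℕ) (c : Bool) (P : List (Step 0)) {N : ℕ}
    (v : Val) {A : List (Circuit PWire)} (hA : ∀ C ∈ A, C.On {w | w.2 < N}) (K : Op Wire) :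
    exec f lam c P (A.map (List.map (Gate.map (packWire N))))
        (Circuit.run ((packCircuit N v).map (Gate.map advWire) : Circuit Wire) K) =
      Circuit.run ((packCircuit N v).map (Gate.map advWire) : Circuit Wire) (exec f lam c P A K) := by
  let φ : Finset Wire → Finset Wire := fun s =>
    (symmDiff s (fill .advInp v.toWires)).image (packPerm N)
  let X : Set Wire := {w | w.1 = .advInp ∨ w.1 = .advOut ∨ w.1 = .advWork → w.2 < N}
  have hmem : ∀ (w : Wire) (s : Finset Wire), w ∈ φ s ↔
      packPerm N w ∈ symmDiff s (fill .advInp v.toWires) := fun w s => mem_image_packPerm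
  have hinj : ∀ w w', packPerm N w = packPerm N w' ↔ w = w' := fun w w' =>
    ⟨fun h => by rw [← packPerm_packPerm N w, h, packPerm_packPerm], fun h => by rw [h]⟩
  have hframe : IsFrame X (packPerm N) (fun _ _ => (1 : ℂ)) φ := by
    refine ⟨fun w hw s => ?_, fun w hw s => ?_, fun _ _ _ _ => rfl, fun _ _ _ _ => rfl⟩
    · have hne : packPerm N w ∉ fill .advInp v.toWires := by
        rw [mem_fill]
        rintro ⟨h, -⟩
        obtain ⟨r, k⟩ := w
        cases r
        case advWork => simp [packPerm, show k < N from hw (by simp)] at h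
        case advInp => simp [packPerm, show k < N from hw (by simp)] at h
        case advOut => simp [packPerm, show k < N from hw (by simp)] at h
        all_goals simp [packPerm] at h
      rw [hmem, Finset.mem_symmDiff]
      tauto
    · ext y
      rw [hmem, mem_toggle, hmem, Finset.mem_symmDiff, Finset.mem_symmDiff, mem_toggle,
        Ne, hinj]
      tauto
  have hrun : ∀ K : Op Wire,
      Circuit.run ((packCircuit N v).map (Gate.map advWire) : Circuit Wire) K =
        frameOp (fun _ _ => (1 : ℂ)) φ K := by
    intro K
    rw [run_packCircuit]
    funext s t
    simp only [frameOp, one_mul, φ]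
  have hfixed : ∀ w : Wire, ¬ (w.1 = .advInp ∨ w.1 = .advOut ∨ w.1 = .advWork) →
      w ∈ X ∧ packPerm N w = w := by
    rintro ⟨r, k⟩ hw
    refine ⟨fun h => absurd h hw, ?_⟩
    cases r
    case advWork => exact absurd (Or.inr (Or.inr rfl)) hw
    case advInp => exact absurd (Or.inl rfl) hw
    case advOut => exact absurd (Or.inr (Or.inl rfl)) hw
    all_goals rfl
  have := hframe.exec_eq f lam c (h := fun w => w) (hA := packWire N) (Y := {w | w.2 < N})
    (fun w hw => hfixed w (by rcases hw with h | h | h <;> simp [h]))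
    (fun w => hfixed _ (by obtain ⟨⟨⟩, k⟩ := w <;> simp [honWire]))
    (fun w hw => by
      obtain ⟨r, k⟩ := w
      change k < N at hw
      cases r
      · exact ⟨fun _ => hw, if_pos hw⟩
      · exact ⟨fun _ => hw, if_pos hw⟩
      · exact ⟨fun _ => hw, if_pos hw⟩
      · exact hfixed _ (by simp [advWire]))
    P (fun i => i.elim0) A hA K
  rwa [Step.map_mapWires_id, ← hrun, ← hrun] at this

theorem start_supp (c : Bool) (x : Bool → Val) (ρ : QState) :
    Supp (fun s => s.filter (fun w => w.1 ≠ Reg.advWork) =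
      fill .advInp (x c).toWires ∪ fill .honOut (x (!c)).toWires ∧
      ∀ k, (Reg.advWork, k) ∈ s → k < ρ.qubits) (start c x ρ) := by
  rw [start_eq_embed]
  have h : Supp (fun s : Finset ℕ => s ⊆ Finset.range ρ.qubits) ρ.op := fun s t h => ρ.op_supp h
  refine (h.embed advEmb _).mono fun s hs => ⟨by rw [← outer_advEmb]; exact hs.1, fun k hk => ?_⟩
  refine Finset.mem_range.1 (hs.2 ?_)
  rw [inner_advEmb]
  exact mem_content.2 hk

/-- The basis states that occur in the initial state of a packed adversary. -/
theorem pack_support {N q : ℕ} {v v' : Val} (hv : v.length < N) (hρ : q ≤ N) {s u : Finset Wire}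
    (hu : u = (symmDiff s (fill .advInp v.toWires)).image (packPerm N))
    (h1 : u.filter (fun w => w.1 ≠ Reg.advWork) =
      fill .advInp v.toWires ∪ fill .honOut v'.toWires)
    (h2 : ∀ k, (Reg.advWork, k) ∈ u → k < q) :
    outer advEmb s = fill .advInp v.toWires ∪ fill .honOut v'.toWires ∧
      ∀ k, (Reg.advWork, k) ∈ s → k < 3 * N := by
  have hmem : ∀ w, packPerm N w ∈ u ↔ w ∈ symmDiff s (fill .advInp v.toWires) := by
    intro w
    rw [hu, mem_image_packPerm, packPerm_packPerm]
  have h3 : ∀ r k, r ≠ Reg.advWork → (((r, k) : Wire) ∈ u ↔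
      (r, k) ∈ fill .advInp v.toWires ∪ fill .honOut v'.toWires) := by
    intro r k hr
    rw [← h1, Finset.mem_filter]
    exact (and_iff_left hr).symm
  have hin : ∀ r k, ((r, k) : Wire) ∈ fill .advInp v.toWires ∪ fill .honOut v'.toWires ↔
      (r = .advInp ∧ k ∈ v.toWires) ∨
      (r = .honOut ∧ k ∈ v'.toWires) := fun r k => by
    rw [Finset.mem_union, mem_fill, mem_fill]
  have hs : ∀ r k, ((r, k) : Wire) ∈ symmDiff s (fill .advInp v.toWires) ↔
      (((r, k) : Wire) ∈ s ∧ ¬ (r = .advInp ∧ k ∈ v.toWires) ∨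
        (r = .advInp ∧ k ∈ v.toWires) ∧ ((r, k) : Wire) ∉ s) := fun r k => by
    rw [Finset.mem_symmDiff, mem_fill]
  refine ⟨?_, fun k hk => ?_⟩
  · rw [outer_advEmb]
    ext ⟨r, k⟩
    rw [Finset.mem_filter]
    have h4 := (hmem (r, k)).trans (hs r k)
    have h6 := hin r k
    have h5' := h3 r k
    have h7 : k ∈ v.toWires → k < N := fun hk => by
      have := Val.lt_of_mem_toWires hk
      omega
    cases r
    case advWork => simp [h6]
    case advInp =>
      by_cases hkN : k < N
      · have h5 : ((Reg.advWork, N + k) : Wire) ∉ u := fun hn => by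
          have := h2 _ hn
          omega
        simp only [packPerm, hkN, if_true] at h4
        simp only [h6, reduceCtorEq, false_and, or_false, true_and, ne_eq, not_false_eq_true,
          and_true] at h4 ⊢
        tauto
      · have h5 := h5' (by simp)
        simp only [packPerm, hkN, if_false] at h4
        simp only [h6, reduceCtorEq, false_and, or_false, true_and, ne_eq, not_false_eq_true,
          and_true] at h4 h5 ⊢
        tauto
    case advOut =>
      by_cases hkN : k < N
      · have h5 : ((Reg.advWork, 2 * N + k) : Wire) ∉ u := fun hn => by
          have := h2 _ hn
          omega
        simp only [packPerm, hkN, if_true] at h4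
        simp only [h6, reduceCtorEq, false_and, or_false, not_false_eq_true, and_true, ne_eq]
          at h4 ⊢
        tauto
      · have h5 := h5' (by simp)
        simp only [packPerm, hkN, if_false] at h4
        simp only [h6, reduceCtorEq, false_and, or_false, not_false_eq_true, and_true, ne_eq]
          at h4 h5 ⊢
        tauto
    all_goals
      have h5 := h5' (by simp)
      simp only [packPerm] at h4
      simp only [h6, reduceCtorEq, false_and, or_false, false_or, not_false_eq_true, and_true,
        ne_eq, true_and] at h4 h5 ⊢
      tauto
  · by_contra hn
    have h4 := (hmem (.advWork, k)).trans (hs .advWork k)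
    simp only [packPerm, show ¬ k < N by omega, show ¬ k < 2 * N by omega, hn, if_false] at h4
    have := h2 k (h4.2 (Or.inl ⟨hk, by simp⟩))
    omega

/-- The initial state of a packed adversary. -/
theorem exists_packed_advice (c : Bool) (x : Bool → Val) (ρ : QState) {N : ℕ}
    (hv : (x c).length < N) (hρ : ρ.qubits ≤ N) : ∃ ρ' : QState, ρ'.qubits = 3 * N ∧
      start c x ρ' =
        Circuit.run ((packCircuit N (x c)).map (Gate.map advWire) : Circuit Wire) (start c x ρ) := by
  have hst := isState_start c x ρ
  set K := Circuit.run ((packCircuit N (x c)).map (Gate.map advWire) : Circuit Wire) (start c x ρ)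
    with hK
  set h := fill .advInp (x c).toWires ∪ fill .honOut (x (!c)).toWires with hh
  have hsupp : Supp (fun s => outer advEmb s = h ∧ ∀ k, (Reg.advWork, k) ∈ s → k < 3 * N) K := by
    intro s t hst
    rw [hK, run_packCircuit] at hst
    obtain ⟨h1, h2⟩ := start_supp c x ρ _ _ hst
    exact ⟨pack_support hv hρ rfl h1.1 h1.2, pack_support hv hρ rfl h2.1 h2.2⟩
  have hemb : K = embed advEmb h (compress advEmb h K) :=
    eq_embed (fun _ _ => rfl) fun s t hst => ⟨(hsupp s t hst).1.1, (hsupp s t hst).2.1⟩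
  have hh' : ∀ w ∈ h, ∀ v, advEmb v ≠ w := by
    intro w hw
    refine advEmb_ne ?_
    rcases Finset.mem_union.1 hw with hw | hw <;> rw [(mem_fill.1 hw).1] <;> simp
  obtain ⟨ρ', hq, hop⟩ := exists_qstate (L := compress advEmb h K) (q := 3 * N)
    (fun s t hst => by
      obtain ⟨h1, h2⟩ := hsupp _ _ hst
      exact ⟨fun k hk => Finset.mem_range.2 (h1.2 k (Finset.mem_union_left _
          (Finset.mem_map_of_mem advEmb hk))),
        fun k hk => Finset.mem_range.2 (h2.2 k (Finset.mem_union_left _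
          (Finset.mem_map_of_mem advEmb hk)))⟩)
    ((hst.pos.run _).compress advEmb h)
    (by
      rw [← tr_embed hh', ← hemb, hK, tr_run hst.finSupp]
      exact hst.tr)
  exact ⟨ρ', hq, by rw [start_eq_embed, hop]; exact hemb.symm⟩

section Unpack

/-- The wires of a distinguisher on which a circuit of the adversary acts. The message channel is
not among them. -/
def outputPort : PWire → DWire
  | (.work, k) => (.advWork, k)
  | (.inp, k) => (.advInp, k)
  | (.out, k) => (.advOut, k)
  | (.msg, k) => (.own, k)

/-- A distinguisher may unpack the registers of the adversary. -/
theorem acceptProb_unpack {N : ℕ} {v : Val} (hv : v.length < N) (D : Circuit DWire) (σ : QState)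
    (K : Op Wire) :
    acceptProb ((unpackCircuit N v).map (Gate.map outputPort) ++ D : Circuit DWire) σ K =
      acceptProb D σ
        (Circuit.run ((unpackCircuit N v).map (Gate.map advWire) : Circuit Wire) K) := by
  have h : List.map (Gate.map distWire) (List.map (Gate.map outputPort) (unpackCircuit N v)) =
      List.map (Gate.map advWire) (unpackCircuit N v) := by
    rw [List.map_map]
    refine List.map_congr_left fun g hg => ?_
    rw [Function.comp_apply, Gate.map_map]
    refine Gate.map_congr fun w hw => ?_
    have h1 := (on_unpackCircuit hv g hg w hw).1
    obtain ⟨⟨⟩, k⟩ := w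
    · rfl
    · rfl
    · rfl
    · exact absurd rfl h1
  rw [acceptProb_eq, acceptProb_eq, List.map_append, Circuit.run_append, h, run_adjoin]
  refine (on_unpackCircuit hv).map _ ?_
  rintro ⟨⟨⟩, k⟩ - <;> simp [advWire]

/-- The choice of the input of the corrupted party may be prepared before the ideal call. -/
theorem idealCall_cons (g : Functionality) (lam : ℕ) (c : Bool) {C D E : Circuit PWire}
    (hE : E.On {w | w.1 ≠ Port.msg}) {K : Op Wire} (hK : FinSupp K) :
    idealCall g lam c (E ++ C : Circuit PWire) D K =
      idealCall g lam c C D (Circuit.run (E.map (Gate.map advWire) : Circuit Wire) K) := by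
  have h : Circuit.On {w : Wire | ¬ w.1 = Reg.msg} (E.map (Gate.map advWire)) := by
    refine hE.map _ ?_
    rintro ⟨⟨⟩, k⟩ h <;> simp_all [advWire]
  simp only [idealCall, clearChannel]
  rw [activate_eq _ (E ++ C : Circuit PWire), List.map_append, Circuit.run_append,
    run_transition _ hK h, ← activate_eq]

theorem exec_pack_on {N : ℕ} {C : Circuit PWire} (hC : C.On {w | w.2 < N}) :
    Packed (3 * N) (C.map (Gate.map (packWire N))) := by
  refine hC.map _ ?_
  rintro ⟨⟨⟩, k⟩ h <;> change k < N at h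
  · exact Or.inr ⟨rfl, show k < 3 * N by omega⟩
  · exact Or.inr ⟨rfl, show N + k < 3 * N by omega⟩
  · exact Or.inr ⟨rfl, show 2 * N + k < 3 * N by omega⟩
  · exact Or.inl rfl

/-- Security against packed adversaries implies security against all adversaries: the simulator and
the distinguisher pack and unpack the registers of the adversary. -/
theorem indistUpTo_of_pack {f₀ : Fin 0 → Functionality} {g : Functionality} {Q : Protocol 0}
    {S : SimInput → Circuit PWire × Circuit PWire} {c : Bool} {x : ℕ → Bool → Val}
    {s : ℕ → ℕ} {ε : ℕ → ℝ} (hx : PolyBounded (fun lam => (x lam c).length)) (hs : PolyBounded s)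
    (h : ∀ A : NonUniformQPT (List (Circuit PWire)),
      (∀ lam, ∀ C ∈ A.code lam, Packed (A.advice lam).qubits C) →
        IndistUpTo ε (fun lam => hybridExec f₀ Q c lam (x lam) (A.code lam) (A.advice lam))
          (fun lam => idealExec g c lam (x lam)
            (S (SimInput.mk lam (s lam) c (x lam c) (A.code lam) (A.advice lam).qubits))
            (A.advice lam)))
    (A : NonUniformQPT (List (Circuit PWire))) :
    IndistUpTo ε (fun lam => hybridExec f₀ Q c lam (x lam) (A.code lam) (A.advice lam))
      (fun lam => idealExec g c lam (x lam)
        (unpackedSimulator S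
          (SimInput.mk lam (s lam) c (x lam c) (A.code lam) (A.advice lam).qubits))
        (A.advice lam)) := by
  let z : ℕ → SimInput := fun lam =>
    SimInput.mk lam (s lam) c (x lam c) (A.code lam) (A.advice lam).qubits
  let N : ℕ → ℕ := fun lam => descLength (z lam)
  have hz : PolyBounded N := polyBounded_simInput A c hx hs
  have hN : ∀ lam, (x lam c).length < N lam ∧ (A.advice lam).qubits ≤ N lam ∧
      descLength (A.code lam) ≤ N lam := by
    intro lam
    have h0 := descLength_simInput (z lam)
    have h1 : (x lam c).length ≤ descLength (z lam).input := length_le_descLength_val (x lam c)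
    have h2 : descLength (z lam).qubits = 2 * (A.advice lam).qubits + 1 := descLength_nat _
    have h3 : descLength (z lam).code = descLength (A.code lam) := rfl
    change _ < descLength (z lam) ∧ _ ≤ descLength (z lam) ∧ _ ≤ descLength (z lam)
    omega
  choose ρ' hρ' hstart using fun lam => exists_packed_advice c (x lam) (A.advice lam) (hN lam).1
    (hN lam).2.1
  have hon : ∀ lam, ∀ C ∈ A.code lam, C.On {w | w.2 < N lam} := fun lam C hC =>
    C.on_descLength ((descLength_le_of_mem_code hC).trans (hN lam).2.2) lt_descLength_wire
  let A' : NonUniformQPT (List (Circuit PWire)) :=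
    { code := fun lam => (packInput (z lam)).code
      advice := ρ'
      poly_code := by
        obtain ⟨p, hp⟩ := polyTime_packInput.size_le
        refine (hz.eval p).mono fun lam => le_trans ?_ (hp (z lam))
        rw [descLength_simInput]
        omega
      poly_advice := ((polyBounded_const 3).mul hz).mono fun lam => (hρ' lam).le }
  have hA' : ∀ lam, ∀ C ∈ A'.code lam, Packed (A'.advice lam).qubits C := by
    intro lam C hC
    obtain ⟨C', hC', rfl⟩ := List.mem_map.1 hC
    change Packed (ρ' lam).qubits _
    rw [hρ' lam]
    exact exec_pack_on (hon lam C' hC')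
  intro D
  let D' : NonUniformQPT (Circuit DWire) :=
    { code := fun lam =>
        ((unpackCircuit (N lam) (x lam c)).map (Gate.map outputPort) ++ D.code lam : Circuit DWire)
      advice := D.advice
      poly_code := by
        refine (((((polyBounded_const 7).mul hz).mul (((polyBounded_const 18).mul hz).add
          (polyBounded_const 61))).add (polyBounded_const 1)).add D.poly_code).mono fun lam => ?_
        have h1 := descLength_append
          (List.map (Gate.map outputPort) (unpackCircuit (N lam) (x lam c))) (D.code lam)
        have h2 : descLength (List.map (Gate.map outputPort) (unpackCircuit (N lam) (x lam c))) ≤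
            (List.map (Gate.map outputPort) (unpackCircuit (N lam) (x lam c))).length *
              (6 * (3 * N lam) + 61) + 1 := by
          refine descLength_dcircuit_le ((on_unpackCircuit (hN lam).1).map _ ?_)
          rintro ⟨⟨⟩, k⟩ ⟨-, hk⟩ <;> exact le_of_lt hk
        rw [List.length_map] at h2
        have h3 := Nat.mul_le_mul_right (6 * (3 * N lam) + 61)
          (length_unpackCircuit (v := x lam c) (hN lam).1)
        have h4 : 6 * (3 * N lam) = 18 * N lam := by ring
        rw [h4] at h2 h3
        omega
      poly_advice := D.poly_advice }
  obtain ⟨μ, hμ, hle⟩ := h A' hA' D'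
  refine ⟨μ, hμ, fun lam => ?_⟩
  have hmsg : (packCircuit (N lam) (x lam c)).On {w | w.1 ≠ Port.msg} :=
    (on_packCircuit (hN lam).1).mono fun w hw => hw.1
  have hmsg' : (unpackCircuit (N lam) (x lam c)).On {w | w.1 ≠ Port.msg} :=
    (on_unpackCircuit (hN lam).1).mono fun w hw => hw.1
  have hfin := (isState_start c (x lam) (A.advice lam)).finSupp
  have hreal : acceptProb (D'.code lam) (D'.advice lam)
        (hybridExec f₀ Q c lam (x lam) (A'.code lam) (A'.advice lam)) =
      acceptProb (D.code lam) (D.advice lam)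
        (hybridExec f₀ Q c lam (x lam) (A.code lam) (A.advice lam)) := by
    refine (acceptProb_unpack (hN lam).1 _ _ _).trans ?_
    rw [hybridExec, hstart lam]
    refine congrArg (acceptProb _ _) ?_
    refine (congrArg (Circuit.run _) (exec_packed f₀ lam c _ (x lam c) (hon lam) _)).trans ?_
    exact run_unpack_pack _ _ _
  have hideal : acceptProb (D'.code lam) (D'.advice lam)
        (idealExec g c lam (x lam) (S (packInput (z lam))) (A'.advice lam)) =
      acceptProb (D.code lam) (D.advice lam)
        (idealExec g c lam (x lam) (unpackedSimulator S (z lam)) (A.advice lam)) := by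
    refine (acceptProb_unpack (hN lam).1 _ _ _).trans ?_
    have e1 : ∀ (T : Circuit PWire × Circuit PWire) (ρ : QState),
        idealExec g c lam (x lam) T ρ = idealCall g lam c T.1 T.2 (start c (x lam) ρ) :=
      fun _ _ => rfl
    rw [e1, e1, hstart lam, ← idealCall_cons g lam c hmsg hfin,
      ← idealCall_append lam c g hmsg' hfin]
    rfl
  have hq : SimInput.mk lam (s lam) c (x lam c) (A'.code lam) (A'.advice lam).qubits =
      packInput (z lam) := by
    change SimInput.mk lam (s lam) c (x lam c) (A'.code lam) (ρ' lam).qubits = _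
    rw [hρ' lam]
    rfl
  have := hle lam
  simp only at this
  rw [hq, hreal, hideal] at this
  exact this

end Unpack

end TwoPC

theorem mainTheorem5 {m : ℕ} (f : Fin m → TwoPC.Functionality) (g : TwoPC.Functionality)
    (π : TwoPC.Protocol m) (ρ : Fin m → TwoPC.Protocol 0)
    (hρ : ∀ i, TwoPC.IsPlainSimulatable (ρ i) (f i))
    (hπ : TwoPC.IsSimulatable f π g) :
    TwoPC.IsPlainSimulatable (TwoPC.compose π ρ) g := by
  obtain ⟨hπt, Sπ, hSπ, hπsec⟩ := hπ
  choose hρt S hS hρsec using hρ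
  obtain ⟨P₁, P₂, q, hb⟩ := TwoPC.exists_hybridBounds f hπt.1 hS
  let T : TwoPC.SimInput → _ := fun z => Sπ (TwoPC.hybridInput S q π ρ z)
  have hT : TwoPC.PolyTime T :=
    hSπ.comp (TwoPC.polyTime_hybridInput hS q hπt.1 fun i => (hρt i).1)
  refine ⟨hπt.compose hρt, TwoPC.unpackedSimulator T, TwoPC.polyTime_unpackedSimulator hT, ?_⟩
  intro A c x hx ε hε
  refine TwoPC.indistUpTo_of_pack (S := T) (hx c) hε.polyBounded_ceil (fun A' hA' => ?_) A
  exact TwoPC.indistUpTo_of_packed hb hπt hρt hS hπsec hρsec A' hA' c x hx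
    (fun lam => ⌈1 / ε lam⌉₊) hε fun _ => rfl

end
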